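/- Let $P\subset\mathbb{R}^2$ be a set of $n$ distinct points, each colored with one of $k\ge 1$ colors, such that every color occurs on at least two points (hence $k\le n/2$) and no four points of $P$ are concyclic. A circular annulus is the region between two concentric circles of radii $0\le r_{\mathrm{in}}\le r_{\mathrm{out}}$; its width is $r_{\mathrm{out}}-r_{\mathrm{in}}$. A set of points is rainbow if it contains at least one point of each color. A circular annulus is a rainbow-bisecting empty circular annulus (RBCA) for $P$ if no point of $P$ lies strictly between its two circles and $P$ can be divided into two non-empty rainbow subsets, one lying within or on the inner circle and the other lying outside or on the outer circle; moreover the closed inner disk is required to contain more than one point of $P$ (which is automatic if $k\ge 2$). There is an algorithm that, given $P$ with its coloring and a line $L\subset\mathbb{R}^2$ (by a point and a nonzero direction vector), outputs the center and the two radii of an RBCA that has maximum width among all RBCAs whose center lies on $L$, or reports that no such maximum-width annulus exists (because there is no RBCA centered on $L$, or because the supremum of the widths is not attained). The algorithm runs in $O(n^2)$ time and uses $O(n^2)$ space, where the constants do not depend on the input. The model is the real RAM: unit-cost exact real operations $+,-,\times,/,\sqrt{\cdot}$ and comparisons, together with integer words of size polynomial in $n$ for colors, counters and addresses. -/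

import Mathlib

/-! ## The machine model: a real RAM in structured form

A program is a finite text, without real constants, that works on two memory banks: one bank of
natural numbers ("words", used for counting, for colours and for addresses) and one bank of real
numbers.  Both banks are randomly accessible through computed addresses.  The exact real operations
`+`, `-`, `*`, `/`, `√` and comparisons have unit cost, there is no rounding from reals to integers.

The machine has a size `M`: each bank has exactly `M` cells, with the addresses `0, …, M - 1`, and a
word is a number below `M`.  A program that uses an address or computes a word `≥ M`, divides
by zero, or takes the square root of a negative number, gets stuck and has no run. -/
namespace RealRAM

/-- The contents of the two memory banks (only cells with address below `M` are accessible). -/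
structure Store where
  word : ℕ → ℕ
  real : ℕ → ℝ

/-- Expressions for words. `cell a` is the content of the word cell whose address is the value of
`a`; `sub` is truncated subtraction. -/
inductive WExp where
  | const (c : ℕ)
  | cell (a : WExp)
  | add (a b : WExp)
  | sub (a b : WExp)
  | mul (a b : WExp)
  | div (a b : WExp)
  | mod (a b : WExp)

/-- Expressions for reals. `cell a` is the content of the real cell whose address is the value of
`a`; `ofWord a` is the word `a` as a real number. -/
inductive RExp where
  | ofWord (a : WExp)
  | cell (a : WExp)
  | add (x y : RExp)
  | sub (x y : RExp)
  | mul (x y : RExp)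
  | div (x y : RExp)
  | sqrt (x : RExp)

/-- Tests. -/
inductive Test where
  | wordLt (a b : WExp)
  | wordEq (a b : WExp)
  | realLt (x y : RExp)
  | realEq (x y : RExp)
  | not (b : Test)
  | and (b c : Test)
  | or (b c : Test)

/-- Programs. -/
inductive Prog where
  | skip
  | setWord (addr : WExp) (val : WExp)
  | setReal (addr : WExp) (val : RExp)
  | seq (p q : Prog)
  | ite (b : Test) (p q : Prog)
  | loop (b : Test) (p : Prog)

/-- The value `v` if it is a word of the machine of size `M`. -/
def checkWord (M v : ℕ) : Option ℕ := if v < M then some v else none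

/-- Value of a word expression, `none` if the evaluation gets stuck. -/
def WExp.eval (M : ℕ) (s : Store) : WExp → Option ℕ
  | .const c => checkWord M c
  | .cell a => (a.eval M s).bind fun i => if i < M then some (s.word i) else none
  | .add a b => (a.eval M s).bind fun u => (b.eval M s).bind fun v => checkWord M (u + v)
  | .sub a b => (a.eval M s).bind fun u => (b.eval M s).bind fun v => checkWord M (u - v)
  | .mul a b => (a.eval M s).bind fun u => (b.eval M s).bind fun v => checkWord M (u * v)
  | .div a b => (a.eval M s).bind fun u => (b.eval M s).bind fun v =>
      if v = 0 then none else checkWord M (u / v)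
  | .mod a b => (a.eval M s).bind fun u => (b.eval M s).bind fun v =>
      if v = 0 then none else checkWord M (u % v)

open Classical in
/-- Value of a real expression, `none` if the evaluation gets stuck. -/
noncomputable def RExp.eval (M : ℕ) (s : Store) : RExp → Option ℝ
  | .ofWord a => (a.eval M s).bind fun v => some (v : ℝ)
  | .cell a => (a.eval M s).bind fun i => if i < M then some (s.real i) else none
  | .add x y => (x.eval M s).bind fun u => (y.eval M s).bind fun v => some (u + v)
  | .sub x y => (x.eval M s).bind fun u => (y.eval M s).bind fun v => some (u - v)
  | .mul x y => (x.eval M s).bind fun u => (y.eval M s).bind fun v => some (u * v)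
  | .div x y => (x.eval M s).bind fun u => (y.eval M s).bind fun v =>
      if v = 0 then none else some (u / v)
  | .sqrt x => (x.eval M s).bind fun u => if u < 0 then none else some (Real.sqrt u)

open Classical in
/-- Truth value of a test, `none` if the evaluation gets stuck. -/
noncomputable def Test.eval (M : ℕ) (s : Store) : Test → Option Bool
  | .wordLt a b => (a.eval M s).bind fun u => (b.eval M s).bind fun v => some (decide (u < v))
  | .wordEq a b => (a.eval M s).bind fun u => (b.eval M s).bind fun v => some (decide (u = v))
  | .realLt x y => (x.eval M s).bind fun u => (y.eval M s).bind fun v => some (decide (u < v))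
  | .realEq x y => (x.eval M s).bind fun u => (y.eval M s).bind fun v => some (decide (u = v))
  | .not b => (b.eval M s).bind fun u => some (!u)
  | .and b c => (b.eval M s).bind fun u => (c.eval M s).bind fun v => some (u && v)
  | .or b c => (b.eval M s).bind fun u => (c.eval M s).bind fun v => some (u || v)

/-- Cost of evaluating a word expression: one step per constant, memory access or operation. -/
def WExp.cost : WExp → ℕ
  | .const _ => 1
  | .cell a => a.cost + 1
  | .add a b | .sub a b | .mul a b | .div a b | .mod a b => a.cost + b.cost + 1

/-- Cost of evaluating a real expression. -/
def RExp.cost : RExp → ℕ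
  | .ofWord a | .cell a => a.cost + 1
  | .add x y | .sub x y | .mul x y | .div x y => x.cost + y.cost + 1
  | .sqrt x => x.cost + 1

/-- Cost of evaluating a test. -/
def Test.cost : Test → ℕ
  | .wordLt a b | .wordEq a b => a.cost + b.cost + 1
  | .realLt x y | .realEq x y => x.cost + y.cost + 1
  | .not b => b.cost + 1
  | .and b c | .or b c => b.cost + c.cost + 1

/-- `Exec M p s t s'`: on the machine of size `M`, the program `p`, started with memory contents
`s`, halts after exactly `t` steps with memory contents `s'`. -/
inductive Exec (M : ℕ) : Prog → Store → ℕ → Store → Prop where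
  | skip (s : Store) : Exec M .skip s 1 s
  | setWord {s : Store} {addr val : WExp} {i v : ℕ}
      (hi : addr.eval M s = some i) (hM : i < M) (hv : val.eval M s = some v) :
      Exec M (.setWord addr val) s (addr.cost + val.cost + 1)
        { s with word := Function.update s.word i v }
  | setReal {s : Store} {addr : WExp} {val : RExp} {i : ℕ} {v : ℝ}
      (hi : addr.eval M s = some i) (hM : i < M) (hv : val.eval M s = some v) :
      Exec M (.setReal addr val) s (addr.cost + val.cost + 1)
        { s with real := Function.update s.real i v }
  | seq {p q : Prog} {s s₁ s₂ : Store} {t₁ t₂ : ℕ}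
      (hp : Exec M p s t₁ s₁) (hq : Exec M q s₁ t₂ s₂) :
      Exec M (.seq p q) s (t₁ + t₂) s₂
  | iteTrue {b : Test} {p q : Prog} {s s₁ : Store} {t : ℕ}
      (hb : b.eval M s = some true) (hp : Exec M p s t s₁) :
      Exec M (.ite b p q) s (b.cost + 1 + t) s₁
  | iteFalse {b : Test} {p q : Prog} {s s₁ : Store} {t : ℕ}
      (hb : b.eval M s = some false) (hq : Exec M q s t s₁) :
      Exec M (.ite b p q) s (b.cost + 1 + t) s₁
  | loopDone {b : Test} {p : Prog} {s : Store}
      (hb : b.eval M s = some false) :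
      Exec M (.loop b p) s (b.cost + 1) s
  | loopStep {b : Test} {p : Prog} {s s₁ s₂ : Store} {t₁ t₂ : ℕ}
      (hb : b.eval M s = some true) (hp : Exec M p s t₁ s₁)
      (hl : Exec M (.loop b p) s₁ t₂ s₂) :
      Exec M (.loop b p) s (b.cost + 1 + t₁ + t₂) s₂

end RealRAM

/-! ## Rainbow-bisecting empty circular annuli -/
namespace RainbowAnnulus

/-- The Euclidean plane. -/
abbrev Plane : Type := EuclideanSpace ℝ (Fin 2)

/-- A circular annulus: the region between two concentric circles, the inner one inside the
outer one. -/
structure CircAnnulus where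
  center : Plane
  rIn : ℝ
  rOut : ℝ
  rIn_nonneg : 0 ≤ rIn
  rIn_le_rOut : rIn ≤ rOut

/-- The width of an annulus. -/
def CircAnnulus.width (A : CircAnnulus) : ℝ := A.rOut - A.rIn

/-- `n` points of the plane, each coloured with one of `k ≥ 1` colours: the points are distinct,
there are at least two points of each colour (so `k ≤ n / 2`), and no four points are concyclic. -/
structure Instance (n k : ℕ) where
  point : Fin n → Plane
  color : Fin n → Fin k
  k_pos : 0 < k
  point_injective : Function.Injective point
  two_le_card_color : ∀ c : Fin k, 2 ≤ (Finset.univ.filter fun i => color i = c).card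
  not_concyclic : ∀ s : Finset (Fin n), s.card = 4 →
    ¬ EuclideanGeometry.Concyclic (point '' (s : Set (Fin n)))

/-- A set of input points is rainbow if it contains at least one point of each colour. -/
def Instance.Rainbow {n k : ℕ} (P : Instance n k) (S : Finset (Fin n)) : Prop :=
  ∀ c : Fin k, ∃ i ∈ S, P.color i = c

/-- `A` is rainbow-bisecting empty: there is no input point in its interior, and the input points
are divided into two non-empty rainbow subsets `S` and `Sᶜ`, with `S` within or on the inner circle
and `Sᶜ` outside or on the outer circle.  As is standard for empty annuli, the inner circle is
required to enclose more than one input point (this is automatic for two or more colours). -/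
def Instance.IsRBCA {n k : ℕ} (P : Instance n k) (A : CircAnnulus) : Prop :=
  (∀ i, ¬ (A.rIn < dist (P.point i) A.center ∧ dist (P.point i) A.center < A.rOut)) ∧
  (∃ S : Finset (Fin n), S.Nonempty ∧ Sᶜ.Nonempty ∧
    (∀ i ∈ S, dist (P.point i) A.center ≤ A.rIn) ∧
    (∀ i ∈ Sᶜ, A.rOut ≤ dist (P.point i) A.center) ∧
    P.Rainbow S ∧ P.Rainbow Sᶜ) ∧
  (∃ i j, i ≠ j ∧ dist (P.point i) A.center ≤ A.rIn ∧ dist (P.point j) A.center ≤ A.rIn)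

/-- `A` is a rainbow-bisecting empty annulus with center on `L`, and has maximum width
among these. -/
def Instance.IsMaxRBCAOn {n k : ℕ} (P : Instance n k) (L : AffineSubspace ℝ Plane)
    (A : CircAnnulus) : Prop :=
  P.IsRBCA A ∧ A.center ∈ L ∧
    ∀ B : CircAnnulus, P.IsRBCA B → B.center ∈ L → B.width ≤ A.width

/-- The line through the point `q` with direction vector `d`. -/
noncomputable def lineThrough (q d : Plane) : AffineSubspace ℝ Plane :=
  AffineSubspace.mk' q (Submodule.span ℝ {d})

open Classical in
/-- The input as memory contents.  Words: `n`, `k`, and then the `n` colours (numbered from `0`).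
Reals: the coordinates of `q` and of `d`, and then those of the `n` points.
All other cells contain zero. -/
noncomputable def Instance.input {n k : ℕ} (P : Instance n k) (q d : Plane) : RealRAM.Store where
  word := fun a =>
    if a = 0 then n else if a = 1 then k
    else if h : a - 2 < n then (P.color ⟨a - 2, h⟩ : ℕ) else 0
  real := fun a =>
    if a = 0 then q 0 else if a = 1 then q 1 else if a = 2 then d 0 else if a = 3 then d 1
    else if h : (a - 4) / 2 < n then
      (if (a - 4) % 2 = 0 then P.point ⟨(a - 4) / 2, h⟩ 0 else P.point ⟨(a - 4) / 2, h⟩ 1)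
    else 0

/-- The memory contents `s` describe the annulus `A`: word `1` in word cell `0`, and in the first
four real cells the coordinates of the center, the inner radius and the outer radius. -/
def OutputsAnnulus (s : RealRAM.Store) (A : CircAnnulus) : Prop :=
  s.word 0 = 1 ∧ s.real 0 = A.center 0 ∧ s.real 1 = A.center 1 ∧
    s.real 2 = A.rIn ∧ s.real 3 = A.rOut

/-- The memory contents `s` answer the problem for the line `L`: they describe a maximum-width
annulus with center on `L`, or report (by `0` in word cell `0`) that there is none. -/
def Instance.IsAnswer {n k : ℕ} (P : Instance n k) (L : AffineSubspace ℝ Plane)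
    (s : RealRAM.Store) : Prop :=
  (∃ A, P.IsMaxRBCAOn L A ∧ OutputsAnnulus s A) ∨
    (s.word 0 = 0 ∧ ¬ ∃ A, P.IsMaxRBCAOn L A)

end RainbowAnnulus

/-! Take `L` as an axis and replace each point by its foot `u` on `L` and its distance `h` to `L`.
The squared distance from the position `x` on `L` to the point is `x² - 2ux + u² + h²`. Dropping the
common term `x²` turns the points into `n` lines of slope `-2u`. An annulus centered at `x` with `p`
points inside corresponds to the gap above `x` between the `p` lowest lines and the others. A
crossing borders only a bounded number of gaps, so all gaps together have `O(n²)` edges.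

The arrangement is built line by line in the order of slopes. A new line is traced through the cells
that it meets. Along the cell boundaries every older line is charged for a bounded number of turns
(`LowerTurns.add`, `UpperTurns.add`), which is a zone theorem and gives `O(n)` steps per line.
Parallel and concurrent lines are handled by a consistent order of the crossings (`key_tri`), so
that the combinatorial part sees only a simple arrangement `Arr`.

Each gap with at least two points below is then swept from left to right, with counters for the
colours on both sides. On one pair of edges, belonging to points `i` below and `j` above, the width
is a difference of two distances. It is quasiconcave where it is nonnegative (`width_quasiconcave`)
and bounded by the distance of the two points. If `i` is closer to the axis, this bound is attained
where the line through the points meets the axis (`width_le_crit`). Otherwise the width approaches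
its supremum at infinity (`exists_width_gt`). So on an edge pair the width is dominated by one of a
few candidate positions or by a limit that is not attained (`InRange.exists_candidate`). The program
keeps the best width found in `best` and the largest limit in `lim`; for three or more points a
maximum exists exactly if an annulus was found and `best` is not less than `lim`.

Width zero needs care, because the points on the circle may be assigned to either side. For such
annuli it only matters whether anything is found at all. It suffices to try also the gaps where `i`
and `j` are equidistant and count for both sides (`SharedRainbow`): at most three points are
concyclic, and comparing the orders just before and just after the position shows that some annulus
is found (`has_of_circle`).

The algorithm is written in a small language with named variables, verified by a calculus for total
correctness (`Go`), and compiled to the machine with constant cost for each step (`Run.sound`). -/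

/-! ## A language with named variables, compiled to the machine -/
namespace RealRAM.HL

/-- Word variables. -/
inductive SV where
  | m | u | c | d | mode | l | p | i | j | ci | cj | li | lj | inC | outC | a | b | go
  | f1 | f2 | f3 | f4 | v | cv | t1 | t2 | has | res | rk
  deriving DecidableEq

/-- Word arrays with two indices. -/
inductive AV where
  | nx | pv | col | cnt | tot
  deriving DecidableEq

/-- Real variables. -/
inductive RV where
  | e0 | e1 | nr | dx | dy | x1 | x2 | x3 | x4 | xx | y1 | y2 | best | bx | bi | bo | lim | ox | oy
  deriving DecidableEq

/-- Real arrays. -/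
inductive RAV where
  | u0 | h0 | u | h
  deriving DecidableEq

/-- Memory as seen by the language, with a step counter. -/
structure St where
  s : SV → ℕ
  a : AV → ℕ → ℕ → ℕ
  r : RV → ℝ
  ra : RAV → ℕ → ℝ
  t : ℕ

/-- An input whose word cell `0` holds the number of points. -/
structure Env where
  I : Store
  n : ℕ
  hn : I.word 0 = n
  two_le : 2 ≤ n

inductive WE where
  | lit (c : ℕ)
  | n
  | inp (e : WE)
  | s (x : SV)
  | a (x : AV) (e f : WE)
  | add (e f : WE)
  | sub (e f : WE)

inductive RE where
  | lit (c : ℕ)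
  | inp (e : WE)
  | r (x : RV)
  | ra (x : RAV) (e : WE)
  | add (x y : RE)
  | sub (x y : RE)
  | mul (x y : RE)
  | div (x y : RE)
  | sqrt (x : RE)

inductive TE where
  | wlt (a b : WE)
  | weq (a b : WE)
  | rlt (x y : RE)
  | req (x y : RE)
  | not (b : TE)
  | and (b c : TE)
  | or (b c : TE)

inductive HP where
  | skip
  | setS (x : SV) (v : WE)
  | setA (x : AV) (e f : WE) (v : WE)
  | setR (x : RV) (v : RE)
  | setRA (x : RAV) (e : WE) (v : RE)
  | seq (p q : HP)
  | ite (b : TE) (p q : HP)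
  | loop (b : TE) (p : HP)

infixr:60 " ;; " => HP.seq

namespace St

def setS (V : St) (x : SV) (v : ℕ) : St := { V with s := Function.update V.s x v, t := V.t + 1 }
def setA (V : St) (x : AV) (i j : ℕ) (v : ℕ) : St :=
  { V with a := fun y i' j' => if y = x ∧ i' = i ∧ j' = j then v else V.a y i' j', t := V.t + 1 }
def setR (V : St) (x : RV) (v : ℝ) : St := { V with r := Function.update V.r x v, t := V.t + 1 }
def setRA (V : St) (x : RAV) (i : ℕ) (v : ℝ) : St :=
  { V with ra := fun y i' => if y = x ∧ i' = i then v else V.ra y i', t := V.t + 1 }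
def tick (V : St) : St := { V with t := V.t + 1 }

variable (V : St)

@[simp] theorem setS_s (x v y) : (V.setS x v).s y = if y = x then v else V.s y := by
  simp [setS, Function.update_apply]
@[simp] theorem setS_a (x v) : (V.setS x v).a = V.a := rfl
@[simp] theorem setS_r (x v) : (V.setS x v).r = V.r := rfl
@[simp] theorem setS_ra (x v) : (V.setS x v).ra = V.ra := rfl
@[simp] theorem setS_t (x v) : (V.setS x v).t = V.t + 1 := rfl
@[simp] theorem setA_s (x i j v) : (V.setA x i j v).s = V.s := rfl
@[simp] theorem setA_a (x i j v y i' j') : (V.setA x i j v).a y i' j' =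
  if y = x ∧ i' = i ∧ j' = j then v else V.a y i' j' := rfl
@[simp] theorem setA_r (x i j v) : (V.setA x i j v).r = V.r := rfl
@[simp] theorem setA_ra (x i j v) : (V.setA x i j v).ra = V.ra := rfl
@[simp] theorem setA_t (x i j v) : (V.setA x i j v).t = V.t + 1 := rfl
@[simp] theorem setR_s (x v) : (V.setR x v).s = V.s := rfl
@[simp] theorem setR_a (x v) : (V.setR x v).a = V.a := rfl
@[simp] theorem setR_r (x v y) : (V.setR x v).r y = if y = x then v else V.r y := by
  simp [setR, Function.update_apply]
@[simp] theorem setR_ra (x v) : (V.setR x v).ra = V.ra := rfl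
@[simp] theorem setR_t (x v) : (V.setR x v).t = V.t + 1 := rfl
@[simp] theorem setRA_s (x i v) : (V.setRA x i v).s = V.s := rfl
@[simp] theorem setRA_a (x i v) : (V.setRA x i v).a = V.a := rfl
@[simp] theorem setRA_r (x i v) : (V.setRA x i v).r = V.r := rfl
@[simp] theorem setRA_ra (x i v y i') : (V.setRA x i v).ra y i' =
  if y = x ∧ i' = i then v else V.ra y i' := rfl
@[simp] theorem setRA_t (x i v) : (V.setRA x i v).t = V.t + 1 := rfl
@[simp] theorem tick_s : V.tick.s = V.s := rfl
@[simp] theorem tick_a : V.tick.a = V.a := rfl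
@[simp] theorem tick_r : V.tick.r = V.r := rfl
@[simp] theorem tick_ra : V.tick.ra = V.ra := rfl
@[simp] theorem tick_t : V.tick.t = V.t + 1 := rfl

end St

/-- Value of a word expression. -/
@[simp] def WE.eval (E : Env) (V : St) : WE → ℕ
  | .lit c => c
  | .n => E.n
  | .inp e => E.I.word (e.eval E V)
  | .s x => V.s x
  | .a x e f => V.a x (e.eval E V) (f.eval E V)
  | .add e f => e.eval E V + f.eval E V
  | .sub e f => e.eval E V - f.eval E V

/-- The evaluation of a word expression does not get stuck. -/
@[simp] def WE.ok (E : Env) (V : St) : WE → Prop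
  -- Values up to `2n + 3` are admissible, the last real input address being `2n + 3`; since `2 ≤
  -- n`, this covers the literals up to `7`.
  | .lit c => c ≤ 7
  | .n => True
  | .inp e => e.ok E V ∧ e.eval E V ≤ 2 * E.n + 3
  | .s _ => True
  | .a _ e f => e.ok E V ∧ f.ok E V ∧ e.eval E V < E.n ∧ f.eval E V < E.n
  | .add e f => e.ok E V ∧ f.ok E V ∧ e.eval E V + f.eval E V ≤ 2 * E.n + 3
  | .sub e f => e.ok E V ∧ f.ok E V ∧ e.eval E V ≤ 2 * E.n + 3

@[simp] noncomputable def RE.eval (E : Env) (V : St) : RE → ℝ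
  | .lit c => c
  | .inp e => E.I.real (e.eval E V)
  | .r x => V.r x
  | .ra x e => V.ra x (e.eval E V)
  | .add x y => x.eval E V + y.eval E V
  | .sub x y => x.eval E V - y.eval E V
  | .mul x y => x.eval E V * y.eval E V
  | .div x y => x.eval E V / y.eval E V
  | .sqrt x => √(x.eval E V)

@[simp] def RE.ok (E : Env) (V : St) : RE → Prop
  | .lit c => c ≤ 7
  | .inp e => e.ok E V ∧ e.eval E V ≤ 2 * E.n + 3
  | .r _ => True
  | .ra _ e => e.ok E V ∧ e.eval E V < E.n
  | .add x y => x.ok E V ∧ y.ok E V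
  | .sub x y => x.ok E V ∧ y.ok E V
  | .mul x y => x.ok E V ∧ y.ok E V
  | .div x y => x.ok E V ∧ y.ok E V ∧ y.eval E V ≠ 0
  | .sqrt x => x.ok E V ∧ 0 ≤ x.eval E V

@[simp] def TE.eval (E : Env) (V : St) : TE → Prop
  | .wlt a b => a.eval E V < b.eval E V
  | .weq a b => a.eval E V = b.eval E V
  | .rlt a b => a.eval E V < b.eval E V
  | .req a b => a.eval E V = b.eval E V
  | .not b => ¬ b.eval E V
  | .and b c => b.eval E V ∧ c.eval E V
  | .or b c => b.eval E V ∨ c.eval E V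

@[simp] def TE.ok (E : Env) (V : St) : TE → Prop
  | .wlt a b => a.ok E V ∧ b.ok E V
  | .weq a b => a.ok E V ∧ b.ok E V
  | .rlt a b => a.ok E V ∧ b.ok E V
  | .req a b => a.ok E V ∧ b.ok E V
  | .not b => b.ok E V
  | .and b c => b.ok E V ∧ c.ok E V
  | .or b c => b.ok E V ∧ c.ok E V

/-- Big-step semantics. -/
inductive Run (E : Env) : HP → St → St → Prop where
  | skip (V) : Run E .skip V V.tick
  | setS {V x v} (hv : v.ok E V) : Run E (.setS x v) V (V.setS x (v.eval E V))
  | setA {V x e f v} (he : e.ok E V) (hf : f.ok E V) (hen : e.eval E V < E.n)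
      (hfn : f.eval E V < E.n) (hv : v.ok E V) :
      Run E (.setA x e f v) V (V.setA x (e.eval E V) (f.eval E V) (v.eval E V))
  | setR {V x v} (hv : v.ok E V) : Run E (.setR x v) V (V.setR x (v.eval E V))
  | setRA {V x e v} (he : e.ok E V) (hen : e.eval E V < E.n) (hv : v.ok E V) :
      Run E (.setRA x e v) V (V.setRA x (e.eval E V) (v.eval E V))
  | seq {p q V V₁ V₂} (hp : Run E p V V₁) (hq : Run E q V₁ V₂) : Run E (.seq p q) V V₂
  | iteT {b p q V V₁} (hb : b.ok E V) (ht : b.eval E V) (hp : Run E p V.tick V₁) :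
      Run E (.ite b p q) V V₁
  | iteF {b p q V V₁} (hb : b.ok E V) (ht : ¬ b.eval E V) (hp : Run E q V.tick V₁) :
      Run E (.ite b p q) V V₁
  | done {b p V} (hb : b.ok E V) (ht : ¬ b.eval E V) : Run E (.loop b p) V V.tick
  | step {b p V V₁ V₂} (hb : b.ok E V) (ht : b.eval E V) (hp : Run E p V.tick V₁)
      (hl : Run E (.loop b p) V₁ V₂) : Run E (.loop b p) V V₂

/-! ### Compilation -/

/-- Word cell `0` keeps `n` until the output is written, so a fixed program text can compute
addresses that depend on `n`. -/
def nE : WExp := .cell (.const 0)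
-- Start of block `b`: each bank is cut into blocks of `2n²` cells, and block `0` is the input.
def addrE (b : ℕ) : WExp := .mul (.const b) (.mul (.add nE nE) nE)

/-- Odd blocks hold single variables and even blocks hold arrays. Words and reals live in different
banks, so their numberings may overlap. -/
def SV.blk (x : SV) : ℕ := 1 + 2 * x.ctorIdx
def AV.blk (x : AV) : ℕ := 2 + 2 * x.ctorIdx
def RV.blk (x : RV) : ℕ := 1 + 2 * x.ctorIdx
def RAV.blk (x : RAV) : ℕ := 2 + 2 * x.ctorIdx

def WE.comp : WE → WExp
  | .lit c => .const c
  | .n => nE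
  | .inp e => .cell e.comp
  | .s x => .cell (addrE x.blk)
  | .a x e f => .cell (.add (addrE x.blk) (.add (.mul e.comp nE) f.comp))
  | .add e f => .add e.comp f.comp
  | .sub e f => .sub e.comp f.comp

def RE.comp : RE → RExp
  | .lit c => .ofWord (.const c)
  | .inp e => .cell e.comp
  | .r x => .cell (addrE x.blk)
  | .ra x e => .cell (.add (addrE x.blk) e.comp)
  | .add e f => .add e.comp f.comp
  | .sub e f => .sub e.comp f.comp
  | .mul e f => .mul e.comp f.comp
  | .div e f => .div e.comp f.comp
  | .sqrt e => .sqrt e.comp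

def TE.comp : TE → Test
  | .wlt a b => .wordLt a.comp b.comp
  | .weq a b => .wordEq a.comp b.comp
  | .rlt a b => .realLt a.comp b.comp
  | .req a b => .realEq a.comp b.comp
  | .not b => .not b.comp
  | .and a b => .and a.comp b.comp
  | .or a b => .or a.comp b.comp

def HP.comp : HP → Prog
  | .skip => .skip
  | .setS x v => .setWord (addrE x.blk) v.comp
  | .setA x e f v => .setWord (.add (addrE x.blk) (.add (.mul e.comp nE) f.comp)) v.comp
  | .setR x v => .setReal (addrE x.blk) v.comp
  | .setRA x e v => .setReal (.add (addrE x.blk) e.comp) v.comp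
  | .seq p q => .seq p.comp q.comp
  | .ite b p q => .ite b.comp p.comp q.comp
  | .loop b p => .loop b.comp p.comp

/-- A bound on the cost of every single step of a program. -/
def HP.unit : HP → ℕ
  | .skip => 1
  | .setS x v => (addrE x.blk).cost + v.comp.cost + 1
  | .setA x e f v => (WExp.add (addrE x.blk) (.add (.mul e.comp nE) f.comp)).cost + v.comp.cost + 1
  | .setR x v => (addrE x.blk).cost + v.comp.cost + 1
  | .setRA x e v => (WExp.add (addrE x.blk) e.comp).cost + v.comp.cost + 1
  | .seq p q => max p.unit q.unit
  | .ite b p q => max (b.comp.cost + 1) (max p.unit q.unit)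
  | .loop b p => max (b.comp.cost + 1) p.unit

/-- The machine memory `s` represents `V`. -/
structure Rep (E : Env) (V : St) (s : Store) : Prop where
  iw : ∀ o < 2 * E.n ^ 2, s.word o = E.I.word o
  ir : ∀ o < 2 * E.n ^ 2, s.real o = E.I.real o
  sv : ∀ x : SV, s.word (x.blk * (2 * E.n ^ 2)) = V.s x
  av : ∀ (x : AV) (i j : ℕ), i < E.n → j < E.n →
    s.word (x.blk * (2 * E.n ^ 2) + (i * E.n + j)) = V.a x i j
  rv : ∀ x : RV, s.real (x.blk * (2 * E.n ^ 2)) = V.r x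
  rav : ∀ (x : RAV) (i : ℕ), i < E.n → s.real (x.blk * (2 * E.n ^ 2) + i) = V.ra x i

/-! ### Memory layout and the values of compiled expressions. -/

theorem SV.ctorIdx_lt (x : SV) : x.ctorIdx < 40 := by cases x <;> decide
theorem AV.ctorIdx_lt (x : AV) : x.ctorIdx < 40 := by cases x <;> decide
theorem RV.ctorIdx_lt (x : RV) : x.ctorIdx < 40 := by cases x <;> decide
theorem RAV.ctorIdx_lt (x : RAV) : x.ctorIdx < 40 := by cases x <;> decide
theorem SV.ctorIdx_inj {x y : SV} (h : x.ctorIdx = y.ctorIdx) : x = y := by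
  cases x <;> cases y <;> first | rfl | (exact absurd h (by decide))
theorem AV.ctorIdx_inj {x y : AV} (h : x.ctorIdx = y.ctorIdx) : x = y := by
  cases x <;> cases y <;> first | rfl | (exact absurd h (by decide))
theorem RV.ctorIdx_inj {x y : RV} (h : x.ctorIdx = y.ctorIdx) : x = y := by
  cases x <;> cases y <;> first | rfl | (exact absurd h (by decide))
theorem RAV.ctorIdx_inj {x y : RAV} (h : x.ctorIdx = y.ctorIdx) : x = y := by
  cases x <;> cases y <;> first | rfl | (exact absurd h (by decide))

section
variable {E : Env} {V : St} {s : Store} {M : ℕ}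

theorem Env.sq_pos (E : Env) : 2 * E.n + 3 < 2 * E.n ^ 2 := by nlinarith [E.two_le]

/-- Uniqueness of quotient and remainder; this keeps distinct variables in distinct cells. -/
theorem block_inj {S b b' o o' : ℕ} (ho : o < S) (ho' : o' < S)
    (h : b * S + o = b' * S + o') : b = b' ∧ o = o' := by
  have hS : 0 < S := by omega
  have h1 : (b * S + o) / S = b := by
    rw [Nat.add_comm, Nat.add_mul_div_right _ _ hS, Nat.div_eq_of_lt ho, Nat.zero_add]
  have h2 : (b' * S + o') / S = b' := by
    rw [Nat.add_comm, Nat.add_mul_div_right _ _ hS, Nat.div_eq_of_lt ho', Nat.zero_add]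
  have : b = b' := by rw [← h1, ← h2, h]
  subst this
  exact ⟨rfl, by omega⟩

theorem index_lt {n i j : ℕ} (hi : i < n) (hj : j < n) : i * n + j < n ^ 2 := by nlinarith

theorem index_inj {n i j i' j' : ℕ} (hj : j < n) (hj' : j' < n)
    (h : i * n + j = i' * n + j') : i = i' ∧ j = j' := block_inj hj hj' h

theorem nE_eval (hM : 400 * E.n ^ 2 ≤ M) (hR : Rep E V s) : nE.eval M s = some E.n := by
  have := E.sq_pos
  have h0 : 0 < M := by omega
  simp [nE, WExp.eval, checkWord, h0, hR.iw 0 (by omega), E.hn]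

theorem addrE_eval (hM : 400 * E.n ^ 2 ≤ M) (hR : Rep E V s) {b : ℕ} (hb : b < 100) :
    (addrE b).eval M s = some (b * (2 * E.n ^ 2)) := by
  have := E.sq_pos
  have h1 : b < M := by nlinarith
  have h2 : E.n + E.n < M := by omega
  have h3 : (E.n + E.n) * E.n = 2 * E.n ^ 2 := by ring
  have h4 : 2 * E.n ^ 2 < M := by omega
  have h5 : b * (2 * E.n ^ 2) < M := by nlinarith
  simp [addrE, WExp.eval, nE_eval hM hR, checkWord, h1, h2, h3, h4, h5]

theorem WE.comp_eval (hM : 400 * E.n ^ 2 ≤ M) (hR : Rep E V s) (e : WE) (he : e.ok E V) :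
    e.comp.eval M s = some (e.eval E V) := by
  have hsq := E.sq_pos
  induction e with
  | lit c =>
    have : c < M := by simp at he; omega
    simp [WE.comp, WExp.eval, checkWord, this]
  | n => exact nE_eval hM hR
  | inp e ih =>
    simp only [WE.ok] at he
    have h1 : e.eval E V < M := by omega
    simp [WE.comp, WExp.eval, ih he.1, h1, hR.iw _ (show e.eval E V < 2 * E.n ^ 2 by omega)]
  | s x =>
    have hx := x.ctorIdx_lt
    have h5 : x.blk * (2 * E.n ^ 2) < M := by unfold SV.blk; nlinarith
    simp [WE.comp, WExp.eval, addrE_eval hM hR (show x.blk < 100 by unfold SV.blk; omega), h5,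
      hR.sv]
  | a x e f ihe ihf =>
    simp only [WE.ok] at he
    have hx := x.ctorIdx_lt
    have hi := index_lt he.2.2.1 he.2.2.2
    have h5 : x.blk * (2 * E.n ^ 2) + (e.eval E V * E.n + f.eval E V) < M := by
      unfold AV.blk; nlinarith
    have h6 : e.eval E V * E.n + f.eval E V < M := by omega
    have h7 : e.eval E V * E.n < M := by omega
    simp [WE.comp, WExp.eval, addrE_eval hM hR (show x.blk < 100 by unfold AV.blk; omega),
      ihe he.1, ihf he.2.1, nE_eval hM hR, checkWord, h5, h6, h7, hR.av _ _ _ he.2.2.1 he.2.2.2]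
  | add e f ihe ihf =>
    simp only [WE.ok] at he
    have : e.eval E V + f.eval E V < M := by omega
    simp [WE.comp, WExp.eval, ihe he.1, ihf he.2.1, checkWord, this]
  | sub e f ihe ihf =>
    simp only [WE.ok] at he
    have : e.eval E V - f.eval E V < M := by omega
    simp [WE.comp, WExp.eval, ihe he.1, ihf he.2.1, checkWord, this]

theorem RE.comp_eval (hM : 400 * E.n ^ 2 ≤ M) (hR : Rep E V s) (e : RE) (he : e.ok E V) :
    e.comp.eval M s = some (e.eval E V) := by
  have hsq := E.sq_pos
  induction e with
  | lit c =>
    have : c < M := by simp at he; omega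
    simp [RE.comp, RExp.eval, WExp.eval, checkWord, this]
  | inp e =>
    simp only [RE.ok] at he
    have h1 : e.eval E V < M := by omega
    simp [RE.comp, RExp.eval, e.comp_eval hM hR he.1, h1,
      hR.ir _ (show e.eval E V < 2 * E.n ^ 2 by omega)]
  | r x =>
    have hx := x.ctorIdx_lt
    have h5 : x.blk * (2 * E.n ^ 2) < M := by unfold RV.blk; nlinarith
    simp [RE.comp, RExp.eval, addrE_eval hM hR (show x.blk < 100 by unfold RV.blk; omega), h5,
      hR.rv]
  | ra x e =>
    simp only [RE.ok] at he
    have hx := x.ctorIdx_lt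
    have h5 : x.blk * (2 * E.n ^ 2) + e.eval E V < M := by
      unfold RAV.blk; nlinarith
    simp [RE.comp, RExp.eval, WExp.eval,
      addrE_eval hM hR (show x.blk < 100 by unfold RAV.blk; omega),
      e.comp_eval hM hR he.1, checkWord, h5, hR.rav _ _ he.2]
  | add e f ihe ihf =>
    simp only [RE.ok] at he
    simp [RE.comp, RExp.eval, ihe he.1, ihf he.2]
  | sub e f ihe ihf =>
    simp only [RE.ok] at he
    simp [RE.comp, RExp.eval, ihe he.1, ihf he.2]
  | mul e f ihe ihf =>
    simp only [RE.ok] at he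
    simp [RE.comp, RExp.eval, ihe he.1, ihf he.2]
  | div e f ihe ihf =>
    simp only [RE.ok] at he
    simp [RE.comp, RExp.eval, ihe he.1, ihf he.2.1, he.2.2]
  | sqrt e ihe =>
    simp only [RE.ok] at he
    simp [RE.comp, RExp.eval, ihe he.1, not_lt.2 he.2]

theorem TE.comp_eval_iff (hM : 400 * E.n ^ 2 ≤ M) (hR : Rep E V s) (b : TE) (he : b.ok E V) :
    ∃ v, b.comp.eval M s = some v ∧ (v = true ↔ b.eval E V) := by
  induction b with
  | wlt a b =>
    simp only [TE.ok] at he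
    simp [TE.comp, Test.eval, WE.comp_eval hM hR _ he.1, WE.comp_eval hM hR _ he.2]
  | weq a b =>
    simp only [TE.ok] at he
    simp [TE.comp, Test.eval, WE.comp_eval hM hR _ he.1, WE.comp_eval hM hR _ he.2]
  | rlt a b =>
    simp only [TE.ok] at he
    simp [TE.comp, Test.eval, RE.comp_eval hM hR _ he.1, RE.comp_eval hM hR _ he.2]
  | req a b =>
    simp only [TE.ok] at he
    simp [TE.comp, Test.eval, RE.comp_eval hM hR _ he.1, RE.comp_eval hM hR _ he.2]
  | not b ih =>
    obtain ⟨v, h1, h2⟩ := ih he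
    exact ⟨!v, by simp [TE.comp, Test.eval, h1], by simp [TE.eval, ← h2]⟩
  | and a b iha ihb =>
    obtain ⟨v, h1, h2⟩ := iha he.1
    obtain ⟨w, h3, h4⟩ := ihb he.2
    exact ⟨v && w, by simp [TE.comp, Test.eval, h1, h3], by simp [TE.eval, ← h2, ← h4]⟩
  | or a b iha ihb =>
    obtain ⟨v, h1, h2⟩ := iha he.1
    obtain ⟨w, h3, h4⟩ := ihb he.2
    exact ⟨v || w, by simp [TE.comp, Test.eval, h1, h3], by simp [TE.eval, ← h2, ← h4]⟩

theorem TE.comp_eval_true (hM : 400 * E.n ^ 2 ≤ M) (hR : Rep E V s) {b : TE} (he : b.ok E V)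
    (h : b.eval E V) : b.comp.eval M s = some true := by
  obtain ⟨v, h1, h2⟩ := b.comp_eval_iff hM hR he
  rw [h1, h2.2 h]

theorem TE.comp_eval_false (hM : 400 * E.n ^ 2 ≤ M) (hR : Rep E V s) {b : TE} (he : b.ok E V)
    (h : ¬ b.eval E V) : b.comp.eval M s = some false := by
  obtain ⟨v, h1, h2⟩ := b.comp_eval_iff hM hR he
  cases v
  · exact h1
  · exact absurd (h2.1 rfl) h

/-! ### Assignments preserve the representation of the memory. -/

theorem Rep.tick (hR : Rep E V s) : Rep E V.tick s :=
  ⟨hR.iw, hR.ir, hR.sv, hR.av, hR.rv, hR.rav⟩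

theorem Rep.setS (hR : Rep E V s) (x : SV) (v : ℕ) :
    Rep E (V.setS x v) { s with word := Function.update s.word (x.blk * (2 * E.n ^ 2)) v } := by
  have hsq := E.sq_pos
  -- Only the cell with the same block and the same offset is overwritten.
  have key : ∀ b o, o < 2 * E.n ^ 2 → (b ≠ x.blk ∨ o ≠ 0) →
      b * (2 * E.n ^ 2) + o ≠ x.blk * (2 * E.n ^ 2) := by
    intro b o ho hne h
    have := block_inj (o' := 0) ho (by omega) (by simpa using h)
    tauto
  refine ⟨fun o ho => ?_, hR.ir, fun y => ?_, fun y i j hi hj => ?_, hR.rv, hR.rav⟩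
  · have := key 0 o ho (Or.inl (by unfold SV.blk; omega))
    rw [zero_mul, zero_add] at this
    simp [Function.update_apply, this, hR.iw o ho]
  · by_cases hxy : y = x
    · subst hxy; simp
    · have h1 : y.blk ≠ x.blk := by
        unfold SV.blk; intro h; exact hxy (SV.ctorIdx_inj (by omega))
      have := key y.blk 0 (by omega) (Or.inl h1)
      rw [add_zero] at this
      simp [Function.update_apply, hxy, hR.sv, this]
  · have := key y.blk _ (show i * E.n + j < 2 * E.n ^ 2 by have := index_lt hi hj; omega)
      (Or.inl (by unfold AV.blk SV.blk; omega))
    simp [Function.update_apply, this, hR.av y i j hi hj]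

theorem Rep.setA (hR : Rep E V s) (x : AV) (i j v : ℕ) (hi : i < E.n) (hj : j < E.n) :
    Rep E (V.setA x i j v)
      { s with word := Function.update s.word (x.blk * (2 * E.n ^ 2) + (i * E.n + j)) v } := by
  have hsq := E.sq_pos
  have hij := index_lt hi hj
  have key : ∀ b o, o < 2 * E.n ^ 2 → (b ≠ x.blk ∨ o ≠ i * E.n + j) →
      b * (2 * E.n ^ 2) + o ≠ x.blk * (2 * E.n ^ 2) + (i * E.n + j) := by
    intro b o ho hne h
    have := block_inj ho (by omega) h
    tauto
  refine ⟨fun o ho => ?_, hR.ir, fun y => ?_, fun y i' j' hi' hj' => ?_, hR.rv, hR.rav⟩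
  · have := key 0 o ho (Or.inl (by unfold AV.blk; omega))
    rw [zero_mul, zero_add] at this
    simp [Function.update_apply, this, hR.iw o ho]
  · have := key y.blk 0 (by omega) (Or.inl (by unfold SV.blk AV.blk; omega))
    rw [add_zero] at this
    simp [Function.update_apply, hR.sv, this]
  · by_cases hxy : y = x ∧ i' = i ∧ j' = j
    · obtain ⟨rfl, rfl, rfl⟩ := hxy; simp
    · have := key y.blk _ (show i' * E.n + j' < 2 * E.n ^ 2 by have := index_lt hi' hj'; omega) (by
        by_contra! hcon
        obtain ⟨h1, h2⟩ := hcon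
        have := index_inj hj' hj h2
        exact hxy ⟨AV.ctorIdx_inj (by unfold AV.blk at h1; omega), this⟩)
      simp [Function.update_apply, this, hR.av y i' j' hi' hj', hxy]

theorem Rep.setR (hR : Rep E V s) (x : RV) (v : ℝ) :
    Rep E (V.setR x v) { s with real := Function.update s.real (x.blk * (2 * E.n ^ 2)) v } := by
  have hsq := E.sq_pos
  have key : ∀ b o, o < 2 * E.n ^ 2 → (b ≠ x.blk ∨ o ≠ 0) →
      b * (2 * E.n ^ 2) + o ≠ x.blk * (2 * E.n ^ 2) := by
    intro b o ho hne h
    have := block_inj (o' := 0) ho (by omega) (by simpa using h)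
    tauto
  refine ⟨hR.iw, fun o ho => ?_, hR.sv, hR.av, fun y => ?_, fun y i hi => ?_⟩
  · have := key 0 o ho (Or.inl (by unfold RV.blk; omega))
    rw [zero_mul, zero_add] at this
    simp [Function.update_apply, this, hR.ir o ho]
  · by_cases hxy : y = x
    · subst hxy; simp
    · have h1 : y.blk ≠ x.blk := by
        unfold RV.blk; intro h; exact hxy (RV.ctorIdx_inj (by omega))
      have := key y.blk 0 (by omega) (Or.inl h1)
      rw [add_zero] at this
      simp [Function.update_apply, hxy, hR.rv, this]
  · have := key y.blk _ (show i < 2 * E.n ^ 2 by omega)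
      (Or.inl (by unfold RAV.blk RV.blk; omega))
    simp [Function.update_apply, this, hR.rav y i hi]

theorem Rep.setRA (hR : Rep E V s) (x : RAV) (i : ℕ) (v : ℝ) (hi : i < E.n) :
    Rep E (V.setRA x i v)
      { s with real := Function.update s.real (x.blk * (2 * E.n ^ 2) + i) v } := by
  have hsq := E.sq_pos
  have key : ∀ b o, o < 2 * E.n ^ 2 → (b ≠ x.blk ∨ o ≠ i) →
      b * (2 * E.n ^ 2) + o ≠ x.blk * (2 * E.n ^ 2) + i := by
    intro b o ho hne h
    have := block_inj ho (by omega) h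
    tauto
  refine ⟨hR.iw, fun o ho => ?_, hR.sv, hR.av, fun y => ?_, fun y i' hi' => ?_⟩
  · have := key 0 o ho (Or.inl (by unfold RAV.blk; omega))
    rw [zero_mul, zero_add] at this
    simp [Function.update_apply, this, hR.ir o ho]
  · have := key y.blk 0 (by omega) (Or.inl (by unfold RV.blk RAV.blk; omega))
    rw [add_zero] at this
    simp [Function.update_apply, hR.rv, this]
  · by_cases hxy : y = x ∧ i' = i
    · obtain ⟨rfl, rfl⟩ := hxy; simp
    · have := key y.blk i' (by omega) (by
        by_contra! hcon
        obtain ⟨h1, h2⟩ := hcon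
        exact hxy ⟨RAV.ctorIdx_inj (by unfold RAV.blk at h1; omega), h2⟩)
      simp [Function.update_apply, this, hR.rav y i' hi', hxy]

/-- The compiled program simulates the source program, with constant cost for each step. -/
theorem Run.sound (hM : 400 * E.n ^ 2 ≤ M) {U : ℕ} {p : HP} {V V' : St} (h : Run E p V V') :
    ∀ s, Rep E V s → p.unit ≤ U →
      -- The cost bound is free of subtraction, so that the bounds of consecutive parts simply add
      -- up.
      ∃ k s', Exec M p.comp s k s' ∧ Rep E V' s' ∧ k + U * V.t ≤ U * V'.t := by
  have hsq := E.sq_pos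
  induction h with
  | skip V =>
    intro s hR hU
    refine ⟨1, s, .skip s, hR.tick, ?_⟩
    simp only [HP.unit] at hU
    simp only [St.tick_t]; linarith
  | @setS V x v hv =>
    intro s hR hU
    have hx := x.ctorIdx_lt
    refine ⟨_, _, .setWord (addrE_eval hM hR (by unfold SV.blk; omega)) ?_
      (v.comp_eval hM hR hv), hR.setS _ _, ?_⟩
    · unfold SV.blk; nlinarith
    · simp only [HP.unit] at hU; simp only [St.setS_t]; linarith
  | @setA V x e f v he hf hen hfn hv =>
    intro s hR hU
    have hx := x.ctorIdx_lt
    have := (WE.a x e f).comp_eval hM hR ⟨he, hf, hen, hfn⟩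
    have hi := index_lt hen hfn
    have h5 : x.blk * (2 * E.n ^ 2) + (e.eval E V * E.n + f.eval E V) < M := by
      unfold AV.blk; nlinarith
    have h6 : e.eval E V * E.n + f.eval E V < M := by omega
    have h7 : e.eval E V * E.n < M := by omega
    refine ⟨_, _, .setWord (i := x.blk * (2 * E.n ^ 2) + (e.eval E V * E.n + f.eval E V)) ?_ h5
      (v.comp_eval hM hR hv), hR.setA _ _ _ _ hen hfn, ?_⟩
    · simp [WExp.eval, addrE_eval hM hR (show x.blk < 100 by unfold AV.blk; omega),
        e.comp_eval hM hR he, f.comp_eval hM hR hf, nE_eval hM hR, checkWord, h5, h6, h7]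
    · simp only [HP.unit] at hU; simp only [St.setA_t]; linarith
  | @setR V x v hv =>
    intro s hR hU
    have hx := x.ctorIdx_lt
    refine ⟨_, _, .setReal (addrE_eval hM hR (by unfold RV.blk; omega)) ?_
      (v.comp_eval hM hR hv), hR.setR _ _, ?_⟩
    · unfold RV.blk; nlinarith
    · simp only [HP.unit] at hU; simp only [St.setR_t]; linarith
  | @setRA V x e v he hen hv =>
    intro s hR hU
    have hx := x.ctorIdx_lt
    have h5 : x.blk * (2 * E.n ^ 2) + e.eval E V < M := by
      unfold RAV.blk; nlinarith
    refine ⟨_, _, .setReal (i := x.blk * (2 * E.n ^ 2) + e.eval E V) ?_ h5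
      (v.comp_eval hM hR hv), hR.setRA _ _ _ hen, ?_⟩
    · simp [WExp.eval, addrE_eval hM hR (show x.blk < 100 by unfold RAV.blk; omega),
        e.comp_eval hM hR he, checkWord, h5]
    · simp only [HP.unit] at hU; simp only [St.setRA_t]; linarith
  | seq hp hq ihp ihq =>
    intro s hR hU
    simp only [HP.unit, max_le_iff] at hU
    obtain ⟨k₁, s₁, e₁, R₁, h₁⟩ := ihp s hR hU.1
    obtain ⟨k₂, s₂, e₂, R₂, h₂⟩ := ihq s₁ R₁ hU.2
    exact ⟨_, s₂, .seq e₁ e₂, R₂, by linarith⟩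
  | iteT hb ht hp ih =>
    intro s hR hU
    simp only [HP.unit, max_le_iff] at hU
    obtain ⟨k₁, s₁, e₁, R₁, h₁⟩ := ih s hR.tick hU.2.1
    refine ⟨_, s₁, .iteTrue (TE.comp_eval_true hM hR hb ht) e₁, R₁, ?_⟩
    · simp only [St.tick_t] at h₁; linarith
  | iteF hb ht hp ih =>
    intro s hR hU
    simp only [HP.unit, max_le_iff] at hU
    obtain ⟨k₁, s₁, e₁, R₁, h₁⟩ := ih s hR.tick hU.2.2
    refine ⟨_, s₁, .iteFalse (TE.comp_eval_false hM hR hb ht) e₁, R₁, ?_⟩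
    · simp only [St.tick_t] at h₁; linarith
  | done hb ht =>
    intro s hR hU
    simp only [HP.unit, max_le_iff] at hU
    refine ⟨_, s, .loopDone (TE.comp_eval_false hM hR hb ht), hR.tick, ?_⟩
    · simp only [St.tick_t]; linarith
  | step hb ht hp hl ihp ihl =>
    intro s hR hU
    obtain ⟨k₂, s₂, e₂, R₂, h₂⟩ := ihp s hR.tick (by
      simp only [HP.unit, max_le_iff] at hU; exact hU.2)
    obtain ⟨k₃, s₃, e₃, R₃, h₃⟩ := ihl s₂ R₂ hU
    refine ⟨_, s₃, .loopStep (TE.comp_eval_true hM hR hb ht) e₂ e₃, R₃, ?_⟩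
    · simp only [HP.unit, max_le_iff] at hU
      simp only [St.tick_t] at h₂; linarith

end

/-! ### Total correctness -/

/-- The program halts from `V` in a state with property `Q`. -/
def Go (E : Env) (p : HP) (V : St) (Q : St → Prop) : Prop := ∃ V', Run E p V V' ∧ Q V'

section
variable {E : Env} {V : St} {Q : St → Prop}

theorem Go.mono {p : HP} {Q' : St → Prop} (h : Go E p V Q) (hQ : ∀ V', Q V' → Q' V') :
    Go E p V Q' := by
  obtain ⟨V', h1, h2⟩ := h; exact ⟨V', h1, hQ _ h2⟩

theorem go_seq {p q : HP} : Go E (p ;; q) V Q ↔ Go E p V fun V' => Go E q V' Q := by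
  constructor
  · rintro ⟨V', h, hQ⟩
    cases h with
    | seq hp hq => exact ⟨_, hp, _, hq, hQ⟩
  · rintro ⟨V₁, hp, V₂, hq, hQ⟩
    exact ⟨V₂, .seq hp hq, hQ⟩

theorem go_skip : Go E .skip V Q ↔ Q V.tick :=
  ⟨by rintro ⟨V', h, hQ⟩; cases h; exact hQ, fun h => ⟨_, .skip V, h⟩⟩

theorem go_setS {x v} : Go E (.setS x v) V Q ↔ v.ok E V ∧ Q (V.setS x (v.eval E V)) :=
  ⟨by rintro ⟨V', h, hQ⟩; cases h; exact ⟨‹_›, hQ⟩, fun h => ⟨_, .setS h.1, h.2⟩⟩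

theorem go_setA {x e f v} : Go E (.setA x e f v) V Q ↔
    (e.ok E V ∧ f.ok E V ∧ e.eval E V < E.n ∧ f.eval E V < E.n ∧ v.ok E V) ∧
      Q (V.setA x (e.eval E V) (f.eval E V) (v.eval E V)) :=
  ⟨by rintro ⟨V', h, hQ⟩; cases h; exact ⟨⟨‹_›, ‹_›, ‹_›, ‹_›, ‹_›⟩, hQ⟩,
    fun ⟨⟨h1, h2, h3, h4, h5⟩, h⟩ => ⟨_, .setA h1 h2 h3 h4 h5, h⟩⟩

theorem go_setR {x v} : Go E (.setR x v) V Q ↔ v.ok E V ∧ Q (V.setR x (v.eval E V)) :=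
  ⟨by rintro ⟨V', h, hQ⟩; cases h; exact ⟨‹_›, hQ⟩, fun h => ⟨_, .setR h.1, h.2⟩⟩

theorem go_setRA {x e v} : Go E (.setRA x e v) V Q ↔
    (e.ok E V ∧ e.eval E V < E.n ∧ v.ok E V) ∧ Q (V.setRA x (e.eval E V) (v.eval E V)) :=
  ⟨by rintro ⟨V', h, hQ⟩; cases h; exact ⟨⟨‹_›, ‹_›, ‹_›⟩, hQ⟩,
    fun ⟨⟨h1, h2, h3⟩, h⟩ => ⟨_, .setRA h1 h2 h3, h⟩⟩

theorem go_ite {b p q} : Go E (.ite b p q) V Q ↔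
    b.ok E V ∧ (b.eval E V → Go E p V.tick Q) ∧ (¬ b.eval E V → Go E q V.tick Q) := by
  constructor
  · rintro ⟨V', h, hQ⟩
    cases h with
    | iteT hb ht hp => exact ⟨hb, fun _ => ⟨_, hp, hQ⟩, fun h => absurd ht h⟩
    | iteF hb ht hp => exact ⟨hb, fun h => absurd h ht, fun _ => ⟨_, hp, hQ⟩⟩
  · rintro ⟨hb, h1, h2⟩
    by_cases ht : b.eval E V
    · obtain ⟨V', hp, hQ⟩ := h1 ht; exact ⟨V', .iteT hb ht hp, hQ⟩
    · obtain ⟨V', hp, hQ⟩ := h2 ht; exact ⟨V', .iteF hb ht hp, hQ⟩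

/-- Strong induction on the variant `k`, which is carried by the invariant `J` and must fall in
every round. -/
theorem go_loop {b p} (J : ℕ → St → Prop) {k : ℕ} (h0 : J k V)
    (hstep : ∀ k V, J k V → b.ok E V ∧ (¬ b.eval E V → Q V.tick) ∧
      (b.eval E V → Go E p V.tick fun V' => ∃ k' < k, J k' V')) : Go E (.loop b p) V Q := by
  induction k using Nat.strong_induction_on generalizing V with
  | _ k ih =>
    obtain ⟨hb, hf, ht⟩ := hstep k V h0
    by_cases h : b.eval E V
    · obtain ⟨V₁, hp, k', hk', hJ⟩ := ht h
      obtain ⟨V₂, hl, hQ⟩ := ih k' hk' hJ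
      exact ⟨V₂, .step hb h hp hl, hQ⟩
    · exact ⟨_, .done hb h, hf h⟩

/-- `for x := lo, …, hi - 1 do p`. -/
def HP.for (x : SV) (lo hi : WE) (p : HP) : HP :=
  .setS x lo ;; .loop (.wlt (.s x) hi) (p ;; .setS x (.add (.s x) (.lit 1)))

/-- The variant is the number of remaining rounds. In `hstep` the lower bound is evaluated in the
current state, and `hlo'` relates it to the initial one. `H ≤ 2n` keeps the incremented counter an
admissible word. -/
theorem go_for {x lo hi p} (J : ℕ → St → Prop) (H : ℕ) (hlo : lo.ok E V)
    (hle : lo.eval E V ≤ H) (hH : H ≤ 2 * E.n)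
    (h0 : J (lo.eval E V) (V.setS x (lo.eval E V)))
    (hhi : ∀ k V, J k V → V.s x = k → hi.ok E V ∧ hi.eval E V = H)
    (hstep : ∀ k V, J k V → V.s x = k → lo.eval E V ≤ k → k < H →
      Go E p V.tick fun V' => V'.s x = k ∧ J (k + 1) (V'.setS x (k + 1)))
    (hlo' : ∀ k V', J k V' → lo.eval E V' ≤ lo.eval E V)
    (hend : ∀ V, J H V → V.s x = H → Q V.tick) : Go E (.for x lo hi p) V Q := by
  rw [HP.for, go_seq, go_setS]
  refine ⟨hlo, ?_⟩
  refine go_loop (fun m V' => ∃ k, k + m = H ∧ lo.eval E V ≤ k ∧ V'.s x = k ∧ J k V')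
    (k := H - lo.eval E V) ⟨_, by omega, le_rfl, by simp, h0⟩ ?_
  rintro m V' ⟨k, hk, hlk, hx, hJ⟩
  obtain ⟨ho, he⟩ := hhi k V' hJ hx
  refine ⟨⟨trivial, ho⟩, fun hb => ?_, fun hb => ?_⟩
  · have : k = H := by simp only [TE.eval, WE.eval, he, hx] at hb; omega
    exact hend V' (this ▸ hJ) (this ▸ hx)
  · have hkH : k < H := by simp only [TE.eval, WE.eval, he, hx] at hb; omega
    have hl2 := hlo' k V' hJ
    rw [go_seq]
    refine (hstep k V' hJ hx (by omega) hkH).mono fun V'' hV => ?_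
    rw [go_setS]
    refine ⟨by simp [hV.1]; omega, m - 1, by omega, k + 1, by omega, by omega, by simp [hV.1], ?_⟩
    simpa [hV.1] using hV.2

end

end RealRAM.HL

/-! ## Arrangements of `n` lines, given by the order of their crossings -/
namespace Arrangement

open Finset

/-- `τ a b` is the time at which the lines `a` and `b` cross; the lines are numbered by slope. -/
structure Arr (τ : ℕ → ℕ → ℕ) (n : ℕ) : Prop where
  symm : ∀ a b, τ a b = τ b a
  -- The crossings of three lines come in one of two orders, with the crossing of the extreme slopes
  -- in the middle. This axiom on triples replaces the geometry in the combinatorial part.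
  tri : ∀ i j k, i < j → j < k → k < n →
    (τ i j < τ i k ∧ τ i k < τ j k) ∨ (τ j k < τ i k ∧ τ i k < τ i j)
  -- No two crossings are simultaneous: the arrangement is simple.
  inj : ∀ a b c d, a < n → b < n → c < n → d < n → a ≠ b → c ≠ d → τ a b = τ c d →
    (a = c ∧ b = d) ∨ (a = d ∧ b = c)

variable {τ : ℕ → ℕ → ℕ} {n : ℕ}

theorem Arr.ne (A : Arr τ n) {u j k : ℕ} (hu : u < n) (hj : j < n) (hk : k < n) (h1 : j ≠ u)
    (h2 : k ≠ u) (h3 : j ≠ k) : τ u j ≠ τ u k := by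
  intro h
  have := A.inj u j u k hu hj hu hk (Ne.symm h1) (Ne.symm h2) h
  omega

/-- The side of the crossing of `u` and `c` on which the line `j` passes. -/
theorem Arr.vertex (A : Arr τ n) {j u c : ℕ} (hj : j < n) (hu : u < n) (hc : c < n) (h1 : j ≠ u)
    (h2 : j ≠ c) (h3 : u ≠ c) : (j < u ↔ τ u j < τ u c) ↔ (j < c ↔ τ c j < τ c u) := by
  have s1 := A.symm u j
  have s2 := A.symm u c
  have s3 := A.symm c j
  -- A line is below another one if it is less steep and already crossed, or steeper and not yet
  -- crossed. At a vertex this can be tested on either of the two lines; each order of `j`, `u`, `c`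
  -- is one use of `tri`.
  rcases lt_or_gt_of_ne h1 with a | a <;> rcases lt_or_gt_of_ne h2 with b | b <;>
    rcases lt_or_gt_of_ne h3 with d | d <;> try omega
  · have := A.tri j u c a d hc; omega
  · have := A.tri j c u b d hu; omega
  · have := A.tri c j u b a hu; omega
  · have := A.tri u j c a b hc; omega
  · have := A.tri u c j d b hj; omega
  · have := A.tri c u j d a hj; omega

/-- `d` is the crossing after `c` on the line `u`, among the crossings with lines from `K`.
The value `u` marks both ends of the line. -/
structure Nxt (τ : ℕ → ℕ → ℕ) (K : Finset ℕ) (u c d : ℕ) : Prop where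
  mem : d ∈ insert u K
  gt : d ≠ u → c = u ∨ τ u c < τ u d
  le : ∀ j ∈ K, (c = u ∨ τ u c < τ u j) → d ≠ u ∧ τ u d ≤ τ u j

/-- The doubly linked list of the crossings on the line `u` with lines from `K`. -/
structure Linked (τ : ℕ → ℕ → ℕ) (K : Finset ℕ) (u : ℕ) (nx pv : ℕ → ℕ) : Prop where
  notMem : u ∉ K
  nxt : ∀ c ∈ insert u K, Nxt τ K u c (nx c)
  pv_mem : ∀ c ∈ insert u K, pv c ∈ insert u K
  pv_nx : ∀ c ∈ insert u K, pv (nx c) = c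
  nx_pv : ∀ c ∈ insert u K, nx (pv c) = c

theorem Linked.empty (u : ℕ) {nx pv : ℕ → ℕ} (h1 : nx u = u) (h2 : pv u = u) :
    Linked τ ∅ u nx pv := by
  constructor
  · simp
  · intro c hc
    simp at hc; subst hc
    exact ⟨by simp [h1], by simp [h1], by simp⟩
  all_goals intro c hc; simp at hc; subst hc; simp [h1, h2]

theorem Linked.congr {K : Finset ℕ} {u : ℕ} {nx pv nx' pv' : ℕ → ℕ} (h : Linked τ K u nx pv)
    (h1 : ∀ c, nx' c = nx c) (h2 : ∀ c, pv' c = pv c) : Linked τ K u nx' pv' := by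
  rw [funext h1, funext h2]; exact h

/-- The sentinel `u` stands for both ends of the list, so inserting at an end needs no separate
treatment. `hd` and `hcm` place the new crossing after `pv c` and before `c`. -/
theorem Linked.insert_between {K : Finset ℕ} {u m c : ℕ} {nx pv nx' pv' : ℕ → ℕ}
    (h : Linked τ K u nx pv) (hm : m ∉ K) (hmu : m ≠ u) (hc : c ∈ insert u K)
    (hinj : ∀ a ∈ K, ∀ b ∈ K, τ u a = τ u b → a = b)
    (hd : pv c = u ∨ τ u (pv c) < τ u m) (hcm : c = u ∨ τ u m < τ u c)
    (h1 : ∀ x, nx' x = if x = m then c else if x = pv c then m else nx x)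
    (h2 : ∀ x, pv' x = if x = c then m else if x = m then pv c else pv x) :
    Linked τ (insert m K) u nx' pv' := by
  have hdK := h.pv_mem c hc
  have hN := h.nxt _ hdK
  rw [h.nx_pv c hc] at hN
  have hnc := h.nx_pv c hc
  generalize hdd : pv c = d at *
  have hcm' : c ≠ m := by
    rintro rfl; simp only [mem_insert] at hc; tauto
  have hdm' : d ≠ m := by
    rintro rfl; simp only [mem_insert] at hdK; tauto
  have hsub : ∀ x, x ∈ insert u (insert m K) ↔ x = m ∨ x ∈ insert u K := by
    intro x; simp only [mem_insert]; tauto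
  refine ⟨?_, ?_, ?_, ?_, ?_⟩
  · simp only [mem_insert, not_or]; exact ⟨Ne.symm hmu, h.notMem⟩
  · intro x hx
    rw [hsub] at hx
    rw [h1]
    by_cases hxm : x = m
    · subst hxm
      simp only [if_true]
      refine ⟨(hsub _).2 (Or.inr hc), fun hcu => Or.inr (hcm.resolve_left hcu), fun j hj hxj => ?_⟩
      have hxj' := hxj.resolve_left hmu
      rcases mem_insert.1 hj with rfl | hj
      · omega
      · exact hN.le j hj (hd.imp id fun h => by omega)
    rw [if_neg hxm]
    have hxK := hx.resolve_left hxm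
    by_cases hxd : x = d
    · subst hxd
      simp only [if_true]
      refine ⟨(hsub _).2 (Or.inl rfl), fun _ => hd, fun j hj hxj => ⟨hmu, ?_⟩⟩
      rcases mem_insert.1 hj with rfl | hj
      · exact le_rfl
      · have := hN.le j hj hxj
        have := hcm.resolve_left this.1
        omega
    rw [if_neg hxd]
    have hNx := h.nxt x hxK
    refine ⟨(hsub _).2 (Or.inr hNx.mem), hNx.gt, fun j hj hxj => ?_⟩
    rcases mem_insert.1 hj with rfl | hj
    -- The inserted crossing comes after `x`. If `x` precedes `d`, the old successor of `x` is at
    -- most `d`, which precedes the inserted crossing. If `x` came after `d`, it would be at or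
    -- after `c`, hence after the inserted crossing.
    · by_cases hdu : d = u
      · have hxu : x ≠ u := fun h => hxd (h.trans hdu.symm)
        have hxK' := (mem_insert.1 hxK).resolve_left hxu
        have h3 := hN.le x hxK' (Or.inl hdu)
        have h4 := hcm.resolve_left h3.1
        have h5 := hxj.resolve_left hxu
        omega
      · have hd' := hd.resolve_left hdu
        have hdK' := (mem_insert.1 hdK).resolve_left hdu
        by_cases hxb : x = u ∨ τ u x < τ u d
        · have := hNx.le d hdK' hxb
          exact ⟨this.1, by omega⟩
        · push Not at hxb
          have hxK' := (mem_insert.1 hxK).resolve_left hxb.1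
          have h6 : τ u d ≠ τ u x := fun h => hxd (hinj _ hxK' _ hdK' h.symm)
          have h3 := hN.le x hxK' (Or.inr (by omega))
          have h4 := hcm.resolve_left h3.1
          have h5 := hxj.resolve_left hxb.1
          omega
    · exact hNx.le j hj hxj
  · intro x hx
    rw [hsub] at hx
    rw [h2, hsub]
    by_cases hxc : x = c
    · simp [hxc]
    by_cases hxm : x = m
    · simp only [hxm, hcm'.symm, if_false, if_true]; exact Or.inr hdK
    · simp only [hxc, hxm, if_false]; exact Or.inr (h.pv_mem x (hx.resolve_left hxm))
  · intro x hx
    rw [hsub] at hx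
    rw [h2, h1]
    by_cases hxm : x = m
    · subst hxm; simp
    · have hxK := hx.resolve_left hxm
      by_cases hxd : x = d
      · subst hxd; simp [hxm, hcm'.symm]
      · have h3 : nx x ≠ c := by
          intro h4; apply hxd; rw [← h.pv_nx x hxK, h4, hdd]
        have h5 : nx x ≠ m := by
          intro h4
          have := (h.nxt x hxK).mem
          rw [h4, mem_insert] at this; tauto
        simp [hxm, hxd, h3, h5, h.pv_nx x hxK]
  · intro x hx
    rw [hsub] at hx
    rw [h2, h1]
    by_cases hxc : x = c
    · simp [hxc]
    by_cases hxm : x = m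
    · simp [hxm, hcm'.symm, hdm']
    · have hxK := hx.resolve_left hxm
      have h3 : pv x ≠ d := by
        intro h4; apply hxc; rw [← h.nx_pv x hxK, h4, hnc]
      have h5 : pv x ≠ m := by
        intro h4
        have := h.pv_mem x hxK
        rw [h4, mem_insert] at this; tauto
      simp [hxc, hxm, h3, h5, h.nx_pv x hxK]

/-! ### Walking along the zone of a new line `m`, steeper than the lines before it -/

/-- The lines in `X` are the first lines crossed by `m`. -/
structure Pre (τ : ℕ → ℕ → ℕ) (m : ℕ) (X : Finset ℕ) : Prop where
  sub : ∀ i ∈ X, i < m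
  lt : ∀ i ∈ X, ∀ j < m, j ∉ X → τ i m < τ j m

/-- The edge on the line `u` that ends with the crossing of `c` lies on the upper boundary of the
cell with exactly the lines in `X` below it, to the right of the line `m`. -/
structure Upper (τ : ℕ → ℕ → ℕ) (m : ℕ) (X : Finset ℕ) (u c : ℕ) : Prop where
  u_lt : u < m
  c_lt : c < m
  notMem : u ∉ X
  right : c = u ∨ τ u m < τ u c
  side : ∀ j < m, j ≠ u → (j ∈ X ↔ (j < u ↔ (c = u ∨ τ u j < τ u c)))

/-- The edge on the line `u` that starts with the crossing of `c` lies on the lower boundary of the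
cell with exactly the lines in `X` below it, to the right of the line `m`. -/
structure Lower (τ : ℕ → ℕ → ℕ) (m : ℕ) (X : Finset ℕ) (u c : ℕ) : Prop where
  u_lt : u < m
  c_le : c ≤ m
  c_ne : c ≠ u
  mem : u ∈ X
  right : τ u m ≤ τ u c
  side : ∀ j < m, j ≠ u → (j ∈ X ↔ (j < u ↔ τ u j ≤ τ u c))

/-- The lines whose crossings with `u` are known while `m` is being inserted. -/
def known (m : ℕ) (X : Finset ℕ) (u : ℕ) : Finset ℕ :=
  (range (m + 1)).filter fun a => a ≠ u ∧ (a < m ∨ u ∈ X)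

theorem mem_known {m : ℕ} {X : Finset ℕ} {u a : ℕ} :
    a ∈ known m X u ↔ a ≠ u ∧ (a < m ∨ a = m ∧ u ∈ X) := by
  simp only [known, mem_filter, mem_range]
  constructor
  · rintro ⟨h1, h2, h3⟩
    refine ⟨h2, ?_⟩
    by_cases h : a < m
    · exact Or.inl h
    · exact Or.inr ⟨by omega, h3.resolve_left h⟩
  · rintro ⟨h1, h2 | ⟨h2, h3⟩⟩
    · exact ⟨by omega, h1, Or.inl h2⟩
    · exact ⟨by omega, h1, Or.inr h3⟩

variable {m u c d : ℕ} {X : Finset ℕ}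

/-- The edge runs to infinity, where the lines are ordered by slope, the steepest on top. -/
theorem Lower.next_end (hL : Lower τ m X u c)
    (hN : Nxt τ (known m X u) u c u) : ∀ j < m, j ∈ X ↔ j ≤ u := by
  intro j hj
  by_cases hju : j = u
  · subst hju; simp [hL.mem]
  · have h1 : ¬ (c = u ∨ τ u c < τ u j) := fun h =>
      (hN.le j (mem_known.2 ⟨hju, Or.inl hj⟩) h).1 rfl
    have := hL.side j hj hju
    push Not at h1
    rw [this]; constructor <;> intro h <;> omega

/-- The cell is unbounded to the right, so the walk passes at infinity to the next line above; its
end is marked by the sentinel. -/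
theorem Lower.next_line (hL : Lower τ m X u c)
    (hN : Nxt τ (known m X u) u c u) (hu : u + 1 < m) : Upper τ m X (u + 1) (u + 1) := by
  have h := hL.next_end hN
  refine ⟨hu, hu, ?_, Or.inl rfl, fun j hj hju => ?_⟩
  · rw [h _ hu]; omega
  · rw [h j hj]; simp only [true_or, iff_true]; omega

/-- At infinity nothing old lies above the steepest old line, so `m` has crossed everything. -/
theorem Lower.all_of_end (hL : Lower τ m X u c) (hX : Pre τ m X)
    (hN : Nxt τ (known m X u) u c u) (hu : u + 1 = m) : X = range m := by
  ext j
  constructor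
  · intro h; exact mem_range.2 (hX.sub j h)
  · intro h; have h := mem_range.1 h; rw [hL.next_end hN j h]; omega

theorem Lower.next_lt (hL : Lower τ m X u c)
    (hN : Nxt τ (known m X u) u c d) (hd : d ≠ u) : d < m ∧ τ u c < τ u d := by
  have h1 := (hN.gt hd).resolve_left hL.c_ne
  refine ⟨?_, h1⟩
  have h2 := mem_known.1 ((mem_insert.1 hN.mem).resolve_left hd)
  rcases h2.2 with h | ⟨h, -⟩
  · exact h
  · subst h; have := hL.right; omega

theorem Lower.lt_next_iff (hL : Lower τ m X u c)
    (hN : Nxt τ (known m X u) u c d) (hd : d ≠ u) {j : ℕ} (hj : j < m) (hju : j ≠ u) :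
    τ u j ≤ τ u c ↔ τ u j < τ u d := by
  have h1 := hL.next_lt hN hd
  constructor
  · intro h; omega
  · intro h
    by_contra hc
    have := (hN.le j (mem_known.2 ⟨hju, Or.inl hj⟩) (Or.inr (by omega))).2
    omega

/-- A steeper line comes from below and continues the lower boundary of the cell; `Arr.vertex`
carries the side conditions over to it. -/
theorem Lower.turn (A : Arr τ n) (hm : m < n) (hL : Lower τ m X u c)
    (hN : Nxt τ (known m X u) u c d) (hd : u < d) : Lower τ m X d u := by
  have h1 := hL.next_lt hN hd.ne'
  have hum := hL.u_lt
  have hdX : d ∈ X := by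
    rw [hL.side d h1.1 hd.ne']; omega
  refine ⟨h1.1, by omega, by omega, hdX, ?_, fun j hj hjd => ?_⟩
  · have h2 := A.vertex (j := m) (u := u) (c := d) hm (by omega) (by omega) (by omega) (by omega)
      (by omega)
    have := hL.right
    omega
  · by_cases hju : j = u
    · subst hju; simp [hL.mem, hd]
    · rw [hL.side j hj hju, hL.lt_next_iff hN hd.ne' hj hju,
        A.vertex (by omega) (by omega) (by omega) hju hjd (by omega)]
      have := A.ne (u := d) (j := j) (k := u) (by omega) (by omega) (by omega) hjd (by omega) hju
      omega

/-- A less steep line comes from above, so lower and upper boundary meet here, at the right end of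
the cell. -/
theorem Lower.apex (A : Arr τ n) (hm : m < n) (hL : Lower τ m X u c)
    (hN : Nxt τ (known m X u) u c d) (hd : d < u) : Upper τ m X d u := by
  have h1 := hL.next_lt hN hd.ne
  have hum := hL.u_lt
  have hdX : d ∉ X := by
    rw [hL.side d h1.1 hd.ne]; omega
  refine ⟨h1.1, by omega, hdX, Or.inr ?_, fun j hj hjd => ?_⟩
  · have h2 := A.vertex (j := m) (u := u) (c := d) hm (by omega) (by omega) (by omega) (by omega)
      (by omega)
    have := hL.right
    have := A.ne (u := d) (j := m) (k := u) (by omega) (by omega) (by omega) (by omega) (by omega)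
      (by omega)
    omega
  · by_cases hju : j = u
    · subst hju; simp only [hL.mem, true_iff]; omega
    · rw [hL.side j hj hju, hL.lt_next_iff hN hd.ne hj hju,
        A.vertex (by omega) (by omega) (by omega) hju hjd (by omega)]
      omega

theorem before_iff
    (hN : Nxt τ (known m X u) u d c) {j : ℕ} (hj : j < m) (hju : j ≠ u) :
    (c = u ∨ τ u j < τ u c) ↔ (d ≠ u ∧ τ u j ≤ τ u d) := by
  have h1 := hN.le j (mem_known.2 ⟨hju, Or.inl hj⟩)
  have h2 := hN.gt
  constructor
  · intro h
    by_contra hcon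
    have h3 := h1 (by by_cases hdu : d = u
                      · exact Or.inl hdu
                      · exact Or.inr (by by_contra h4; exact hcon ⟨hdu, by omega⟩))
    rcases h with h | h
    · exact h3.1 h
    · omega
  · rintro ⟨h3, h4⟩
    by_cases hcu : c = u
    · exact Or.inl hcu
    · right; have := (h2 hcu).resolve_left h3; omega

/-- Any other line above the cell meets `u` after `m` does if it is less steep than `u`, and before
if it is steeper. In both cases `tri` makes it cross `m` later than `u` does. -/
theorem Upper.prefix_insert (A : Arr τ n) (hm : m < n) (hU : Upper τ m X u c) (hX : Pre τ m X)
    (hN : Nxt τ (known m X u) u d c) (hd : d = u ∨ τ u d < τ u m) :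
    Pre τ m (insert u X) := by
  refine ⟨fun i hi => ?_, fun i hi j hj hjX => ?_⟩
  · rcases mem_insert.1 hi with rfl | hi
    · exact hU.u_lt
    · exact hX.sub i hi
  · simp only [mem_insert, not_or] at hjX
    have key : τ u m < τ j m := by
      have h1 := hU.side j hj hjX.1
      have h2 := before_iff hN hj hjX.1
      have h3 := hU.right
      have hu := hU.u_lt
      have s1 := A.symm u j
      have hne := A.ne (u := u) (j := j) (k := m) (by omega) (by omega) hm hjX.1 (by omega)
        (by omega)
      rcases lt_or_gt_of_ne hjX.1 with h | h
      · have := A.tri j u m h hu hm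
        have h5 : ¬ (c = u ∨ τ u j < τ u c) := by tauto
        push Not at h5
        have := h3.resolve_left h5.1
        omega
      · have := A.tri u j m h hj hm
        have h5 : (c = u ∨ τ u j < τ u c) := by
          by_contra hc
          apply hjX.2; rw [h1]; constructor <;> intro h6
          · omega
          · exact absurd h6 hc
        have h6 := h2.1 h5
        have := hd.resolve_left h6.1
        omega
    rcases mem_insert.1 hi with rfl | hi
    · exact key
    · exact hX.lt i hi j hj hjX.2

/-- Having crossed `u`, the line `m` enters the cell above it, and the edge of `u` that starts at
the new crossing is on the lower boundary of that cell. -/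
theorem Upper.cross (A : Arr τ n) (hm : m < n) (hU : Upper τ m X u c)
    (hN : Nxt τ (known m X u) u d c) (hd : d = u ∨ τ u d < τ u m) :
    Lower τ m (insert u X) u m := by
  have hu := hU.u_lt
  refine ⟨hu, le_rfl, by omega, by simp, le_rfl, fun j hj hju => ?_⟩
  rw [mem_insert]
  have hne := A.ne (u := u) (j := j) (k := m) (by omega) (by omega) hm hju (by omega) (by omega)
  have : (c = u ∨ τ u j < τ u c) ↔ τ u j ≤ τ u m := by
    constructor
    · intro h
      have h2 := (before_iff hN hj hju).1 h
      have := hd.resolve_left h2.1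
      omega
    · intro h
      refine hU.right.imp id fun h2 => by omega
  rw [← this, ← hU.side j hj hju]
  tauto

/-- The edge lies wholly to the right of `m`, so the walk goes on with the line through its left
end. A less steep line there would belong to `X`; then `m` would cross it before `u`, and by `tri`
its crossing with `u` would precede that of `m`. -/
theorem Upper.prev (A : Arr τ n) (hm : m < n) (hU : Upper τ m X u c) (hX : Pre τ m X)
    (hN : Nxt τ (known m X u) u d c) (hdK : d ∈ insert u (known m X u)) (hdu : d ≠ u)
    (hdm : ¬ τ u d < τ u m) : u < d ∧ Upper τ m X d u := by
  have hu := hU.u_lt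
  have hd' := mem_known.1 ((mem_insert.1 hdK).resolve_left hdu)
  have hdlt : d < m := by
    rcases hd'.2 with h | h
    · exact h
    · exact absurd h.2 hU.notMem
  have hne := A.ne (u := u) (j := d) (k := m) (by omega) (by omega) hm hdu (by omega) (by omega)
  have hbef : c = u ∨ τ u d < τ u c := by
    by_cases hcu : c = u
    · exact Or.inl hcu
    · exact Or.inr ((hN.gt hcu).resolve_left hdu)
  have s1 := A.symm u d
  have hud : u < d := by
    by_contra hcon
    have hlt : d < u := by omega
    have hdX : d ∈ X := by rw [hU.side d hdlt hdu]; tauto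
    have := hX.lt d hdX u hu hU.notMem
    have := A.tri d u m hlt hu hm
    omega
  have hdX : d ∉ X := by
    rw [hU.side d hdlt hdu]; intro h
    have := h.2 hbef; omega
  refine ⟨hud, hdlt, hu, hdX, Or.inr ?_, fun j hj hjd => ?_⟩
  · have h2 := A.vertex (j := m) (u := u) (c := d) hm (by omega) (by omega) (by omega) (by omega)
      (by omega)
    have := A.ne (u := d) (j := m) (k := u) (by omega) (by omega) (by omega) (by omega) (by omega)
      (by omega)
    omega
  · by_cases hju : j = u
    · subst hju; simp only [hU.notMem, false_iff]; omega
    · have h4 : (d ≠ u ∧ τ u j ≤ τ u d) ↔ τ u j < τ u d := by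
        have := A.ne (u := u) (j := j) (k := d) (by omega) (by omega) (by omega) hju hdu hjd
        omega
      rw [hU.side j hj hju, before_iff hN hj hju, h4,
        A.vertex (by omega) (by omega) (by omega) hju hjd (by omega)]
      omega

/-- The lines at which the walk has turned to a steeper line, on the lower boundary of a cell. -/
structure LowerTurns (τ : ℕ → ℕ → ℕ) (m : ℕ) (X : Finset ℕ) (low : Prop) (u : ℕ)
    (W : Finset ℕ) : Prop where
  sub : W ⊆ range m
  -- `b` is the line that was turned to and `Y` the set of lines below the cell of the turn. The
  -- last clause orders the turns in the current cell, where slopes increase along the lower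
  -- boundary.
  turn : ∀ a ∈ W, ∃ b Y, a < b ∧ b < m ∧ b ∈ Y ∧ a ∈ Y ∧ Y ⊆ X ∧ Pre τ m Y ∧
    (∀ j < m, j ≠ a → (j ∈ Y ↔ (j < a ↔ τ a j < τ a b))) ∧ (Y = X → low → a < u)

/-- The lines to which the walk has turned from a less steep line, on the upper boundary of a
cell. -/
structure UpperTurns (τ : ℕ → ℕ → ℕ) (m : ℕ) (X : Finset ℕ) (low : Prop) (u : ℕ)
    (W : Finset ℕ) : Prop where
  sub : W ⊆ range m
  turn : ∀ b ∈ W, ∃ a Y, a < b ∧ b < m ∧ b ∉ Y ∧ Y ⊆ X ∧ Pre τ m Y ∧ τ b m < τ b a ∧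
    (∀ j < m, j ≠ b → (j ∈ Y ↔ (j < b ↔ τ b j < τ b a))) ∧ (Y = X → ¬ low ∧ b ≤ u)

/-! ### No turn of the walk is charged twice. -/

variable {W : Finset ℕ}

/-- Suppose that the walk has turned at `u` before, to `b`, in a cell with `Y ⊆ X` below it. If `b`
meets `u` before `d`, it is not below the present cell, against `Y ⊆ X`. If `b = d`, the cells
coincide, and the order of slopes is violated. If `b` meets `u` after `d`, then `d ∉ Y`, so `m`
crosses `u` before `d`, which `tri` excludes to the right of `m`. -/
theorem LowerTurns.add (A : Arr τ n) (hm : m < n) (hL : Lower τ m X u c) (hX : Pre τ m X)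
    (hN : Nxt τ (known m X u) u c d) (hd : u < d) (hW : LowerTurns τ m X True u W) :
    u ∉ W ∧ LowerTurns τ m X True d (insert u W) := by
  have h1 := hL.next_lt hN hd.ne'
  have hu := hL.u_lt
  have hside : ∀ j < m, j ≠ u → (j ∈ X ↔ (j < u ↔ τ u j < τ u d)) := fun j hj hju => by
    rw [hL.side j hj hju, hL.lt_next_iff hN hd.ne' hj hju]
  refine ⟨fun huW => ?_, ?_, fun a ha => ?_⟩
  · obtain ⟨b, Y, hab, hbm, hbY, haY, hYX, hY, hYs, hlast⟩ := hW.turn u huW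
    rcases lt_trichotomy (τ u b) (τ u d) with h | h | h
    · have := (hside b hbm (by omega)).1 (hYX hbY)
      omega
    · have hbd : b = d := by
        by_contra hne
        exact A.ne (u := u) (by omega) (by omega) (by omega) (by omega) (by omega) hne h
      subst hbd
      have : Y = X := by
        ext j
        by_cases hju : j = u
        · subst hju; simp [haY, hL.mem]
        · constructor <;> intro hj
          · exact hYX hj
          · have hjm := hX.sub j hj
            rw [hYs j hjm hju, ← hside j hjm hju]; exact hj
      exact absurd (hlast this trivial) (lt_irrefl _)
    · have hdY : d ∉ Y := by rw [hYs d h1.1 (by omega)]; omega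
      have h5 := hY.lt u haY d h1.1 hdY
      have := A.tri u d m hd h1.1 hm
      have := hL.right
      omega
  · intro j hj
    rcases mem_insert.1 hj with rfl | hj
    · exact mem_range.2 hu
    · exact hW.sub hj
  · rcases mem_insert.1 ha with rfl | ha
    · exact ⟨d, X, hd, h1.1, (hL.turn A hm hN hd).mem, hL.mem, subset_rfl, hX, hside,
        fun _ _ => hd⟩
    · obtain ⟨b, Y, hab, hbm, hbY, haY, hYX, hY, hYs, hlast⟩ := hW.turn a ha
      exact ⟨b, Y, hab, hbm, hbY, haY, hYX, hY, hYs, fun h _ => (hlast h trivial).trans hd⟩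

/-- Mirror image of `LowerTurns.add`. An earlier turn to `d` from another line `a` puts `a` or `u`
below one of the two cells. Then `m` crosses that line before `d`, and its crossing with `d` is not
to the right of `m`. -/
theorem UpperTurns.add (A : Arr τ n) (hm : m < n) (hU : Upper τ m X d u) (hX : Pre τ m X)
    (hu : u < d) (hW : UpperTurns τ m X False u W) :
    d ∉ W ∧ UpperTurns τ m X False d (insert d W) := by
  have hdm := hU.u_lt
  have hright := hU.right.resolve_left hu.ne
  have hside : ∀ j < m, j ≠ d → (j ∈ X ↔ (j < d ↔ τ d j < τ d u)) := fun j hj hju => by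
    rw [hU.side j hj hju]; simp [hu.ne]
  refine ⟨fun hdW => ?_, ?_, fun b hb => ?_⟩
  · obtain ⟨a, Y, hab, hbm, hbY, hYX, hY, hr, hYs, hlast⟩ := hW.turn d hdW
    have s1 := A.symm d a
    have s2 := A.symm d u
    rcases lt_trichotomy (τ d a) (τ d u) with h | h | h
    · have haX : a ∈ X := by rw [hside a (by omega) (by omega)]; omega
      have := hX.lt a haX d hdm hU.notMem
      have := A.tri a d m hab hdm hm
      omega
    · have hau : a = u := by
        by_contra hne
        exact A.ne (u := d) (by omega) (by omega) (by omega) (by omega) (by omega) hne h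
      subst hau
      have : Y = X := by
        ext j
        by_cases hjd : j = d
        · subst hjd; simp [hbY, hU.notMem]
        · constructor <;> intro hj
          · exact hYX hj
          · have hjm := hX.sub j hj
            rw [hYs j hjm hjd, ← hside j hjm hjd]; exact hj
      have := (hlast this).2
      omega
    · have huY : u ∈ Y := by rw [hYs u (by omega) (by omega)]; omega
      have := hY.lt u huY d hdm hbY
      have := A.tri u d m hu hdm hm
      omega
  · intro j hj
    rcases mem_insert.1 hj with rfl | hj
    · exact mem_range.2 hdm
    · exact hW.sub hj
  · rcases mem_insert.1 hb with rfl | hb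
    · exact ⟨u, X, hu, hdm, hU.notMem, subset_rfl, hX, hright, hside, fun _ => ⟨id, le_rfl⟩⟩
    · obtain ⟨a, Y, hab, hbm, hbY, hYX, hY, hr, hYs, hlast⟩ := hW.turn b hb
      exact ⟨a, Y, hab, hbm, hbY, hYX, hY, hr, hYs, fun h => ⟨id, (hlast h).2.trans hu.le⟩⟩

theorem LowerTurns.to_upper {low : Prop} {v : ℕ} (hW : LowerTurns τ m X low u W) :
    LowerTurns τ m X False v W := by
  refine ⟨hW.sub, fun a ha => ?_⟩
  obtain ⟨b, Y, h1, h2, h3, h4, h5, h6, h7, h8⟩ := hW.turn a ha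
  exact ⟨b, Y, h1, h2, h3, h4, h5, h6, h7, fun _ h => h.elim⟩

theorem UpperTurns.of_lower {low : Prop} {v : ℕ} (hW : UpperTurns τ m X True u W) :
    UpperTurns τ m X low v W := by
  refine ⟨hW.sub, fun a ha => ?_⟩
  obtain ⟨b, Y, h1, h2, h3, h4, h5, h6, h7, h8⟩ := hW.turn a ha
  exact ⟨b, Y, h1, h2, h3, h4, h5, h6, h7, fun h => absurd trivial (h8 h).1⟩

/-- The new cell has `u` below it, which no recorded cell has, so the clause on the current cell
becomes void. -/
theorem LowerTurns.cross {low low' : Prop} {v : ℕ} (hu : u ∉ X)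
    (hW : LowerTurns τ m X low u W) : LowerTurns τ m (insert u X) low' v W := by
  refine ⟨hW.sub, fun a ha => ?_⟩
  obtain ⟨b, Y, h1, h2, h3, h4, h5, h6, h7, h8⟩ := hW.turn a ha
  refine ⟨b, Y, h1, h2, h3, h4, h5.trans (subset_insert _ _), h6, h7, fun h => ?_⟩
  subst h; exact absurd (h5 (mem_insert_self _ _)) hu

theorem UpperTurns.cross {low low' : Prop} {v : ℕ} (hu : u ∉ X)
    (hW : UpperTurns τ m X low u W) : UpperTurns τ m (insert u X) low' v W := by
  refine ⟨hW.sub, fun a ha => ?_⟩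
  obtain ⟨b, Y, h1, h2, h3, h4, h5, h6, h7, h8⟩ := hW.turn a ha
  refine ⟨b, Y, h1, h2, h3, h4.trans (subset_insert _ _), h5, h6, h7, fun h => ?_⟩
  subst h; exact absurd (h4 (mem_insert_self _ _)) hu

end Arrangement

/-! ## The arrangement of the squared distances along a line -/
namespace Arrangement

open Finset

/-- The points with feet `U` on an axis and heights `H ≥ 0` above it, sorted. -/
structure Sorted (U H : ℕ → ℝ) (n : ℕ) : Prop where
  -- Decreasing feet are increasing slopes. Among parallel lines the higher one comes first, in
  -- accordance with a crossing at `+∞`.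
  lt : ∀ i j, i < j → j < n → U j < U i ∨ (U j = U i ∧ H j ≤ H i)
  nonneg : ∀ i < n, 0 ≤ H i

/-- The position on the axis with equal distances to the points `a` and `b`. -/
noncomputable def cross (U H : ℕ → ℝ) (a b : ℕ) : ℝ :=
  ((U b * U b + H b * H b) - (U a * U a + H a * H a)) / (2 * (U b - U a))

/-- The crossing as an extended number, `⊤` for parallel lines. -/
noncomputable def crossTop (U H : ℕ → ℝ) (a b : ℕ) : WithTop ℝ :=
  if U a = U b then ⊤ else (cross U H a b : ℝ)

abbrev Key : Type := WithTop ℝ ×ₗ ℝ ×ₗ ℤ ×ₗ ℕ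

/-- The order of the crossings, ties being broken in a consistent way; for `a < b`. -/
noncomputable def orderedKey (U H : ℕ → ℝ) (a b : ℕ) : Key :=
  if U a = U b then toLex (⊤, toLex (0, toLex ((a : ℤ), b)))
  -- At a common point of three lines of distinct slopes the pairs come in the order `ij`, `ik`,
  -- `jk`. The sign of `-a` is needed for coincident lines `i`, `j`: their mutual crossing is at
  -- `⊤`, so `tri` demands `jk` before `ik`.
  else toLex (((cross U H a b : ℝ) : WithTop ℝ), toLex (- U a, toLex (-(a : ℤ), b)))

noncomputable def key (U H : ℕ → ℝ) (a b : ℕ) : Key := orderedKey U H (min a b) (max a b)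

open Classical in
/-- The rank of the crossing of `a` and `b` among all crossings. -/
noncomputable def rank (U H : ℕ → ℝ) (n : ℕ) (a b : ℕ) : ℕ :=
  #{x ∈ range n ×ˢ range n | key U H x.1 x.2 < key U H a b}

variable {U H : ℕ → ℝ} {n : ℕ}

theorem cross_comm (a b : ℕ) : cross U H a b = cross U H b a := by
  unfold cross
  rw [← neg_sub (U a * U a + _), ← neg_sub (U a) (U b), mul_neg, neg_div_neg_eq]

theorem crossTop_comm (a b : ℕ) : crossTop U H a b = crossTop U H b a := by
  unfold crossTop
  rw [cross_comm]
  simp only [eq_comm]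

theorem key_comm (a b : ℕ) : key U H a b = key U H b a := by
  unfold key; rw [min_comm, max_comm]

theorem key_of_lt {a b : ℕ} (h : a < b) : key U H a b = orderedKey U H a b := by
  unfold key; rw [min_eq_left h.le, max_eq_right h.le]

theorem key_fst (a b : ℕ) : (ofLex (key U H a b)).1 = crossTop U H a b := by
  wlog h : a ≤ b generalizing a b
  · rw [key_comm, crossTop_comm]; exact this b a (by omega)
  unfold key orderedKey crossTop
  rw [min_eq_left h, max_eq_right h]
  split <;> rfl

theorem crossTop_mono {a b c d : ℕ} (h : key U H a b ≤ key U H c d) :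
    crossTop U H a b ≤ crossTop U H c d := by
  rw [← key_fst, ← key_fst]
  exact Prod.Lex.monotone_fst _ _ h

/-- Counting the smaller keys transports their order to natural numbers. The program never computes
ranks. -/
theorem rank_lt_iff {a b c d : ℕ} (ha : a < n) (hb : b < n) :
    rank U H n a b < rank U H n c d ↔ key U H a b < key U H c d := by
  classical
  constructor
  · intro h
    by_contra hcon
    refine absurd h (not_lt.2 (card_le_card fun x hx => ?_))
    simp only [mem_filter] at hx ⊢
    exact ⟨hx.1, hx.2.trans_le (not_lt.1 hcon)⟩
  · intro h
    refine card_lt_card ⟨fun x hx => ?_, fun hsub => ?_⟩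
    · simp only [mem_filter] at hx ⊢
      exact ⟨hx.1, hx.2.trans h⟩
    · have : (a, b) ∈ {x ∈ range n ×ˢ range n | key U H x.1 x.2 < key U H c d} := by
        simp [ha, hb, h]
      have := hsub this
      simp at this

theorem crossTop_le_of_rank {a b c d : ℕ} (hc : c < n) (hd : d < n)
    (h : rank U H n a b ≤ rank U H n c d) : crossTop U H a b ≤ crossTop U H c d :=
  crossTop_mono (not_lt.1 fun h' => absurd ((rank_lt_iff hc hd).2 h') (not_lt.2 h))

theorem orderedKey_inj {a b c d : ℕ} (h : orderedKey U H a b = orderedKey U H c d) :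
    a = c ∧ b = d := by
  have h2 := congrArg (fun x => (ofLex (ofLex (ofLex x).2).2)) h
  have h1 := congrArg (fun x => (ofLex x).1) h
  unfold orderedKey at h1 h2
  split_ifs at h1 h2 <;> simp at h1 h2 <;> exact h2

theorem key_inj {a b c d : ℕ} (h : key U H a b = key U H c d) :
    (a = c ∧ b = d) ∨ (a = d ∧ b = c) := by
  have := orderedKey_inj h
  omega

theorem orderedKey_lt_fin {a b c d : ℕ} (h1 : U a ≠ U b) (h2 : U c ≠ U d) :
    orderedKey U H a b < orderedKey U H c d ↔ cross U H a b < cross U H c d ∨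
      (cross U H a b = cross U H c d ∧ (U c < U a ∨ (U a = U c ∧ (c < a ∨ (a = c ∧ b < d))))) := by
  unfold orderedKey
  rw [if_neg h1, if_neg h2]
  simp only [Prod.Lex.toLex_lt_toLex, WithTop.coe_lt_coe, WithTop.coe_inj, neg_lt_neg_iff, neg_inj,
    Nat.cast_lt, Nat.cast_inj]

theorem orderedKey_lt_top {a b c d : ℕ} (h1 : U a ≠ U b) (h2 : U c = U d) :
    orderedKey U H a b < orderedKey U H c d := by
  unfold orderedKey
  rw [if_neg h1, if_pos h2, Prod.Lex.toLex_lt_toLex]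
  exact Or.inl (WithTop.coe_lt_top _)

theorem orderedKey_top_lt_top {a b c d : ℕ} (h1 : U a = U b) (h2 : U c = U d) :
    orderedKey U H a b < orderedKey U H c d ↔ a < c ∨ (a = c ∧ b < d) := by
  unfold orderedKey
  rw [if_pos h1, if_pos h2]
  simp [Prod.Lex.toLex_lt_toLex]

theorem cross_eq {a b : ℕ} (h : U a ≠ U b) :
    2 * (U b - U a) * cross U H a b = (U b * U b + H b * H b) - (U a * U a + H a * H a) := by
  unfold cross
  have : U b - U a ≠ 0 := sub_ne_zero.2 h.symm
  field_simp

/-- By `cross_eq` the crossing of `i` and `k` is a convex combination of the other two crossings,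
weighted by slope differences, so it lies between them. Equality and parallel lines are decided by
the tie-breaking components. -/
theorem key_tri (S : Sorted U H n) {i j k : ℕ} (hij : i < j) (hjk : j < k) (hk : k < n) :
    (key U H i j < key U H i k ∧ key U H i k < key U H j k) ∨
      (key U H j k < key U H i k ∧ key U H i k < key U H i j) := by
  have hik : i < k := by omega
  rw [key_of_lt hij, key_of_lt hjk, key_of_lt hik]
  have hHk := S.nonneg k hk
  have hHj := S.nonneg j (by omega)
  rcases S.lt i j hij (by omega) with h1 | ⟨h1, h1'⟩ <;>
    rcases S.lt j k hjk hk with h2 | ⟨h2, h2'⟩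
  · have e1 := cross_eq (H := H) h1.ne'
    have e2 := cross_eq (H := H) h2.ne'
    have e3 := cross_eq (H := H) (h2.trans h1).ne'
    rw [orderedKey_lt_fin h1.ne' (h2.trans h1).ne', orderedKey_lt_fin (h2.trans h1).ne' h2.ne',
      orderedKey_lt_fin h2.ne' (h2.trans h1).ne', orderedKey_lt_fin (h2.trans h1).ne' h1.ne']
    set x := cross U H i j
    set y := cross U H j k
    set z := cross U H i k
    have e4 : (U i - U k) * z = (U i - U j) * x + (U j - U k) * y := by linarith
    rcases lt_trichotomy x y with h | h | h
    · left; constructor <;> left <;> nlinarith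
    · left
      have hz : z = y := by
        have : (U i - U k) * (z - y) = 0 := by rw [h] at e4; linarith
        rcases mul_eq_zero.1 this with h3 | h3 <;> linarith
      have hx : x = z := by linarith
      refine ⟨Or.inr ⟨hx, Or.inr ⟨rfl, Or.inr ⟨rfl, hjk⟩⟩⟩, Or.inr ⟨hz, Or.inl h1⟩⟩
    · right; constructor <;> left <;> nlinarith
  · have hik' : U i ≠ U k := by rw [h2]; exact h1.ne'
    have e1 := cross_eq (H := H) h1.ne'
    have e3 := cross_eq (H := H) hik'
    left
    refine ⟨?_, orderedKey_lt_top hik' h2.symm⟩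
    rw [orderedKey_lt_fin h1.ne' hik']
    rcases lt_or_ge (cross U H i j) (cross U H i k) with h | h
    · exact Or.inl h
    · right
      refine ⟨?_, Or.inr ⟨rfl, Or.inr ⟨rfl, hjk⟩⟩⟩
      rw [h2] at e3
      nlinarith
  · have hik' : U i ≠ U k := by rw [← h1]; exact h2.ne'
    have e2 := cross_eq (H := H) h2.ne'
    have e3 := cross_eq (H := H) hik'
    right
    refine ⟨?_, orderedKey_lt_top hik' h1.symm⟩
    rw [orderedKey_lt_fin h2.ne' hik']
    rcases lt_or_ge (cross U H j k) (cross U H i k) with h | h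
    · exact Or.inl h
    · right
      refine ⟨?_, Or.inr ⟨h1, Or.inl hij⟩⟩
      rw [← h1] at e3
      nlinarith
  · have h3 : U i = U k := by rw [h2, h1]
    left
    rw [orderedKey_top_lt_top h1.symm h3, orderedKey_top_lt_top h3 h2.symm]
    omega

/-- The crossings along a line form an arrangement. -/
theorem arr_rank (S : Sorted U H n) : Arr (rank U H n) n where
  symm a b := by unfold rank; rw [key_comm]
  tri i j k hij hjk hk := by
    simp only [rank_lt_iff (show i < n by omega) (show j < n by omega),
      rank_lt_iff (show i < n by omega) hk, rank_lt_iff (show j < n by omega) hk]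
    exact key_tri S hij hjk hk
  inj a b c d ha hb hc hd _ _ h := by
    refine key_inj (U := U) (H := H) (le_antisymm (not_lt.1 fun h' => ?_) (not_lt.1 fun h' => ?_))
    · exact absurd ((rank_lt_iff hc hd).2 h') (by omega)
    · exact absurd ((rank_lt_iff ha hb).2 h') (by omega)

/-- Comparison with a crossing of a line that comes later in the order. -/
theorem rank_lt_rank_iff (S : Sorted U H n) {u d m : ℕ} (hu : u < m) (hd : d < m) (hdu : d ≠ u)
    (hm : m < n) : rank U H n u d < rank U H n u m ↔
      U m = U u ∨ (U d ≠ U u ∧ cross U H u d ≤ cross U H u m) := by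
  rw [rank_lt_iff (by omega) (by omega), key_of_lt hu]
  by_cases hm' : U m = U u
  · simp only [hm', true_or, iff_true]
    by_cases hd' : U d = U u
    · rcases lt_or_gt_of_ne hdu with h | h
      · rw [key_comm, key_of_lt h, orderedKey_top_lt_top hd' hm'.symm]; omega
      · rw [key_of_lt h, orderedKey_top_lt_top hd'.symm hm'.symm]; omega
    · rcases lt_or_gt_of_ne hdu with h | h
      · rw [key_comm, key_of_lt h]; exact orderedKey_lt_top hd' hm'.symm
      · rw [key_of_lt h]; exact orderedKey_lt_top (Ne.symm hd') hm'.symm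
  · simp only [hm', false_or]
    by_cases hd' : U d = U u
    · simp only [hd', ne_eq, not_true, false_and, iff_false, not_lt]
      rcases lt_or_gt_of_ne hdu with h | h
      · rw [key_comm, key_of_lt h]; exact (orderedKey_lt_top (Ne.symm hm') hd').le
      · rw [key_of_lt h]; exact (orderedKey_lt_top (Ne.symm hm') hd'.symm).le
    · simp only [ne_eq, hd', not_false_eq_true, true_and]
      -- At equal positions the crossing with `m` comes last: if `d < u`, the foot of `d` is larger
      -- than that of `u`, and if `u < d`, the last component `d < m` decides. Hence one comparison
      -- `≤` of positions suffices.
      rcases lt_or_gt_of_ne hdu with h | h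
      · rw [key_comm, key_of_lt h, orderedKey_lt_fin hd' (Ne.symm hm'), cross_comm d u]
        have h3 : U u < U d := by
          rcases S.lt d u h (by omega) with h3 | h3
          · exact h3
          · exact absurd h3.1.symm hd'
        rw [le_iff_lt_or_eq]
        simp [h3]
      · rw [key_of_lt h, orderedKey_lt_fin (Ne.symm hd') (Ne.symm hm')]
        rw [le_iff_lt_or_eq]
        simp [hd]

end Arrangement

/-! ## Building the arrangement -/
namespace RealRAM.HL

open Arrangement Finset

attribute [simp] go_seq go_skip go_setS go_setA go_setR go_setRA go_ite

/-- The crossing of two lines. -/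
def crossE (u v : SV) : RE :=
  .div (.sub (.add (.mul (.ra .u (.s v)) (.ra .u (.s v))) (.mul (.ra .h (.s v)) (.ra .h (.s v))))
    (.add (.mul (.ra .u (.s u)) (.ra .u (.s u))) (.mul (.ra .h (.s u)) (.ra .h (.s u)))))
    (.mul (.lit 2) (.sub (.ra .u (.s v)) (.ra .u (.s u))))

theorem crossE_eval {E : Env} {V : St} (u v : SV) :
    (crossE u v).eval E V = cross (V.ra .u) (V.ra .h) (V.s u) (V.s v) := by
  simp [crossE, cross]

theorem crossE_ok {E : Env} {V : St} {u v : SV} (hu : V.s u < E.n) (hv : V.s v < E.n)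
    (h : V.ra .u (V.s u) ≠ V.ra .u (V.s v)) : (crossE u v).ok E V := by
  simp [crossE, hu, hv, sub_eq_zero, h.symm]

/-- `t1 := 1` if the crossing of `u` and `d` comes before that of `u` and `m` (or `d = u`). -/
def beforeP : HP :=
  .ite (.or (.weq (.s .d) (.s .u)) (.req (.ra .u (.s .m)) (.ra .u (.s .u)))) (.setS .t1 (.lit 1))
    (.ite (.req (.ra .u (.s .d)) (.ra .u (.s .u))) (.setS .t1 (.lit 0))
      (.setR .x1 (crossE .u .d) ;; .setR .x2 (crossE .u .m) ;;
        .ite (.rlt (.r .x2) (.r .x1)) (.setS .t1 (.lit 0)) (.setS .t1 (.lit 1))))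

/-- Insert the crossing of `m` and `u` between `d` and `c`, and append it to the list of `m`. -/
def crossP : HP :=
  .setA .nx (.s .u) (.s .d) (.s .m) ;; .setA .pv (.s .u) (.s .m) (.s .d) ;;
  .setA .nx (.s .u) (.s .m) (.s .c) ;; .setA .pv (.s .u) (.s .c) (.s .m) ;;
  .setS .l (.a .pv (.s .m) (.s .m)) ;;
  .setA .nx (.s .m) (.s .l) (.s .u) ;; .setA .pv (.s .m) (.s .u) (.s .l) ;;
  .setA .nx (.s .m) (.s .u) (.s .m) ;; .setA .pv (.s .m) (.s .m) (.s .u) ;;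
  .setS .mode (.lit 0) ;; .setS .c (.s .m)

/-- Mode `1`: one step leftwards on the upper boundary, in search of the edge that `m` crosses. -/
def upperP : HP :=
  .setS .d (.a .pv (.s .u) (.s .c)) ;; beforeP ;;
  .ite (.weq (.s .t1) (.lit 1)) crossP (.setS .c (.s .u) ;; .setS .u (.s .d))

/-- Mode `0`: one step rightwards on the lower boundary. `d = u` signals an unbounded edge; beyond
the steepest old line, mode `2` ends the walk. -/
def lowerP : HP :=
  .setS .d (.a .nx (.s .u) (.s .c)) ;;
  .ite (.weq (.s .d) (.s .u))
    (.ite (.weq (.add (.s .u) (.lit 1)) (.s .m)) (.setS .mode (.lit 2))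
      (.setS .u (.add (.s .u) (.lit 1)) ;; .setS .c (.s .u) ;; .setS .mode (.lit 1)))
    (.ite (.wlt (.s .u) (.s .d)) (.setS .c (.s .u) ;; .setS .u (.s .d))
      (.setS .c (.s .u) ;; .setS .u (.s .d) ;; .setS .mode (.lit 1)))

def walkP : HP := .ite (.weq (.s .mode) (.lit 1)) upperP lowerP

/-- Build the lists of crossings, adding the lines one by one. -/
def buildP : HP :=
  .for .m (.lit 0) .n
    (.setA .nx (.s .m) (.s .m) (.s .m) ;; .setA .pv (.s .m) (.s .m) (.s .m) ;;
    .setS .u (.lit 0) ;; .setS .c (.lit 0) ;;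
    .ite (.weq (.s .m) (.lit 0)) (.setS .mode (.lit 2)) (.setS .mode (.lit 1)) ;;
    .loop (.wlt (.s .mode) (.lit 2)) walkP)

/-- What the construction leaves unchanged. -/
structure BuildFrame (V V' : St) : Prop where
  a : ∀ y, y ≠ .nx → y ≠ .pv → V'.a y = V.a y
  ra : V'.ra = V.ra
  r : ∀ y, y ≠ .x1 → y ≠ .x2 → V'.r y = V.r y

/-- The state of the walk along the zone of `m`. -/
structure WalkInv (E : Env) (V₀ : St) (m T : ℕ) (μ : ℕ) (V : St) (X W₁ W₂ : Finset ℕ) : Prop where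
  frame : BuildFrame V₀ V
  m_eq : V.s .m = m
  pre : Pre (rank (V₀.ra .u) (V₀.ra .h) E.n) m X
  link : ∀ u < m, Linked (rank (V₀.ra .u) (V₀.ra .h) E.n) (known m X u) u (V.a .nx u) (V.a .pv u)
  linkm : Linked (rank (V₀.ra .u) (V₀.ra .h) E.n) X m (V.a .nx m) (V.a .pv m)
  lowerTurns : LowerTurns (rank (V₀.ra .u) (V₀.ra .h) E.n) m X (V.s .mode = 0) (V.s .u) W₁
  upperTurns : UpperTurns (rank (V₀.ra .u) (V₀.ra .h) E.n) m X (V.s .mode = 0) (V.s .u) W₂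
  state : (V.s .mode = 0 ∧ Lower (rank (V₀.ra .u) (V₀.ra .h) E.n) m X (V.s .u) (V.s .c)) ∨
    (V.s .mode = 1 ∧ Upper (rank (V₀.ra .u) (V₀.ra .h) E.n) m X (V.s .u) (V.s .c)) ∨
    (V.s .mode = 2 ∧ X = range m)
  -- A step records a turn, leaves the lower boundary, or crosses a line. Crossing resets the mode
  -- from `1` to `0`, which costs one; the weight `2` of `#X` pays for it.
  measure : (m - #W₁) + (m - #W₂) + 2 * (m - #X) + (2 - V.s .mode) = μ
  time : V.t + 30 * μ ≤ T

section
variable {E : Env} {V₀ V : St} {m T μ : ℕ} {X W₁ W₂ : Finset ℕ}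

theorem go_before (S : Sorted (V.ra .u) (V.ra .h) E.n) (hm : V.s .m < E.n)
    (hu : V.s .u < V.s .m) (hd : V.s .d < V.s .m) {Q : St → Prop}
    (hQ : ∀ V' : St, V'.a = V.a → V'.ra = V.ra → (∀ y, y ≠ .x1 → y ≠ .x2 → V'.r y = V.r y) →
      (∀ y, y ≠ .t1 → V'.s y = V.s y) → V'.t ≤ V.t + 6 →
      (V'.s .t1 = 1 ↔ V.s .d = V.s .u ∨
        rank (V.ra .u) (V.ra .h) E.n (V.s .u) (V.s .d) <
          rank (V.ra .u) (V.ra .h) E.n (V.s .u) (V.s .m)) → Q V') : Go E beforeP V Q := by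
  have hun : V.s .u < E.n := hu.trans hm
  have hdn : V.s .d < E.n := hd.trans hm
  by_cases hdu : V.s .d = V.s .u
  · simp [beforeP, hdu, hun, hm]
    apply hQ <;> simp +contextual [hdu]
  have key := rank_lt_rank_iff S hu hd hdu hm
  by_cases h1 : V.ra .u (V.s .m) = V.ra .u (V.s .u)
  · simp [beforeP, hdu, h1, hun, hm]
    apply hQ <;> simp +contextual [key, h1]
  by_cases h2 : V.ra .u (V.s .d) = V.ra .u (V.s .u)
  · simp [beforeP, hdu, h1, h2, hun, hdn, hm]
    apply hQ <;> simp +contextual [key, h1, h2, hdu]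
  · have o1 : (crossE .u .d).ok E V.tick.tick := crossE_ok hun hdn (Ne.symm h2)
    have o2 : ∀ v, (crossE .u .m).ok E (V.tick.tick.setR .x1 v) :=
      fun v => crossE_ok hun hm (Ne.symm h1)
    simp only [beforeP, go_ite, go_seq, go_setR, o1, o2, crossE_eval]
    simp [hdu, h1, h2, hun, hdn, hm]
    constructor <;> intro h3 <;> apply hQ <;> simp +contextual [key, h1, h2, hdu, h3]

theorem known_insert {u : ℕ} (hu : u ∉ X) (hum : u < m) :
    known m (insert u X) u = insert m (known m X u) := by
  ext a
  simp only [mem_known, mem_insert, hu]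
  constructor
  · rintro ⟨h1, h2 | h2⟩ <;> tauto
  · rintro (h | ⟨h1, h2 | h2⟩)
    · subst h; exact ⟨by omega, Or.inr ⟨rfl, by tauto⟩⟩
    · exact ⟨h1, Or.inl h2⟩
    · exact absurd h2.2 id

theorem known_insert_of_ne {u v : ℕ} (hv : v ≠ u) : known m (insert u X) v = known m X v := by
  ext a
  simp only [mem_known, mem_insert, hv, false_or]

theorem go_upper (S : Sorted (V₀.ra .u) (V₀.ra .h) E.n) (hm : m < E.n)
    (h : WalkInv E V₀ m T μ V X W₁ W₂) (hmode : V.s .mode = 1) {V' : St}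
    (hV : V' = V.tick.tick) :
    Go E upperP V' fun V' => ∃ μ' < μ, ∃ X W₁ W₂, WalkInv E V₀ m T μ' V' X W₁ W₂ := by
  have A := arr_rank S
  have hU := (h.state.resolve_left (by omega)).resolve_right (by omega) |>.2
  have hr := h.frame.ra
  have hmm := h.m_eq
  have hu := hU.u_lt
  have hc := hU.c_lt
  have hL := h.link _ hu
  have hcK : V.s .c ∈ insert (V.s .u) (known m X (V.s .u)) := by
    rw [mem_insert, mem_known]
    by_cases hcu : V.s .c = V.s .u
    · exact Or.inl hcu
    · exact Or.inr ⟨hcu, Or.inl hc⟩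
  have hdK := hL.pv_mem _ hcK
  have hN := hL.nxt _ hdK
  rw [hL.nx_pv _ hcK] at hN
  have hdlt : V.a .pv (V.s .u) (V.s .c) < m := by
    rcases mem_insert.1 hdK with h1 | h1
    · omega
    · rcases (mem_known.1 h1).2 with h2 | h2
      · exact h2
      · exact absurd h2.2 hU.notMem
  have hXsub : ∀ i ∈ X, i < m := h.pre.sub
  have hX2 : #(insert (V.s .u) X) = #X + 1 := card_insert_of_notMem hU.notMem
  have hX3 : #(insert (V.s .u) X) ≤ m := by
    have : insert (V.s .u) X ⊆ range m := by
      intro a ha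
      rcases mem_insert.1 ha with rfl | ha
      · exact mem_range.2 hu
      · exact mem_range.2 (hXsub a ha)
    simpa using card_le_card this
  have hmeas := h.measure
  have htime := h.time
  have hlow : (V.s .mode = 0) = False := by simp [hmode]
  have hl1 := h.lowerTurns
  have hl2 := h.upperTurns
  rw [hlow] at hl1 hl2
  rw [hmode] at hmeas
  subst hV
  rw [upperP, go_seq, go_setS]
  refine ⟨by simp; omega, ?_⟩
  rw [go_seq]
  refine go_before (by simpa [hr] using S) (by simp; omega) (by simp; omega)
    (by simp; omega) fun V₁ ha hra hrr hs ht hiff => ?_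
  simp only [St.setS_s, St.setS_a, St.setS_ra, St.setS_r, St.setS_t, St.tick_s, St.tick_a,
    St.tick_ra, St.tick_r, St.tick_t, reduceCtorEq, if_false, if_true, hr, WE.eval, hmm]
    at ha hra hrr hs ht hiff
  have s1 : V₁.s .u = V.s .u := by rw [hs _ (by decide)]; simp
  have s2 : V₁.s .c = V.s .c := by rw [hs _ (by decide)]; simp
  have s3 : V₁.s .m = m := by rw [hs _ (by decide)]; simp [hmm]
  have s4 : V₁.s .d = V.a .pv (V.s .u) (V.s .c) := by rw [hs _ (by decide)]; simp
  have s5 : V₁.s .mode = 1 := by rw [hs _ (by decide)]; simp [hmode]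
  generalize hd : V.a .pv (V.s .u) (V.s .c) = d at *
  generalize hue : V.s .u = u at *
  generalize hce : V.s .c = c at *
  have hframe : BuildFrame V₀ V₁ := ⟨fun y h1 h2 => by rw [ha]; exact h.frame.a y h1 h2,
    hra, fun y h1 h2 => by rw [hrr y h1 h2]; exact h.frame.r y h1 h2⟩
  rw [go_ite]
  refine ⟨by simp, fun ht1 => ?_, fun ht1 => ?_⟩
  -- `m` crosses this edge: `X` grows, and the walk continues on the lower boundary of the next
  -- cell.
  · simp only [TE.eval, WE.eval] at ht1
    have hb := hiff.1 ht1
    have hl : V.a .pv m m ∈ insert m X := h.linkm.pv_mem m (mem_insert_self _ _)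
    have hl' : V.a .pv m m ≤ m := by
      rcases mem_insert.1 hl with h1 | h1
      · omega
      · exact (hXsub _ h1).le
    have hmu : m ≠ u := by omega
    have o1 : u < E.n := by omega
    have o2 : d < E.n := by omega
    have o3 : c < E.n := by omega
    have o4 : V.a .pv m m < E.n := by omega
    simp [crossP, s1, s2, s3, s4, ha, hmu, o1, o2, o3, o4, hm]
    refine ⟨μ - 1, by omega, insert u X, W₁, W₂, ?_⟩
    have hpre := hU.prefix_insert A hm h.pre hN hb
    have hum : V.a .pv m m = m ∨
        rank (V₀.ra .u) (V₀.ra .h) E.n m (V.a .pv m m) < rank (V₀.ra .u) (V₀.ra .h) E.n m u := by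
      rcases mem_insert.1 hl with h1 | h1
      · exact Or.inl h1
      · right
        rw [A.symm m, A.symm m]
        exact h.pre.lt _ h1 u hu hU.notMem
    constructor
    · refine ⟨fun y h1 h2 => ?_, by simpa using hra, fun y h1 h2 => by simpa using hframe.r y h1 h2⟩
      funext i j
      simp [h1, h2, ha, h.frame.a y h1 h2]
    · simpa using s3
    · exact hpre
    · intro v hv
      by_cases hvu : v = u
      · subst hvu
        rw [known_insert hU.notMem hv]
        refine hL.insert_between (m := m) (c := c) ?_ hmu hcK ?_ ?_ ?_ (fun x => ?_)
          (fun x => ?_)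
        · rw [mem_known]; rintro ⟨-, h1 | h1⟩
          · omega
          · exact hU.notMem h1.2
        · intro a haK b hbK hab
          have h1 := mem_known.1 haK
          have h2 := mem_known.1 hbK
          by_contra hne
          exact A.ne (u := v) (by omega) (by omega) (by omega) h1.1 h2.1 hne hab
        · rw [hd]; exact hb
        · exact hU.right
        · have : v ≠ m := by omega
          simp [this, hd, ha]
        · have : v ≠ m := by omega
          simp [this, hd, ha]
      · rw [known_insert_of_ne hvu]
        have h4 : v ≠ m := by omega
        refine (h.link v hv).congr (fun x => ?_) (fun x => ?_) <;> simp [hvu, h4, ha]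
    · refine h.linkm.insert_between (m := u) (c := m) hU.notMem (by omega) (mem_insert_self _ _) ?_
        hum (Or.inl rfl) (fun x => ?_) (fun x => ?_)
      · intro a haK b hbK hab
        have h1 := hXsub a haK
        have h2 := hXsub b hbK
        by_contra hne
        exact A.ne (u := m) (by omega) (by omega) (by omega) (by omega) (by omega) hne hab
      · simp [hmu, ha]
      · simp [hmu, ha]
    · exact LowerTurns.cross hU.notMem hl1
    · exact UpperTurns.cross hU.notMem hl2
    · left
      refine ⟨by simp, ?_⟩
      simpa [s1] using hU.cross A hm hN hb
    · simp; omega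
    · simp; omega
  -- The edge is to the right of `m`: an upper turn, charged to `d`.
  · simp only [TE.eval, WE.eval] at ht1
    have hb : ¬ (d = u ∨ _) := fun h => ht1 (hiff.2 h)
    push Not at hb
    obtain ⟨hud, hU'⟩ := hU.prev A hm h.pre hN hdK hb.1 (by omega)
    obtain ⟨hW, hW2⟩ := UpperTurns.add A hm hU' h.pre hud hl2
    have hcard : #(insert d W₂) = #W₂ + 1 := card_insert_of_notMem hW
    have hcard' : #(insert d W₂) ≤ m := by simpa using card_le_card hW2.sub
    simp
    refine ⟨μ - 1, by omega, X, W₁, insert d W₂, ?_⟩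
    constructor
    · exact ⟨fun y h1 h2 => hframe.a y h1 h2, hra, hframe.r⟩
    · simpa using s3
    · exact h.pre
    · simpa [ha] using h.link
    · simpa [ha] using h.linkm
    · simp [s5, s4]
      exact hl1.to_upper
    · simpa [s5, s4] using hW2
    · right; left
      simpa [s5, s4, s1] using hU'
    · simp [s5]; omega
    · simp; omega

theorem go_lower (S : Sorted (V₀.ra .u) (V₀.ra .h) E.n) (hm : m < E.n)
    (h : WalkInv E V₀ m T μ V X W₁ W₂) (hmode : V.s .mode = 0) {V' : St}
    (hV : V' = V.tick.tick) :
    Go E lowerP V' fun V' => ∃ μ' < μ, ∃ X W₁ W₂, WalkInv E V₀ m T μ' V' X W₁ W₂ := by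
  have A := arr_rank S
  have hLw : Lower (rank (V₀.ra .u) (V₀.ra .h) E.n) m X (V.s .u) (V.s .c) := by
    rcases h.state with h1 | h1 | h1
    · exact h1.2
    · omega
    · omega
  have hmm := h.m_eq
  have hu := hLw.u_lt
  have hc := hLw.c_le
  have hL := h.link _ hu
  have hcK : V.s .c ∈ insert (V.s .u) (known m X (V.s .u)) := by
    rw [mem_insert, mem_known]
    refine Or.inr ⟨hLw.c_ne, ?_⟩
    rcases hc.lt_or_eq with h1 | h1
    · exact Or.inl h1
    · exact Or.inr ⟨h1, hLw.mem⟩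
  have hN := hL.nxt _ hcK
  have hmeas := h.measure
  have htime := h.time
  have hlow : (V.s .mode = 0) = True := by simp [hmode]
  have hl1 := h.lowerTurns
  have hl2 := h.upperTurns
  rw [hlow] at hl1 hl2
  rw [hmode] at hmeas
  subst hV
  generalize hd : V.a .nx (V.s .u) (V.s .c) = d at *
  generalize hue : V.s .u = u at *
  generalize hce : V.s .c = c at *
  have o1 : u < E.n := by omega
  have o2 : c < E.n := by omega
  -- Less steep: the right end of the cell. Equal: an unbounded edge. Steeper: a lower turn, charged
  -- to `u`.
  rcases lt_trichotomy d u with h1 | h1 | h1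
  · have h2 : d ≠ u := by omega
    have h3 : ¬ u < d := by omega
    simp [lowerP, hue, hce, hd, o1, o2, h2, h3, h1.le]
    refine ⟨μ - 1, by omega, X, W₁, W₂, ?_⟩
    constructor
    · exact ⟨fun y h1 h2 => h.frame.a y h1 h2, h.frame.ra, h.frame.r⟩
    · simpa using hmm
    · exact h.pre
    · simpa using h.link
    · simpa using h.linkm
    · simpa using hl1.to_upper
    · simpa using hl2.of_lower
    · right; left
      simpa [hue] using hLw.apex A hm hN h1
    · simp; omega
    · simp; omega
  · rw [h1] at hN
    by_cases h2 : u + 1 = m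
    · simp [lowerP, hue, hce, hd, o1, o2, h1, h2, hmm]
      refine ⟨by omega, μ - 2, by omega, X, W₁, W₂, ?_⟩
      constructor
      · exact ⟨fun y h1 h2 => h.frame.a y h1 h2, h.frame.ra, h.frame.r⟩
      · simpa using hmm
      · exact h.pre
      · simpa using h.link
      · simpa using h.linkm
      · simpa using hl1.to_upper
      · simpa using hl2.of_lower
      · right; right
        simpa using hLw.all_of_end h.pre hN h2
      · simp; omega
      · simp; omega
    · simp [lowerP, hue, hce, hd, o1, o2, h1, h2, hmm]
      refine ⟨by omega, μ - 1, by omega, X, W₁, W₂, ?_⟩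
      constructor
      · exact ⟨fun y h1 h2 => h.frame.a y h1 h2, h.frame.ra, h.frame.r⟩
      · simpa using hmm
      · exact h.pre
      · simpa using h.link
      · simpa using h.linkm
      · simpa using hl1.to_upper
      · simpa using hl2.of_lower
      · right; left
        simpa [hue] using hLw.next_line hN (by omega)
      · simp; omega
      · simp; omega
  · have h2 : d ≠ u := by omega
    obtain ⟨hW, hW2⟩ := LowerTurns.add A hm hLw h.pre hN h1 hl1
    have hcard : #(insert u W₁) = #W₁ + 1 := card_insert_of_notMem hW
    have hcard' : #(insert u W₁) ≤ m := by simpa using card_le_card hW2.sub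
    simp [lowerP, hue, hce, hd, o1, o2, h2, h1]
    refine ⟨μ - 1, by omega, X, insert u W₁, W₂, ?_⟩
    constructor
    · exact ⟨fun y h1 h2 => h.frame.a y h1 h2, h.frame.ra, h.frame.r⟩
    · simpa using hmm
    · exact h.pre
    · simpa using h.link
    · simpa using h.linkm
    · simpa [hmode] using hW2
    · simp only [St.setS_s, St.tick_s, hmode]
      simpa using hl2.of_lower (low := True)
    · left
      simpa [hue, hmode] using hLw.turn A hm hN h1
    · simp [hmode]; omega
    · simp; omega

/-- The lists of crossings of the first `m` lines. -/
def Built (E : Env) (V : St) (m : ℕ) : Prop :=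
  ∀ u < m, Linked (rank (V.ra .u) (V.ra .h) E.n) ((range m).erase u) u (V.a .nx u) (V.a .pv u)

theorem known_empty {u : ℕ} : known m ∅ u = (range m).erase u := by
  ext a; simp [mem_known]

theorem known_range {u : ℕ} (hu : u < m) : known m (range m) u = (range (m + 1)).erase u := by
  ext a
  simp only [mem_known, mem_erase, mem_range, hu, and_true]
  omega

/-- For a line `m > 0` the measure starts at `4m + 1`, and each walking step is paid with `30` units
of time, so a line costs `O(n)`. -/
theorem go_build (S : Sorted (V.ra .u) (V.ra .h) E.n) {Q : St → Prop}
    (hQ : ∀ V', BuildFrame V V' → Built E V' E.n → V'.t ≤ V.t + 1000 * E.n ^ 2 → Q V') :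
    Go E buildP V Q := by
  have A := arr_rank S
  have h2 := E.two_le
  refine go_for (fun k V' => BuildFrame V V' ∧ Built E V' k ∧
      V'.t ≤ V.t + 1 + k * (120 * E.n + 60)) E.n (by simp)
    (by simp) (by omega) ?_ (fun k V' _ _ => ⟨trivial, rfl⟩) ?_ (fun _ _ _ => le_rfl) ?_
  · exact ⟨⟨fun _ _ _ => rfl, rfl, fun _ _ _ => rfl⟩, fun u hu => absurd hu (by simp), by simp⟩
  · rintro m V₁ ⟨hF, hB, hT⟩ hm - hmn
    have hmn' : m < E.n := hmn
    simp [hm, hmn]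
    have hend : ∀ V₂ : St, (∃ μ X W₁ W₂, WalkInv E V m (V.t + (m + 1) * (120 * E.n + 60) - 2) μ
        V₂ X W₁ W₂) → V₂.s .mode = 2 → V₂.tick.s .m = m ∧ BuildFrame V (V₂.tick.setS .m (m + 1)) ∧
        Built E (V₂.tick.setS .m (m + 1)) (m + 1) ∧
          V₂.t + 1 + 1 ≤ V.t + 1 + (m + 1) * (120 * E.n + 60) := by
      rintro V₂ ⟨μ, X, W₁, W₂, hW⟩ hmode
      have hX : X = range m := by
        rcases hW.state with h | h | h
        · omega
        · omega
        · exact h.2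
      subst hX
      refine ⟨hW.m_eq, ⟨hW.frame.a, hW.frame.ra, hW.frame.r⟩, fun u hu => ?_, ?_⟩
      · simp only [St.setS_ra, St.tick_ra, hW.frame.ra, St.setS_a, St.tick_a]
        rcases Nat.lt_succ_iff_lt_or_eq.1 hu with hu | hu
        · rw [← known_range hu]; exact hW.link u hu
        · subst hu
          have := hW.linkm
          rwa [show (range (u + 1)).erase u = range u by
            ext a; simp only [mem_erase, mem_range]; omega]
      · have := hW.time
        have : 60 ≤ (m + 1) * (120 * E.n + 60) := by nlinarith
        omega
    have hloop : ∀ V₂ : St, (∃ μ X W₁ W₂, WalkInv E V m (V.t + (m + 1) * (120 * E.n + 60) - 2) μ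
        V₂ X W₁ W₂) → Go E (.loop (.wlt (.s .mode) (.lit 2)) walkP) V₂ fun V' => V'.s .m = m ∧
          BuildFrame V (V'.setS .m (m + 1)) ∧ Built E (V'.setS .m (m + 1)) (m + 1) ∧
          V'.t + 1 ≤ V.t + 1 + (m + 1) * (120 * E.n + 60) := by
      rintro V₂ ⟨μ, X, W₁, W₂, hW⟩
      refine go_loop (fun μ V' => ∃ X W₁ W₂, WalkInv E V m
        (V.t + (m + 1) * (120 * E.n + 60) - 2) μ V' X W₁ W₂) ⟨X, W₁, W₂, hW⟩ ?_
      rintro μ V₃ ⟨X, W₁, W₂, hW⟩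
      refine ⟨by simp, fun hb => ?_, fun hb => ?_⟩
      · refine hend V₃ ⟨μ, X, W₁, W₂, hW⟩ ?_
        simp at hb
        rcases hW.state with h | h | h <;> omega
      · simp only [TE.eval, WE.eval] at hb
        rw [walkP, go_ite]
        refine ⟨by simp, fun h1 => ?_, fun h1 => ?_⟩
        · exact go_upper S hmn' hW (by simpa using h1) rfl
        · exact go_lower S hmn' hW (by simp at h1; omega) rfl
    have hlinkm : ∀ V₂ : St, V₂.a .nx m m = m → V₂.a .pv m m = m →
        Linked (rank (V.ra .u) (V.ra .h) E.n) ∅ m (V₂.a .nx m) (V₂.a .pv m) :=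
      fun V₂ h1 h2 => Linked.empty m h1 h2
    have hlink : ∀ u < m, Linked (rank (V.ra .u) (V.ra .h) E.n) (known m ∅ u) u
        (V₁.a .nx u) (V₁.a .pv u) := by
      intro u hu
      have := hB u hu
      rwa [hF.ra, ← known_empty] at this
    have hm4 : 4 * m + 4 ≤ 4 * E.n := by omega
    have hT2 : (m + 1) * (120 * E.n + 60) = m * (120 * E.n + 60) + (120 * E.n + 60) := by ring
    constructor <;> intro h0 <;> apply hloop
    · refine ⟨0, ∅, ∅, ∅, ?_⟩
      subst h0
      constructor
      · exact ⟨fun y h1 h2 => by funext i j; simp [h1, h2, hF.a y h1 h2], hF.ra, hF.r⟩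
      · simpa using hm
      · exact ⟨by simp, by simp⟩
      · intro u hu; omega
      · exact hlinkm _ (by simp) (by simp)
      · exact ⟨by simp, by simp⟩
      · exact ⟨by simp, by simp⟩
      · right; right; simp
      · simp
      · simp; omega
    · refine ⟨4 * m + 1, ∅, ∅, ∅, ?_⟩
      constructor
      · exact ⟨fun y h1 h2 => by funext i j; simp [h1, h2, hF.a y h1 h2], hF.ra, hF.r⟩
      · simpa using hm
      · exact ⟨by simp, by simp⟩
      · intro u hu
        have : u ≠ m := by omega
        refine (hlink u hu).congr (fun x => ?_) (fun x => ?_) <;> simp [this]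
      · exact hlinkm _ (by simp) (by simp)
      · exact ⟨by simp, by simp⟩
      · exact ⟨by simp, by simp⟩
      · right; left
        refine ⟨by simp, ?_⟩
        simp
        exact ⟨by omega, by omega, by simp, Or.inl rfl, by simp⟩
      · simp; omega
      · simp; omega
  · rintro V₁ ⟨hF, hB, hT⟩ -
    refine hQ _ ⟨hF.a, hF.ra, hF.r⟩ hB ?_
    simp only [St.tick_t]
    nlinarith

end

end RealRAM.HL

/-! ## The gap between two consecutive levels of an arrangement -/
namespace Arrangement

open Finset

variable {τ : ℕ → ℕ → ℕ} {n : ℕ}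

/-- The lines in `S` are the lowest ones, `i` is the highest of them, on its edge after the crossing
with `ci`, and `j` is the line above, on its edge after the crossing with `cj`. -/
structure Gap (τ : ℕ → ℕ → ℕ) (n : ℕ) (S : Finset ℕ) (i ci j cj : ℕ) : Prop where
  sub : ∀ a ∈ S, a < n
  i_mem : i ∈ S
  j_notMem : j ∉ S
  j_lt : j < n
  ci_lt : ci < n
  cj_lt : cj < n
  lower : ∀ a < n, a ≠ i → (a ∈ S ↔ (a < i ↔ (ci ≠ i ∧ τ i a ≤ τ i ci)))
  upper : ∀ a < n, a ≠ j → (a ∈ S ↔ (a < j ↔ (cj ≠ j ∧ τ j a ≤ τ j cj)))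

abbrev NxtOn (τ : ℕ → ℕ → ℕ) (n u c d : ℕ) : Prop := Nxt τ ((range n).erase u) u c d

variable {S : Finset ℕ} {i ci j cj li lj : ℕ}

theorem Gap.i_lt (G : Gap τ n S i ci j cj) : i < n := G.sub i G.i_mem

theorem Gap.ne (G : Gap τ n S i ci j cj) : i ≠ j := fun h => G.j_notMem (h ▸ G.i_mem)

theorem NxtOn.lt {u c d : ℕ} (h : NxtOn τ n u c d) (hu : u < n) : d < n := by
  rcases mem_insert.1 h.mem with h | h
  · omega
  · exact mem_range.1 (mem_of_mem_erase h)

theorem NxtOn.le' {u c d a : ℕ} (h : NxtOn τ n u c d) (ha : a < n) (hau : a ≠ u)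
    (hca : ¬ (c ≠ u ∧ τ u a ≤ τ u c)) : d ≠ u ∧ τ u d ≤ τ u a :=
  h.le a (mem_erase.2 ⟨hau, mem_range.2 ha⟩) (by omega)

theorem NxtOn.not_le {u c d : ℕ} (h : NxtOn τ n u c d) (hd : d ≠ u) :
    ¬ (c ≠ u ∧ τ u d ≤ τ u c) := by
  have := h.gt hd; omega

/-- Below a crossing that is still ahead on the line `u`. -/
theorem NxtOn.crossed_iff (A : Arr τ n) {u c d a : ℕ} (h : NxtOn τ n u c d) (hu : u < n)
    (ha : a < n) (hau : a ≠ u) (hd : d ≠ u) (had : a ≠ d) :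
    (c ≠ u ∧ τ u a ≤ τ u c) ↔ τ u a < τ u d := by
  have hdn := h.lt hu
  have h1 := A.ne hu ha hdn hau hd had
  have h2 := h.not_le hd
  constructor
  · intro h3; omega
  · intro h3
    by_contra h4
    have := h.le' ha hau h4
    omega

/-- At `-∞` the steepest lines are the lowest, so the `p` lowest lines are the last ones in the
order. -/
theorem Gap.initial {p : ℕ} (hp : 0 < p) (hpn : p < n) :
    Gap τ n ((range n).filter (n - p ≤ ·)) (n - p) (n - p) (n - p - 1) (n - p - 1) := by
  constructor
  · intro a ha; simp at ha; exact ha.1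
  · simp; omega
  · simp; omega
  · omega
  · omega
  · omega
  · intro a ha hai; simp [ha]
  · intro a ha hai; simp [ha]; omega

/-- The other line of a crossing with the level below is in `S`. -/
theorem Gap.next_mem (G : Gap τ n S i ci j cj) (hN : NxtOn τ n i ci li) (h : i < li) : li ∈ S := by
  rw [G.lower li (hN.lt G.i_lt) h.ne']
  have := hN.not_le h.ne'
  omega

theorem Gap.next_notMem (G : Gap τ n S i ci j cj) (hN : NxtOn τ n j cj lj) (h : lj < j) :
    lj ∉ S := by
  rw [G.upper lj (hN.lt G.j_lt) h.ne]
  have := hN.not_le h.ne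
  omega

/-- A steeper line of `S` comes from below and takes over the lower level. -/
theorem Gap.lower_step (A : Arr τ n) (G : Gap τ n S i ci j cj) (hN : NxtOn τ n i ci li)
    (h : i < li) : Gap τ n S li i j cj := by
  have hln := hN.lt G.i_lt
  have hi := G.i_lt
  refine ⟨G.sub, G.next_mem hN h, G.j_notMem, G.j_lt, hi, G.cj_lt, fun a ha hal => ?_, G.upper⟩
  by_cases hai : a = i
  · subst hai; simp only [G.i_mem, true_iff]; omega
  · rw [G.lower a ha hai, hN.crossed_iff A hi ha hai h.ne' hal,
      A.vertex ha hi hln hai hal h.ne]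
    have := A.ne hln ha hi hal h.ne hai
    omega

/-- A less steep line outside `S` comes from above and takes over the upper level. -/
theorem Gap.upper_step (A : Arr τ n) (G : Gap τ n S i ci j cj) (hN : NxtOn τ n j cj lj)
    (h : lj < j) : Gap τ n S i ci lj j := by
  have hln := hN.lt G.j_lt
  have hj := G.j_lt
  refine ⟨G.sub, G.i_mem, G.next_notMem hN h, hln, G.ci_lt, hj, G.lower, fun a ha hal => ?_⟩
  by_cases haj : a = j
  · subst haj; simp only [G.j_notMem, false_iff]; omega
  · rw [G.upper a ha haj, hN.crossed_iff A hj ha haj h.ne hal,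
      A.vertex ha hj hln haj hal h.ne']
    have := A.ne hln ha hj hal h.ne' haj
    omega

/-- The two levels meet; this is the only event that changes the set below the gap. -/
theorem Gap.swap (A : Arr τ n) (G : Gap τ n S i ci j cj) (hi : NxtOn τ n i ci j)
    (hj : NxtOn τ n j cj i) (h : j < i) : Gap τ n (insert j (S.erase i)) j i i j := by
  have hin := G.i_lt
  have hjn := G.j_lt
  constructor
  · intro a ha
    rcases mem_insert.1 ha with rfl | ha
    · exact hjn
    · exact G.sub a (mem_of_mem_erase ha)
  · simp
  · simp; omega
  · exact hin
  · exact hin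
  · exact hjn
  · intro a ha haj
    rw [mem_insert, mem_erase]
    by_cases hai : a = i
    · subst hai; simp; omega
    · simp only [haj, hai, false_or, ne_eq, not_false_eq_true, true_and]
      rw [G.lower a ha hai, hi.crossed_iff A hin ha hai h.ne haj,
        A.vertex ha hin hjn hai haj h.ne']
      have := A.ne hjn ha hin haj h.ne' hai
      omega
  · intro a ha hai
    rw [mem_insert, mem_erase]
    by_cases haj : a = j
    · subst haj; simp; omega
    · simp only [haj, hai, false_or, ne_eq, not_false_eq_true, true_and]
      rw [G.upper a ha haj, hj.crossed_iff A hjn ha haj h.ne' hai,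
        A.vertex ha hjn hin haj hai h.ne]
      have := A.ne hin ha hjn hai h.ne haj
      omega

/-- A crossing of the upper line that is not with the level above is not the first one. -/
theorem Gap.lower_first (A : Arr τ n) (G : Gap τ n S i ci j cj) (hi : NxtOn τ n i ci li)
    (hj : NxtOn τ n j cj lj) (h : j < lj) : li ≠ i ∧ τ i li ≤ τ j lj := by
  have hin := G.i_lt
  have hjn := G.j_lt
  have hlj := hj.lt hjn
  have hij := G.ne
  have u1 := hj.not_le h.ne'
  have s1 := A.symm i j
  have l1 := G.lower j hjn hij.symm
  have l2 := G.upper i hin hij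
  have e1 := hi.le' hjn hij.symm
  simp only [G.i_mem, G.j_notMem, true_iff, false_iff] at l1 l2
  by_cases hlji : lj = i
  · subst hlji; omega
  have hS : lj ∈ S := by rw [G.upper lj hlj h.ne']; omega
  have l3 := G.lower lj hlj hlji
  simp only [hS, true_iff] at l3
  have e2 := hi.le' hlj hlji
  have e3 := hj.le' hin hij
  have s2 := A.symm i lj
  have s3 := A.symm j lj
  have n1 := A.ne hin hjn hlj hij.symm hlji (by omega)
  have n2 := A.ne hjn hin hlj hij (by omega) (Ne.symm hlji)
  rcases lt_or_gt_of_ne hij with h1 | h1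
  · have := A.tri i j lj h1 h hlj; omega
  · rcases lt_or_gt_of_ne hlji with h2 | h2
    · have := A.tri j lj i h h2 hin; omega
    · have := A.tri j i lj h1 h2 hlj; omega

/-- A line from above reaches the lower level only through the upper one, so the next crossing on
`j` comes no later. -/
theorem Gap.upper_first (A : Arr τ n) (G : Gap τ n S i ci j cj) (hi : NxtOn τ n i ci li)
    (hj : NxtOn τ n j cj lj) (h : li < i) : lj ≠ j ∧ τ j lj ≤ τ i li := by
  have hin := G.i_lt
  have hjn := G.j_lt
  have hli := hi.lt hin
  have hij := G.ne
  have u1 := hi.not_le h.ne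
  have s1 := A.symm i j
  have l1 := G.lower j hjn hij.symm
  have l2 := G.upper i hin hij
  have e1 := hj.le' hin hij
  simp only [G.i_mem, G.j_notMem, true_iff, false_iff] at l1 l2
  by_cases hlij : li = j
  · subst hlij; omega
  have hS : li ∉ S := by rw [G.lower li hli h.ne]; omega
  have l3 := G.upper li hli hlij
  simp only [hS, false_iff] at l3
  have e2 := hj.le' hli hlij
  have e3 := hi.le' hjn hij.symm
  have s2 := A.symm i li
  have s3 := A.symm j li
  have n1 := A.ne hin hjn hli hij.symm (by omega) (Ne.symm hlij)
  have n2 := A.ne hjn hin hli hij hlij (by omega)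
  rcases lt_or_gt_of_ne hij with h1 | h1
  · have := A.tri li i j h h1 hjn; omega
  · rcases lt_or_gt_of_ne hlij with h2 | h2
    · have := A.tri li j i h2 h1 hin; omega
    · have := A.tri j li i h2 h hin; omega

/-- `upper_first` and `lower_first` make the next crossings of both levels simultaneous, so they are
one and the same crossing. -/
theorem Gap.swap_of (A : Arr τ n) (G : Gap τ n S i ci j cj) (hi : NxtOn τ n i ci li)
    (hj : NxtOn τ n j cj lj) (h1 : li < i) (h2 : ¬ lj < j) : li = j ∧ lj = i := by
  have h3 := G.upper_first A hi hj h1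
  have h4 := G.lower_first A hi hj (by omega)
  have := A.inj i li j lj G.i_lt (hi.lt G.i_lt) G.j_lt (hj.lt G.j_lt) h1.ne' h3.1.symm (by omega)
  have := G.ne
  omega

/-! ### Counting the crossings on the levels -/

open Classical in
/-- The number of lines below the crossing of `a` and `b`. -/
noncomputable def lev (τ : ℕ → ℕ → ℕ) (n a b : ℕ) : ℕ :=
  #{x ∈ range n | x ≠ a ∧ x ≠ b ∧ (x < a ↔ τ a x < τ a b)}

open Classical in
/-- The number of crossings with level in `L` that are not before that of `i` and `ci`. -/
noncomputable def remaining (τ : ℕ → ℕ → ℕ) (n : ℕ) (L : ℕ → Prop) (i ci : ℕ) : ℕ :=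
  #{x ∈ range n ×ˢ range n | L (lev τ n x.1 x.2) ∧ (ci = i ∨ τ i ci < τ x.1 x.2)}

/-- The crossing of `u` and `d` is counted before the step and no longer after it. -/
theorem remaining_step (A : Arr τ n) {L : ℕ → Prop} {u c d : ℕ} (hN : NxtOn τ n u c d) (hu : u < n)
    (hd : d ≠ u) (hL : L (lev τ n u d)) : remaining τ n L d u < remaining τ n L u c := by
  classical
  have h1 := hN.not_le hd
  have s := A.symm u d
  refine card_lt_card ⟨fun x hx => ?_, fun hsub => ?_⟩
  · simp only [mem_filter] at hx ⊢
    have := hx.2.2.resolve_left (Ne.symm hd)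
    exact ⟨hx.1, hx.2.1, by omega⟩
  · have : (u, d) ∈ {x ∈ range n ×ˢ range n | L (lev τ n x.1 x.2) ∧ (c = u ∨ τ u c < τ x.1 x.2)} := by
      simp [hu, hN.lt hu, hL]; omega
    have := hsub this
    simp only [mem_filter] at this
    omega

theorem Gap.lev_lower (A : Arr τ n) (G : Gap τ n S i ci j cj) (hN : NxtOn τ n i ci li)
    (h : li ≠ i) : lev τ n i li = #((S.erase i).erase li) := by
  unfold lev
  congr 1
  ext x
  simp only [mem_filter, mem_range, mem_erase]
  constructor
  · rintro ⟨h1, h2, h3, h4⟩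
    refine ⟨h3, h2, ?_⟩
    rwa [G.lower x h1 h2, hN.crossed_iff A G.i_lt h1 h2 h h3]
  · rintro ⟨h1, h2, h3⟩
    have hx := G.sub x h3
    refine ⟨hx, h2, h1, ?_⟩
    rwa [G.lower x hx h2, hN.crossed_iff A G.i_lt hx h2 h h1] at h3

theorem Gap.lev_upper (A : Arr τ n) (G : Gap τ n S i ci j cj) (hN : NxtOn τ n j cj lj)
    (h : lj ≠ j) : lev τ n j lj = #(S.erase lj) := by
  unfold lev
  congr 1
  ext x
  simp only [mem_filter, mem_range, mem_erase]
  constructor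
  · rintro ⟨h1, h2, h3, h4⟩
    refine ⟨h3, ?_⟩
    rwa [G.upper x h1 h2, hN.crossed_iff A G.j_lt h1 h2 h h3]
  · rintro ⟨h1, h3⟩
    have hx := G.sub x h3
    have h2 : x ≠ j := fun h => G.j_notMem (h ▸ h3)
    refine ⟨hx, h2, h1, ?_⟩
    rwa [G.upper x hx h2, hN.crossed_iff A G.j_lt hx h2 h h1] at h3

/-- The crossings on the gap with `p` lines below it. -/
noncomputable def gapMeasure (τ : ℕ → ℕ → ℕ) (n p i ci j cj : ℕ) : ℕ :=
  -- A crossing on the lower level has `p - 2` or `p - 1` lines below it, and one on the upper level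
  -- `p - 1` or `p`, depending on whether the other line belongs to `S`.
  remaining τ n (fun q => q + 2 = p ∨ q + 1 = p) i ci +
    remaining τ n (fun q => q + 1 = p ∨ q = p) j cj

theorem Gap.measure_lower (A : Arr τ n) (G : Gap τ n S i ci j cj) (hN : NxtOn τ n i ci li)
    (h : i < li) : gapMeasure τ n #S li i j cj < gapMeasure τ n #S i ci j cj := by
  have h1 := G.next_mem hN h
  have h2 := card_erase_add_one G.i_mem
  have h3 := card_erase_add_one (mem_erase.2 ⟨h.ne', h1⟩)
  have := remaining_step A hN G.i_lt h.ne' (L := fun q => q + 2 = #S ∨ q + 1 = #S)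
    (by rw [G.lev_lower A hN h.ne']; omega)
  unfold gapMeasure; omega

theorem Gap.measure_upper (A : Arr τ n) (G : Gap τ n S i ci j cj) (hN : NxtOn τ n j cj lj)
    (h : lj < j) : gapMeasure τ n #S i ci lj j < gapMeasure τ n #S i ci j cj := by
  have h1 := G.next_notMem hN h
  have := remaining_step A hN G.j_lt h.ne (L := fun q => q + 1 = #S ∨ q = #S)
    (by rw [G.lev_upper A hN h.ne, erase_eq_of_notMem h1]; omega)
  unfold gapMeasure; omega

theorem Gap.card_swap (G : Gap τ n S i ci j cj) : #(insert j (S.erase i)) = #S := by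
  rw [card_insert_of_notMem (by simp [G.j_notMem]), card_erase_add_one G.i_mem]

theorem Gap.measure_swap (A : Arr τ n) (G : Gap τ n S i ci j cj) (hi : NxtOn τ n i ci j)
    (hj : NxtOn τ n j cj i) : gapMeasure τ n #S j i i j < gapMeasure τ n #S i ci j cj := by
  have hne := G.ne
  have h2 := card_erase_add_one G.i_mem
  have e1 := remaining_step A hi G.i_lt hne.symm (L := fun q => q + 2 = #S ∨ q + 1 = #S)
    (by rw [G.lev_lower A hi hne.symm, erase_eq_of_notMem (by simp [G.j_notMem])]; omega)
  have e2 := remaining_step A hj G.j_lt hne (L := fun q => q + 1 = #S ∨ q = #S)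
    (by rw [G.lev_upper A hj hne]; omega)
  unfold gapMeasure; omega

theorem sum_card_fiber_le {α : Type*} (s : Finset α) (f : α → ℕ) (t : Finset ℕ) :
    ∑ p ∈ t, #{x ∈ s | f x = p} ≤ #s := by
  classical
  rw [← card_biUnion]
  · exact card_le_card (biUnion_subset.2 fun p _ => filter_subset _ _)
  · intro a _ b _ hab
    rw [Function.onFun, disjoint_filter]
    intro x _ h1 h2; exact hab (h1.symm.trans h2)

/-- An ordered pair of lines has a single level, so it counts for at most one `p` in each of the
four cases. This makes the sweeps quadratic in total. -/
theorem sum_gapMeasure_le (t : Finset ℕ) (f : ℕ → ℕ) (g : ℕ → ℕ) :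
    ∑ p ∈ t, gapMeasure τ n p (f p) (f p) (g p) (g p) ≤ 4 * n ^ 2 := by
  classical
  have key : ∀ p ∈ t, gapMeasure τ n p (f p) (f p) (g p) (g p) ≤
      (#{x ∈ range n ×ˢ range n | lev τ n x.1 x.2 + 2 = p} +
        #{x ∈ range n ×ˢ range n | lev τ n x.1 x.2 + 1 = p}) +
      (#{x ∈ range n ×ˢ range n | lev τ n x.1 x.2 + 1 = p} +
        #{x ∈ range n ×ˢ range n | lev τ n x.1 x.2 = p}) := by
    intro p _
    unfold gapMeasure remaining
    refine add_le_add ?_ ?_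
    · rw [← card_union_add_card_inter]
      refine le_trans (card_le_card fun x hx => ?_) (Nat.le_add_right _ _)
      simp only [mem_union, mem_filter] at hx ⊢; tauto
    · rw [← card_union_add_card_inter]
      refine le_trans (card_le_card fun x hx => ?_) (Nat.le_add_right _ _)
      simp only [mem_union, mem_filter] at hx ⊢; tauto
  refine (sum_le_sum key).trans ?_
  rw [sum_add_distrib, sum_add_distrib, sum_add_distrib]
  have h1 := sum_card_fiber_le (range n ×ˢ range n) (fun x => lev τ n x.1 x.2 + 2) t
  have h2 := sum_card_fiber_le (range n ×ˢ range n) (fun x => lev τ n x.1 x.2 + 1) t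
  have h3 := sum_card_fiber_le (range n ×ˢ range n) (fun x => lev τ n x.1 x.2) t
  have h4 : #(range n ×ˢ range n) = n ^ 2 := by simp [sq]
  rw [h4] at h1 h2 h3
  linarith

/-! ### The gap at a position on the axis -/

variable {U H : ℕ → ℝ}

/-- The squared distance to the point `a`. -/
def sqd (U H : ℕ → ℝ) (a : ℕ) (x : ℝ) : ℝ := (x - U a) * (x - U a) + H a * H a

/-- The less steep line is below to the right of the crossing. -/
theorem sqd_le_of_lt (T : Sorted U H n) {a b : ℕ} {x : ℝ} (hab : a < b) (hb : b < n)
    (h : U a ≠ U b ∧ cross U H b a ≤ x) : sqd U H a x ≤ sqd U H b x := by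
  rcases T.lt a b hab hb with h1 | h1
  · have := cross_eq (H := H) h1.ne
    unfold sqd
    nlinarith [mul_nonneg (sub_nonneg.2 h1.le) (sub_nonneg.2 h.2)]
  · exact absurd h1.1.symm h.1

/-- The steeper line is below to the left of the crossing; of two parallel lines the later one is
nowhere above the other. -/
theorem sqd_le_of_gt (T : Sorted U H n) {a b : ℕ} {x : ℝ} (hab : b < a) (ha : a < n)
    (h : U a ≠ U b → x ≤ cross U H b a) : sqd U H a x ≤ sqd U H b x := by
  rcases T.lt b a hab ha with h1 | h1
  · have := cross_eq (H := H) h1.ne'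
    have h2 := h h1.ne
    unfold sqd
    nlinarith [mul_nonneg (sub_nonneg.2 h1.le) (sub_nonneg.2 h2)]
  · have h3 := T.nonneg a ha
    unfold sqd
    rw [h1.1]
    nlinarith [h1.2]

/-- Infinite crossings come last, so whatever precedes a finite crossing is finite. -/
theorem cross_le_of_rank {a b c d : ℕ} (hc : c < n) (hd : d < n)
    (h : rank U H n a b ≤ rank U H n c d) (hcd : U c ≠ U d) :
    U a ≠ U b ∧ cross U H a b ≤ cross U H c d := by
  have := crossTop_le_of_rank hc hd h
  unfold crossTop at this
  rw [if_neg hcd] at this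
  split_ifs at this with h1
  · exact absurd this (not_le.2 (WithTop.coe_lt_top _))
  · exact ⟨h1, WithTop.coe_le_coe.1 this⟩

/-- Bounds on the position on the axis; the first two are from below. -/
def InRange (f₁ f₂ f₃ f₄ : Prop) (x₁ x₂ x₃ x₄ x : ℝ) : Prop :=
  (f₁ → x₁ ≤ x) ∧ (f₂ → x₂ ≤ x) ∧ (f₃ → x ≤ x₃) ∧ (f₄ → x ≤ x₄)

/-- The positions on the axis that belong to the state of the gap. -/
def GapRange (U H : ℕ → ℝ) (i ci j cj li lj : ℕ) : ℝ → Prop :=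
  InRange (U i ≠ U ci) (U j ≠ U cj) (U i ≠ U li) (U j ≠ U lj) (cross U H i ci) (cross U H j cj)
    (cross U H i li) (cross U H j lj)

/-- No crossing on `i` lies strictly inside the range, so each line of `S` stays on its side of `i`
there. -/
theorem Gap.sqd_le (T : Sorted U H n) (G : Gap (rank U H n) n S i ci j cj)
    (hN : NxtOn (rank U H n) n i ci li) (hci : ci ≠ i → U i ≠ U ci) {x : ℝ}
    (hx : GapRange U H i ci j cj li lj x) {a : ℕ} (ha : a ∈ S) : sqd U H a x ≤ sqd U H i x := by
  by_cases hai : a = i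
  · subst hai; exact le_rfl
  have han := G.sub a ha
  have h1 := (G.lower a han hai).1 ha
  rcases lt_or_gt_of_ne hai with h | h
  · obtain ⟨h2, h3⟩ := h1.1 h
    obtain ⟨h4, h5⟩ := cross_le_of_rank G.i_lt G.ci_lt h3 (hci h2)
    exact sqd_le_of_lt T h G.i_lt ⟨h4.symm, h5.trans (hx.1 (hci h2))⟩
  · refine sqd_le_of_gt T h han fun h2 => ?_
    obtain ⟨h3, h4⟩ := hN.le' han hai (by omega)
    obtain ⟨h5, h6⟩ := cross_le_of_rank G.i_lt han h4 h2.symm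
    exact (hx.2.2.1 h5).trans h6

theorem Gap.le_sqd (T : Sorted U H n) (G : Gap (rank U H n) n S i ci j cj)
    (hN : NxtOn (rank U H n) n j cj lj) (hcj : cj ≠ j → U j ≠ U cj) {x : ℝ}
    (hx : GapRange U H i ci j cj li lj x) {a : ℕ} (han : a < n) (ha : a ∉ S) :
    sqd U H j x ≤ sqd U H a x := by
  by_cases haj : a = j
  · subst haj; exact le_rfl
  have h1 := mt (G.upper a han haj).2 ha
  rcases lt_or_gt_of_ne haj with h | h
  · refine sqd_le_of_gt T h G.j_lt fun h2 => ?_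
    rw [cross_comm]
    obtain ⟨h3, h4⟩ := hN.le' han haj (by tauto)
    obtain ⟨h5, h6⟩ := cross_le_of_rank G.j_lt han h4 h2
    exact (hx.2.2.2 h5).trans h6
  · have h2 : cj ≠ j ∧ rank U H n j a ≤ rank U H n j cj := by
      by_contra h3; exact h1 ⟨fun h4 => by omega, fun h4 => absurd h4 h3⟩
    obtain ⟨h4, h5⟩ := cross_le_of_rank G.j_lt G.cj_lt h2.2 (hcj h2.1)
    refine sqd_le_of_lt T h han ⟨h4, ?_⟩
    rw [cross_comm]
    exact h5.trans (hx.2.1 (hcj h2.1))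

/-- The crossings before the position `x` (and at `x`, if `b` holds). -/
def Cut (U H : ℕ → ℝ) (b : Prop) (x : ℝ) (a c : ℕ) : Prop :=
  U a ≠ U c ∧ (cross U H a c < x ∨ (b ∧ cross U H a c = x))

theorem Cut.comm {b : Prop} {x : ℝ} {a c : ℕ} : Cut U H b x a c ↔ Cut U H b x c a := by
  unfold Cut; rw [cross_comm, ne_comm]

theorem Cut.mono {b : Prop} {x : ℝ} {a c a' c' : ℕ} (h : Cut U H b x a' c')
    (h1 : U a ≠ U c) (h2 : cross U H a c ≤ cross U H a' c') : Cut U H b x a c := by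
  refine ⟨h1, ?_⟩
  rcases h.2 with h3 | ⟨h3, h4⟩
  · exact Or.inl (h2.trans_lt h3)
  · rcases h2.lt_or_eq with h5 | h5
    · exact Or.inl (h4 ▸ h5)
    · exact Or.inr ⟨h3, h5.trans h4⟩

theorem Cut.of_rank {b : Prop} {x : ℝ} {a c a' c' : ℕ} (h : Cut U H b x a' c') (ha : a' < n)
    (hc : c' < n) (hr : rank U H n a c ≤ rank U H n a' c') : Cut U H b x a c := by
  obtain ⟨h1, h2⟩ := cross_le_of_rank ha hc hr h.1
  exact h.mono h1 h2

theorem Cut.le {b : Prop} {x : ℝ} {a c : ℕ} (h : Cut U H b x a c) : cross U H a c ≤ x := by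
  rcases h.2 with h | h
  · exact h.le
  · exact h.2.le

theorem Cut.ge {b : Prop} {x : ℝ} {a c : ℕ} (h : ¬ Cut U H b x a c) (h1 : U a ≠ U c) :
    x ≤ cross U H a c := by
  by_contra h2
  exact h ⟨h1, Or.inl (not_le.1 h2)⟩

/-- `S` consists of the lines that are lowest at a cut; `i` is the highest of them, and `j` the
line above. -/
structure PrefixAt (D : ℕ → ℕ → Prop) (n : ℕ) (S : Finset ℕ) (i j : ℕ) : Prop where
  sub : ∀ a ∈ S, a < n
  i_mem : i ∈ S
  j_notMem : j ∉ S
  j_lt : j < n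
  lower : ∀ a < n, a ≠ i → (a ∈ S ↔ (a < i ↔ D i a))
  upper : ∀ a < n, a ≠ j → (a ∈ S ↔ (a < j ↔ D j a))

/-- The state of the gap is past all crossings before the cut. -/
def Pending (D : ℕ → ℕ → Prop) (i ci j cj : ℕ) : Prop := (ci ≠ i → D i ci) ∧ (cj ≠ j → D j cj)

/-- If neither of the next crossings precedes the cut, the state of the sweep is the state at the
cut. Cuts with `b` false and `b` true give the orders just before and just after `x`, and both are
used where several lines meet. -/
theorem Gap.prefixAt {b : Prop} {x : ℝ} (G : Gap (rank U H n) n S i ci j cj)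
    (hi : NxtOn (rank U H n) n i ci li) (hj : NxtOn (rank U H n) n j cj lj)
    (hP : Pending (Cut U H b x) i ci j cj) (h1 : ¬ Cut U H b x i li) (h2 : ¬ Cut U H b x j lj) :
    PrefixAt (Cut U H b x) n S i j ∧ GapRange U H i ci j cj li lj x := by
  refine ⟨⟨G.sub, G.i_mem, G.j_notMem, G.j_lt, fun a ha hai => ?_, fun a ha haj => ?_⟩, ?_⟩
  · rw [G.lower a ha hai]
    have : (ci ≠ i ∧ rank U H n i a ≤ rank U H n i ci) ↔ Cut U H b x i a := by
      constructor
      · rintro ⟨h3, h4⟩; exact (hP.1 h3).of_rank G.i_lt G.ci_lt h4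
      · intro h3
        by_contra h4
        exact h1 (h3.of_rank G.i_lt ha (hi.le' ha hai h4).2)
    rw [this]
  · rw [G.upper a ha haj]
    have : (cj ≠ j ∧ rank U H n j a ≤ rank U H n j cj) ↔ Cut U H b x j a := by
      constructor
      · rintro ⟨h3, h4⟩; exact (hP.2 h3).of_rank G.j_lt G.cj_lt h4
      · intro h3
        by_contra h4
        exact h2 (h3.of_rank G.j_lt ha (hj.le' ha haj h4).2)
    rw [this]
  · exact ⟨fun h => (hP.1 fun h' => h (by rw [h'])).le, fun h => (hP.2 fun h' => h (by rw [h'])).le,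
      fun h => Cut.ge h1 h, fun h => Cut.ge h2 h⟩

end Arrangement

/-! ## The width of an annulus as a function of its center -/
namespace Arrangement

/-- The Cauchy–Schwarz inequality in the plane. -/
theorem mul_add_mul_le_sqrt (p q r s : ℝ) : p * r + q * s ≤ √(p * p + q * q) * √(r * r + s * s) := by
  rw [← Real.sqrt_mul (by nlinarith [mul_self_nonneg p, mul_self_nonneg q])]
  apply Real.le_sqrt_of_sq_le
  nlinarith [sq_nonneg (p * s - q * r)]

/-- The distance from `(x, 0)` to `(u, a)`. -/
noncomputable def dst (u a x : ℝ) : ℝ := √((x - u) * (x - u) + a * a)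

variable {u a v b x y z w : ℝ}

theorem dst_nonneg (u a x : ℝ) : 0 ≤ dst u a x := Real.sqrt_nonneg _

theorem dst_mul_self (u a x : ℝ) : dst u a x * dst u a x = (x - u) * (x - u) + a * a :=
  Real.mul_self_sqrt (by nlinarith [mul_self_nonneg (x - u), mul_self_nonneg a])

theorem dst_neg (u a x : ℝ) : dst (-u) a (-x) = dst u a x := by
  unfold dst; congr 1; ring

theorem sub_le_dst (u a x : ℝ) : x - u ≤ dst u a x :=
  Real.le_sqrt_of_sq_le (by nlinarith [mul_self_nonneg a])

theorem dst_triangle (u a v b x : ℝ) :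
    dst v b x ≤ dst u a x + √((u - v) * (u - v) + (b - a) * (b - a)) := by
  have h := mul_add_mul_le_sqrt (x - u) a (u - v) (b - a)
  have h1 := dst_mul_self u a x
  have h2 := Real.mul_self_sqrt (show 0 ≤ (u - v) * (u - v) + (b - a) * (b - a) by
    nlinarith [mul_self_nonneg (u - v), mul_self_nonneg (b - a)])
  have h3 := dst_nonneg u a x
  change _ ≤ dst u a x * _ at h
  set E := √((u - v) * (u - v) + (b - a) * (b - a))
  have hE : 0 ≤ E := Real.sqrt_nonneg _
  refine Real.sqrt_le_iff.2 ⟨by positivity, ?_⟩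
  nlinarith

/-- Convexity of the norm, by squaring and Cauchy–Schwarz. -/
theorem dst_convex {s t p q : ℝ} (hs : 0 ≤ s) (ht : 0 ≤ t) (hst : s + t = 1) :
    dst u a (s * p + t * q) ≤ s * dst u a p + t * dst u a q := by
  have h := mul_add_mul_le_sqrt (p - u) a (q - u) a
  have h1 := dst_mul_self u a p
  have h2 := dst_mul_self u a q
  have h3 := dst_nonneg u a p
  have h4 := dst_nonneg u a q
  change _ ≤ dst u a p * dst u a q at h
  refine Real.sqrt_le_iff.2 ⟨by positivity, ?_⟩
  have e : s * p + t * q - u = s * (p - u) + t * (q - u) := by linear_combination u * hst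
  have e2 : a * a = (s + t) * (s + t) * (a * a) := by rw [hst]; ring
  rw [e, e2]
  have h5 := mul_le_mul_of_nonneg_left h (mul_nonneg hs ht)
  have h6 : (s * dst u a p + t * dst u a q) ^ 2 = s * s * (dst u a p * dst u a p) +
      t * t * (dst u a q * dst u a q) + 2 * (s * t * (dst u a p * dst u a q)) := by ring
  rw [h6, h1, h2]
  linarith

/-- The superlevel sets of the width are convex. -/
theorem width_quasiconcave (hw : 0 ≤ w) (hx : w ≤ dst v b x - dst u a x)
    (hz : w ≤ dst v b z - dst u a z) (hxy : x ≤ y) (hyz : y ≤ z) :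
    w ≤ dst v b y - dst u a y := by
  rcases hxy.eq_or_lt with rfl | hxy
  · exact hx
  obtain ⟨s, t, hs, ht, hst, rfl⟩ : ∃ s t : ℝ, 0 ≤ s ∧ 0 ≤ t ∧ s + t = 1 ∧ s * x + t * z = y := by
    have hp : 0 < z - x := by linarith
    refine ⟨(z - y) / (z - x), (y - x) / (z - x), div_nonneg (by linarith) hp.le,
      div_nonneg (by linarith) hp.le, ?_, ?_⟩
    · field_simp; ring
    · field_simp; ring
  have h1 := dst_mul_self u a x
  have h2 := dst_mul_self u a z
  have h3 := dst_mul_self v b x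
  have h4 := dst_mul_self v b z
  have n1 := dst_nonneg u a x
  have n2 := dst_nonneg u a z
  have c := dst_convex (u := u) (a := a) (p := x) (q := z) hs ht hst
  have m1 := dst_mul_self u a (s * x + t * z)
  have n3 := dst_nonneg u a (s * x + t * z)
  -- As `w ≥ 0`, squaring turns the claim into `w² + 2w · dst u ≤ (dst v)² - (dst u)²`, where the
  -- left side is convex and the right side affine in the position.
  have k1 : (dst u a x + w) * (dst u a x + w) ≤ dst v b x * dst v b x := by
    apply mul_self_le_mul_self <;> linarith
  have k2 : (dst u a z + w) * (dst u a z + w) ≤ dst v b z * dst v b z := by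
    apply mul_self_le_mul_self <;> linarith
  have : dst u a (s * x + t * z) + w ≤ dst v b (s * x + t * z) := by
    apply Real.le_sqrt_of_sq_le
    have e : t = 1 - s := by linarith
    have k3 := mul_le_mul_of_nonneg_left k1 hs
    have k4 := mul_le_mul_of_nonneg_left k2 ht
    have k5 := mul_le_mul_of_nonneg_left c hw
    subst e
    nlinarith
  linarith

/-- The position with the maximum width. -/
theorem width_le_crit (ha : 0 ≤ a) (hab : a < b) (x : ℝ) :
    dst v b x - dst u a x ≤
      dst v b ((v * a - u * b) / (a - b)) - dst u a ((v * a - u * b) / (a - b)) := by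
  have hp : 0 < b - a := by linarith
  set E := √((u - v) * (u - v) + (b - a) * (b - a)) with hE
  have hE2 : E * E = (u - v) * (u - v) + (b - a) * (b - a) := Real.mul_self_sqrt (by
    nlinarith [mul_self_nonneg (u - v), mul_self_nonneg (b - a)])
  have hp' : a - b ≠ 0 := by linarith
  have hE0 : 0 ≤ E := Real.sqrt_nonneg _
  -- At the point where the line through `(u, a)` and `(v, b)` meets the axis, both distances are
  -- proportional to the heights. Their difference is the distance `E` of the two points, which the
  -- triangle inequality shows to be an upper bound.
  have key : ∀ p c : ℝ, 0 ≤ c → (v * a - u * b) / (a - b) - p = c / (b - a) * (v - u) * (-1) →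
      dst p c ((v * a - u * b) / (a - b)) = c / (b - a) * E := by
    intro p c hc hpc
    unfold dst
    rw [hpc, ← Real.sqrt_mul_self (show 0 ≤ c / (b - a) * E by positivity)]
    congr 1
    rw [mul_mul_mul_comm _ E, hE2]
    field_simp
    ring
  have e1 := key v b (ha.trans hab.le) (by rw [← neg_sub b a]; field_simp; ring)
  have e2 := key u a ha (by rw [← neg_sub b a]; field_simp; ring)
  rw [e1, e2]
  have := dst_triangle u a v b x
  have e3 : b / (b - a) * E - a / (b - a) * E = E := by field_simp
  rw [e3]; linarith

/-- Raising the outer point to the height `a` does not decrease the width. For equal heights the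
bound is the triangle inequality. -/
theorem width_le_of_height_le (hb : 0 ≤ b) (hba : b ≤ a) (huv : v ≤ u) (x : ℝ) :
    dst v b x - dst u a x ≤ u - v := by
  have h1 : dst v b x ≤ dst v a x := Real.sqrt_le_sqrt (by nlinarith)
  have h2 := dst_triangle u a v a x
  rw [show (u - v) * (u - v) + (a - a) * (a - a) = (u - v) * (u - v) by ring,
    Real.sqrt_mul_self (by linarith)] at h2
  linarith

/-- The limit of the width in the direction of the axis. -/
theorem exists_width_gt (hw : w < u - v) : ∃ Z, ∀ z, Z ≤ z → w < dst v b z - dst u a z := by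
  have hp : 0 < u - v - w := by linarith
  -- Let `δ = u - v - w`. From `a² ≤ δ(z - u)` it follows that the distance to `(u, a)` is less than
  -- `z - u + δ`, while the distance to `(v, b)` is at least `z - v`.
  refine ⟨max u (u + a * a / (u - v - w)), fun z hz => ?_⟩
  have h1 : u ≤ z := (le_max_left _ _).trans hz
  have h2 : a * a / (u - v - w) ≤ z - u := by linarith [(le_max_right _ _).trans hz]
  rw [div_le_iff₀ hp] at h2
  have h3 : dst u a z < z - u + (u - v - w) := by
    refine (Real.sqrt_lt' (by linarith)).2 ?_
    nlinarith [mul_self_nonneg (z - u), mul_pos hp hp, mul_nonneg (sub_nonneg.2 h1) hp.le]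
  linarith [sub_le_dst v b z]

/-- Every value below the limit `u - v` is exceeded far out, so quasiconcavity forbids a decrease.
If the limit itself is attained at `x`, the argument is applied to all smaller values. -/
theorem width_mono (hb : 0 ≤ b) (hba : b ≤ a) (huv : v ≤ u) (hx : 0 ≤ dst v b x - dst u a x)
    (hxz : x ≤ z) : dst v b x - dst u a x ≤ dst v b z - dst u a z := by
  have h := width_le_of_height_le hb hba huv x
  rcases h.lt_or_eq with h | h
  · obtain ⟨Z, hZ⟩ := exists_width_gt (b := b) (a := a) h
    exact width_quasiconcave hx le_rfl (hZ (max Z z) (le_max_left _ _)).le hxz (le_max_right _ _)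
  · rcases huv.eq_or_lt with rfl | huv
    · have h1 : dst v b x = dst v a x := by linarith
      have h2 := dst_mul_self v b x
      have h3 := dst_mul_self v a x
      rw [h1, h3] at h2
      rw [h, sub_self, dst, dst, show b * b = a * a by linarith, sub_self]
    · refine le_of_forall_lt_imp_le_of_dense fun w hw => ?_
      rcases lt_or_ge w 0 with h0 | h0
      · refine h0.le.trans ?_
        obtain ⟨Z, hZ⟩ := exists_width_gt (b := b) (a := a) (show 0 < u - v by linarith)
        exact width_quasiconcave le_rfl hx (hZ (max Z z) (le_max_left _ _)).le hxz (le_max_right _ _)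
      · obtain ⟨Z, hZ⟩ := exists_width_gt (b := b) (a := a) (h ▸ hw)
        exact width_quasiconcave h0 hw.le (hZ (max Z z) (le_max_left _ _)).le hxz (le_max_right _ _)

/-- The width attains its limit only if it is constant from there on. -/
theorem width_eq_limit (hb : 0 ≤ b) (hba : b ≤ a) (huv : v ≤ u)
    (h : dst v b x - dst u a x = u - v) :
    (u ≤ x ∧ ∀ y, u ≤ y → dst v b y - dst u a y = u - v) ∨
      ∀ y, dst v b y - dst u a y = u - v := by
  have h1 : dst v b x ≤ dst v a x := Real.sqrt_le_sqrt (by nlinarith)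
  have h2 := dst_triangle u a v a x
  rw [show (u - v) * (u - v) + (a - a) * (a - a) = (u - v) * (u - v) by ring,
    Real.sqrt_mul_self (by linarith)] at h2
  have h3 : dst v b x = dst v a x := by linarith
  have h4 : dst v a x = dst u a x + (u - v) := by linarith
  have m1 := dst_mul_self v b x
  have m2 := dst_mul_self v a x
  have m3 := dst_mul_self u a x
  rw [h3, m2] at m1
  have e : a = b := by nlinarith
  subst e
  rcases huv.eq_or_lt with rfl | huv
  · right; intro y; simp
  -- Equality in the triangle inequality: both points lie on the axis, and the center is not to the
  -- left of them.
  · left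
    rw [h4] at m2
    have h5 : dst u a x = x - u := by
      have h6 : (u - v) * (dst u a x - (x - u)) = 0 := by linarith
      rcases mul_eq_zero.1 h6 with h6 | h6 <;> linarith
    rw [h5] at m3
    have h0 : a = 0 := by nlinarith
    subst h0
    refine ⟨by linarith [dst_nonneg u 0 x], fun y hy => ?_⟩
    unfold dst
    simp only [mul_zero, add_zero]
    rw [Real.sqrt_mul_self (by linarith), Real.sqrt_mul_self (by linarith)]
    ring

/-! ### The candidates for the position of the center -/

section Candidates

variable {f₁ f₂ f₃ f₄ : Prop} {x₁ x₂ x₃ x₄ c : ℝ}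

/-- The finite ends of the range, and the position `c`. -/
def Candidate (f₁ f₂ f₃ f₄ : Prop) (x₁ x₂ x₃ x₄ c y : ℝ) : Prop :=
  y = c ∨ (f₁ ∧ y = x₁) ∨ (f₂ ∧ y = x₂) ∨ (f₃ ∧ y = x₃) ∨ (f₄ ∧ y = x₄)

/-- The witness is the least finite upper end. -/
theorem InRange.exists_ge (h : InRange f₁ f₂ f₃ f₄ x₁ x₂ x₃ x₄ x) (hf : f₃ ∨ f₄) (c : ℝ) :
    ∃ y, InRange f₁ f₂ f₃ f₄ x₁ x₂ x₃ x₄ y ∧ Candidate f₁ f₂ f₃ f₄ x₁ x₂ x₃ x₄ c y ∧ x ≤ y ∧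
      ((f₃ → y ≤ x₃) ∧ (f₄ → y ≤ x₄) ∧ (f₃ ∧ y = x₃ ∨ f₄ ∧ y = x₄)) := by
  obtain ⟨h1, h2, h3, h4⟩ := h
  by_cases h5 : f₃ <;> by_cases h6 : f₄
  · rcases le_total x₃ x₄ with h7 | h7
    · exact ⟨x₃, ⟨fun h => (h1 h).trans (h3 h5), fun h => (h2 h).trans (h3 h5), fun _ => le_rfl,
        fun _ => h7⟩, by unfold Candidate; tauto, h3 h5, by tauto⟩
    · exact ⟨x₄, ⟨fun h => (h1 h).trans (h4 h6), fun h => (h2 h).trans (h4 h6), fun _ => h7,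
        fun _ => le_rfl⟩, by unfold Candidate; tauto, h4 h6, by tauto⟩
  · exact ⟨x₃, ⟨fun h => (h1 h).trans (h3 h5), fun h => (h2 h).trans (h3 h5), fun _ => le_rfl,
        fun h => absurd h h6⟩, by unfold Candidate; tauto, h3 h5, by tauto⟩
  · exact ⟨x₄, ⟨fun h => (h1 h).trans (h4 h6), fun h => (h2 h).trans (h4 h6),
        fun h => absurd h h5, fun _ => le_rfl⟩, by unfold Candidate; tauto, h4 h6, by tauto⟩
  · tauto

theorem InRange.neg (h : InRange f₁ f₂ f₃ f₄ x₁ x₂ x₃ x₄ x) :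
    InRange f₃ f₄ f₁ f₂ (-x₃) (-x₄) (-x₁) (-x₂) (-x) := by
  obtain ⟨h1, h2, h3, h4⟩ := h
  exact ⟨fun h => neg_le_neg (h3 h), fun h => neg_le_neg (h4 h), fun h => neg_le_neg (h1 h),
    fun h => neg_le_neg (h2 h)⟩

theorem Candidate.neg (h : Candidate f₁ f₂ f₃ f₄ x₁ x₂ x₃ x₄ c y) :
    Candidate f₃ f₄ f₁ f₂ (-x₃) (-x₄) (-x₁) (-x₂) (-c) (-y) := by
  unfold Candidate at *
  simp only [neg_inj]
  tauto

theorem InRange.exists_between_ge (h : InRange f₁ f₂ f₃ f₄ x₁ x₂ x₃ x₄ x) (hc : x ≤ c) :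
    ∃ y, InRange f₁ f₂ f₃ f₄ x₁ x₂ x₃ x₄ y ∧ Candidate f₁ f₂ f₃ f₄ x₁ x₂ x₃ x₄ c y ∧
      x ≤ y ∧ y ≤ c := by
  by_cases hcR : (f₃ → c ≤ x₃) ∧ (f₄ → c ≤ x₄)
  · exact ⟨c, ⟨fun h' => (h.1 h').trans hc, fun h' => (h.2.1 h').trans hc, hcR.1, hcR.2⟩, Or.inl rfl,
      hc, le_rfl⟩
  · obtain ⟨y, h1, h2, h3, h4⟩ := h.exists_ge (by tauto) c
    refine ⟨y, h1, h2, h3, ?_⟩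
    by_contra h5
    exact hcR ⟨fun h => by linarith [h4.1 h], fun h => by linarith [h4.2.1 h]⟩

theorem InRange.exists_between (h : InRange f₁ f₂ f₃ f₄ x₁ x₂ x₃ x₄ x) (c : ℝ) :
    ∃ y, InRange f₁ f₂ f₃ f₄ x₁ x₂ x₃ x₄ y ∧ Candidate f₁ f₂ f₃ f₄ x₁ x₂ x₃ x₄ c y ∧
      ((x ≤ y ∧ y ≤ c) ∨ (c ≤ y ∧ y ≤ x)) := by
  rcases le_total x c with hc | hc
  · obtain ⟨y, h1, h2, h3⟩ := h.exists_between_ge hc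
    exact ⟨y, h1, h2, Or.inl h3⟩
  · obtain ⟨y, h1, h2, h3⟩ := h.neg.exists_between_ge (neg_le_neg hc)
    refine ⟨-y, ?_, ?_, Or.inr ⟨by linarith, by linarith⟩⟩
    · have := h1.neg; simpa only [neg_neg] using this
    · have := h2.neg; simpa only [neg_neg] using this

/-- If the range is bounded above, monotonicity moves the center to the upper end. Otherwise the
width stays below its limit, or it attains the limit and is constant at least from `u` on, and then
a candidate between `x` and `u` is as good. -/
theorem exists_candidate_of_le (hb : 0 ≤ b) (hba : b ≤ a) (huv : v ≤ u)
    (h : InRange f₁ f₂ f₃ f₄ x₁ x₂ x₃ x₄ x) (hx : dst u a x ≤ dst v b x) :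
    (∃ y, InRange f₁ f₂ f₃ f₄ x₁ x₂ x₃ x₄ y ∧ Candidate f₁ f₂ f₃ f₄ x₁ x₂ x₃ x₄ u y ∧
      dst v b x - dst u a x ≤ dst v b y - dst u a y) ∨
    (¬ f₃ ∧ ¬ f₄ ∧ dst v b x - dst u a x < u - v) := by
  by_cases hf : f₃ ∨ f₄
  · obtain ⟨y, h1, h2, h3, -⟩ := h.exists_ge hf u
    exact Or.inl ⟨y, h1, h2, width_mono hb hba huv (sub_nonneg.2 hx) h3⟩
  · rcases (width_le_of_height_le hb hba huv x).lt_or_eq with hl | hl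
    · right; tauto
    · left
      obtain ⟨y, h1, h2, h3⟩ := h.exists_between u
      refine ⟨y, h1, h2, ?_⟩
      rw [hl]
      rcases width_eq_limit hb hba huv hl with h4 | h4
      · exact (h4.2 y (by rcases h3 with h3 | h3 <;> linarith)).ge
      · exact (h4 y).ge

open Classical in
/-- The position of the maximum, or any position if there is no maximum. -/
noncomputable def critPos (u a v b : ℝ) : ℝ := if a < b then (v * a - u * b) / (a - b) else u

/-- The maximum of the width is attained at a candidate or is a limit. -/
theorem InRange.exists_candidate (ha : 0 ≤ a) (hb : 0 ≤ b)
    (h : InRange f₁ f₂ f₃ f₄ x₁ x₂ x₃ x₄ x) (hx : dst u a x ≤ dst v b x) :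
    (∃ y, InRange f₁ f₂ f₃ f₄ x₁ x₂ x₃ x₄ y ∧
      Candidate f₁ f₂ f₃ f₄ x₁ x₂ x₃ x₄ (critPos u a v b) y ∧
      dst v b x - dst u a x ≤ dst v b y - dst u a y) ∨
    (¬ f₁ ∧ ¬ f₂ ∧ dst v b x - dst u a x < v - u) ∨
    (¬ f₃ ∧ ¬ f₄ ∧ dst v b x - dst u a x < u - v) := by
  unfold critPos
  split_ifs with hab
  · left
    have hm := width_le_crit (u := u) (v := v) ha hab x
    obtain ⟨y, h1, h2, h3⟩ := h.exists_between ((v * a - u * b) / (a - b))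
    refine ⟨y, h1, h2, ?_⟩
    rcases h3 with h3 | h3
    · exact width_quasiconcave (sub_nonneg.2 hx) le_rfl hm h3.1 h3.2
    · exact width_quasiconcave (sub_nonneg.2 hx) hm le_rfl h3.1 h3.2
  · have hba := not_lt.1 hab
    rcases le_total v u with huv | huv
    · exact (exists_candidate_of_le hb hba huv h hx).imp_right Or.inr
    -- Reflecting the axis exchanges the two ends of the range and reduces this case to the previous
    -- one.
    · rw [← dst_neg u, ← dst_neg v] at hx ⊢
      rcases exists_candidate_of_le hb hba (neg_le_neg huv) h.neg hx with ⟨y, h1, h2, h3⟩ | h1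
      · left
        refine ⟨-y, ?_, ?_, ?_⟩
        · have := h1.neg; simpa only [neg_neg] using this
        · have := h2.neg; simpa only [neg_neg] using this
        · have e1 := dst_neg u a (-y)
          have e2 := dst_neg v b (-y)
          rw [neg_neg] at e1 e2
          rw [← e1, ← e2]; exact h3
      · right; left; exact ⟨h1.1, h1.2.1, by linarith [h1.2.2]⟩

end Candidates

end Arrangement

/-! ## Counting the colours on both sides -/
namespace RealRAM.HL

open Arrangement Finset

/-- Only the membership of `c` can change; the form without subtraction serves both directions. -/
theorem card_filter_toggle {s : Finset ℕ} {P P' : ℕ → Prop} [DecidablePred P] [DecidablePred P']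
    {c : ℕ} (hc : c ∈ s) (h : ∀ d ∈ s, d ≠ c → (P' d ↔ P d)) :
    #{d ∈ s | P' d} + (if P c then 1 else 0) = #{d ∈ s | P d} + (if P' c then 1 else 0) := by
  rw [← insert_erase hc, filter_insert, filter_insert]
  have : {d ∈ s.erase c | P' d} = {d ∈ s.erase c | P d} :=
    filter_congr fun d hd => h d (mem_of_mem_erase hd) (ne_of_mem_erase hd)
  rw [this]
  have h1 : c ∉ {d ∈ s.erase c | P d} := by simp
  split_ifs <;> simp [h1]

/-- The number of elements of `S` with colour `c`. -/
def colorCount (col : ℕ → ℕ) (S : Finset ℕ) (c : ℕ) : ℕ := #{a ∈ S | col a = c}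

theorem colorCount_insert {col : ℕ → ℕ} {S : Finset ℕ} {a : ℕ} (ha : a ∉ S) (c : ℕ) :
    colorCount col (insert a S) c = colorCount col S c + if c = col a then 1 else 0 := by
  unfold colorCount
  rw [filter_insert]
  by_cases h : col a = c
  · rw [if_pos h, if_pos h.symm, card_insert_of_notMem (by simp [ha])]
  · rw [if_neg h, if_neg (Ne.symm h)]; rfl

theorem colorCount_mono {col : ℕ → ℕ} {S T : Finset ℕ} (h : S ⊆ T) (c : ℕ) :
    colorCount col S c ≤ colorCount col T c := card_le_card (filter_subset_filter _ h)

theorem colorCount_pos {col : ℕ → ℕ} {S : Finset ℕ} {c : ℕ} :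
    0 < colorCount col S c ↔ ∃ a ∈ S, col a = c := by
  unfold colorCount
  rw [card_pos]
  constructor
  · rintro ⟨a, ha⟩; exact ⟨a, mem_filter.1 ha⟩
  · rintro ⟨a, ha⟩; exact ⟨a, mem_filter.2 ha⟩

theorem colorCount_lt {col : ℕ → ℕ} {S T : Finset ℕ} {c : ℕ} (h : S ⊆ T) :
    colorCount col S c < colorCount col T c ↔ ∃ a ∈ T, a ∉ S ∧ col a = c := by
  constructor
  · intro hlt
    by_contra! hcon
    refine absurd hlt (not_lt.2 (card_le_card fun a ha => ?_))
    rw [mem_filter] at ha ⊢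
    refine ⟨?_, ha.2⟩
    by_contra h1
    exact hcon a ha.1 h1 ha.2
  · rintro ⟨a, h1, h2, h3⟩
    refine card_lt_card ⟨filter_subset_filter _ h, fun hsub => h2 ?_⟩
    exact (mem_filter.1 (hsub (mem_filter.2 ⟨h1, h3⟩))).1

/-- The counters for the set `S` of points among `n` points with `k` colours. -/
structure Counts (n k : ℕ) (col : ℕ → ℕ) (S : Finset ℕ) (V : St) : Prop where
  color : ∀ a < n, V.a .col a 0 = col a
  tot : ∀ c < k, V.a .tot c 0 = colorCount col (range n) c
  cnt : ∀ c < k, V.a .cnt c 0 = colorCount col S c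
  inC : V.s .inC = #{c ∈ range k | 0 < colorCount col S c}
  outC : V.s .outC = #{c ∈ range k | colorCount col S c < colorCount col (range n) c}

theorem Counts.congr {n k : ℕ} {col : ℕ → ℕ} {S : Finset ℕ} {V V' : St} (h : Counts n k col S V)
    (h1 : V'.a = V.a) (h2 : V'.s .inC = V.s .inC) (h3 : V'.s .outC = V.s .outC) :
    Counts n k col S V' :=
  ⟨by rw [h1]; exact h.color, by rw [h1]; exact h.tot, by rw [h1]; exact h.cnt, by rw [h2]; exact h.inC,
    by rw [h3]; exact h.outC⟩

theorem Counts.inC_le {n k : ℕ} {col : ℕ → ℕ} {S : Finset ℕ} {V : St} (h : Counts n k col S V) :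
    V.s .inC ≤ k := by
  rw [h.inC]; exact (card_filter_le _ _).trans (card_range k).le

theorem Counts.outC_le {n k : ℕ} {col : ℕ → ℕ} {S : Finset ℕ} {V : St} (h : Counts n k col S V) :
    V.s .outC ≤ k := by
  rw [h.outC]; exact (card_filter_le _ _).trans (card_range k).le

/-- A colour becomes present inside when its counter leaves zero, and is exhausted outside when the
counter reaches the total. -/
def addP (x : SV) : HP :=
  .setS .t1 (.a .cnt (.a .col (.s x) (.lit 0)) (.lit 0)) ;;
  .ite (.weq (.s .t1) (.lit 0)) (.setS .inC (.add (.s .inC) (.lit 1))) .skip ;;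
  .setS .t1 (.add (.s .t1) (.lit 1)) ;;
  .setA .cnt (.a .col (.s x) (.lit 0)) (.lit 0) (.s .t1) ;;
  .ite (.weq (.s .t1) (.a .tot (.a .col (.s x) (.lit 0)) (.lit 0)))
    (.setS .outC (.sub (.s .outC) (.lit 1))) .skip

def removeP (x : SV) : HP :=
  .setS .t1 (.a .cnt (.a .col (.s x) (.lit 0)) (.lit 0)) ;;
  .ite (.weq (.s .t1) (.a .tot (.a .col (.s x) (.lit 0)) (.lit 0)))
    (.setS .outC (.add (.s .outC) (.lit 1))) .skip ;;
  .setS .t1 (.sub (.s .t1) (.lit 1)) ;;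
  .setA .cnt (.a .col (.s x) (.lit 0)) (.lit 0) (.s .t1) ;;
  .ite (.weq (.s .t1) (.lit 0)) (.setS .inC (.sub (.s .inC) (.lit 1))) .skip

/-- What counting leaves unchanged. -/
structure CountFrame (V V' : St) : Prop where
  a : ∀ y, y ≠ .cnt → V'.a y = V.a y
  ra : V'.ra = V.ra
  r : V'.r = V.r
  s : ∀ y, y ≠ .t1 → y ≠ .inC → y ≠ .outC → V'.s y = V.s y

section
variable {E : Env} {V : St} {k : ℕ} {col : ℕ → ℕ} {S : Finset ℕ}

/-- The change of the counters when one point changes sides. -/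
theorem counts_step {n : ℕ} {x : ℕ} (hx : x ∉ S) (hS : ∀ a ∈ S, a < n) (hxn : x < n)
    (hxk : col x < k) :
    (#{c ∈ range k | 0 < colorCount col (insert x S) c} =
      #{c ∈ range k | 0 < colorCount col S c} + if colorCount col S (col x) = 0 then 1 else 0) ∧
    (#{c ∈ range k | colorCount col S c < colorCount col (range n) c} =
      #{c ∈ range k | colorCount col (insert x S) c < colorCount col (range n) c} +
        if colorCount col S (col x) + 1 = colorCount col (range n) (col x) then 1 else 0) ∧
    colorCount col S (col x) + 1 ≤ colorCount col (range n) (col x) := by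
  have e : ∀ c, c ≠ col x → colorCount col (insert x S) c = colorCount col S c := by
    intro c hc; rw [colorCount_insert hx, if_neg hc, add_zero]
  have e2 : colorCount col (insert x S) (col x) = colorCount col S (col x) + 1 := by
    rw [colorCount_insert hx, if_pos rfl]
  have e3 : colorCount col S (col x) + 1 ≤ colorCount col (range n) (col x) := by
    rw [← e2]
    refine colorCount_mono (fun a ha => ?_) _
    rcases mem_insert.1 ha with rfl | ha
    · exact mem_range.2 hxn
    · exact mem_range.2 (hS a ha)
  have h1 := card_filter_toggle (P := fun c => 0 < colorCount col S c)
    (P' := fun c => 0 < colorCount col (insert x S) c) (mem_range.2 hxk)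
    (fun d _ hd => by rw [e d hd])
  have h2 := card_filter_toggle (P := fun c => colorCount col S c < colorCount col (range n) c)
    (P' := fun c => colorCount col (insert x S) c < colorCount col (range n) c) (mem_range.2 hxk)
    (fun d _ hd => by rw [e d hd])
  simp only [e2] at h1 h2
  refine ⟨?_, ?_, e3⟩
  · split_ifs at h1 ⊢ <;> omega
  · split_ifs at h2 ⊢ <;> omega

theorem go_add {x : SV} (hx1 : x ≠ .t1) (hx2 : x ≠ .inC) (hC : Counts E.n k col S V)
    (hk : k ≤ E.n) (hS : ∀ a ∈ S, a < E.n) (hxn : V.s x < E.n) (hxS : V.s x ∉ S)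
    (hxk : col (V.s x) < k) {Q : St → Prop}
    (hQ : ∀ V', CountFrame V V' → Counts E.n k col (insert (V.s x) S) V' → V'.t ≤ V.t + 8 → Q V') :
    Go E (addP x) V Q := by
  have hn : 0 < E.n := by omega
  obtain ⟨h1, h2, h3⟩ := counts_step hxS hS hxn hxk
  have h4 : col (V.s x) < E.n := by omega
  have h5 := hC.inC_le
  have h6 := hC.outC_le
  have h7 : colorCount col (range E.n) (col (V.s x)) ≤ E.n :=
    (card_filter_le _ _).trans (card_range _).le
  have hc := hC.color _ hxn
  have hi := hC.inC
  have ho := hC.outC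
  have hcn := hC.cnt _ hxk
  have ht := hC.tot _ hxk
  have key : ∀ V', CountFrame V V' → V'.a .cnt = (fun c d => if c = col (V.s x) ∧ d = 0 then
      colorCount col S (col (V.s x)) + 1 else V.a .cnt c d) →
      (V'.s .inC = V.s .inC + if colorCount col S (col (V.s x)) = 0 then 1 else 0) →
      (V'.s .outC = V.s .outC - if colorCount col S (col (V.s x)) + 1 =
        colorCount col (range E.n) (col (V.s x)) then 1 else 0) → V'.t ≤ V.t + 8 → Q V' := by
    intro V' hF e1 e2 e3 e4
    refine hQ V' hF ⟨?_, ?_, ?_, ?_, ?_⟩ e4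
    · rw [hF.a _ (by decide)]; exact hC.color
    · rw [hF.a _ (by decide)]; exact hC.tot
    · intro c hck
      have := hC.cnt c hck
      rw [congrFun (congrFun e1 c) 0, colorCount_insert hxS]
      by_cases g1 : c = col (V.s x)
      · simp [g1]
      · simp [g1, this]
    · rw [e2, h1, hi]
    · rw [e3, ho, h2, Nat.add_sub_cancel]
  simp [addP, hxn, hn, hc, h4, hcn, hx1, hx2, ht]
  refine ⟨fun g1 => ?_, fun g1 => ?_⟩ <;> (repeat' apply And.intro) <;> (try intro g2) <;>
    (repeat' apply And.intro) <;> first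
    | omega
    | (apply key
       · refine ⟨fun y hy => ?_, rfl, rfl, fun y e1 e2 e3 => by simp [e1, e2, e3]⟩
         funext i j; simp [hy]
       · funext i j; simp
       · simp [g1]
       · simp [g2]
       · simp)

theorem go_remove {x : SV} (hx1 : x ≠ .t1) (hx2 : x ≠ .outC)
    (hC : Counts E.n k col (insert (V.s x) S) V)
    (hk : k ≤ E.n) (hS : ∀ a ∈ S, a < E.n) (hxn : V.s x < E.n) (hxS : V.s x ∉ S)
    (hxk : col (V.s x) < k) {Q : St → Prop}
    (hQ : ∀ V', CountFrame V V' → Counts E.n k col S V' → V'.t ≤ V.t + 8 → Q V') :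
    Go E (removeP x) V Q := by
  have hn : 0 < E.n := by omega
  obtain ⟨h1, h2, h3⟩ := counts_step hxS hS hxn hxk
  have h4 : col (V.s x) < E.n := by omega
  have h5 := hC.inC_le
  have h6 := hC.outC_le
  have h7 : colorCount col (range E.n) (col (V.s x)) ≤ E.n :=
    (card_filter_le _ _).trans (card_range _).le
  have hc := hC.color _ hxn
  have hi := hC.inC
  have ho := hC.outC
  have hcn := hC.cnt _ hxk
  rw [colorCount_insert hxS, if_pos rfl] at hcn
  have ht := hC.tot _ hxk
  have key : ∀ V', CountFrame V V' → V'.a .cnt = (fun c d => if c = col (V.s x) ∧ d = 0 then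
      colorCount col S (col (V.s x)) else V.a .cnt c d) →
      (V'.s .inC = V.s .inC - if colorCount col S (col (V.s x)) = 0 then 1 else 0) →
      (V'.s .outC = V.s .outC + if colorCount col S (col (V.s x)) + 1 =
        colorCount col (range E.n) (col (V.s x)) then 1 else 0) → V'.t ≤ V.t + 8 → Q V' := by
    intro V' hF e1 e2 e3 e4
    refine hQ V' hF ⟨?_, ?_, ?_, ?_, ?_⟩ e4
    · rw [hF.a _ (by decide)]; exact hC.color
    · rw [hF.a _ (by decide)]; exact hC.tot
    · intro c hck
      have := hC.cnt c hck
      rw [colorCount_insert hxS] at this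
      rw [congrFun (congrFun e1 c) 0]
      by_cases g1 : c = col (V.s x)
      · simp [g1]
      · simpa [g1] using this
    · rw [e2, hi, h1, Nat.add_sub_cancel]
    · rw [e3, ho, h2]
  simp [removeP, hxn, hn, hc, h4, hcn, hx1, hx2, ht]
  refine ⟨fun g1 => ?_, fun g1 => ?_⟩ <;> (repeat' apply And.intro) <;> (try intro g2) <;>
    (repeat' apply And.intro) <;> first
    | omega
    | (apply key
       · refine ⟨fun y hy => ?_, rfl, rfl, fun y e1 e2 e3 => by simp [e1, e2, e3]⟩
         funext i j; simp [hy]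
       · funext i j; simp
       · simp [g2]
       · simp [g1]
       · simp)

end

end RealRAM.HL

/-! ## Examining one edge pair of the gap -/
namespace Arrangement

open Finset

variable {U H : ℕ → ℝ} {n k : ℕ} {S : Finset ℕ} {i ci j cj li lj : ℕ}

theorem dst_mul_self_eq_sqd (a : ℕ) (x : ℝ) :
    dst (U a) (H a) x * dst (U a) (H a) x = sqd U H a x := dst_mul_self _ _ _

theorem dst_le_dst {a b : ℕ} {x : ℝ} :
    dst (U a) (H a) x ≤ dst (U b) (H b) x ↔ sqd U H a x ≤ sqd U H b x := by
  rw [← dst_mul_self_eq_sqd, ← dst_mul_self_eq_sqd]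
  exact (mul_self_le_mul_self_iff (dst_nonneg _ _ _) (dst_nonneg _ _ _))

theorem eq_cross_of_sqd_eq {a b : ℕ} {x : ℝ} (h : sqd U H a x = sqd U H b x) (hab : U a ≠ U b) :
    x = cross U H a b := by
  have := cross_eq (H := H) hab
  unfold sqd at h
  have h1 : (x - cross U H a b) * (U b - U a) = 0 := by nlinarith
  rcases mul_eq_zero.1 h1 with h2 | h2
  · linarith
  · exact absurd (by linarith) hab

theorem Gap.sqd_le_sqd (T : Sorted U H n) (G : Gap (rank U H n) n S i ci j cj)
    (hN : NxtOn (rank U H n) n i ci li) (hci : ci ≠ i → U i ≠ U ci) {x : ℝ}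
    (hx : GapRange U H i ci j cj li lj x) : sqd U H i x ≤ sqd U H j x := by
  have h1 := mt (G.lower j G.j_lt G.ne.symm).2 G.j_notMem
  rcases lt_or_gt_of_ne G.ne with h | h
  · have h2 : ci ≠ i ∧ rank U H n i j ≤ rank U H n i ci := by
      by_contra h3; exact h1 ⟨fun h4 => by omega, fun h4 => absurd h4 h3⟩
    obtain ⟨h4, h5⟩ := cross_le_of_rank G.i_lt G.ci_lt h2.2 (hci h2.1)
    refine sqd_le_of_lt T h G.j_lt ⟨h4, ?_⟩
    rw [cross_comm]
    exact h5.trans (hx.1 (hci h2.1))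
  · refine sqd_le_of_gt T h G.i_lt fun h2 => ?_
    obtain ⟨h3, h4⟩ := hN.le' G.j_lt G.ne.symm (by tauto)
    obtain ⟨h5, h6⟩ := cross_le_of_rank G.i_lt G.j_lt h4 h2
    rw [cross_comm]
    exact (hx.2.2.1 h5).trans h6

/-- A tie between lines that are not parallel is at an end of the range. -/
theorem Gap.tie (G : Gap (rank U H n) n S i ci j cj) (hN : NxtOn (rank U H n) n i ci li)
    (hci : ci ≠ i → U i ≠ U ci) {x : ℝ} (hx : GapRange U H i ci j cj li lj x)
    (h : sqd U H i x = sqd U H j x) (hij : U i ≠ U j) :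
    (U i ≠ U ci ∧ x = cross U H i ci) ∨ (U i ≠ U li ∧ x = cross U H i li) := by
  have hx2 := eq_cross_of_sqd_eq h hij
  by_cases h2 : ci ≠ i ∧ rank U H n i j ≤ rank U H n i ci
  · obtain ⟨h4, h5⟩ := cross_le_of_rank G.i_lt G.ci_lt h2.2 (hci h2.1)
    exact Or.inl ⟨hci h2.1, le_antisymm (by rw [hx2]; exact h5) (hx.1 (hci h2.1))⟩
  · obtain ⟨h3, h4⟩ := hN.le' G.j_lt G.ne.symm h2
    obtain ⟨h5, h6⟩ := cross_le_of_rank G.i_lt G.j_lt h4 hij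
    exact Or.inr ⟨h5, le_antisymm (hx.2.2.1 h5) (by rw [hx2]; exact h6)⟩

/-- Both `S` and its complement have all `k` colours. -/
def BothRainbow (n k : ℕ) (col : ℕ → ℕ) (S : Finset ℕ) : Prop :=
  ∀ c < k, (∃ a ∈ S, col a = c) ∧ ∃ a ∈ range n, a ∉ S ∧ col a = c

/-- Like `BothRainbow`, with `i ∈ S` and `j ∉ S` belonging to both sides. -/
def SharedRainbow (n k : ℕ) (col : ℕ → ℕ) (S : Finset ℕ) (i j : ℕ) : Prop :=
  ∀ c < k, (∃ a ∈ insert j S, col a = c) ∧ ∃ a ∈ range n, a ∉ S.erase i ∧ col a = c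

end Arrangement

namespace RealRAM.HL

open Arrangement Finset

/-- The distance of the point with index `i` to the current position. -/
def distE (i : SV) : RE :=
  .sqrt (.add (.mul (.sub (.r .xx) (.ra .u (.s i))) (.sub (.r .xx) (.ra .u (.s i))))
    (.mul (.ra .h (.s i)) (.ra .h (.s i))))

/-- Try the annulus with center at the current position. -/
def evalP : HP :=
  .ite (.and
      (.and (.or (.weq (.s .f1) (.lit 0)) (.not (.rlt (.r .xx) (.r .x1))))
        (.or (.weq (.s .f2) (.lit 0)) (.not (.rlt (.r .xx) (.r .x2)))))
      (.and (.or (.weq (.s .f3) (.lit 0)) (.not (.rlt (.r .x3) (.r .xx))))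
        (.or (.weq (.s .f4) (.lit 0)) (.not (.rlt (.r .x4) (.r .xx))))))
    (.setR .y1 (distE .i) ;; .setR .y2 (distE .j) ;;
      .ite (.or (.weq (.s .v) (.lit 1)) (.and (.weq (.s .cv) (.lit 1)) (.req (.r .y1) (.r .y2))))
        (.ite (.or (.weq (.s .has) (.lit 0)) (.rlt (.r .best) (.sub (.r .y2) (.r .y1))))
          (.setS .has (.lit 1) ;; .setR .best (.sub (.r .y2) (.r .y1)) ;; .setR .bx (.r .xx) ;;
            .setR .bi (.r .y1) ;; .setR .bo (.r .y2)) .skip) .skip) .skip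

def evalAtP (b : TE) (e : RE) : HP := .ite b (.setR .xx e ;; evalP) .skip

/-- What trying annuli leaves unchanged. -/
structure EvalFrame (V V' : St) : Prop where
  a : V'.a = V.a
  ra : V'.ra = V.ra
  s : ∀ y, y ≠ .has → V'.s y = V.s y
  r : ∀ y, y ≠ .xx → y ≠ .y1 → y ≠ .y2 → y ≠ .best → y ≠ .bx → y ≠ .bi → y ≠ .bo → V'.r y = V.r y

def rangeOf (V : St) : ℝ → Prop :=
  InRange (V.s .f1 ≠ 0) (V.s .f2 ≠ 0) (V.s .f3 ≠ 0) (V.s .f4 ≠ 0)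
    (V.r .x1) (V.r .x2) (V.r .x3) (V.r .x4)

noncomputable def dstOf (V : St) (i : SV) (x : ℝ) : ℝ := dst (V.ra .u (V.s i)) (V.ra .h (V.s i)) x

/-- `v` flags a partition that is valid as it stands, and `cv` one that can be made valid when `i`
and `j` are equidistant and may change sides. -/
def Accepted (V : St) (x : ℝ) : Prop := V.s .v = 1 ∨ (V.s .cv = 1 ∧ dstOf V .i x = dstOf V .j x)

/-- The best annulus that was found has the property `Φ`. -/
def BestOK (Φ : ℝ → ℝ → ℝ → Prop) (V : St) : Prop :=
  V.s .has ≤ 1 ∧ (V.s .has = 1 → Φ (V.r .bx) (V.r .bi) (V.r .bo) ∧ V.r .best = V.r .bo - V.r .bi)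

/-- The widths below the limit are exceeded. -/
def LimOK (Φ : ℝ → ℝ → ℝ → Prop) (V : St) : Prop :=
  0 ≤ V.r .lim ∧ ∀ w, 0 ≤ w → w < V.r .lim → ∃ x ri ro, Φ x ri ro ∧ w < ro - ri

/-- The search has progressed. -/
def Ext (V V' : St) : Prop :=
  (V.s .has = 1 → V'.s .has = 1 ∧ V.r .best ≤ V'.r .best) ∧ V.r .lim ≤ V'.r .lim

theorem Ext.trans {V V' V'' : St} (h : Ext V V') (h' : Ext V' V'') : Ext V V'' :=
  ⟨fun h1 => ⟨(h'.1 (h.1 h1).1).1, (h.1 h1).2.trans (h'.1 (h.1 h1).1).2⟩, h.2.trans h'.2⟩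

theorem Ext.of_eq {V V' : St} (h : V'.s .has = V.s .has) (h1 : V'.r .best = V.r .best)
    (h2 : V'.r .lim = V.r .lim) : Ext V V' :=
  ⟨fun h' => ⟨h.trans h', h1.ge⟩, h2.ge⟩

theorem EvalFrame.trans {V V' V'' : St} (h : EvalFrame V V') (h' : EvalFrame V' V'') :
    EvalFrame V V'' :=
  ⟨h'.a.trans h.a, h'.ra.trans h.ra, fun y hy => (h'.s y hy).trans (h.s y hy),
    fun y h1 h2 h3 h4 h5 h6 h7 =>
      (h'.r y h1 h2 h3 h4 h5 h6 h7).trans (h.r y h1 h2 h3 h4 h5 h6 h7)⟩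

section
variable {E : Env} {V V₀ : St} {Φ : ℝ → ℝ → ℝ → Prop}

theorem EvalFrame.dstOf (h : EvalFrame V₀ V) {i : SV} (hi : i ≠ .has) (x : ℝ) :
    dstOf V i x = dstOf V₀ i x := by
  unfold HL.dstOf; rw [h.s _ hi, h.ra]

theorem EvalFrame.rangeOf (h : EvalFrame V₀ V) : rangeOf V = rangeOf V₀ := by
  unfold HL.rangeOf
  rw [h.s _ (by decide), h.s _ (by decide), h.s _ (by decide), h.s _ (by decide)]
  congr 1 <;> exact h.r _ (by decide) (by decide) (by decide) (by decide) (by decide) (by decide)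
    (by decide)

theorem EvalFrame.accepted (h : EvalFrame V₀ V) (x : ℝ) : Accepted V x ↔ Accepted V₀ x := by
  unfold Accepted
  rw [h.s _ (by decide), h.s _ (by decide), h.dstOf (by decide), h.dstOf (by decide)]

theorem distE_ok {i : SV} (h : V.s i < E.n) : (distE i).ok E V := by
  simp only [distE, RE.ok, WE.ok, WE.eval, RE.eval, h, true_and, and_true]
  exact add_nonneg (mul_self_nonneg _) (mul_self_nonneg _)

theorem distE_eval {i : SV} : (distE i).eval E V = dstOf V i (V.r .xx) := rfl

theorem go_eval (hi : V.s .i < E.n) (hj : V.s .j < E.n) (hB : BestOK Φ V)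
    (hΦ : rangeOf V (V.r .xx) → Accepted V (V.r .xx) →
      Φ (V.r .xx) (dstOf V .i (V.r .xx)) (dstOf V .j (V.r .xx))) {Q : St → Prop}
    (hQ : ∀ V', EvalFrame V V' → BestOK Φ V' → Ext V V' →
      (rangeOf V (V.r .xx) → Accepted V (V.r .xx) → V'.s .has = 1 ∧
        dstOf V .j (V.r .xx) - dstOf V .i (V.r .xx) ≤ V'.r .best) → V'.t ≤ V.t + 10 → Q V') :
    Go E evalP V Q := by
  have hr : rangeOf V (V.r .xx) ↔
      ((V.s .f1 = 0 ∨ ¬ V.r .xx < V.r .x1) ∧ (V.s .f2 = 0 ∨ ¬ V.r .xx < V.r .x2)) ∧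
        (V.s .f3 = 0 ∨ ¬ V.r .x3 < V.r .xx) ∧ (V.s .f4 = 0 ∨ ¬ V.r .x4 < V.r .xx) := by
    have : ∀ p q : Prop, (¬ p → q) ↔ (p ∨ q) := fun p q => by tauto
    unfold rangeOf InRange
    simp only [ne_eq, this, and_assoc, not_lt]
  have keep : ∀ V', EvalFrame V V' → V'.s .has = V.s .has → (∀ y, y ≠ .xx → y ≠ .y1 → y ≠ .y2 →
      V'.r y = V.r y) → ¬ (rangeOf V (V.r .xx) ∧ Accepted V (V.r .xx) ∧ (V.s .has = 0 ∨
        V.r .best < dstOf V .j (V.r .xx) - dstOf V .i (V.r .xx))) → V'.t ≤ V.t + 10 → Q V' := by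
    intro V' h1 h2 h3 h4 h5
    have hb := h3 .best (by decide) (by decide) (by decide)
    refine hQ V' h1 ⟨h2 ▸ hB.1, fun h => ?_⟩
      (Ext.of_eq h2 hb (h3 _ (by decide) (by decide) (by decide))) (fun g1 g2 => ?_) h5
    · rw [hb, h3 _ (by decide) (by decide) (by decide), h3 _ (by decide) (by decide) (by decide),
        h3 _ (by decide) (by decide) (by decide)]
      exact hB.2 (h2 ▸ h)
    · have h6 : ¬ (V.s .has = 0 ∨ V.r .best < dstOf V .j (V.r .xx) - dstOf V .i (V.r .xx)) :=
        fun h => h4 ⟨g1, g2, h⟩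
      push Not at h6
      have := hB.1
      exact ⟨by rw [h2]; omega, by rw [hb]; exact h6.2⟩
  rw [evalP, go_ite]
  refine ⟨by simp, fun h1 => ?_, fun h1 => ?_⟩
  · have h1 := hr.2 h1
    rw [go_seq, go_setR]
    refine ⟨distE_ok hi, ?_⟩
    rw [go_seq, go_setR]
    refine ⟨distE_ok hj, ?_⟩
    rw [distE_eval, distE_eval]
    change Go E _ ((V.tick.setR .y1 (dstOf V .i (V.r .xx))).setR .y2 (dstOf V .j (V.r .xx))) Q
    rw [go_ite]
    refine ⟨by simp, fun h2 => ?_, fun h2 => ?_⟩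
    · have h2 : Accepted V (V.r .xx) := by simpa [Accepted] using h2
      have hΦ' := hΦ h1 h2
      rw [go_ite]
      refine ⟨by simp, fun h3 => ?_, fun h3 => ?_⟩
      · have h3 : V.s .has = 0 ∨ V.r .best < dstOf V .j (V.r .xx) - dstOf V .i (V.r .xx) := by
          simpa using h3
        simp
        apply hQ
        · exact ⟨rfl, rfl, fun y hy => by simp [hy], fun y h1 h2 h3 h4 h5 h6 h7 => by
            simp [h1, h2, h3, h4, h5, h6, h7]⟩
        · exact ⟨by simp, fun _ => by simpa using hΦ'⟩
        · refine ⟨fun h4 => ⟨by simp, ?_⟩, by simp⟩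
          simpa using (h3.resolve_left (by omega)).le
        · simp
        · simp
      · rw [go_skip]
        refine keep _ ⟨rfl, rfl, fun y hy => rfl, fun y h1 h2 h3 h4 h5 h6 h7 => by
            simp [h1, h2, h3]⟩ rfl (fun y h1 h2 h3 => by simp [h2, h3]) (fun h => h3 ?_) (by simp)
        simpa using h.2.2
    · rw [go_skip]
      refine keep _ ⟨rfl, rfl, fun y hy => rfl, fun y h1 h2 h3 h4 h5 h6 h7 => by
          simp [h1, h2, h3]⟩ rfl (fun y h1 h2 h3 => by simp [h2, h3]) (fun h => h2 ?_) (by simp)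
      simpa [Accepted] using h.2.1
  · rw [go_skip]
    exact keep _ ⟨rfl, rfl, fun y hy => rfl, fun y h1 h2 h3 h4 h5 h6 h7 => rfl⟩ rfl
      (fun y h1 h2 h3 => rfl) (fun h => h1 (hr.1 h.1)) (by simp)

/-- Some annuli have been tried, since the state `V₀`. -/
structure Searched (Φ : ℝ → ℝ → ℝ → Prop) (V₀ V : St) (T : ℕ) : Prop where
  frame : EvalFrame V₀ V
  best : BestOK Φ V
  ext : Ext V₀ V
  time : V.t ≤ V₀.t + T

/-- The position `x` has been tried. -/
def Tried (V₀ V : St) (x : ℝ) : Prop :=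
  rangeOf V₀ x → Accepted V₀ x → V.s .has = 1 ∧ dstOf V₀ .j x - dstOf V₀ .i x ≤ V.r .best

theorem Tried.ext {V' : St} {x : ℝ} (h : Tried V₀ V x) (h' : Ext V V') : Tried V₀ V' x :=
  fun h1 h2 => ⟨(h'.1 (h h1 h2).1).1, (h h1 h2).2.trans (h'.1 (h h1 h2).1).2⟩

theorem go_evalAt {T : ℕ} {b : TE} {e : RE} {x : ℝ} (hS : Searched Φ V₀ V T) (hi : V₀.s .i < E.n)
    (hj : V₀.s .j < E.n) (hb : b.ok E V) (he : b.eval E V → e.ok E V.tick)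
    (hx : b.eval E V → e.eval E V.tick = x)
    (hΦ : ∀ y, rangeOf V₀ y → Accepted V₀ y → Φ y (dstOf V₀ .i y) (dstOf V₀ .j y)) {Q : St → Prop}
    (hQ : ∀ V', Searched Φ V₀ V' (T + 12) → Ext V V' → (b.eval E V → Tried V₀ V' x) → Q V') :
    Go E (evalAtP b e) V Q := by
  rw [evalAtP, go_ite]
  refine ⟨hb, fun h1 => ?_, fun h1 => ?_⟩
  · rw [go_seq, go_setR]
    refine ⟨he h1, ?_⟩
    rw [hx h1]
    have F : EvalFrame V₀ (V.tick.setR .xx x) :=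
      ⟨hS.frame.a, hS.frame.ra, hS.frame.s, fun y h1 h2 h3 h4 h5 h6 h7 => by
        simp [h1, hS.frame.r y h1 h2 h3 h4 h5 h6 h7]⟩
    have Ex : Ext V (V.tick.setR .xx x) := Ext.of_eq rfl (by simp) (by simp)
    have hxx : (V.tick.setR .xx x).r .xx = x := by simp
    refine go_eval (Φ := Φ) ((F.s .i (by decide)).trans_lt hi) ((F.s .j (by decide)).trans_lt hj)
      ⟨hS.best.1, fun h => by simpa using hS.best.2 h⟩ ?_ ?_
    · rw [hxx, F.rangeOf, F.accepted, F.dstOf (by decide), F.dstOf (by decide)]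
      exact hΦ x
    · rw [hxx, F.rangeOf, F.accepted, F.dstOf (by decide), F.dstOf (by decide)]
      intro V' F' B' E' D' t'
      have := hS.time
      simp only [St.setR_t, St.tick_t] at t'
      exact hQ V' ⟨F.trans F', B', (hS.ext.trans Ex).trans E', by omega⟩ (Ex.trans E') fun _ => D'
  · rw [go_skip]
    refine hQ _ ⟨⟨hS.frame.a, hS.frame.ra, hS.frame.s, hS.frame.r⟩, hS.best,
      hS.ext.trans (Ext.of_eq rfl rfl rfl), ?_⟩ (Ext.of_eq rfl rfl rfl) fun h => absurd h h1
    have := hS.time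
    simp; omega

/-- The position with the maximum width. -/
def critE : RE :=
  .div (.sub (.mul (.ra .u (.s .j)) (.ra .h (.s .i))) (.mul (.ra .u (.s .i)) (.ra .h (.s .j))))
    (.sub (.ra .h (.s .i)) (.ra .h (.s .j)))

/-- Try all candidates for the center. -/
def searchP : HP :=
  evalAtP (.weq (.s .f1) (.lit 1)) (.r .x1) ;; evalAtP (.weq (.s .f2) (.lit 1)) (.r .x2) ;;
  evalAtP (.weq (.s .f3) (.lit 1)) (.r .x3) ;; evalAtP (.weq (.s .f4) (.lit 1)) (.r .x4) ;;
  evalAtP (.rlt (.ra .h (.s .i)) (.ra .h (.s .j))) critE ;;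
  evalAtP (.not (.rlt (.ra .h (.s .i)) (.ra .h (.s .j)))) (.ra .u (.s .i))

/-- A position that has been tried stays tried, because the best width never decreases
(`Tried.ext`). -/
theorem go_search (hi : V₀.s .i < E.n) (hj : V₀.s .j < E.n) (hB : BestOK Φ V₀)
    (hf1 : V₀.s .f1 ≤ 1) (hf2 : V₀.s .f2 ≤ 1) (hf3 : V₀.s .f3 ≤ 1) (hf4 : V₀.s .f4 ≤ 1)
    (hΦ : ∀ y, rangeOf V₀ y → Accepted V₀ y → Φ y (dstOf V₀ .i y) (dstOf V₀ .j y)) {Q : St → Prop}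
    (hQ : ∀ V', Searched Φ V₀ V' 72 → (∀ y, Candidate (V₀.s .f1 ≠ 0) (V₀.s .f2 ≠ 0) (V₀.s .f3 ≠ 0)
      (V₀.s .f4 ≠ 0) (V₀.r .x1) (V₀.r .x2) (V₀.r .x3) (V₀.r .x4)
      (critPos (V₀.ra .u (V₀.s .i)) (V₀.ra .h (V₀.s .i)) (V₀.ra .u (V₀.s .j)) (V₀.ra .h (V₀.s .j)))
      y → Tried V₀ V' y) → Q V') : Go E searchP V₀ Q := by
  have S0 : Searched Φ V₀ V₀ 0 :=
    ⟨⟨rfl, rfl, fun _ _ => rfl, fun _ _ _ _ _ _ _ _ => rfl⟩, hB, Ext.of_eq rfl rfl rfl, by simp⟩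
  have hr : ∀ {V T}, Searched Φ V₀ V T → ∀ y, y ∈ [RV.x1, .x2, .x3, .x4] →
      V.tick.r y = V₀.r y := by
    intro V T h y hy
    apply h.frame.r <;> rintro rfl <;> simp at hy
  rw [searchP, go_seq]
  refine go_evalAt (e := .r .x1) (x := V₀.r .x1) S0 hi hj (by simp) (by simp) (fun _ => hr S0 .x1 (by simp)) hΦ fun V₁ S1 E1 D1 => ?_
  rw [go_seq]
  refine go_evalAt (e := .r .x2) (x := V₀.r .x2) S1 hi hj (by simp) (by simp) (fun _ => hr S1 .x2 (by simp)) hΦ fun V₂ S2 E2 D2 => ?_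
  rw [go_seq]
  refine go_evalAt (e := .r .x3) (x := V₀.r .x3) S2 hi hj (by simp) (by simp) (fun _ => hr S2 .x3 (by simp)) hΦ fun V₃ S3 E3 D3 => ?_
  rw [go_seq]
  refine go_evalAt (e := .r .x4) (x := V₀.r .x4) S3 hi hj (by simp) (by simp) (fun _ => hr S3 .x4 (by simp)) hΦ fun V₄ S4 E4 D4 => ?_
  rw [go_seq]
  have i4 : V₄.s .i < E.n := by rw [S4.frame.s _ (by decide)]; exact hi
  have j4 : V₄.s .j < E.n := by rw [S4.frame.s _ (by decide)]; exact hj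
  refine go_evalAt (x := critPos (V₀.ra .u (V₀.s .i)) (V₀.ra .h (V₀.s .i)) (V₀.ra .u (V₀.s .j))
    (V₀.ra .h (V₀.s .j))) S4 hi hj (by simp [i4, j4]) (fun h => ?_) (fun h => ?_) hΦ
    fun V₅ S5 E5 D5 => ?_
  · simp only [TE.eval, RE.eval, WE.eval] at h
    simp [critE, i4, j4, sub_eq_zero, h.ne]
  · simp only [TE.eval, RE.eval, WE.eval, S4.frame.ra, S4.frame.s _ (show SV.i ≠ .has by decide),
      S4.frame.s _ (show SV.j ≠ .has by decide)] at h
    simp [critE, critPos, h, S4.frame.ra, S4.frame.s _ (show SV.i ≠ .has by decide),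
      S4.frame.s _ (show SV.j ≠ .has by decide)]
  have i5 : V₅.s .i < E.n := by rw [S5.frame.s _ (by decide)]; exact hi
  have j5 : V₅.s .j < E.n := by rw [S5.frame.s _ (by decide)]; exact hj
  refine go_evalAt (x := critPos (V₀.ra .u (V₀.s .i)) (V₀.ra .h (V₀.s .i)) (V₀.ra .u (V₀.s .j))
    (V₀.ra .h (V₀.s .j))) S5 hi hj (by simp [i5, j5]) (fun h => by simp [i5]) (fun h => ?_) hΦ
    fun V₆ S6 E6 D6 => ?_
  · simp only [TE.eval, RE.eval, WE.eval, S5.frame.ra, S5.frame.s _ (show SV.i ≠ .has by decide),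
      S5.frame.s _ (show SV.j ≠ .has by decide)] at h
    simp [critPos, h, S5.frame.ra, S5.frame.s _ (show SV.i ≠ .has by decide)]
  refine hQ _ S6 fun y hy => ?_
  rcases hy with h | h | h | h | h
  · subst h
    by_cases h : V₀.ra .h (V₀.s .i) < V₀.ra .h (V₀.s .j)
    · refine (D5 ?_).ext E6
      simpa [S4.frame.ra, S4.frame.s] using h
    · refine (D6 ?_)
      simpa [S5.frame.ra, S5.frame.s] using h
  · rw [h.2]
    refine ((((D1 ?_).ext E2).ext E3).ext (E4.trans E5)).ext E6
    simp only [TE.eval, WE.eval]; omega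
  · rw [h.2]
    refine (((D2 ?_).ext E3).ext (E4.trans E5)).ext E6
    simp only [TE.eval, WE.eval, S1.frame.s _ (show SV.f2 ≠ .has by decide)]; omega
  · rw [h.2]
    refine ((D3 ?_).ext (E4.trans E5)).ext E6
    simp only [TE.eval, WE.eval, S2.frame.s _ (show SV.f3 ≠ .has by decide)]; omega
  · rw [h.2]
    refine ((D4 ?_).ext E5).ext E6
    simp only [TE.eval, WE.eval, S3.frame.s _ (show SV.f4 ≠ .has by decide)]; omega

end

end RealRAM.HL

/-! ## Processing one edge pair of the gap -/
namespace RealRAM.HL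

open Arrangement Finset

/-- `V'` differs from `V` at most in the variables `ls` and `lr`, and in the step counter. -/
structure Upd (ls : List SV) (lr : List RV) (V V' : St) : Prop where
  a : V'.a = V.a
  ra : V'.ra = V.ra
  s : ∀ y, y ∉ ls → V'.s y = V.s y
  r : ∀ y, y ∉ lr → V'.r y = V.r y

/-- The flag tells whether this end of the range is finite. For the sentinel, `v` has the same value
as `u`, so the feet agree and the end counts as infinite. -/
def crossingP (f : SV) (x : RV) (u v : SV) : HP :=
  .ite (.req (.ra .u (.s u)) (.ra .u (.s v))) (.setS f (.lit 0))
    (.setS f (.lit 1) ;; .setR x (crossE u v))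

def edgesP : HP :=
  .setS .li (.a .nx (.s .i) (.s .ci)) ;; .setS .lj (.a .nx (.s .j) (.s .cj)) ;;
  crossingP .f1 .x1 .i .ci ;; crossingP .f2 .x2 .j .cj ;;
  crossingP .f3 .x3 .i .li ;; crossingP .f4 .x4 .j .lj

/-- `t1` counts the colours inside if `j` is included, and `t2` the colours outside if `i` is
included. -/
def flagsP : HP :=
  .ite (.and (.weq (.s .inC) (.inp (.lit 1))) (.weq (.s .outC) (.inp (.lit 1))))
    (.setS .v (.lit 1)) (.setS .v (.lit 0)) ;;
  .ite (.weq (.a .cnt (.a .col (.s .j) (.lit 0)) (.lit 0)) (.lit 0))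
    (.setS .t1 (.add (.s .inC) (.lit 1))) (.setS .t1 (.s .inC)) ;;
  .ite (.weq (.a .cnt (.a .col (.s .i) (.lit 0)) (.lit 0))
      (.a .tot (.a .col (.s .i) (.lit 0)) (.lit 0)))
    (.setS .t2 (.add (.s .outC) (.lit 1))) (.setS .t2 (.s .outC)) ;;
  .ite (.and (.weq (.s .t1) (.inp (.lit 1))) (.weq (.s .t2) (.inp (.lit 1))))
    (.setS .cv (.lit 1)) (.setS .cv (.lit 0))

/-- If both ends on one side are infinite, the width tends to a difference of feet there, which may
raise `lim`. -/
def raiseP (f g : SV) (u v : SV) : HP :=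
  .ite (.and (.and (.weq (.s f) (.lit 0)) (.weq (.s g) (.lit 0)))
      (.and (.weq (.s .v) (.lit 1)) (.rlt (.r .lim) (.sub (.ra .u (.s u)) (.ra .u (.s v))))))
    (.setR .lim (.sub (.ra .u (.s u)) (.ra .u (.s v)))) .skip

def eventP : HP := edgesP ;; flagsP ;; raiseP .f1 .f2 .j .i ;; raiseP .f3 .f4 .i .j ;; searchP

section
variable {E : Env} {V V₀ : St} {Φ : ℝ → ℝ → ℝ → Prop} {S : Finset ℕ} {k : ℕ} {col : ℕ → ℕ}

theorem go_crossing {f : SV} {x : RV} {u v : SV} (huf : u ≠ f) (hvf : v ≠ f) (hu : V.s u < E.n)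
    (hv : V.s v < E.n) {Q : St → Prop}
    (hQ : ∀ V', Upd [f] [x] V V' → V'.s f ≤ 1 →
      (V'.s f ≠ 0 ↔ V.ra .u (V.s u) ≠ V.ra .u (V.s v)) →
      (V'.s f ≠ 0 → V'.r x = cross (V.ra .u) (V.ra .h) (V.s u) (V.s v)) → V'.t ≤ V.t + 3 → Q V') :
    Go E (crossingP f x u v) V Q := by
  rw [crossingP, go_ite]
  refine ⟨by simp [hu, hv], fun h => ?_, fun h => ?_⟩
  · simp only [TE.eval, RE.eval, WE.eval] at h
    simp
    apply hQ
    · exact ⟨rfl, rfl, fun y hy => by simp at hy; simp [hy], fun y hy => rfl⟩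
    · simp
    · simp [h]
    · simp
    · simp
  · simp only [TE.eval, RE.eval, WE.eval] at h
    rw [go_seq, go_setS, go_setR]
    refine ⟨by simp, crossE_ok (by simpa [huf] using hu) (by simpa [hvf] using hv)
      (by simpa [huf, hvf] using h), ?_⟩
    apply hQ
    · exact ⟨rfl, rfl, fun y hy => by simp at hy; simp [hy], fun y hy => by simp at hy; simp [hy]⟩
    · simp
    · simp [h]
    · simp [crossE_eval, huf, hvf]
    · simp

theorem go_edges (hi : V.s .i < E.n) (hj : V.s .j < E.n) (hci : V.s .ci < E.n) (hcj : V.s .cj < E.n)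
    (hli : V.a .nx (V.s .i) (V.s .ci) < E.n) (hlj : V.a .nx (V.s .j) (V.s .cj) < E.n)
    {Q : St → Prop}
    (hQ : ∀ V', Upd [.li, .lj, .f1, .f2, .f3, .f4] [.x1, .x2, .x3, .x4] V V' →
      V'.s .li = V.a .nx (V.s .i) (V.s .ci) → V'.s .lj = V.a .nx (V.s .j) (V.s .cj) →
      V'.s .f1 ≤ 1 → V'.s .f2 ≤ 1 → V'.s .f3 ≤ 1 → V'.s .f4 ≤ 1 →
      (V'.s .f1 ≠ 0 ↔ V.ra .u (V.s .i) ≠ V.ra .u (V.s .ci)) →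
      (V'.s .f2 ≠ 0 ↔ V.ra .u (V.s .j) ≠ V.ra .u (V.s .cj)) →
      (V'.s .f3 ≠ 0 ↔ V.ra .u (V.s .i) ≠ V.ra .u (V'.s .li)) →
      (V'.s .f4 ≠ 0 ↔ V.ra .u (V.s .j) ≠ V.ra .u (V'.s .lj)) →
      (V'.s .f1 ≠ 0 → V'.r .x1 = cross (V.ra .u) (V.ra .h) (V.s .i) (V.s .ci)) →
      (V'.s .f2 ≠ 0 → V'.r .x2 = cross (V.ra .u) (V.ra .h) (V.s .j) (V.s .cj)) →
      (V'.s .f3 ≠ 0 → V'.r .x3 = cross (V.ra .u) (V.ra .h) (V.s .i) (V'.s .li)) →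
      (V'.s .f4 ≠ 0 → V'.r .x4 = cross (V.ra .u) (V.ra .h) (V.s .j) (V'.s .lj)) →
      V'.t ≤ V.t + 14 → Q V') : Go E edgesP V Q := by
  rw [edgesP, go_seq, go_setS]
  refine ⟨by simp [hi, hci], ?_⟩
  rw [go_seq, go_setS]
  refine ⟨by simp [hj, hcj], ?_⟩
  rw [go_seq]
  refine go_crossing (by decide) (by decide) (by simpa) (by simpa) fun V₁ U₁ a₁ b₁ c₁ t₁ => ?_
  rw [go_seq]
  refine go_crossing (by decide) (by decide) (by simpa [U₁.s]) (by simpa [U₁.s])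
    fun V₂ U₂ a₂ b₂ c₂ t₂ => ?_
  rw [go_seq]
  refine go_crossing (by decide) (by decide) (by simpa [U₁.s, U₂.s]) (by simpa [U₁.s, U₂.s])
    fun V₃ U₃ a₃ b₃ c₃ t₃ => ?_
  refine go_crossing (by decide) (by decide) (by simpa [U₁.s, U₂.s, U₃.s])
    (by simpa [U₁.s, U₂.s, U₃.s]) fun V₄ U₄ a₄ b₄ c₄ t₄ => ?_
  simp [U₁.s, U₂.s, U₃.s, U₁.ra, U₂.ra, U₃.ra] at b₁ b₂ b₃ b₄ c₁ c₂ c₃ c₄ t₁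
  refine hQ V₄ ⟨?_, ?_, fun y hy => ?_, fun y hy => ?_⟩ ?_ ?_ ?_ ?_ ?_ ?_ ?_ ?_ ?_ ?_ ?_ ?_ ?_ ?_ ?_
  · rw [U₄.a, U₃.a, U₂.a, U₁.a]; rfl
  · rw [U₄.ra, U₃.ra, U₂.ra, U₁.ra]; rfl
  · simp at hy; simp [U₁.s, U₂.s, U₃.s, U₄.s, hy]
  · simp at hy; simp [U₁.r, U₂.r, U₃.r, U₄.r, hy]
  · simp [U₁.s, U₂.s, U₃.s, U₄.s]
  · simp [U₁.s, U₂.s, U₃.s, U₄.s]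
  · simpa [U₂.s, U₃.s, U₄.s] using a₁
  · simpa [U₃.s, U₄.s] using a₂
  · simpa [U₄.s] using a₃
  · exact a₄
  · simpa [U₂.s, U₃.s, U₄.s] using b₁
  · simpa [U₃.s, U₄.s] using b₂
  · simpa [U₁.s, U₂.s, U₃.s, U₄.s] using b₃
  · simpa [U₁.s, U₂.s, U₃.s, U₄.s] using b₄
  · simpa [U₂.s, U₃.s, U₄.s, U₂.r, U₃.r, U₄.r] using c₁
  · simpa [U₃.s, U₄.s, U₃.r, U₄.r] using c₂
  · simpa [U₁.s, U₂.s, U₃.s, U₄.s, U₄.r] using c₃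
  · simpa [U₁.s, U₂.s, U₃.s, U₄.s] using c₄
  · omega

theorem card_filter_range_eq {P : ℕ → Prop} [DecidablePred P] :
    #{c ∈ range k | P c} = k ↔ ∀ c < k, P c := by
  conv_lhs => rhs; rw [← card_range k]
  rw [card_filter_eq_iff]
  simp

theorem Counts.bothRainbow (hC : Counts E.n k col S V) (hS : ∀ a ∈ S, a < E.n) :
    BothRainbow E.n k col S ↔ V.s .inC = k ∧ V.s .outC = k := by
  have hsub : S ⊆ range E.n := fun a ha => mem_range.2 (hS a ha)
  rw [hC.inC, hC.outC, card_filter_range_eq, card_filter_range_eq]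
  simp only [BothRainbow, colorCount_pos, colorCount_lt hsub]
  exact ⟨fun h => ⟨fun c hc => (h c hc).1, fun c hc => (h c hc).2⟩, fun h c hc => ⟨h.1 c hc, h.2 c hc⟩⟩

theorem Counts.sharedRainbow (hC : Counts E.n k col S V) (hS : ∀ a ∈ S, a < E.n) {i j : ℕ}
    (hi : i ∈ S) (hj : j ∉ S) (hjn : j < E.n) (hik : col i < k) (hjk : col j < k) :
    SharedRainbow E.n k col S i j ↔
      (V.s .inC + (if V.a .cnt (col j) 0 = 0 then 1 else 0) = k ∧
        V.s .outC + (if V.a .cnt (col i) 0 = V.a .tot (col i) 0 then 1 else 0) = k) := by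
  have h1 := counts_step hj hS hjn hjk
  have hS' : ∀ a ∈ S.erase i, a < E.n := fun a ha => hS a (mem_of_mem_erase ha)
  have h2 := counts_step (notMem_erase i S) hS' (hS i hi) hik
  rw [insert_erase hi] at h2
  have h3 := colorCount_insert (col := col) (notMem_erase i S) (col i)
  rw [insert_erase hi, if_pos rfl] at h3
  have hsub : S.erase i ⊆ range E.n := fun a ha => mem_range.2 (hS' a ha)
  rw [hC.inC, hC.outC, hC.cnt _ hjk, hC.cnt _ hik, hC.tot _ hik, ← h1.1, h3, ← h2.2.1,
    card_filter_range_eq, card_filter_range_eq]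
  simp only [SharedRainbow, colorCount_pos, colorCount_lt hsub]
  exact ⟨fun h => ⟨fun c hc => (h c hc).1, fun c hc => (h c hc).2⟩, fun h c hc => ⟨h.1 c hc, h.2 c hc⟩⟩

theorem go_flags (hC : Counts E.n k col S V) (hk : k ≤ E.n) (hk' : E.I.word 1 = k)
    (hS : ∀ a ∈ S, a < E.n) (hi : V.s .i ∈ S) (hj : V.s .j ∉ S) (hjn : V.s .j < E.n)
    (hcol : ∀ a < E.n, col a < k) {Q : St → Prop}
    (hQ : ∀ V', Upd [.v, .cv, .t1, .t2] [] V V' → (V'.s .v = 1 ↔ BothRainbow E.n k col S) →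
      (V'.s .cv = 1 ↔ SharedRainbow E.n k col S (V.s .i) (V.s .j)) → V'.t ≤ V.t + 8 → Q V') :
    Go E flagsP V Q := by
  have hin := hS _ hi
  have hn : 0 < E.n := by omega
  have hik := hcol _ hin
  have hjk := hcol _ hjn
  have h1 := hC.bothRainbow hS
  have h2 := hC.sharedRainbow hS hi hj hjn hik hjk
  have ci := hC.color _ hin
  have cj := hC.color _ hjn
  have li := hC.inC_le
  have lo := hC.outC_le
  have o1 : col (V.s .i) < E.n := by omega
  have o2 : col (V.s .j) < E.n := by omega
  have o3 : V.s .inC ≤ 2 * E.n + 2 := by omega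
  have o4 : V.s .outC ≤ 2 * E.n + 2 := by omega
  rw [h1] at hQ
  rw [h2] at hQ
  have key : ∀ V' : St, V'.a = V.a → V'.ra = V.ra → V'.r = V.r →
      (∀ y, y ≠ .v → y ≠ .cv → y ≠ .t1 → y ≠ .t2 → V'.s y = V.s y) →
      (V'.s .v = 1 ↔ V.s .inC = k ∧ V.s .outC = k) → (V'.s .cv = 1 ↔
      (V.s .inC + (if V.a .cnt (col (V.s .j)) 0 = 0 then 1 else 0) = k ∧
        V.s .outC + (if V.a .cnt (col (V.s .i)) 0 = V.a .tot (col (V.s .i)) 0 then 1 else 0) = k)) →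
      V'.t ≤ V.t + 8 → Q V' := fun V' e1 e2 e3 e4 e5 e6 e7 =>
    hQ V' ⟨e1, e2, fun y hy => by simp at hy; exact e4 y hy.1 hy.2.1 hy.2.2.1 hy.2.2.2,
      fun y _ => by rw [e3]⟩ e5 e6 e7
  clear hQ
  by_cases g1 : V.s .inC = k ∧ V.s .outC = k <;>
  by_cases g2 : V.a .cnt (col (V.s .j)) 0 = 0 <;>
  by_cases g3 : V.a .cnt (col (V.s .i)) 0 = V.a .tot (col (V.s .i)) 0 <;>
  simp only [g2, g3, if_true, if_false, add_zero] at key <;>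
  simp only [flagsP, go_seq, go_ite, go_setS, TE.ok, TE.eval, WE.ok, WE.eval, St.tick_s, St.tick_a,
    St.setS_s, St.setS_a, hk', hin, hjn, hn, ci, cj, o1, o2, g1, g2, g3, reduceCtorEq, if_false,
    if_true, true_implies, not_true, false_implies, not_false_eq_true, and_true, true_and] <;>
  refine ⟨by omega, ?_⟩ <;> (repeat' apply And.intro) <;> (try intro g4) <;>
    (repeat' apply And.intro) <;> first
    | omega
    | (apply key
       · rfl
       · rfl
       · rfl
       · intro y h1 h2 h3 h4; simp [h1, h2, h3, h4]
       · simp [g1]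
       · simp; omega
       · simp)

theorem go_raise {f g u v : SV} (hu : V.s u < E.n) (hv : V.s v < E.n) (hL : LimOK Φ V)
    (hnew : V.s f = 0 → V.s g = 0 → V.s .v = 1 → ∀ w, 0 ≤ w →
      w < V.ra .u (V.s u) - V.ra .u (V.s v) → ∃ x ri ro, Φ x ri ro ∧ w < ro - ri) {Q : St → Prop}
    (hQ : ∀ V', Upd [] [.lim] V V' → LimOK Φ V' → V.r .lim ≤ V'.r .lim →
      (V.s f = 0 → V.s g = 0 → V.s .v = 1 → V.ra .u (V.s u) - V.ra .u (V.s v) ≤ V'.r .lim) →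
      V'.t ≤ V.t + 2 → Q V') : Go E (raiseP f g u v) V Q := by
  rw [raiseP, go_ite]
  refine ⟨by simp [hu, hv], fun h => ?_, fun h => ?_⟩
  · simp only [TE.eval, WE.eval, RE.eval] at h
    rw [go_setR]
    refine ⟨by simp [hu, hv], ?_⟩
    apply hQ
    · exact ⟨rfl, rfl, fun y hy => rfl, fun y hy => by simp at hy; simp [hy]⟩
    · refine ⟨?_, ?_⟩
      · simpa using hL.1.trans h.2.2.le
      · simpa using hnew h.1.1 h.1.2 h.2.1
    · simpa using h.2.2.le
    · simp
    · simp
  · simp only [TE.eval, WE.eval, RE.eval] at h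
    rw [go_skip]
    refine hQ _ ⟨rfl, rfl, fun y hy => rfl, fun y hy => rfl⟩ hL le_rfl (fun h1 h2 h3 => ?_) (by simp)
    by_contra h4
    exact h ⟨⟨h1, h2⟩, h3, not_le.1 h4⟩

/-- A valid range that is not bounded above has all widths below the limit. -/
theorem exists_of_unbounded {f₁ f₂ f₃ f₄ : Prop} {x₁ x₂ x₃ x₄ u a v b w : ℝ} (h3 : ¬ f₃) (h4 : ¬ f₄)
    (hw : w < u - v) :
    ∃ x, InRange f₁ f₂ f₃ f₄ x₁ x₂ x₃ x₄ x ∧ w < dst v b x - dst u a x := by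
  obtain ⟨Z, hZ⟩ := exists_width_gt (a := a) (b := b) hw
  refine ⟨max Z (max x₁ x₂), ⟨fun _ => ?_, fun _ => ?_, fun h => absurd h h3, fun h => absurd h h4⟩,
    hZ _ (le_max_left _ _)⟩
  · exact (le_max_left _ _).trans (le_max_right _ _)
  · exact (le_max_right _ _).trans (le_max_right _ _)

theorem exists_of_unbounded_below {f₁ f₂ f₃ f₄ : Prop} {x₁ x₂ x₃ x₄ u a v b w : ℝ} (h1 : ¬ f₁)
    (h2 : ¬ f₂) (hw : w < v - u) :
    ∃ x, InRange f₁ f₂ f₃ f₄ x₁ x₂ x₃ x₄ x ∧ w < dst v b x - dst u a x := by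
  obtain ⟨x, h, h'⟩ := exists_of_unbounded (f₁ := f₃) (f₂ := f₄) (x₁ := -x₃) (x₂ := -x₄) (x₃ := -x₁)
    (x₄ := -x₂) (u := -u) (v := -v) (a := a) (b := b) (w := w) h1 h2 (by linarith)
  refine ⟨-x, ?_, ?_⟩
  · have := h.neg; simpa only [neg_neg] using this
  · have e1 := dst_neg u a (-x)
    have e2 := dst_neg v b (-x)
    rw [neg_neg] at e1 e2
    rwa [← e1, ← e2]

/-- The position `x` is taken care of, for the gap between `i ∈ S` and `j ∉ S`. -/
def Dom (n k : ℕ) (col : ℕ → ℕ) (S : Finset ℕ) (i j : ℕ) (V : St) (x : ℝ) : Prop :=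
  (BothRainbow n k col S → V.s .has = 1 ∧
    (dst (V.ra .u j) (V.ra .h j) x - dst (V.ra .u i) (V.ra .h i) x ≤ V.r .best ∨
      dst (V.ra .u j) (V.ra .h j) x - dst (V.ra .u i) (V.ra .h i) x < V.r .lim)) ∧
  (SharedRainbow n k col S i j →
    sqd (V.ra .u) (V.ra .h) i x = sqd (V.ra .u) (V.ra .h) j x → V.s .has = 1)

theorem Dom.ext {n i j : ℕ} {V' : St} {x : ℝ} (h : Dom n k col S i j V x) (hE : Ext V V')
    (hr : V'.ra = V.ra) : Dom n k col S i j V' x := by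
  unfold Dom at *
  rw [hr]
  refine ⟨fun h1 => ?_, fun h1 h2 => (hE.1 (h.2 h1 h2)).1⟩
  obtain ⟨h2, h3⟩ := h.1 h1
  exact ⟨(hE.1 h2).1, h3.imp (fun h => h.trans (hE.1 h2).2) (fun h => h.trans_le hE.2)⟩

/-- The variables that may change when an edge pair is processed. -/
def eventS : List SV := [.li, .lj, .f1, .f2, .f3, .f4, .v, .cv, .t1, .t2, .has]

def eventR : List RV := [.x1, .x2, .x3, .x4, .lim, .xx, .y1, .y2, .best, .bx, .bi, .bo]

/-- By `InRange.exists_candidate` each position of the edge pair is dominated by a tried candidate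
or by `lim`. A tie of `i` and `j` is at an end of the range (`Gap.tie`), or on all of it if the feet
agree, so a tie is tried as well. -/
theorem go_event (T : Sorted (V.ra .u) (V.ra .h) E.n)
    (G : Gap (rank (V.ra .u) (V.ra .h) E.n) E.n S (V.s .i) (V.s .ci) (V.s .j) (V.s .cj))
    (hci : V.s .ci ≠ V.s .i → V.ra .u (V.s .i) ≠ V.ra .u (V.s .ci))
    (hli : NxtOn (rank (V.ra .u) (V.ra .h) E.n) E.n (V.s .i) (V.s .ci) (V.a .nx (V.s .i) (V.s .ci)))
    (hlj : NxtOn (rank (V.ra .u) (V.ra .h) E.n) E.n (V.s .j) (V.s .cj) (V.a .nx (V.s .j) (V.s .cj)))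
    (hC : Counts E.n k col S V) (hk : k ≤ E.n) (hk' : E.I.word 1 = k) (hcol : ∀ a < E.n, col a < k)
    (hB : BestOK Φ V) (hL : LimOK Φ V)
    (hΦ : ∀ y, GapRange (V.ra .u) (V.ra .h) (V.s .i) (V.s .ci) (V.s .j) (V.s .cj)
        (V.a .nx (V.s .i) (V.s .ci)) (V.a .nx (V.s .j) (V.s .cj)) y →
      (BothRainbow E.n k col S ∨ (SharedRainbow E.n k col S (V.s .i) (V.s .j) ∧
        sqd (V.ra .u) (V.ra .h) (V.s .i) y = sqd (V.ra .u) (V.ra .h) (V.s .j) y)) →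
      Φ y (dstOf V .i y) (dstOf V .j y)) {Q : St → Prop}
    (hQ : ∀ V', Upd eventS eventR V V' →
      V'.s .li = V.a .nx (V.s .i) (V.s .ci) → V'.s .lj = V.a .nx (V.s .j) (V.s .cj) →
      V'.s .f3 ≤ 1 → V'.s .f4 ≤ 1 →
      (V'.s .f3 ≠ 0 ↔ V.ra .u (V.s .i) ≠ V.ra .u (V'.s .li)) →
      (V'.s .f4 ≠ 0 ↔ V.ra .u (V.s .j) ≠ V.ra .u (V'.s .lj)) →
      (V'.s .f3 ≠ 0 → V'.r .x3 = cross (V.ra .u) (V.ra .h) (V.s .i) (V'.s .li)) →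
      (V'.s .f4 ≠ 0 → V'.r .x4 = cross (V.ra .u) (V.ra .h) (V.s .j) (V'.s .lj)) →
      BestOK Φ V' → LimOK Φ V' → Ext V V' →
      (∀ x, GapRange (V.ra .u) (V.ra .h) (V.s .i) (V.s .ci) (V.s .j) (V.s .cj)
        (V'.s .li) (V'.s .lj) x → Dom E.n k col S (V.s .i) (V.s .j) V' x) →
      V'.t ≤ V.t + 98 → Q V') : Go E eventP V Q := by
  have hin := G.i_lt
  have hjn := G.j_lt
  rw [eventP, go_seq]
  refine go_edges hin hjn G.ci_lt G.cj_lt (hli.lt hin) (hlj.lt hjn)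
    fun V₁ U₁ l1 l2 g1 g2 g3 g4 b1 b2 b3 b4 c1 c2 c3 c4 t1 => ?_
  have i1 : V₁.s .i = V.s .i := U₁.s _ (by decide)
  have j1 : V₁.s .j = V.s .j := U₁.s _ (by decide)
  rw [go_seq]
  refine go_flags (hC.congr U₁.a (U₁.s _ (by decide)) (U₁.s _ (by decide))) hk hk' G.sub
    (by rw [i1]; exact G.i_mem) (by rw [j1]; exact G.j_notMem) (by rw [j1]; exact hjn) hcol
    fun V₂ U₂ v1 v2 t2 => ?_
  rw [i1, j1] at v2
  have i2 : V₂.s .i = V.s .i := (U₂.s _ (by decide)).trans i1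
  have j2 : V₂.s .j = V.s .j := (U₂.s _ (by decide)).trans j1
  have ra2 : V₂.ra = V.ra := U₂.ra.trans U₁.ra
  have hr2 : ∀ y, rangeOf V₂ y ↔ GapRange (V.ra .u) (V.ra .h) (V.s .i) (V.s .ci) (V.s .j) (V.s .cj)
      (V₁.s .li) (V₁.s .lj) y := by
    intro y
    unfold rangeOf GapRange InRange
    simp only [U₂.s .f1 (by decide), U₂.s .f2 (by decide), U₂.s .f3 (by decide),
      U₂.s .f4 (by decide), U₂.r _ (List.not_mem_nil)]
    rw [← b1, ← b2, ← b3, ← b4]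
    refine and_congr ?_ (and_congr ?_ (and_congr ?_ ?_))
    · exact forall_congr' fun h => by rw [c1 h]
    · exact forall_congr' fun h => by rw [c2 h]
    · exact forall_congr' fun h => by rw [c3 h]
    · exact forall_congr' fun h => by rw [c4 h]
  have hacc : ∀ y, Accepted V₂ y ↔ (BothRainbow E.n k col S ∨
      (SharedRainbow E.n k col S (V.s .i) (V.s .j) ∧
        sqd (V.ra .u) (V.ra .h) (V.s .i) y = sqd (V.ra .u) (V.ra .h) (V.s .j) y)) := by
    intro y
    unfold Accepted dstOf
    rw [v1, v2, ra2, i2, j2, le_antisymm_iff, le_antisymm_iff, dst_le_dst, dst_le_dst]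
  have hd2 : ∀ y, dstOf V₂ .i y = dstOf V .i y ∧ dstOf V₂ .j y = dstOf V .j y := by
    intro y; unfold dstOf; rw [ra2, i2, j2]; exact ⟨rfl, rfl⟩
  have hΦ2 : ∀ y, rangeOf V₂ y → Accepted V₂ y → Φ y (dstOf V₂ .i y) (dstOf V₂ .j y) := by
    intro y h1 h2
    rw [(hd2 y).1, (hd2 y).2]
    refine hΦ y ?_ ((hacc y).1 h2)
    have := (hr2 y).1 h1
    rwa [l1, l2] at this
  have hL2 : LimOK Φ V₂ := by
    unfold LimOK
    rw [U₂.r _ (by simp), U₁.r _ (by decide)]; exact hL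
  rw [go_seq]
  refine go_raise (Φ := Φ) (by rw [j2]; exact hjn) (by rw [i2]; exact hin) hL2 ?_
    fun V₃ U₃ L3 e3 d3 t3 => ?_
  · intro h1 h2 h3 w _ hw
    obtain ⟨x, hx, hx'⟩ := exists_of_unbounded_below (f₁ := V₂.s .f1 ≠ 0) (f₂ := V₂.s .f2 ≠ 0)
      (f₃ := V₂.s .f3 ≠ 0) (f₄ := V₂.s .f4 ≠ 0) (x₁ := V₂.r .x1) (x₂ := V₂.r .x2) (x₃ := V₂.r .x3)
      (x₄ := V₂.r .x4) (a := V₂.ra .h (V₂.s .i)) (b := V₂.ra .h (V₂.s .j)) (by simp [h1])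
      (by simp [h2]) hw
    exact ⟨x, _, _, hΦ2 x hx (Or.inl h3), hx'⟩
  have ra3 : V₃.ra = V.ra := U₃.ra.trans ra2
  have s3 : V₃.s = V₂.s := funext fun y => U₃.s y (by simp)
  rw [go_seq]
  refine go_raise (Φ := Φ) (by rw [s3, i2]; exact hin) (by rw [s3, j2]; exact hjn) L3 ?_
    fun V₄ U₄ L4 e4 d4 t4 => ?_
  · rw [s3, U₃.ra]
    intro h1 h2 h3 w _ hw
    obtain ⟨x, hx, hx'⟩ := exists_of_unbounded (f₁ := V₂.s .f1 ≠ 0) (f₂ := V₂.s .f2 ≠ 0)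
      (f₃ := V₂.s .f3 ≠ 0) (f₄ := V₂.s .f4 ≠ 0) (x₁ := V₂.r .x1) (x₂ := V₂.r .x2) (x₃ := V₂.r .x3)
      (x₄ := V₂.r .x4) (a := V₂.ra .h (V₂.s .i)) (b := V₂.ra .h (V₂.s .j)) (by simp [h1])
      (by simp [h2]) hw
    exact ⟨x, _, _, hΦ2 x hx (Or.inl h3), hx'⟩
  have ra4 : V₄.ra = V.ra := U₄.ra.trans ra3
  have s4 : V₄.s = V₂.s := (funext fun y => U₄.s y (by simp)).trans s3
  have r4 : ∀ y, y ≠ .lim → V₄.r y = V₂.r y := fun y hy =>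
    (U₄.r y (by simpa using hy)).trans (U₃.r y (by simpa using hy))
  have hr4 : rangeOf V₄ = rangeOf V₂ := by
    unfold rangeOf
    rw [s4, r4 _ (by decide), r4 _ (by decide), r4 _ (by decide), r4 _ (by decide)]
  have hd4 : ∀ i, dstOf V₄ i = dstOf V₂ i := fun i => by
    unfold dstOf; rw [s4, ra4, ra2]
  have hacc4 : ∀ y, Accepted V₄ y ↔ Accepted V₂ y := fun y => by
    unfold Accepted; rw [s4, hd4, hd4]
  have hhas : V₄.s .has = V.s .has := by
    rw [s4, U₂.s _ (by decide), U₁.s _ (by decide)]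
  have hr04 : ∀ y, y ∉ [RV.x1, .x2, .x3, .x4, .lim] → V₄.r y = V.r y := by
    intro y hy
    simp only [List.mem_cons, not_or] at hy
    rw [r4 _ hy.2.2.2.2.1, U₂.r _ (by simp), U₁.r]
    simp [hy]
  have B4 : BestOK Φ V₄ := by
    unfold BestOK
    rw [hhas, hr04 _ (by decide), hr04 _ (by decide), hr04 _ (by decide), hr04 _ (by decide)]
    exact hB
  have E4 : Ext V V₄ := by
    refine ⟨fun h => ⟨hhas.trans h, (hr04 _ (by decide)).ge⟩, ?_⟩
    have : V₂.r .lim = V.r .lim := by rw [U₂.r _ (by simp), U₁.r _ (by decide)]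
    linarith
  have f12 : ∀ y, y ∉ [SV.v, .cv, .t1, .t2] → V₄.s y = V₁.s y := fun y hy => by
    rw [s4]; exact U₂.s y hy
  refine go_search (Φ := Φ) (by rw [s4, i2]; exact hin) (by rw [s4, j2]; exact hjn) B4
    (by rw [f12 _ (by decide)]; exact g1) (by rw [f12 _ (by decide)]; exact g2)
    (by rw [f12 _ (by decide)]; exact g3) (by rw [f12 _ (by decide)]; exact g4)
    (fun y h1 h2 => ?_) fun V₅ S5 D5 => ?_
  · rw [hd4, hd4]; exact hΦ2 y (hr4 ▸ h1) ((hacc4 y).1 h2)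
  have s5 : ∀ y, y ∉ [SV.v, .cv, .t1, .t2, .has] → V₅.s y = V₁.s y := fun y hy => by
    simp only [List.mem_cons, not_or] at hy
    rw [S5.frame.s y hy.2.2.2.2.1, f12]
    simp [hy]
  have ra5 : V₅.ra = V.ra := S5.frame.ra.trans ra4
  have r5 : ∀ y, y ∉ [RV.lim, .xx, .y1, .y2, .best, .bx, .bi, .bo] → V₅.r y = V₁.r y := fun y hy => by
    simp only [List.mem_cons, not_or] at hy
    rw [S5.frame.r y hy.2.1 hy.2.2.1 hy.2.2.2.1 hy.2.2.2.2.1 hy.2.2.2.2.2.1 hy.2.2.2.2.2.2.1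
      hy.2.2.2.2.2.2.2.1, r4 y hy.1, U₂.r _ (by simp)]
  have L5 : V₅.r .lim = V₄.r .lim := S5.frame.r _ (by decide) (by decide) (by decide) (by decide)
    (by decide) (by decide) (by decide)
  have tried : ∀ y, rangeOf V₂ y → Accepted V₂ y → Candidate (V₄.s .f1 ≠ 0) (V₄.s .f2 ≠ 0)
      (V₄.s .f3 ≠ 0) (V₄.s .f4 ≠ 0) (V₄.r .x1) (V₄.r .x2) (V₄.r .x3) (V₄.r .x4)
      (critPos (V.ra .u (V.s .i)) (V.ra .h (V.s .i)) (V.ra .u (V.s .j)) (V.ra .h (V.s .j))) y →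
      V₅.s .has = 1 ∧ dstOf V .j y - dstOf V .i y ≤ V₅.r .best := by
    intro y h1 h2 h3
    have := D5 y (by rw [s4, ra4, i2, j2]; rwa [s4] at h3) (hr4.symm ▸ h1) ((hacc4 y).2 h2)
    rwa [hd4, hd4, (hd2 y).1, (hd2 y).2] at this
  refine hQ V₅ ⟨?_, ra5, fun y hy => ?_, fun y hy => ?_⟩ ?_ ?_ ?_ ?_ ?_ ?_ ?_ ?_ S5.best ?_
    (E4.trans S5.ext) (fun x hx => ?_) ?_
  · rw [S5.frame.a, U₄.a, U₃.a, U₂.a, U₁.a]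
  · simp only [eventS, List.mem_cons, not_or] at hy
    rw [s5 _ (by simp [hy]), U₁.s _ (by simp [hy])]
  · simp only [eventR, List.mem_cons, not_or] at hy
    rw [r5 _ (by simp [hy]), U₁.r _ (by simp [hy])]
  · rw [s5 _ (by decide)]; exact l1
  · rw [s5 _ (by decide)]; exact l2
  · rw [s5 _ (by decide)]; exact g3
  · rw [s5 _ (by decide)]; exact g4
  · rw [s5 _ (by decide), s5 _ (by decide)]; exact b3
  · rw [s5 _ (by decide), s5 _ (by decide)]; exact b4
  · rw [s5 _ (by decide), s5 _ (by decide), r5 _ (by decide)]; exact c3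
  · rw [s5 _ (by decide), s5 _ (by decide), r5 _ (by decide)]; exact c4
  · unfold LimOK; rw [L5]; exact L4
  · rw [s5 _ (by decide), s5 _ (by decide)] at hx
    have hxr := (hr2 x).2 hx
    have hli' := hli
    rw [← l1] at hli'
    have hle := G.sqd_le_sqd T hli' hci hx
    have hdle := dst_le_dst.2 hle
    have hrange4 : InRange (V₄.s .f1 ≠ 0) (V₄.s .f2 ≠ 0) (V₄.s .f3 ≠ 0) (V₄.s .f4 ≠ 0)
        (V₄.r .x1) (V₄.r .x2) (V₄.r .x3) (V₄.r .x4) x := by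
      rw [← hr4] at hxr; exact hxr
    unfold Dom
    rw [ra5]
    refine ⟨fun hv => ?_, fun hv htie => ?_⟩
    -- Some candidate lies in the range, so `has` is set even where only the limit dominates.
    · obtain ⟨z, z1, z2, -⟩ := hrange4.exists_between (critPos (V.ra .u (V.s .i)) (V.ra .h (V.s .i))
        (V.ra .u (V.s .j)) (V.ra .h (V.s .j)))
      refine ⟨(tried z (hr4 ▸ z1) ((hacc z).2 (Or.inl hv)) z2).1, ?_⟩
      rcases hrange4.exists_candidate (T.nonneg _ hin) (T.nonneg _ hjn) hdle with
        ⟨y, y1, y2, y3⟩ | ⟨h1, h2, h3⟩ | ⟨h1, h2, h3⟩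
      · exact Or.inl (y3.trans (tried y (hr4 ▸ y1) ((hacc y).2 (Or.inl hv)) y2).2)
      · right
        refine h3.trans_le ?_
        have := d3 (by rw [← s4]; simpa using h1) (by rw [← s4]; simpa using h2) (v1.2 hv |>.symm ▸ rfl)
        rw [ra2, i2, j2] at this
        rw [L5]; exact this.trans e4
      · right
        refine h3.trans_le ?_
        have := d4 (by rw [s3, ← s4]; simpa using h1) (by rw [s3, ← s4]; simpa using h2)
          (by rw [s3]; exact v1.2 hv)
        rw [ra3, s3, i2, j2] at this
        rw [L5]; exact this
    -- With equal feet the lines coincide, so the tie holds at any candidate in the range.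
    · by_cases hij : V.ra .u (V.s .i) = V.ra .u (V.s .j)
      · obtain ⟨z, z1, z2, -⟩ := hrange4.exists_between (critPos (V.ra .u (V.s .i))
          (V.ra .h (V.s .i)) (V.ra .u (V.s .j)) (V.ra .h (V.s .j)))
        refine (tried z (hr4 ▸ z1) ((hacc z).2 (Or.inr ⟨hv, ?_⟩)) z2).1
        unfold sqd at htie ⊢
        rw [hij] at htie ⊢
        linarith
      · refine (tried x hxr ((hacc x).2 (Or.inr ⟨hv, htie⟩)) ?_).1
        rcases G.tie hli' hci hx htie hij with ⟨h1, h2⟩ | ⟨h1, h2⟩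
        · have h3 := b1.2 h1
          rw [← c1 h3] at h2
          refine Or.inr (Or.inl ⟨by rw [f12 _ (by decide)]; exact h3, ?_⟩)
          rw [r4 _ (by decide), U₂.r _ (by simp)]; exact h2
        · have h3 := b3.2 h1
          rw [← c3 h3] at h2
          refine Or.inr (Or.inr (Or.inr (Or.inl ⟨by rw [f12 _ (by decide)]; exact h3, ?_⟩)))
          rw [r4 _ (by decide), U₂.r _ (by simp)]; exact h2
  · have := S5.time
    omega

end

end RealRAM.HL

/-! ## The sweep along one gap -/
namespace Arrangement

open Finset

variable {U H : ℕ → ℝ} {n k : ℕ} {col : ℕ → ℕ} {S : Finset ℕ} {i ci j cj li lj : ℕ} {b : Prop} {x : ℝ}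

/-- If some next crossing precedes the cut, so does the chosen one: a crossing of `j` with a line
from above is not earlier by assumption, and one with a line from below is not earlier by
`lower_first`. -/
theorem Gap.pending_lower (A : Arr (rank U H n) n) (G : Gap (rank U H n) n S i ci j cj)
    (hi : NxtOn (rank U H n) n i ci li) (hj : NxtOn (rank U H n) n j cj lj)
    (hP : Pending (Cut U H b x) i ci j cj) (h : Cut U H b x i li ∨ Cut U H b x j lj)
    (h1 : U i ≠ U li) (h3 : ¬ (U j ≠ U lj ∧ lj < j) ∨ cross U H i li ≤ cross U H j lj) :
    Pending (Cut U H b x) li i j cj := by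
  refine ⟨fun _ => Cut.comm.1 ?_, hP.2⟩
  rcases h with h | h
  · exact h
  · rcases lt_trichotomy lj j with h4 | h4 | h4
    · exact h.mono h1 (h3.resolve_left (not_not.2 ⟨h.1, h4⟩))
    · exact absurd (by rw [h4]) h.1
    · exact h.of_rank G.j_lt (hj.lt G.j_lt) (G.lower_first A hi hj h4).2

theorem Gap.pending_upper (A : Arr (rank U H n) n) (G : Gap (rank U H n) n S i ci j cj)
    (hi : NxtOn (rank U H n) n i ci li) (hj : NxtOn (rank U H n) n j cj lj)
    (hP : Pending (Cut U H b x) i ci j cj) (h : Cut U H b x i li ∨ Cut U H b x j lj)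
    (h1 : U j ≠ U lj) (h3 : ¬ (U i ≠ U li ∧ i < li) ∨ cross U H j lj ≤ cross U H i li) :
    Pending (Cut U H b x) i ci lj j := by
  refine ⟨hP.1, fun _ => Cut.comm.1 ?_⟩
  rcases h with h | h
  · rcases lt_trichotomy i li with h4 | h4 | h4
    · exact h.mono h1 (h3.resolve_left (not_not.2 ⟨h.1, h4⟩))
    · exact absurd (by rw [← h4]) h.1
    · exact h.of_rank G.i_lt (hi.lt G.i_lt) (G.upper_first A hi hj h4).2
  · exact h

/-- No line enters the gap's levels from outside at a finite position, so the next finite crossing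
of `i` is the one with `j`. -/
theorem Gap.swap_of_ne (A : Arr (rank U H n) n) (G : Gap (rank U H n) n S i ci j cj)
    (hi : NxtOn (rank U H n) n i ci li) (hj : NxtOn (rank U H n) n j cj lj)
    (h1 : U i ≠ U li) (h2 : ¬ i < li) (h3 : ¬ (U j ≠ U lj ∧ lj < j)) :
    li = j ∧ lj = i ∧ j < i := by
  have h4 : li < i := lt_of_le_of_ne (not_lt.1 h2) fun h => h1 (by rw [h])
  have h5 := G.upper_first A hi hj h4
  have h6 := (cross_le_of_rank G.i_lt (hi.lt G.i_lt) h5.2 h1).1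
  have h7 := G.swap_of A hi hj h4 (by tauto)
  exact ⟨h7.1, h7.2, h7.1 ▸ h4⟩

/-- A finite crossing left on `j` would be with a line from below, and then `i` would have a finite
crossing before it or at the same time. -/
theorem Gap.no_more (A : Arr (rank U H n) n) (G : Gap (rank U H n) n S i ci j cj)
    (hi : NxtOn (rank U H n) n i ci li) (hj : NxtOn (rank U H n) n j cj lj)
    (h1 : U i = U li) (h3 : ¬ (U j ≠ U lj ∧ lj < j)) :
    ¬ (Cut U H b x i li ∨ Cut U H b x j lj) := by
  rintro (h | h)
  · exact h.1 h1
  · have h4 : j < lj := lt_of_le_of_ne (not_lt.1 fun h4 => h3 ⟨h.1, h4⟩) fun h5 => h.1 (by rw [← h5])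
    exact (cross_le_of_rank G.j_lt (hj.lt G.j_lt) (G.lower_first A hi hj h4).2 h.1).1 h1

/-- The circles around the position `x` with radii `ri` and `ro` separate the points as desired. -/
def Found (U H : ℕ → ℝ) (n k : ℕ) (col : ℕ → ℕ) (x ri ro : ℝ) : Prop :=
  ∃ S i j, (∀ a ∈ S, a < n) ∧ i ∈ S ∧ j ∉ S ∧ j < n ∧ 2 ≤ #S ∧
    (∀ a ∈ S, sqd U H a x ≤ sqd U H i x) ∧ (∀ a < n, a ∉ S → sqd U H j x ≤ sqd U H a x) ∧
    sqd U H i x ≤ sqd U H j x ∧ ri = dst (U i) (H i) x ∧ ro = dst (U j) (H j) x ∧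
    (BothRainbow n k col S ∨ (SharedRainbow n k col S i j ∧ sqd U H i x = sqd U H j x))

theorem Gap.found (T : Sorted U H n) (G : Gap (rank U H n) n S i ci j cj)
    (hi : NxtOn (rank U H n) n i ci li) (hj : NxtOn (rank U H n) n j cj lj)
    (hci : ci ≠ i → U i ≠ U ci) (hcj : cj ≠ j → U j ≠ U cj) (hS : 2 ≤ #S)
    (hx : GapRange U H i ci j cj li lj x)
    (h : BothRainbow n k col S ∨ (SharedRainbow n k col S i j ∧ sqd U H i x = sqd U H j x)) :
    Found U H n k col x (dst (U i) (H i) x) (dst (U j) (H j) x) :=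
  ⟨S, i, j, G.sub, G.i_mem, G.j_notMem, G.j_lt, hS, fun _ ha => G.sqd_le T hi hci hx ha,
    fun _ ha ha' => G.le_sqd T hj hcj hx ha ha', G.sqd_le_sqd T hi hci hx, rfl, rfl, h⟩

end Arrangement

namespace RealRAM.HL

open Arrangement Finset

/-- Proceed to the next edge pair of the gap. -/
def advanceP : HP :=
  -- A steeper line entering the lower level is taken first, unless a less steep line enters the
  -- upper level earlier. If neither happens and `i` has a finite crossing left, the levels meet.
  .ite (.and (.and (.weq (.s .f3) (.lit 1)) (.wlt (.s .i) (.s .li)))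
      (.or (.not (.and (.weq (.s .f4) (.lit 1)) (.wlt (.s .lj) (.s .j))))
        (.not (.rlt (.r .x4) (.r .x3)))))
    (.setS .ci (.s .i) ;; .setS .i (.s .li))
    (.ite (.and (.weq (.s .f4) (.lit 1)) (.wlt (.s .lj) (.s .j)))
      (.setS .cj (.s .j) ;; .setS .j (.s .lj))
      (.ite (.weq (.s .f3) (.lit 1))
        (removeP .i ;; addP .j ;; .setS .ci (.s .i) ;; .setS .cj (.s .j) ;; .setS .i (.s .cj) ;;
          .setS .j (.s .ci))
        (.setS .go (.lit 0))))

def sweepP : HP := .loop (.weq (.s .go) (.lit 1)) (eventP ;; advanceP)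

/-- The gap of size `p` has been searched at the cut at `x`. -/
def Covered (n k : ℕ) (col : ℕ → ℕ) (p : ℕ) (V : St) (b : Prop) (x : ℝ) : Prop :=
  ∃ S i j, #S = p ∧ PrefixAt (Cut (V.ra .u) (V.ra .h) b x) n S i j ∧ Dom n k col S i j V x

theorem Covered.ext {n k p : ℕ} {col : ℕ → ℕ} {V V' : St} {b : Prop} {x : ℝ}
    (h : Covered n k col p V b x) (hE : Ext V V') (hr : V'.ra = V.ra) :
    Covered n k col p V' b x := by
  obtain ⟨S, i, j, h1, h2, h3⟩ := h
  exact ⟨S, i, j, h1, by rw [hr]; exact h2, h3.ext hE hr⟩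

/-- The state of the search, apart from the current gap. -/
structure SearchInv (E : Env) (k : ℕ) (col : ℕ → ℕ) (V₀ V : St) : Prop where
  a : ∀ y, y ≠ .cnt → V.a y = V₀.a y
  ra : V.ra = V₀.ra
  r : ∀ y, y ∉ eventR → V.r y = V₀.r y
  p_eq : V.s .p = V₀.s .p
  best : BestOK (Found (V₀.ra .u) (V₀.ra .h) E.n k col) V
  lim : LimOK (Found (V₀.ra .u) (V₀.ra .h) E.n k col) V
  ext : Ext V₀ V

/-- The state at an edge pair. -/
structure SweepInv (E : Env) (k : ℕ) (col : ℕ → ℕ) (p : ℕ) (V₀ V : St) (S : Finset ℕ) : Prop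
    extends SearchInv E k col V₀ V where
  gap : Gap (rank (V₀.ra .u) (V₀.ra .h) E.n) E.n S (V.s .i) (V.s .ci) (V.s .j) (V.s .cj)
  card : #S = p
  hci : V.s .ci ≠ V.s .i → V₀.ra .u (V.s .i) ≠ V₀.ra .u (V.s .ci)
  hcj : V.s .cj ≠ V.s .j → V₀.ra .u (V.s .j) ≠ V₀.ra .u (V.s .cj)
  counts : Counts E.n k col S V
  -- Every cut is done or still ahead; the sweep ends when none is ahead.
  cover : ∀ b x, Covered E.n k col p V b x ∨
    Pending (Cut (V₀.ra .u) (V₀.ra .h) b x) (V.s .i) (V.s .ci) (V.s .j) (V.s .cj)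

section
variable {E : Env} {V V₀ : St} {S : Finset ℕ} {k p : ℕ} {col : ℕ → ℕ}

theorem SearchInv.congr {V' : St} (h : SearchInv E k col V₀ V) (ha : ∀ y, y ≠ .cnt → V'.a y = V.a y)
    (hra : V'.ra = V.ra) (hr : V'.r = V.r) (hp : V'.s .p = V.s .p) (hh : V'.s .has = V.s .has) :
    SearchInv E k col V₀ V' := by
  refine ⟨fun y hy => (ha y hy).trans (h.a y hy), hra.trans h.ra, fun y hy => ?_, hp.trans h.p_eq, ?_,
    ?_, h.ext.trans (Ext.of_eq hh (by rw [hr]) (by rw [hr]))⟩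
  · rw [hr]; exact h.r y hy
  · unfold BestOK; rw [hr, hh]; exact h.best
  · unfold LimOK; rw [hr]; exact h.lim

/-- Built lists give the next crossings. -/
theorem Built.nxtOn (hB : Built E V E.n) {u c : ℕ} (hu : u < E.n) (hc : c < E.n) :
    NxtOn (rank (V.ra .u) (V.ra .h) E.n) E.n u c (V.a .nx u c) :=
  (hB u hu).nxt c (by simp only [mem_insert, mem_erase, mem_range]; tauto)

theorem go_advance (T : Sorted (V₀.ra .u) (V₀.ra .h) E.n) (hk : k ≤ E.n)
    (hcol : ∀ a < E.n, col a < k) {li lj : ℕ}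
    (hI : SearchInv E k col V₀ V) (hgo : V.s .go = 1)
    (G : Gap (rank (V₀.ra .u) (V₀.ra .h) E.n) E.n S (V.s .i) (V.s .ci) (V.s .j) (V.s .cj))
    (hcard : #S = p)
    (hci : V.s .ci ≠ V.s .i → V₀.ra .u (V.s .i) ≠ V₀.ra .u (V.s .ci))
    (hcj : V.s .cj ≠ V.s .j → V₀.ra .u (V.s .j) ≠ V₀.ra .u (V.s .cj))
    (hC : Counts E.n k col S V)
    (hcover : ∀ b x, Covered E.n k col p V b x ∨
      (Pending (Cut (V₀.ra .u) (V₀.ra .h) b x) (V.s .i) (V.s .ci) (V.s .j) (V.s .cj) ∧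
        (Cut (V₀.ra .u) (V₀.ra .h) b x (V.s .i) li ∨ Cut (V₀.ra .u) (V₀.ra .h) b x (V.s .j) lj)))
    (hli : V.s .li = li) (hlj : V.s .lj = lj)
    (hi : NxtOn (rank (V₀.ra .u) (V₀.ra .h) E.n) E.n (V.s .i) (V.s .ci) li)
    (hj : NxtOn (rank (V₀.ra .u) (V₀.ra .h) E.n) E.n (V.s .j) (V.s .cj) lj)
    (g3 : V.s .f3 ≤ 1) (g4 : V.s .f4 ≤ 1)
    (b3 : V.s .f3 ≠ 0 ↔ V₀.ra .u (V.s .i) ≠ V₀.ra .u li)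
    (b4 : V.s .f4 ≠ 0 ↔ V₀.ra .u (V.s .j) ≠ V₀.ra .u lj)
    (c3 : V.s .f3 ≠ 0 → V.r .x3 = cross (V₀.ra .u) (V₀.ra .h) (V.s .i) li)
    (c4 : V.s .f4 ≠ 0 → V.r .x4 = cross (V₀.ra .u) (V₀.ra .h) (V.s .j) lj) {Q : St → Prop}
    (hnext : ∀ V' S', V'.s .go = 1 → SweepInv E k col p V₀ V' S' →
      gapMeasure (rank (V₀.ra .u) (V₀.ra .h) E.n) E.n p (V'.s .i) (V'.s .ci) (V'.s .j) (V'.s .cj) <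
        gapMeasure (rank (V₀.ra .u) (V₀.ra .h) E.n) E.n p (V.s .i) (V.s .ci) (V.s .j) (V.s .cj) →
      V'.t ≤ V.t + 24 → Q V')
    (hhalt : ∀ V', V'.s .go = 0 → SearchInv E k col V₀ V' →
      (∀ b x, Covered E.n k col p V' b x) → V'.t ≤ V.t + 24 → Q V') : Go E advanceP V Q := by
  have A := arr_rank T
  subst hcard
  rw [advanceP, go_ite]
  refine ⟨by simp, fun h => ?_, fun h => ?_⟩
  · simp only [TE.eval, WE.eval, RE.eval, hli, hlj] at h
    obtain ⟨⟨h1, h2⟩, h3⟩ := h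
    have hne := b3.1 (by omega)
    simp [hli]
    have hI' : SearchInv E k col V₀ (V.tick.setS .ci (V.s .i) |>.setS .i li) :=
      hI.congr (fun _ _ => rfl) rfl rfl (by simp) (by simp)
    refine hnext _ S (by simpa) ⟨hI', ?_, rfl, ?_, ?_, hC.congr rfl (by simp) (by simp), ?_⟩ ?_
      (by simp)
    · simpa using G.lower_step A hi h2
    · simpa using fun _ => hne.symm
    · simpa using hcj
    · intro b x
      rcases hcover b x with h4 | ⟨h4, h5⟩
      · exact Or.inl (h4.ext (Ext.of_eq (by simp) rfl rfl) rfl)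
      · right
        have h6 : ¬ (V₀.ra .u (V.s .j) ≠ V₀.ra .u lj ∧ lj < V.s .j) ∨
            cross (V₀.ra .u) (V₀.ra .h) (V.s .i) li ≤ cross (V₀.ra .u) (V₀.ra .h) (V.s .j) lj := by
          by_cases h7 : V₀.ra .u (V.s .j) ≠ V₀.ra .u lj ∧ lj < V.s .j
          · right
            have h8 := b4.2 h7.1
            rw [← c3 (by omega), ← c4 h8]
            exact not_lt.1 (h3.resolve_left (not_not.2 ⟨by omega, h7.2⟩))
          · exact Or.inl h7
        simpa using G.pending_lower A hi hj h4 h5 hne h6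
    · simpa using G.measure_lower A hi h2
  rw [go_ite]
  simp only [TE.eval, WE.eval, RE.eval, hli, hlj] at h
  refine ⟨by simp, fun h' => ?_, fun h' => ?_⟩
  · simp only [TE.eval, WE.eval, RE.eval, St.tick_s, hlj] at h'
    obtain ⟨h1, h2⟩ := h'
    have hne := b4.1 (by omega)
    simp [hlj]
    have hI' : SearchInv E k col V₀ (V.tick.tick.setS .cj (V.s .j) |>.setS .j lj) :=
      hI.congr (fun _ _ => rfl) rfl rfl (by simp) (by simp)
    refine hnext _ S (by simpa) ⟨hI', ?_, rfl, ?_, ?_, hC.congr rfl (by simp) (by simp), ?_⟩ ?_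
      (by simp)
    · simpa using G.upper_step A hj h2
    · simpa using hci
    · simpa using fun _ => hne.symm
    · intro b x
      rcases hcover b x with h4 | ⟨h4, h5⟩
      · exact Or.inl (h4.ext (Ext.of_eq (by simp) rfl rfl) rfl)
      · right
        have h6 : ¬ (V₀.ra .u (V.s .i) ≠ V₀.ra .u li ∧ V.s .i < li) ∨
            cross (V₀.ra .u) (V₀.ra .h) (V.s .j) lj ≤ cross (V₀.ra .u) (V₀.ra .h) (V.s .i) li := by
          by_cases h7 : V₀.ra .u (V.s .i) ≠ V₀.ra .u li ∧ V.s .i < li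
          · right
            have h8 := b3.2 h7.1
            rw [← c3 h8, ← c4 (by omega)]
            by_contra h9
            exact h ⟨⟨by omega, h7.2⟩, Or.inr (fun h10 => h9 h10.le)⟩
          · exact Or.inl h7
        simpa using G.pending_upper A hi hj h4 h5 hne h6
    · simpa using G.measure_upper A hj h2
  simp only [TE.eval, WE.eval, RE.eval, St.tick_s, hlj] at h'
  have h4' : ¬ (V₀.ra .u (V.s .j) ≠ V₀.ra .u lj ∧ lj < V.s .j) := fun h4 =>
    h' ⟨by have := b4.2 h4.1; omega, h4.2⟩
  rw [go_ite]
  refine ⟨by simp, fun h1 => ?_, fun h1 => ?_⟩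
  · simp only [TE.eval, WE.eval, St.tick_s] at h1
    have hne := b3.1 (by omega)
    obtain ⟨e1, e2, hji⟩ := G.swap_of_ne A hi hj hne
      (fun h5 => h ⟨⟨h1, h5⟩, Or.inl h'⟩) h4'
    rw [e1] at hi hne hcover
    rw [e2] at hj hcover
    have hin := G.i_lt
    have hjn := G.j_lt
    rw [go_seq]
    refine go_remove (V := V.tick.tick.tick) (S := S.erase (V.s .i)) (col := col) (k := k) (by decide) (by decide)
      ?_ hk (fun a ha => G.sub a (mem_of_mem_erase ha)) hin (by simp) (hcol _ hin)
      fun V₁ F₁ C₁ t₁ => ?_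
    · simp only [St.tick_s]
      rw [insert_erase G.i_mem]
      exact hC.congr rfl rfl rfl
    have j1 : V₁.s .j = V.s .j := F₁.s _ (by decide) (by decide) (by decide)
    rw [go_seq]
    refine go_add (S := S.erase (V.s .i)) (col := col) (k := k) (by decide) (by decide)
      C₁ hk (fun a ha => G.sub a (mem_of_mem_erase ha)) (j1 ▸ hjn)
      (by rw [j1]; exact fun h => G.j_notMem (mem_of_mem_erase h)) (by rw [j1]; exact hcol _ hjn)
      fun V₂ F₂ C₂ t₂ => ?_
    rw [j1] at C₂
    have s2 : ∀ y, y ≠ .t1 → y ≠ .inC → y ≠ .outC → V₂.s y = V.s y := fun y g1 g2 g3 =>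
      (F₂.s y g1 g2 g3).trans (F₁.s y g1 g2 g3)
    have i2 : V₂.s .i = V.s .i := s2 _ (by decide) (by decide) (by decide)
    have j2 : V₂.s .j = V.s .j := s2 _ (by decide) (by decide) (by decide)
    have ext2 : Ext V V₂ := Ext.of_eq (s2 _ (by decide) (by decide) (by decide))
      (by rw [F₂.r, F₁.r]; rfl) (by rw [F₂.r, F₁.r]; rfl)
    have ra2 : V₂.ra = V.ra := F₂.ra.trans F₁.ra
    simp [i2, j2]
    have hI' : SearchInv E k col V₀ (((V₂.setS .ci (V.s .i)).setS .cj (V.s .j)).setS .i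
        (V.s .j) |>.setS .j (V.s .i)) :=
      hI.congr (fun y hy => (F₂.a y hy).trans (F₁.a y hy)) ra2 (F₂.r.trans F₁.r)
        (by simp [s2]) (by simp [s2])
    refine hnext _ (insert (V.s .j) (S.erase (V.s .i))) (by simpa [s2])
      ⟨hI', ?_, G.card_swap, ?_, ?_, C₂.congr rfl (by simp) (by simp), ?_⟩ ?_ ?_
    · simpa using G.swap A hi hj hji
    · simpa using fun _ => hne.symm
    · simpa using fun _ => hne
    · intro b x
      rcases hcover b x with h4 | ⟨h4, h5⟩
      · exact Or.inl (h4.ext (ext2.trans (Ext.of_eq (by simp) rfl rfl)) ra2)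
      · right
        have h6 : Cut (V₀.ra .u) (V₀.ra .h) b x (V.s .i) (V.s .j) := h5.elim id Cut.comm.1
        simp only [Pending]
        simpa using ⟨fun _ => Cut.comm.1 h6, fun _ => h6⟩
    · simpa using G.measure_swap A hi hj
    · simp at t₁ ⊢; omega
  · simp only [TE.eval, WE.eval, St.tick_s] at h1
    have he : V₀.ra .u (V.s .i) = V₀.ra .u li := by
      by_contra h5; have := b3.2 h5; omega
    simp
    refine hhalt _ (by simp) (hI.congr (fun _ _ => rfl) rfl rfl (by simp) (by simp))
      (fun b x => ?_) (by simp)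
    rcases hcover b x with h5 | ⟨h5, h6⟩
    · exact h5.ext (Ext.of_eq (by simp) rfl rfl) rfl
    · exact absurd h6 (G.no_more A hi hj he h4')

theorem go_sweep (T : Sorted (V₀.ra .u) (V₀.ra .h) E.n) (hB : Built E V₀ E.n) (hk : k ≤ E.n)
    (hk' : E.I.word 1 = k) (hcol : ∀ a < E.n, col a < k) (hp : 2 ≤ p)
    (h : SweepInv E k col p V₀ V S) (hgo : V.s .go = 1) {Q : St → Prop}
    (hQ : ∀ V', SearchInv E k col V₀ V' → (∀ b x, Covered E.n k col p V' b x) →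
      V'.t ≤ V.t + 130 * (gapMeasure (rank (V₀.ra .u) (V₀.ra .h) E.n) E.n p
        (V.s .i) (V.s .ci) (V.s .j) (V.s .cj) + 1) + 1 → Q V') : Go E sweepP V Q := by
  rw [sweepP]
  -- The value `m = 0` is reserved for the state after `go` has been cleared, hence the `+ 1`.
  refine go_loop (fun m V' => (V'.t + 130 * m ≤ V.t + 130 * (gapMeasure
      (rank (V₀.ra .u) (V₀.ra .h) E.n) E.n p (V.s .i) (V.s .ci) (V.s .j) (V.s .cj) + 1)) ∧
    ((V'.s .go = 1 ∧ ∃ S, SweepInv E k col p V₀ V' S ∧ gapMeasure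
      (rank (V₀.ra .u) (V₀.ra .h) E.n) E.n p (V'.s .i) (V'.s .ci) (V'.s .j) (V'.s .cj) + 1 = m) ∨
    (m = 0 ∧ V'.s .go = 0 ∧ SearchInv E k col V₀ V' ∧ ∀ b x, Covered E.n k col p V' b x)))
    ⟨le_rfl, Or.inl ⟨hgo, S, h, rfl⟩⟩ ?_
  rintro m V₁ ⟨ht, ⟨hgo, S, h, hm⟩ | ⟨rfl, hgo, hI, hcov⟩⟩
  · refine ⟨by simp, fun h1 => absurd hgo (by simpa using h1), fun _ => ?_⟩
    have e1 : V₁.ra = V₀.ra := h.ra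
    have e2 : V₁.a .nx = V₀.a .nx := h.a _ (by decide)
    have hi := hB.nxtOn h.gap.i_lt h.gap.ci_lt
    have hj := hB.nxtOn h.gap.j_lt h.gap.cj_lt
    rw [go_seq]
    refine go_event (V := V₁.tick) (Φ := Found (V₀.ra .u) (V₀.ra .h) E.n k col) (S := S) (k := k) (col := col)
      (by simpa [e1] using T) (by simpa [e1] using h.gap) (by simpa [e1] using h.hci)
      (by simpa [e1, e2] using hi) (by simpa [e1, e2] using hj) (h.counts.congr rfl rfl rfl) hk hk'
      hcol h.best h.lim ?_ fun V₂ F₂ l1 l2 g3 g4 b3 b4 c3 c4 B₂ L₂ X₂ D₂ t₂ => ?_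
    · simp only [St.tick_ra, St.tick_s, St.tick_a, e1, e2]
      intro y hy hy'
      unfold dstOf
      simp only [St.tick_ra, St.tick_s, e1]
      exact h.gap.found T hi hj h.hci h.hcj (by rw [h.card]; exact hp) hy hy'
    · simp only [St.tick_ra, St.tick_s, St.tick_a, St.tick_t, e1, e2] at l1 l2 b3 b4 c3 c4 D₂ t₂
      rw [l1] at b3 c3 D₂
      rw [l2] at b4 c4 D₂
      have ra2 : V₂.ra = V₀.ra := F₂.ra.trans e1
      have i2 : V₂.s .i = V₁.s .i := F₂.s _ (by decide)
      have j2 : V₂.s .j = V₁.s .j := F₂.s _ (by decide)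
      have ci2 : V₂.s .ci = V₁.s .ci := F₂.s _ (by decide)
      have cj2 : V₂.s .cj = V₁.s .cj := F₂.s _ (by decide)
      have X₂' : Ext V₁ V₂ := (Ext.of_eq rfl rfl rfl : Ext V₁ V₁.tick).trans X₂
      refine go_advance (S := S) (k := k) (p := p) (col := col) T hk hcol
        ⟨fun y hy => by rw [F₂.a]; exact h.a y hy, ra2, fun y hy => (F₂.r y hy).trans (h.r y hy),
          (F₂.s _ (by decide)).trans h.p_eq, B₂, L₂, h.ext.trans X₂'⟩ ((F₂.s _ (by decide)).trans hgo)
        ?_ h.card ?_ ?_ (h.counts.congr F₂.a (F₂.s _ (by decide)) (F₂.s _ (by decide)))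
        (fun b x => ?_) l1 l2 ?_ ?_ g3 g4 ?_ ?_ ?_ ?_ (fun V₃ S' g1 g2 g3' t₃ => ?_)
        fun V₃ g1 g2 g3' t₃ => ?_
      · rw [i2, j2, ci2, cj2]; exact h.gap
      · rw [i2, ci2]; exact h.hci
      · rw [j2, cj2]; exact h.hcj
      · rw [i2, j2, ci2, cj2]
        rcases h.cover b x with h5 | h5
        · exact Or.inl (h5.ext X₂' F₂.ra)
        · by_cases h6 : Cut (V₀.ra .u) (V₀.ra .h) b x (V₁.s .i) (V₀.a .nx (V₁.s .i) (V₁.s .ci)) ∨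
            Cut (V₀.ra .u) (V₀.ra .h) b x (V₁.s .j) (V₀.a .nx (V₁.s .j) (V₁.s .cj))
          · exact Or.inr ⟨h5, h6⟩
          · rw [not_or] at h6
            obtain ⟨h7, h8⟩ := h.gap.prefixAt hi hj h5 h6.1 h6.2
            exact Or.inl ⟨S, _, _, h.card, by rw [ra2]; exact h7, D₂ x h8⟩
      · rw [i2, ci2]; exact hi
      · rw [j2, cj2]; exact hj
      · rw [i2]; exact b3
      · rw [j2]; exact b4
      · rw [i2]; exact c3
      · rw [j2]; exact c4
      · rw [i2, j2, ci2, cj2] at g3'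
        exact ⟨_, by omega, by omega, Or.inl ⟨g1, S', g2, rfl⟩⟩
      · exact ⟨0, by omega, by omega, Or.inr ⟨rfl, g1, g2, g3'⟩⟩
  · refine ⟨by simp, fun _ => hQ _ (hI.congr (fun _ _ => rfl) rfl rfl rfl rfl)
      (fun b x => (hcov b x).ext (Ext.of_eq rfl rfl rfl) rfl) (by simp; omega), fun h1 => ?_⟩
    simp [hgo] at h1

end

end RealRAM.HL

/-! ## The search over all gaps -/
namespace RealRAM.HL

open Arrangement Finset

/-- The first edge pair of the gap above the `p` lowest lines. -/
def initP : HP :=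
  .setS .i (.sub .n (.s .p)) ;; .setS .j (.sub (.s .i) (.lit 1)) ;; .setS .ci (.s .i) ;;
  .setS .cj (.s .j) ;; .setS .inC (.lit 0) ;; .setS .outC (.inp (.lit 1)) ;; .setS .go (.lit 1) ;;
  .for .c (.lit 0) (.inp (.lit 1)) (.setA .cnt (.s .c) (.lit 0) (.lit 0)) ;;
  .for .a (.s .i) .n (addP .a)

/-- The gaps start at `p = 2` because the inner disk has to contain two points, and `p < n` leaves a
point outside. -/
def scanP : HP := .for .p (.lit 2) .n (initP ;; sweepP)

/-- The variables that may change in the initialization. -/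
def initS : List SV := [.i, .j, .ci, .cj, .inC, .outC, .go, .c, .a, .t1]

section
variable {E : Env} {V V₀ : St} {S : Finset ℕ} {k p : ℕ} {col : ℕ → ℕ}

theorem SearchInv.trans {V₁ : St} (h : SearchInv E k col V₀ V₁) (h' : SearchInv E k col V₁ V) :
    SearchInv E k col V₀ V :=
  ⟨fun y hy => (h'.a y hy).trans (h.a y hy), h'.ra.trans h.ra, fun y hy => (h'.r y hy).trans (h.r y hy),
    h'.p_eq.trans h.p_eq, h.ra ▸ h'.best, h.ra ▸ h'.lim, h.ext.trans h'.ext⟩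

theorem go_init (hk : k ≤ E.n) (hk' : E.I.word 1 = k) (hcol : ∀ a < E.n, col a < k)
    (hp : 0 < p) (hpn : p < E.n) (hVp : V.s .p = p) (hc : ∀ a < E.n, V.a .col a 0 = col a)
    (ht : ∀ c < k, V.a .tot c 0 = colorCount col (range E.n) c)
    (hpos : ∀ c < k, 0 < colorCount col (range E.n) c) {Q : St → Prop}
    (hQ : ∀ V', (∀ y, y ≠ .cnt → V'.a y = V.a y) → V'.ra = V.ra → V'.r = V.r →
      (∀ y, y ∉ initS → V'.s y = V.s y) → V'.s .go = 1 → V'.s .i = E.n - p → V'.s .ci = E.n - p →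
      V'.s .j = E.n - p - 1 → V'.s .cj = E.n - p - 1 → Counts E.n k col (Ico (E.n - p) E.n) V' →
      V'.t ≤ V.t + 13 * E.n + 12 → Q V') : Go E initP V Q := by
  have hn : 0 < E.n := by omega
  simp only [initP, go_seq, go_setS, WE.ok, WE.eval, St.setS_s, reduceCtorEq, if_true, if_false, hVp,
    hk']
  refine ⟨⟨trivial, trivial, by omega⟩, ⟨trivial, by omega, by omega⟩, trivial, trivial, by omega,
    ⟨by omega, by omega⟩, by omega, ?_⟩
  refine go_for (fun c V' => (∀ y, y ≠ .cnt → V'.a y = V.a y) ∧ V'.ra = V.ra ∧ V'.r = V.r ∧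
      (∀ y, y ∉ initS → V'.s y = V.s y) ∧ (V'.s .go = 1 ∧ V'.s .i = E.n - p ∧ V'.s .ci = E.n - p ∧
      V'.s .j = E.n - p - 1 ∧ V'.s .cj = E.n - p - 1) ∧ V'.s .inC = 0 ∧ V'.s .outC = k ∧
      (∀ d < c, V'.a .cnt d 0 = 0) ∧ V'.t ≤ V.t + 8 + 3 * c) k (by simp) (by simp) (by omega) ?_ ?_ ?_
      (fun _ _ _ => le_rfl) ?_
  · refine ⟨fun _ _ => rfl, rfl, rfl, fun y hy => ?_, ?_, ?_, ?_, ?_, ?_⟩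
    · simp only [initS, List.mem_cons, not_or] at hy
      simp [hy]
    all_goals simp
  · intro c V' _ _
    simp [hk']
  · rintro c V₁ ⟨h1, h2, h3, h4, h5, h6, h7, h8, h9⟩ hVc - hck
    rw [go_setA]
    refine ⟨by simp [hVc]; omega, by simpa using hVc, fun y hy => ?_, h2, h3, fun y hy => ?_, ?_, ?_,
      ?_, fun d hd => ?_, ?_⟩
    · rw [← h1 y hy]; funext i j; simp [hy]
    · have hy' := hy
      simp only [initS, List.mem_cons, not_or] at hy
      simp [hy, h4 y hy']
    · simpa using h5
    · simpa using h6
    · simpa using h7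
    · by_cases hdc : d = c
      · simp [hVc, hdc]
      · have := h8 d (by omega)
        simpa [hVc, hdc] using this
    · simp; omega
  · rintro V₁ ⟨h1, h2, h3, h4, h5, h6, h7, h8, h9⟩ -
    refine go_for (fun a V' => (∀ y, y ≠ .cnt → V'.a y = V.a y) ∧ V'.ra = V.ra ∧ V'.r = V.r ∧
      (∀ y, y ∉ initS → V'.s y = V.s y) ∧ (V'.s .go = 1 ∧ V'.s .i = E.n - p ∧ V'.s .ci = E.n - p ∧
      V'.s .j = E.n - p - 1 ∧ V'.s .cj = E.n - p - 1) ∧ Counts E.n k col (Ico (E.n - p) a) V' ∧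
      V'.t ≤ V.t + 10 + 3 * k + 10 * (a - (E.n - p))) E.n (by simp) (by simp [h5.2.1]) (by omega)
      ?_ (fun _ _ _ _ => ⟨trivial, rfl⟩) ?_ ?_ ?_
    · simp only [WE.eval, St.tick_s, h5.2.1]
      refine ⟨h1, h2, h3, fun y hy => ?_, by simpa using h5, ⟨?_, ?_, ?_, ?_, ?_⟩, ?_⟩
      · have hy' := hy
        simp only [initS, List.mem_cons, not_or] at hy
        simp [hy, h4 y hy']
      · simpa [h1] using hc
      · simpa [h1] using ht
      · simpa [colorCount] using h8
      · simp [h6, colorCount]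
      · have : ∀ c < k, 0 < colorCount col (range E.n) c := hpos
        simp only [Ico_self]
        rw [card_filter_range_eq.2 (fun c hc => by simpa [colorCount] using hpos c hc)]
        simpa using h7
      · simp; omega
    · rintro a V₂ ⟨g1, g2, g3, g4, g5, g6, g7⟩ hVa hla han
      simp only [WE.eval, St.tick_s, h5.2.1] at hla
      refine go_add (V := V₂.tick) (S := Ico (E.n - p) a) (by decide) (by decide)
        (g6.congr rfl rfl rfl) hk
        (fun x hx => by simp at hx; omega) (by simpa [hVa] using han) (by simp [hVa])
        (by simpa [hVa] using hcol a han) fun V₃ F₃ C₃ t₃ => ?_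
      simp only [St.tick_s, hVa] at C₃
      have e : insert a (Ico (E.n - p) a) = Ico (E.n - p) (a + 1) := by
        ext x; simp only [mem_insert, mem_Ico]; omega
      rw [e] at C₃
      have hs : ∀ y, y ≠ .t1 → y ≠ .inC → y ≠ .outC → V₃.s y = V₂.s y := F₃.s
      refine ⟨by rw [hs _ (by decide) (by decide) (by decide)]; exact hVa,
        fun y hy => (F₃.a y hy).trans (g1 y hy), F₃.ra.trans g2, F₃.r.trans g3, fun y hy => ?_, ?_,
        C₃.congr rfl (by simp) (by simp), ?_⟩
      · have hy' := hy
        simp only [initS, List.mem_cons, not_or] at hy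
        simp [hy, hs, g4 y hy']
      · simpa [hs] using g5
      · simp at t₃ ⊢; omega
    · rintro a V₂ ⟨g1, g2, g3, g4, g5, g6, g7⟩
      simp [h5.2.1, g5.2.1]
    · rintro V₂ ⟨g1, g2, g3, g4, g5, g6, g7⟩ -
      exact hQ _ g1 g2 g3 g4 g5.1 g5.2.1 g5.2.2.1 g5.2.2.2.1 g5.2.2.2.2 (g6.congr rfl rfl rfl)
        (by simp; omega)

theorem go_scan (T : Sorted (V.ra .u) (V.ra .h) E.n) (hB : Built E V E.n) (hk : k ≤ E.n)
    (hk' : E.I.word 1 = k) (hcol : ∀ a < E.n, col a < k) (hc : ∀ a < E.n, V.a .col a 0 = col a)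
    (ht : ∀ c < k, V.a .tot c 0 = colorCount col (range E.n) c)
    (hpos : ∀ c < k, 0 < colorCount col (range E.n) c)
    (hbest : BestOK (Found (V.ra .u) (V.ra .h) E.n k col) V)
    (hlim : LimOK (Found (V.ra .u) (V.ra .h) E.n k col) V) {Q : St → Prop}
    (hQ : ∀ V', (∀ y, y ∉ eventR → V'.r y = V.r y) →
      BestOK (Found (V.ra .u) (V.ra .h) E.n k col) V' →
      LimOK (Found (V.ra .u) (V.ra .h) E.n k col) V' → V'.ra = V.ra →
      (∀ p, 2 ≤ p → p < E.n → ∀ b x, Covered E.n k col p V' b x) →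
      V'.t ≤ V.t + 1000 * E.n ^ 2 → Q V') : Go E scanP V Q := by
  have h2 := E.two_le
  set τ := rank (V.ra .u) (V.ra .h) E.n with hτ
  refine go_for (fun p V' => SearchInv E k col (V.setS .p p) V' ∧
      (∀ p', 2 ≤ p' → p' < p → ∀ b x, Covered E.n k col p' V' b x) ∧
      V'.t ≤ V.t + 1 + ∑ q ∈ Ico 2 p, (13 * E.n + 146 + 130 * gapMeasure τ E.n q (E.n - q) (E.n - q)
        (E.n - q - 1) (E.n - q - 1))) E.n (by simp) (by simpa using h2) (by omega) ?_
      (fun _ _ _ _ => ⟨trivial, rfl⟩) ?_ (fun _ _ _ => le_rfl) ?_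
  · refine ⟨⟨fun _ _ => rfl, rfl, fun _ _ => rfl, rfl, ?_, hlim, Ext.of_eq rfl rfl rfl⟩,
      fun p' h1 h2 => ?_, by simp⟩
    · simpa [BestOK] using hbest
    · simp at h2; omega
  · rintro p V₁ ⟨hI, hcov, hT⟩ hVp hlp hpn
    have hlp : 2 ≤ p := hlp
    rw [go_seq]
    refine go_init (V := V₁.tick) hk hk' hcol (by omega) hpn hVp
      (fun a ha => by simpa [hI.a] using hc a ha) (fun c hck => by simpa [hI.a] using ht c hck) hpos
      fun V₂ f1 f2 f3 f4 e0 e1 e2 e3 e4 C₂ t₂ => ?_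
    have hI2 : SearchInv E k col (V.setS .p p) V₂ :=
      hI.congr f1 f2 f3 (f4 _ (by decide)) (f4 _ (by decide))
    have ra2 : V₂.ra = V.ra := hI2.ra
    have hG := Gap.initial (τ := τ) (show 0 < p by omega) hpn
    have hset : (range E.n).filter (E.n - p ≤ ·) = Ico (E.n - p) E.n := by
      ext a; simp; omega
    rw [hset] at hG
    have E2 : Ext V₁ V₂ := Ext.of_eq (f4 _ (by decide)) (by rw [f3]; rfl) (by rw [f3]; rfl)
    refine go_sweep (V₀ := V₂) (S := Ico (E.n - p) E.n) (k := k) (p := p) (col := col)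
      (by rw [ra2]; exact T) ?_ hk hk' hcol hlp ⟨⟨fun _ _ => rfl, rfl, fun _ _ => rfl, rfl, ?_, ?_,
        Ext.of_eq rfl rfl rfl⟩, ?_, by simp; omega, ?_, ?_, C₂, fun b x => Or.inr ?_⟩ e0
      fun V₃ hI3 hcov3 t₃ => ?_
    · unfold Built
      rw [ra2, hI2.a _ (by decide), hI2.a _ (by decide)]; exact hB
    · rw [ra2]; exact hI2.best
    · rw [ra2]; exact hI2.lim
    · rw [e1, e2, e3, e4, ra2]; exact hG
    · rw [e1, e2]; exact fun h => absurd rfl h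
    · rw [e3, e4]; exact fun h => absurd rfl h
    · rw [e1, e2, e3, e4]; exact ⟨fun h => absurd rfl h, fun h => absurd rfl h⟩
    · have hI4 := hI2.trans hI3
      refine ⟨hI4.p_eq.trans (by simp), ⟨hI4.a, hI4.ra, hI4.r, by simp, ?_, hI4.lim, ?_⟩,
        fun p' h1 h2 b x => ?_, ?_⟩
      · simpa [BestOK] using hI4.best
      · have := hI4.ext
        simpa [Ext] using this
      · rcases Nat.lt_succ_iff_lt_or_eq.1 h2 with h2 | rfl
        · refine (hcov p' h1 h2 b x).ext ((E2.trans hI3.ext).trans (Ext.of_eq (by simp) rfl rfl)) ?_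
          exact hI4.ra.trans hI.ra.symm
        · exact (hcov3 b x).ext (Ext.of_eq (by simp) rfl rfl) rfl
      · rw [sum_Ico_succ_top hlp]
        rw [e1, e2, e3, e4, ra2] at t₃
        simp only [St.tick_t] at t₂
        simp only [St.setS_t]
        rw [← hτ] at t₃
        omega
  · rintro V₁ ⟨hI, hcov, hT⟩ -
    refine hQ _ (fun y hy => hI.r y hy) hI.best hI.lim hI.ra
      (fun p h1 h2 b x => (hcov p h1 h2 b x).ext (Ext.of_eq rfl rfl rfl) rfl) ?_
    have key := sum_gapMeasure_le (τ := τ) (n := E.n) (Ico 2 E.n) (fun q => E.n - q)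
      (fun q => E.n - q - 1)
    rw [sum_add_distrib, ← mul_sum] at hT
    simp only [sum_const, Nat.card_Ico, smul_eq_mul] at hT
    have : (E.n - 2) * (13 * E.n + 146) ≤ 86 * E.n ^ 2 := by
      obtain ⟨m, hm⟩ := Nat.exists_eq_add_of_le h2
      rw [hm, Nat.add_sub_cancel_left]; nlinarith
    simp only [St.tick_t]
    nlinarith

end

end RealRAM.HL

/-! ## Preparing the arrangement -/
namespace Arrangement

open Finset

variable {U H : ℕ → ℝ} {n : ℕ}

/-- The order in which the points are sorted. -/
def Prior (U H : ℕ → ℝ) (i j : ℕ) : Prop :=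
  U j < U i ∨ (U i = U j ∧ (H j < H i ∨ (H i = H j ∧ i < j)))

theorem Prior.irrefl (i : ℕ) : ¬ Prior U H i i := by simp [Prior]

theorem Prior.trans {i j l : ℕ} (h : Prior U H i j) (h' : Prior U H j l) : Prior U H i l := by
  unfold Prior at *
  rcases h with h | ⟨h1, h | ⟨h2, h3⟩⟩ <;> rcases h' with h' | ⟨h1', h' | ⟨h2', h3'⟩⟩
  · left; linarith
  · left; linarith
  · left; linarith
  · left; linarith
  · right; exact ⟨h1.trans h1', Or.inl (h'.trans h)⟩
  · right; exact ⟨h1.trans h1', Or.inl (h2' ▸ h)⟩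
  · left; linarith
  · right; exact ⟨h1.trans h1', Or.inl (h2 ▸ h')⟩
  · right; exact ⟨h1.trans h1', Or.inr ⟨h2.trans h2', h3.trans h3'⟩⟩

theorem Prior.total {i j : ℕ} (h : i ≠ j) : Prior U H i j ∨ Prior U H j i := by
  unfold Prior
  rcases lt_trichotomy (U i) (U j) with h1 | h1 | h1
  · exact Or.inr (Or.inl h1)
  · rcases lt_trichotomy (H i) (H j) with h2 | h2 | h2
    · exact Or.inr (Or.inr ⟨h1.symm, Or.inl h2⟩)
    · rcases lt_or_gt_of_ne h with h3 | h3
      · exact Or.inl (Or.inr ⟨h1, Or.inr ⟨h2, h3⟩⟩)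
      · exact Or.inr (Or.inr ⟨h1.symm, Or.inr ⟨h2.symm, h3⟩⟩)
    · exact Or.inl (Or.inr ⟨h1, Or.inl h2⟩)
  · exact Or.inl (Or.inl h1)

open Classical in
/-- The place of `j` in the sorted order. -/
noncomputable def place (U H : ℕ → ℝ) (n j : ℕ) : ℕ := #{i ∈ range n | Prior U H i j}

theorem place_lt_place {i j : ℕ} (hi : i < n) (h : Prior U H i j) :
    place U H n i < place U H n j := by
  classical
  refine card_lt_card ⟨fun x hx => ?_, fun hsub => ?_⟩
  · simp only [mem_filter] at hx ⊢; exact ⟨hx.1, hx.2.trans h⟩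
  · have := hsub (mem_filter.2 ⟨mem_range.2 hi, h⟩)
    exact Prior.irrefl i (mem_filter.1 this).2

theorem place_lt {j : ℕ} (hj : j < n) : place U H n j < n := by
  classical
  conv_rhs => rw [← card_range n]
  refine card_lt_card ⟨filter_subset _ _, fun hsub => ?_⟩
  exact Prior.irrefl j (mem_filter.1 (hsub (mem_range.2 hj))).2

theorem place_inj {i j : ℕ} (hi : i < n) (hj : j < n) (h : place U H n i = place U H n j) :
    i = j := by
  by_contra hne
  rcases Prior.total hne with h1 | h1
  · exact (place_lt_place hi h1).ne h
  · exact (place_lt_place hj h1).ne' h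

theorem place_surj {a : ℕ} (ha : a < n) : ∃ j < n, place U H n j = a := by
  have h := surj_on_of_inj_on_of_card_le (s := range n) (t := range n)
    (fun j _ => place U H n j) (fun j hj => mem_range.2 (place_lt (mem_range.1 hj)))
    (fun i j hi hj h => place_inj (mem_range.1 hi) (mem_range.1 hj) h) le_rfl a (mem_range.2 ha)
  obtain ⟨j, hj, h⟩ := h
  exact ⟨j, mem_range.1 hj, h.symm⟩

theorem sorted_of_place {U' H' : ℕ → ℝ} (hU : ∀ j < n, U' (place U H n j) = U j)
    (hH : ∀ j < n, H' (place U H n j) = H j) (h0 : ∀ j < n, 0 ≤ H j) : Sorted U' H' n := by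
  constructor
  · intro a b hab hb
    obtain ⟨i, hi, rfl⟩ := place_surj (U := U) (H := H) (hab.trans hb)
    obtain ⟨j, hj, rfl⟩ := place_surj (U := U) (H := H) hb
    rw [hU i hi, hU j hj, hH i hi, hH j hj]
    have hne : i ≠ j := fun h => by subst h; omega
    rcases Prior.total (U := U) (H := H) hne with h1 | h1
    · rcases h1 with h1 | ⟨h1, h2 | h2⟩
      · exact Or.inl h1
      · exact Or.inr ⟨h1.symm, h2.le⟩
      · exact Or.inr ⟨h1.symm, h2.1.ge⟩
    · exact absurd (place_lt_place hj h1) (by omega)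
  · intro a ha
    obtain ⟨i, hi, rfl⟩ := place_surj (U := U) (H := H) ha
    rw [hH i hi]; exact h0 i hi

end Arrangement

namespace RealRAM.HL

open Arrangement Finset

def rotateP : HP :=
  .setR .nr (.sqrt (.add (.mul (.inp (.lit 2)) (.inp (.lit 2))) (.mul (.inp (.lit 3)) (.inp (.lit 3))))) ;;
  .setR .e0 (.div (.inp (.lit 2)) (.r .nr)) ;; .setR .e1 (.div (.inp (.lit 3)) (.r .nr)) ;;
  .for .j (.lit 0) .n
    (.setR .dx (.sub (.inp (.add (.lit 4) (.add (.s .j) (.s .j)))) (.inp (.lit 0))) ;;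
    .setR .dy (.sub (.inp (.add (.lit 5) (.add (.s .j) (.s .j)))) (.inp (.lit 1))) ;;
    .setRA .u0 (.s .j) (.add (.mul (.r .dx) (.r .e0)) (.mul (.r .dy) (.r .e1))) ;;
    .setR .x1 (.sub (.mul (.r .dx) (.r .e1)) (.mul (.r .dy) (.r .e0))) ;;
    -- The root of the square is the absolute value: for centers on the line, the side of a point
    -- does not matter.
    .setRA .h0 (.s .j) (.sqrt (.mul (.r .x1) (.r .x1))))

def rankP : HP :=
  .setS .rk (.lit 0) ;;
  .for .i (.lit 0) .n
    (.ite (.or (.rlt (.ra .u0 (.s .j)) (.ra .u0 (.s .i)))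
        (.and (.req (.ra .u0 (.s .i)) (.ra .u0 (.s .j)))
          (.or (.rlt (.ra .h0 (.s .j)) (.ra .h0 (.s .i)))
            (.and (.req (.ra .h0 (.s .i)) (.ra .h0 (.s .j))) (.wlt (.s .i) (.s .j))))))
      (.setS .rk (.add (.s .rk) (.lit 1))) .skip)

/-- Sorting by counting predecessors takes quadratic time, which is affordable. -/
def sortP : HP :=
  .for .j (.lit 0) .n
    (rankP ;; .setRA .u (.s .rk) (.ra .u0 (.s .j)) ;; .setRA .h (.s .rk) (.ra .h0 (.s .j)) ;;
    .setS .c (.inp (.add (.lit 2) (.s .j))) ;; .setA .col (.s .rk) (.lit 0) (.s .c) ;;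
    -- The totals start from the zeros in the initial memory.
    .setA .tot (.s .c) (.lit 0) (.add (.a .tot (.s .c) (.lit 0)) (.lit 1)))

section
variable {E : Env} {V : St}

/-- The norm of the direction vector. -/
noncomputable def Env.nr (E : Env) : ℝ := √(E.I.real 2 * E.I.real 2 + E.I.real 3 * E.I.real 3)

/-- The position of a point along the line. -/
noncomputable def Env.along (E : Env) (j : ℕ) : ℝ :=
  (E.I.real (4 + (j + j)) - E.I.real 0) * (E.I.real 2 / E.nr) +
    (E.I.real (5 + (j + j)) - E.I.real 1) * (E.I.real 3 / E.nr)

/-- The signed distance of a point to the line. -/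
noncomputable def Env.across (E : Env) (j : ℕ) : ℝ :=
  (E.I.real (4 + (j + j)) - E.I.real 0) * (E.I.real 3 / E.nr) -
    (E.I.real (5 + (j + j)) - E.I.real 1) * (E.I.real 2 / E.nr)

theorem go_rotate (hnr : E.nr ≠ 0) {Q : St → Prop}
    (hQ : ∀ V', V'.a = V.a → V'.s .has = V.s .has → V'.r .lim = V.r .lim →
      V'.r .e0 = E.I.real 2 / E.nr → V'.r .e1 = E.I.real 3 / E.nr →
      (∀ j < E.n, V'.ra .u0 j = E.along j ∧ V'.ra .h0 j = √(E.across j * E.across j)) →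
      V'.t ≤ V.t + 7 * E.n + 5 → Q V') : Go E rotateP V Q := by
  have h2 := E.two_le
  simp only [rotateP, go_seq, go_setR, RE.ok, WE.ok, WE.eval, RE.eval]
  refine ⟨⟨by simp, ?_⟩, ⟨by simp, trivial, ?_⟩, ⟨by simp, trivial, ?_⟩, ?_⟩
  · exact add_nonneg (mul_self_nonneg _) (mul_self_nonneg _)
  · simpa [Env.nr] using hnr
  · simpa [Env.nr] using hnr
  refine go_for (fun k V' => V'.a = V.a ∧ V'.s .has = V.s .has ∧ V'.r .lim = V.r .lim ∧
      V'.r .e0 = E.I.real 2 / E.nr ∧ V'.r .e1 = E.I.real 3 / E.nr ∧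
      (∀ j < k, V'.ra .u0 j = E.along j ∧ V'.ra .h0 j = √(E.across j * E.across j)) ∧
      V'.t ≤ V.t + 7 * k + 4) E.n (by simp) (by simp) (by omega) ?_
      (fun _ _ _ _ => ⟨trivial, rfl⟩) ?_ (fun _ _ _ => le_rfl) ?_
  · simp [Env.nr]
  · rintro k V₁ ⟨h1, h2, h3, h4, h5, h6, h7⟩ hk - hkn
    simp [hk, hkn, h4, h5, h1, h2, h3]
    refine ⟨⟨by omega, by omega⟩, ⟨by omega, by omega⟩, mul_self_nonneg _, fun j hj => ?_, by omega⟩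
    by_cases hjk : j = k
    · subst hjk; simp [Env.along, Env.across]
    · simp [hjk, h6 j (by omega)]
  · rintro V₁ ⟨h1, h2, h3, h4, h5, h6, h7⟩ -
    exact hQ _ h1 h2 h3 h4 h5 h6 (by simp; omega)

open Classical in
theorem go_rank {j : ℕ} (hj : V.s .j = j) (hjn : j < E.n) {Q : St → Prop}
    (hQ : ∀ V', V'.a = V.a → V'.ra = V.ra → V'.r = V.r → (∀ y, y ≠ .rk → y ≠ .i → V'.s y = V.s y) →
      V'.s .rk = place (V.ra .u0) (V.ra .h0) E.n j → V'.t ≤ V.t + 4 * E.n + 3 → Q V') :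
    Go E rankP V Q := by
  have h2 := E.two_le
  rw [rankP, go_seq, go_setS]
  refine ⟨by simp, ?_⟩
  refine go_for (fun k V' => V'.a = V.a ∧ V'.ra = V.ra ∧ V'.r = V.r ∧
      (∀ y, y ≠ .rk → y ≠ .i → V'.s y = V.s y) ∧
      V'.s .rk = #{i ∈ range k | Prior (V.ra .u0) (V.ra .h0) i j} ∧ V'.t ≤ V.t + 4 * k + 2) E.n
      (by simp) (by simp) (by omega) ?_
      (fun _ _ _ _ => ⟨trivial, rfl⟩) ?_ (fun _ _ _ => le_rfl) ?_
  · refine ⟨rfl, rfl, rfl, fun y h1 h2 => by simp [h1, h2], by simp, by simp⟩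
  · rintro k V₁ ⟨h1, h2, h3, h4, h5, h6⟩ hk - hkn
    have hj1 : V₁.s .j = j := (h4 _ (by decide) (by decide)).trans hj
    have hle : V₁.s .rk ≤ k := by
      rw [h5]; exact (card_filter_le _ _).trans (card_range k).le
    rw [go_ite]
    refine ⟨by simp [hk, hj1, hkn, hjn], fun hb => ?_, fun hb => ?_⟩
    · have hb : Prior (V.ra .u0) (V.ra .h0) k j := by simpa [hj1, hk, h2, Prior] using hb
      rw [go_setS]
      refine ⟨by simp; omega, by simpa using hk, h1, h2, h3, fun y g1 g2 => ?_, ?_, by simp; omega⟩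
      · simp [g1, g2, h4]
      · rw [range_add_one, filter_insert, if_pos hb, card_insert_of_notMem (by simp)]
        simp [h5]
    · have hb : ¬ Prior (V.ra .u0) (V.ra .h0) k j := by
        intro h; apply hb; simpa [hj1, hk, h2, Prior] using h
      rw [go_skip]
      refine ⟨by simpa using hk, h1, h2, h3, fun y g1 g2 => ?_, ?_, by simp; omega⟩
      · simp [g2, h4 y g1 g2]
      · rw [range_add_one, filter_insert, if_neg hb]
        simp [h5]
  · rintro V₁ ⟨h1, h2, h3, h4, h5, h6⟩ -
    exact hQ _ h1 h2 h3 h4 h5 (by simp; omega)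

theorem go_sort {k : ℕ} (hk : k ≤ E.n) (hcol : ∀ j < E.n, E.I.word (2 + j) < k)
    (htot : ∀ c, V.a .tot c 0 = 0) {Q : St → Prop}
    (hQ : ∀ V', V'.s .has = V.s .has → V'.r = V.r →
      (∀ j < E.n, V'.ra .u (place (V.ra .u0) (V.ra .h0) E.n j) = V.ra .u0 j ∧
        V'.ra .h (place (V.ra .u0) (V.ra .h0) E.n j) = V.ra .h0 j ∧
        V'.a .col (place (V.ra .u0) (V.ra .h0) E.n j) 0 = E.I.word (2 + j)) →
      (∀ c < k, V'.a .tot c 0 = colorCount (fun j => E.I.word (2 + j)) (range E.n) c) →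
      V'.t ≤ V.t + (4 * E.n + 12) * E.n + 2 → Q V') : Go E sortP V Q := by
  have h2 := E.two_le
  refine go_for (fun m V' => V'.s .has = V.s .has ∧ V'.r = V.r ∧ V'.ra .u0 = V.ra .u0 ∧
      V'.ra .h0 = V.ra .h0 ∧
      (∀ j < m, V'.ra .u (place (V.ra .u0) (V.ra .h0) E.n j) = V.ra .u0 j ∧
        V'.ra .h (place (V.ra .u0) (V.ra .h0) E.n j) = V.ra .h0 j ∧
        V'.a .col (place (V.ra .u0) (V.ra .h0) E.n j) 0 = E.I.word (2 + j)) ∧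
      (∀ c < k, V'.a .tot c 0 = colorCount (fun j => E.I.word (2 + j)) (range m) c) ∧
      V'.t ≤ V.t + (4 * E.n + 12) * m + 1) E.n
      (by simp) (by simp) (by omega) ?_
      (fun _ _ _ _ => ⟨trivial, rfl⟩) ?_ (fun _ _ _ => le_rfl) ?_
  · simp [htot, colorCount]
  · rintro m V₁ ⟨h1, h2, h3, h4, h5, h6, h7⟩ hm - hmn
    have hmn : m < E.n := hmn
    rw [go_seq]
    refine go_rank (V := V₁.tick) hm hmn fun V₂ f1 f2 f3 f4 f5 f6 => ?_
    simp only [St.tick_ra, h3, h4] at f5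
    simp only [St.tick_a, St.tick_ra, St.tick_r] at f1 f2 f3
    have hrk := place_lt (U := V.ra .u0) (H := V.ra .h0) hmn
    have hm2 : V₂.s .j = m := (f4 _ (by decide) (by decide)).trans hm
    have hc := hcol m hmn
    have hc' : E.I.word (2 + m) < E.n := by omega
    have hn : 0 < E.n := by omega
    have htm : V₁.a .tot (E.I.word (2 + m)) 0 ≤ m := by
      rw [h6 _ hc]; exact (card_filter_le _ _).trans (card_range m).le
    simp [hm2, hmn, f5, hrk, hc', hn, f1, f2, h3, h4]
    refine ⟨by omega, by omega, ?_, by rw [f3]; exact h2, ?_, ?_, ?_, ?_, ?_⟩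
    · rw [f4 _ (by decide) (by decide)]; exact h1
    · funext i; simp [f2, h3]
    · funext i; simp [f2, h4]
    · intro j hj
      by_cases hjm : j = m
      · subst hjm; simp
      · have : place (V.ra .u0) (V.ra .h0) E.n j ≠ place (V.ra .u0) (V.ra .h0) E.n m :=
          fun h => hjm (place_inj (by omega) hmn h)
        simpa [this] using h5 j (by omega)
    · intro c hck
      rw [range_add_one, colorCount_insert (by simp), ← h6 c hck]
      by_cases hcm : c = E.I.word (2 + m)
      · simp [hcm]
      · simp [hcm]
    · simp at f6; nlinarith
  · rintro V₁ ⟨h1, h2, h3, h4, h5, h6, h7⟩ -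
    exact hQ _ h1 h2 h5 h6 (by simp; omega)

end

end RealRAM.HL

/-! ## Completeness of the search -/
namespace Arrangement

open Finset

variable {U H : ℕ → ℝ} {n k : ℕ} {col : ℕ → ℕ} {S B T : Finset ℕ} {i j : ℕ} {b : Prop} {x R : ℝ}

/-- The points in `S` are nearest, `i` is the farthest of them, and `j` is the nearest of the
others. -/
structure Nearest (D : ℕ → ℝ) (n : ℕ) (S : Finset ℕ) (i j : ℕ) : Prop where
  sub : ∀ a ∈ S, a < n
  i_mem : i ∈ S
  j_notMem : j ∉ S
  j_lt : j < n
  le_i : ∀ a ∈ S, D a ≤ D i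
  j_le : ∀ a < n, a ∉ S → D j ≤ D a
  i_le_j : D i ≤ D j

/-- Up to ties, the order of the lines at a cut at `x` is the order of the distances from `x`. -/
theorem PrefixAt.nearest (hT : Sorted U H n) (h : PrefixAt (Cut U H b x) n S i j) :
    Nearest (fun a => dst (U a) (H a) x) n S i j := by
  have hi : i < n := h.sub i h.i_mem
  have hij : i ≠ j := fun e => h.j_notMem (e ▸ h.i_mem)
  refine ⟨h.sub, h.i_mem, h.j_notMem, h.j_lt, fun a ha => ?_, fun a han ha => ?_, ?_⟩
  · by_cases hai : a = i
    · subst hai; exact le_rfl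
    have han := h.sub a ha
    have h1 := (h.lower a han hai).1 ha
    refine dst_le_dst.2 ?_
    rcases lt_or_gt_of_ne hai with h2 | h2
    · have h3 := h1.1 h2
      exact sqd_le_of_lt hT h2 hi ⟨h3.1.symm, h3.le⟩
    · have h3 : ¬ Cut U H b x i a := fun h4 => absurd (h1.2 h4) (by omega)
      exact sqd_le_of_gt hT h2 han fun h4 => Cut.ge (b := b) h3 h4.symm
  · by_cases haj : a = j
    · subst haj; exact le_rfl
    have h1 := mt (h.upper a han haj).2 ha
    refine dst_le_dst.2 ?_
    rcases lt_or_gt_of_ne haj with h2 | h2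
    · refine sqd_le_of_gt hT h2 h.j_lt fun h4 => ?_
      rw [cross_comm]
      exact Cut.ge (b := b) (fun h3 => h1 ⟨fun _ => h3, fun _ => h2⟩) h4
    · have h3 : Cut U H b x j a := by
        by_contra h3; exact h1 ⟨fun h4 => by omega, fun h4 => absurd h4 h3⟩
      refine sqd_le_of_lt hT h2 han ⟨h3.1, ?_⟩
      rw [cross_comm]; exact h3.le
  · have h1 := mt (h.lower j h.j_lt hij.symm).2 h.j_notMem
    refine dst_le_dst.2 ?_
    rcases lt_or_gt_of_ne hij with h2 | h2
    · have h3 : Cut U H b x i j := by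
        by_contra h3; exact h1 ⟨fun h4 => by omega, fun h4 => absurd h4 h3⟩
      refine sqd_le_of_lt hT h2 h.j_lt ⟨h3.1, ?_⟩
      rw [cross_comm]; exact h3.le
    · refine sqd_le_of_gt hT h2 hi fun h4 => ?_
      rw [cross_comm]
      exact Cut.ge (b := b) (fun h3 => h1 ⟨fun _ => h3, fun _ => h2⟩) h4

/-! ### Prefixes of the order compared with a circle. -/

variable {D : ℕ → ℝ}

theorem Nearest.le (h : Nearest D n S i j) {a c : ℕ} (ha : a ∈ S) (hc : c ∉ S) (hcn : c < n) :
    D a ≤ D c := (h.le_i a ha).trans (h.i_le_j.trans (h.j_le c hcn hc))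

/-- Both sets are initial segments for the distance, so the cardinalities decide the inclusion. The
strict inequality in `hB` makes the disk independent of the order among ties. -/
theorem Nearest.subset_of_card (h : Nearest D n S i j) (hB : ∀ a, a ∈ B ↔ a < n ∧ D a < R)
    (hc : #B ≤ #S) : B ⊆ S := by
  intro a ha
  by_contra haS
  have ha' := (hB a).1 ha
  refine absurd hc (not_le.2 (card_lt_card ⟨fun c hcS => (hB c).2 ⟨h.sub c hcS, ?_⟩, fun h1 => ?_⟩))
  · exact (h.le hcS haS ha'.1).trans_lt ha'.2
  · exact haS (h1 ha)

theorem Nearest.subset_of_card' (h : Nearest D n S i j) (hB : ∀ a, a ∈ B ↔ a < n ∧ D a ≤ R)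
    (hc : #S ≤ #B) : S ⊆ B := by
  intro a ha
  by_contra haB
  have h1 : R < D a := by
    by_contra h1; exact haB ((hB a).2 ⟨h.sub a ha, not_lt.1 h1⟩)
  refine absurd hc (not_le.2 (card_lt_card ⟨fun c hcB => ?_, fun h2 => haB (h2 ha)⟩))
  have := (hB c).1 hcB
  by_contra hcS
  linarith [h.le ha hcS this.1]

/-- The position of a point in the order does not change where its distance equals that of two
other points. -/
theorem no_fixed_place (hno3 : ∀ a c e, a < n → c < n → e < n → a ≠ c → a ≠ e → c ≠ e →
      ¬ (U a = U c ∧ U a = U e ∧ sqd U H a x = sqd U H c x ∧ sqd U H a x = sqd U H e x))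
    {y m z : ℕ} (hy : y < n) (hm : m < n) (hz : z < n) (hym : y ≠ m) (hyz : y ≠ z) (hmz : m ≠ z)
    (h1 : sqd U H y x = sqd U H m x) (h2 : sqd U H y x = sqd U H z x)
    (hm' : Cut U H False x m y ↔ Cut U H True x m y)
    (hz' : Cut U H False x z y ↔ Cut U H True x z y) : False := by
  -- A line of another slope that meets `y` above `x` has its crossing at `x`, and only the later of
  -- the two cuts includes it.
  have key : ∀ a, sqd U H y x = sqd U H a x → (Cut U H False x a y ↔ Cut U H True x a y) →
      U y = U a := by
    intro a h3 h4
    by_contra h5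
    have h6 := eq_cross_of_sqd_eq h3 h5
    rw [cross_comm] at h6
    have h7 : Cut U H True x a y := ⟨Ne.symm h5, Or.inr ⟨trivial, h6.symm⟩⟩
    have h8 := (h4.2 h7).2
    rcases h8 with h8 | h8
    · exact absurd h6 h8.ne'
    · exact h8.1
  exact hno3 y m z hy hm hz hym hyz hmz ⟨key m h1 hm', key z h2 hz', h1, h2⟩

/-- The points of an annulus of width zero: `B` inside the circle, `T` on it, `C` inside or on it,
and `S` inside the annulus. -/
structure OnCircle (D : ℕ → ℝ) (n k : ℕ) (col : ℕ → ℕ) (R : ℝ) (S B T C : Finset ℕ) : Prop where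
  mem_B : ∀ a, a ∈ B ↔ a < n ∧ D a < R
  mem_T : ∀ a, a ∈ T ↔ a < n ∧ D a = R
  mem_C : ∀ a, a ∈ C ↔ a < n ∧ D a ≤ R
  B_sub : B ⊆ S
  sub_C : S ⊆ C
  rainbow : BothRainbow n k col S

namespace OnCircle

variable {C S' : Finset ℕ}

theorem mem_T_of (h : OnCircle D n k col R S B T C) {a : ℕ} (h1 : a ∈ C) (h2 : a ∉ B) : a ∈ T := by
  have h1 := (h.mem_C a).1 h1
  exact (h.mem_T a).2 ⟨h1.1, le_antisymm h1.2 (not_lt.1 fun h3 => h2 ((h.mem_B a).2 ⟨h1.1, h3⟩))⟩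

theorem T_sub (h : OnCircle D n k col R S B T C) : T ⊆ C := fun a ha => by
  have := (h.mem_T a).1 ha; exact (h.mem_C a).2 ⟨this.1, this.2.le⟩

theorem notMem_B (h : OnCircle D n k col R S B T C) {a : ℕ} (ha : a ∈ T) : a ∉ B :=
  fun h1 => ((h.mem_B a).1 h1).2.ne ((h.mem_T a).1 ha).2

theorem card_C (h : OnCircle D n k col R S B T C) : #C = #B + #T := by
  rw [← card_union_of_disjoint (disjoint_right.2 fun _ ha => h.notMem_B ha)]
  congr 1; ext a
  rw [mem_union]
  exact ⟨fun ha => or_iff_not_imp_left.2 (h.mem_T_of ha),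
    fun ha => ha.elim (fun h1 => h.sub_C (h.B_sub h1)) fun h1 => h.T_sub h1⟩

/-- The gaps strictly between the points inside and the points outside. -/
theorem mid (h : OnCircle D n k col R S B T C) (hN : Nearest D n S' i j) (h1 : #B < #S')
    (h2 : #S' < #C) : B ⊆ S' ∧ S' ⊆ C ∧ i ∈ T ∧ j ∈ T ∧ i ≠ j := by
  have e1 := hN.subset_of_card h.mem_B h1.le
  have e2 := hN.subset_of_card' h.mem_C h2.le
  obtain ⟨a, ha, haB⟩ := exists_mem_notMem_of_card_lt_card h1
  obtain ⟨c, hc, hcS⟩ := exists_mem_notMem_of_card_lt_card h2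
  have f1 := (h.mem_T a).1 (h.mem_T_of (e2 ha) haB)
  have f2 := (h.mem_C c).1 hc
  have f3 := ((h.mem_C i).1 (e2 hN.i_mem)).2
  have f4 := hN.le_i a ha
  have f5 := hN.j_le c f2.1 hcS
  have f6 := hN.i_le_j
  refine ⟨e1, e2, (h.mem_T i).2 ⟨hN.sub i hN.i_mem, ?_⟩, (h.mem_T j).2 ⟨hN.j_lt, ?_⟩,
    fun h => hN.j_notMem (h ▸ hN.i_mem)⟩ <;> linarith

/-- If all points of the prefix but `i` are inside the circle, the others keep all colours. -/
theorem colours_above (h : OnCircle D n k col R S B T C) (e2 : S' ⊆ C)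
    (hi : ∀ a ∈ S', a ∈ T → a = i) {c : ℕ} (hck : c < k) :
    ∃ a ∈ range n, a ∉ S'.erase i ∧ col a = c := by
  obtain ⟨a, g1, g2, g3⟩ := (h.rainbow c hck).2
  refine ⟨a, g1, fun h4 => ?_, g3⟩
  rw [mem_erase] at h4
  exact h4.1 (hi a h4.2 (h.mem_T_of (e2 h4.2) fun h5 => g2 (h.B_sub h5)))

/-- If all points after the prefix but `j` are outside the circle, the prefix and `j` have all
colours. -/
theorem colours_below (h : OnCircle D n k col R S B T C) (hj : ∀ a ∈ C, a ∉ S' → a = j)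
    {c : ℕ} (hck : c < k) : ∃ a ∈ insert j S', col a = c := by
  obtain ⟨a, g1, g2⟩ := (h.rainbow c hck).1
  refine ⟨a, ?_, g2⟩
  rw [mem_insert]
  by_cases haS : a ∈ S'
  · exact Or.inr haS
  · exact Or.inl (hj a (h.sub_C g1) haS)

/-- `S'` has only one point more than `B`, hence only one point on the circle. -/
theorem eq_i (h : OnCircle D n k col R S B T C) (hc : #S' = #B + 1) (e1 : B ⊆ S') (hiS : i ∈ S')
    (hi : i ∈ T) : ∀ a ∈ S', a ∈ T → a = i := by
  intro a ha haT
  by_contra hai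
  have h4 := card_le_card (insert_subset ha (insert_subset hiS e1))
  rw [card_insert_of_notMem (by simp [hai, h.notMem_B haT]),
    card_insert_of_notMem (h.notMem_B hi)] at h4
  omega

theorem eq_j (h : OnCircle D n k col R S B T C) (hc : #C = #S' + 1) (e2 : S' ⊆ C) (hjS : j ∉ S')
    (hj : j ∈ T) : ∀ a ∈ C, a ∉ S' → a = j := by
  intro a ha haS
  by_contra haj
  have h4 := card_le_card (insert_subset ha (insert_subset (h.T_sub hj) e2))
  rw [card_insert_of_notMem (by simp [haj, haS]), card_insert_of_notMem hjS] at h4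
  omega

/-- The point whose colour is missing inside the circle. -/
theorem low (h : OnCircle D n k col R S B T C) (hP : PrefixAt (Cut U H b x) n S' i j)
    (hN : Nearest D n S' i j) (hc : #S' = #B + 1) (hcC : #S' < #C)
    (hS : ¬ (SharedRainbow n k col S' i j ∧ D i = R ∧ D j = R)) :
    ∃ z, i ∈ T ∧ j ∈ T ∧ z ∈ T ∧ i ≠ j ∧ z ≠ i ∧ z ≠ j ∧ z ∈ S ∧
      (¬ (z < i) ↔ Cut U H b x i z) ∧ (¬ (z < j) ↔ Cut U H b x j z) := by
  obtain ⟨e1, e2, hi, hj, hij⟩ := h.mid hN (by omega) hcC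
  have h4 : ∃ c < k, ∀ a ∈ insert j S', col a ≠ c := by
    by_contra! hcon
    exact hS ⟨fun c hck => ⟨hcon c hck, h.colours_above e2 (h.eq_i hc e1 hN.i_mem hi) hck⟩,
      ((h.mem_T i).1 hi).2, ((h.mem_T j).1 hj).2⟩
  obtain ⟨c, hck, hc'⟩ := h4
  obtain ⟨z, hzS, hz⟩ := (h.rainbow c hck).1
  have hzj : z ≠ j := fun h => hc' z (by rw [h]; exact mem_insert_self _ _) hz
  have hzS' : z ∉ S' := fun h => hc' z (mem_insert_of_mem h) hz
  have hzT : z ∈ T := h.mem_T_of (h.sub_C hzS) fun h => hzS' (e1 h)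
  have hzi : z ≠ i := fun h => hzS' (h ▸ hN.i_mem)
  have g1 := mt (hP.lower z ((h.mem_T z).1 hzT).1 hzi).2 hzS'
  have g2 := mt (hP.upper z ((h.mem_T z).1 hzT).1 hzj).2 hzS'
  -- The two equivalences say that `z` is above both `i` and `j` at the cut.
  exact ⟨z, hi, hj, hzT, hij, hzi, hzj, hzS, not_iff.1 g1, not_iff.1 g2⟩

/-- The point whose colour is missing outside the circle. -/
theorem high (h : OnCircle D n k col R S B T C) (hP : PrefixAt (Cut U H b x) n S' i j)
    (hN : Nearest D n S' i j) (hc : #C = #S' + 1) (hcB : #B < #S')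
    (hS : ¬ (SharedRainbow n k col S' i j ∧ D i = R ∧ D j = R)) :
    ∃ y, i ∈ T ∧ j ∈ T ∧ y ∈ T ∧ i ≠ j ∧ y ≠ i ∧ y ≠ j ∧ y ∉ S ∧
      (y < i ↔ Cut U H b x i y) ∧ (y < j ↔ Cut U H b x j y) := by
  obtain ⟨e1, e2, hi, hj, hij⟩ := h.mid hN hcB (by omega)
  have h4 : ∃ c < k, ∀ a ∈ range n, a ∉ S'.erase i → col a ≠ c := by
    by_contra! hcon
    exact hS ⟨fun c hck => ⟨h.colours_below (h.eq_j hc e2 hN.j_notMem hj) hck, hcon c hck⟩,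
      ((h.mem_T i).1 hi).2, ((h.mem_T j).1 hj).2⟩
  obtain ⟨c, hck, hc'⟩ := h4
  obtain ⟨y, hyn, hyS, hy⟩ := (h.rainbow c hck).2
  have hyS' : y ∈ S'.erase i := by
    by_contra h; exact hc' y hyn h hy
  rw [mem_erase] at hyS'
  have hyT : y ∈ T := h.mem_T_of (e2 hyS'.2) fun h1 => hyS (h.B_sub h1)
  have hyj : y ≠ j := fun h => hN.j_notMem (h ▸ hyS'.2)
  -- The two equivalences say that `y` is below both `i` and `j` at the cut.
  exact ⟨y, hi, hj, hyT, hij, hyS'.1, hyj, hyS, (hP.lower y (mem_range.1 hyn) hyS'.1).1 hyS'.2,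
    (hP.upper y (mem_range.1 hyn) hyj).1 hyS'.2⟩

/-- With two points on the circle the annulus that swaps them is found. -/
theorem shared_of_card_two (h : OnCircle D n k col R S B T C) (hN : Nearest D n S' i j)
    (hc : #S' = #B + 1) (hcC : #C = #S' + 1) :
    SharedRainbow n k col S' i j ∧ D i = R ∧ D j = R := by
  obtain ⟨e1, e2, hi, hj, -⟩ := h.mid hN (by omega) (by omega)
  exact ⟨fun c hck => ⟨h.colours_below (h.eq_j hcC e2 hN.j_notMem hj) hck,
      h.colours_above e2 (h.eq_i hc e1 hN.i_mem hi) hck⟩,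
    ((h.mem_T i).1 hi).2, ((h.mem_T j).1 hj).2⟩

/-- A point of a triple is not at the same place for both cuts. -/
theorem no_fixed (h : OnCircle D n k col R S B T C) (hT3 : #T = 3)
    (hsqd : ∀ a c, D a = R → D c = R → sqd U H a x = sqd U H c x)
    (hno3 : ∀ a c e, a < n → c < n → e < n → a ≠ c → a ≠ e → c ≠ e →
      ¬ (U a = U c ∧ U a = U e ∧ sqd U H a x = sqd U H c x ∧ sqd U H a x = sqd U H e x))
    {y i j i' j' : ℕ} (hy : y ∈ T) (hi : i ∈ T) (hj : j ∈ T) (hi' : i' ∈ T) (hj' : j' ∈ T)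
    (hij : i ≠ j) (hij' : i' ≠ j') (hyi : y ≠ i) (hyj : y ≠ j) (hyi' : y ≠ i') (hyj' : y ≠ j')
    {p : ℕ → Prop} (h1 : p i ↔ Cut U H False x i y) (h2 : p j ↔ Cut U H False x j y)
    (h3 : p i' ↔ Cut U H True x i' y) (h4 : p j' ↔ Cut U H True x j' y) : False := by
  have hT : ∀ a ∈ T, a = y ∨ a = i ∨ a = j := by
    have : ({y, i, j} : Finset ℕ) = T := by
      refine eq_of_subset_of_card_le ?_ ?_
      · intro a ha
        simp only [mem_insert, mem_singleton] at ha
        rcases ha with rfl | rfl | rfl <;> assumption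
      · rw [hT3, card_eq_three.2 ⟨y, i, j, hyi, hyj, hij, rfl⟩]
    intro a ha
    rw [← this] at ha
    simpa using ha
  have hlt := fun a (ha : a ∈ T) => (h.mem_T a).1 ha
  -- The circle has only two further points, so both cuts speak of the same pair, possibly
  -- exchanged.
  have key : (p i ↔ Cut U H True x i y) ∧ (p j ↔ Cut U H True x j y) := by
    rcases hT i' hi' with e | e | e
    · exact absurd e.symm hyi'
    · rcases hT j' hj' with e' | e' | e'
      · exact absurd e'.symm hyj'
      · exact absurd (e.trans e'.symm) hij'
      · rw [e] at h3; rw [e'] at h4; exact ⟨h3, h4⟩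
    · rcases hT j' hj' with e' | e' | e'
      · exact absurd e'.symm hyj'
      · rw [e] at h3; rw [e'] at h4; exact ⟨h4, h3⟩
      · exact absurd (e.trans e'.symm) hij'
  exact no_fixed_place hno3 (hlt y hy).1 (hlt i hi).1 (hlt j hj).1 hyi hyj hij
    (hsqd _ _ (hlt y hy).2 (hlt i hi).2) (hsqd _ _ (hlt y hy).2 (hlt j hj).2)
    (h1.symm.trans key.1) (h2.symm.trans key.2)

end OnCircle

end Arrangement

namespace RealRAM.HL

open Arrangement Finset

variable {U H : ℕ → ℝ} {n k : ℕ} {col : ℕ → ℕ} {V : St} {x R : ℝ}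

/-- An annulus of positive width is found. -/
theorem has_of_width (hT : Sorted (V.ra .u) (V.ra .h) n)
    (hcov : ∀ p, 2 ≤ p → p < n → ∀ b, Covered n k col p V b x) {S : Finset ℕ} {ri ro : ℝ}
    (hr : ri < ro) (hsub : ∀ a ∈ S, a < n) (hS2 : 2 ≤ #S) (hSn : #S < n)
    (hin : ∀ a ∈ S, dst (V.ra .u a) (V.ra .h a) x ≤ ri)
    (hout : ∀ a < n, a ∉ S → ro ≤ dst (V.ra .u a) (V.ra .h a) x) (hv : BothRainbow n k col S) :
    V.s .has = 1 ∧ (ro - ri ≤ V.r .best ∨ ro - ri < V.r .lim) := by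
  obtain ⟨S', i, j, hc, hP, hD⟩ := hcov _ hS2 hSn True
  have hN := hP.nearest hT
  have hB : ∀ a, a ∈ S ↔ a < n ∧ dst (V.ra .u a) (V.ra .h a) x ≤ ri := by
    refine fun a => ⟨fun h => ⟨hsub a h, hin a h⟩, fun h => ?_⟩
    by_contra h1
    linarith [hout a h.1 h1, h.2]
  have hSS : S' = S := eq_of_subset_of_card_le (hN.subset_of_card' hB hc.le) hc.ge
  subst hSS
  obtain ⟨h1, h2⟩ := hD.1 hv
  have h3 := hin i hN.i_mem
  have h4 := hout j hN.j_lt hN.j_notMem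
  exact ⟨h1, h2.imp (fun h => by linarith) (fun h => by linarith)⟩

/-- If there is an annulus of width zero, then some annulus is found. -/
theorem has_of_circle (hT : Sorted (V.ra .u) (V.ra .h) n) (hn : 3 ≤ n)
    (hcov : ∀ p, 2 ≤ p → p < n → ∀ b, Covered n k col p V b x)
    (hcol : ∀ a < n, col a < k)
    (hno3 : ∀ a c e, a < n → c < n → e < n → a ≠ c → a ≠ e → c ≠ e →
      ¬ (V.ra .u a = V.ra .u c ∧ V.ra .u a = V.ra .u e ∧
        sqd (V.ra .u) (V.ra .h) a x = sqd (V.ra .u) (V.ra .h) c x ∧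
        sqd (V.ra .u) (V.ra .h) a x = sqd (V.ra .u) (V.ra .h) e x))
    (hno4 : ∀ Q : Finset ℕ, (∀ a ∈ Q, a < n ∧ dst (V.ra .u a) (V.ra .h a) x = R) → #Q ≤ 3)
    {S : Finset ℕ} (hsub : ∀ a ∈ S, a < n)
    (hin : ∀ a ∈ S, dst (V.ra .u a) (V.ra .h a) x ≤ R)
    (hout : ∀ a < n, a ∉ S → R ≤ dst (V.ra .u a) (V.ra .h a) x) (hv : BothRainbow n k col S) :
    V.s .has = 1 := by
  classical
  by_contra hhas
  obtain ⟨D, hD⟩ : ∃ D : ℕ → ℝ, ∀ a, dst (V.ra .u a) (V.ra .h a) x = D a := ⟨_, fun _ => rfl⟩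
  have hsqd : ∀ a c, D a = R → D c = R →
      sqd (V.ra .u) (V.ra .h) a x = sqd (V.ra .u) (V.ra .h) c x := by
    intro a c h1 h2
    rw [← dst_mul_self_eq_sqd, ← dst_mul_self_eq_sqd, hD, hD, h1, h2]
  have hcov' : ∀ p, 2 ≤ p → p < n → ∀ b : Prop, ∃ S i j, #S = p ∧
      PrefixAt (Cut (V.ra .u) (V.ra .h) b x) n S i j ∧ Nearest D n S i j ∧
      ¬ BothRainbow n k col S ∧ ¬ (SharedRainbow n k col S i j ∧ D i = R ∧ D j = R) := by
    intro p h1 h2 b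
    obtain ⟨S, i, j, h3, h4, h5⟩ := hcov p h1 h2 b
    have h6 := h4.nearest hT
    simp only [hD] at h6
    exact ⟨S, i, j, h3, h4, h6, fun h => hhas (h5.1 h).1,
      fun h => hhas (h5.2 h.1 (hsqd _ _ h.2.1 h.2.2))⟩
  clear hcov
  simp only [hD] at hno4 hin hout
  -- With a single colour every division into nonempty parts is rainbow, so the gap above two points
  -- would have been found.
  have hk : 2 ≤ k := by
    by_contra hk
    obtain ⟨S', i, j, hc, hP, hN, h1, -⟩ := hcov' 2 le_rfl (by omega) True
    refine h1 fun c hck => ⟨⟨i, hN.i_mem, ?_⟩, ⟨j, mem_range.2 hN.j_lt, hN.j_notMem, ?_⟩⟩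
    · have := hcol i (hN.sub i hN.i_mem); omega
    · have := hcol j hN.j_lt; omega
  have two : ∀ {Q : Finset ℕ}, (∀ c < k, ∃ a ∈ Q, col a = c) → 2 ≤ #Q := by
    intro Q h
    obtain ⟨a, ha, ha'⟩ := h 0 (by omega)
    obtain ⟨c, hc, hc'⟩ := h 1 (by omega)
    exact one_lt_card.2 ⟨a, ha, c, hc, fun h => by subst h; omega⟩
  have hS2 : 2 ≤ #S := two fun c hc => (hv c hc).1
  obtain ⟨B, hB⟩ : ∃ B : Finset ℕ, ∀ a, a ∈ B ↔ a < n ∧ D a < R :=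
    ⟨(range n).filter fun a => D a < R, by simp⟩
  obtain ⟨T, hTm⟩ : ∃ T : Finset ℕ, ∀ a, a ∈ T ↔ a < n ∧ D a = R :=
    ⟨(range n).filter fun a => D a = R, by simp⟩
  obtain ⟨C, hC⟩ : ∃ C : Finset ℕ, ∀ a, a ∈ C ↔ a < n ∧ D a ≤ R :=
    ⟨(range n).filter fun a => D a ≤ R, by simp⟩
  have O : OnCircle D n k col R S B T C := by
    refine ⟨hB, hTm, hC, fun a ha => ?_, fun a ha => (hC a).2 ⟨hsub a ha, hin a ha⟩, hv⟩
    have := (hB a).1 ha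
    by_contra h; linarith [hout a this.1 h]
  have hCB := O.card_C
  have lt_n : ∀ {Q : Finset ℕ}, (∀ a ∈ Q, a < n) → ∀ {r}, r < n → r ∉ Q → #Q < n := by
    intro Q h r h1 h2
    have : Q ⊂ range n := ⟨fun a ha => mem_range.2 (h a ha), fun h => h2 (h (mem_range.2 h1))⟩
    simpa using card_lt_card this
  have hCn : #C ≤ n := by
    have : C ⊆ range n := fun a ha => mem_range.2 ((hC a).1 ha).1
    simpa using card_le_card this
  have hSn : #S < n := by
    obtain ⟨-, a, ha, ha', -⟩ := hv 0 (by omega)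
    exact lt_n hsub (mem_range.1 ha) ha'
  have hTC : #T ≤ 3 := hno4 T fun a ha => (hTm a).1 ha
  -- If the points strictly inside had all colours, they would themselves form a prefix that is
  -- found.
  have hin' : ∃ c < k, ∀ a ∈ B, col a ≠ c := by
    by_contra! hcon
    obtain ⟨S', i, j, hc, hP, hN, h1, -⟩ :=
      hcov' #B (two hcon) ((card_le_card O.B_sub).trans_lt hSn) True
    have : B = S' := eq_of_subset_of_card_le (hN.subset_of_card hB hc.ge) hc.le
    subst this
    refine h1 fun c hck => ⟨hcon c hck, ?_⟩
    obtain ⟨a, h2, h3, h4⟩ := (hv c hck).2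
    exact ⟨a, h2, fun h => h3 (O.B_sub h), h4⟩
  -- Likewise for the points strictly outside.
  have hout' : ∃ c < k, ∀ a < n, a ∉ C → col a ≠ c := by
    by_contra! hcon
    have hCn : #C < n := by
      obtain ⟨a, h1, h2, -⟩ := hcon 0 (by omega)
      exact lt_n (fun a ha => ((hC a).1 ha).1) h1 h2
    obtain ⟨S', i, j, hc, hP, hN, h1, -⟩ := hcov' #C (hS2.trans (card_le_card O.sub_C)) hCn True
    have : S' = C := eq_of_subset_of_card_le (hN.subset_of_card' hC hc.le) hc.ge
    subst this
    refine h1 fun c hck => ⟨?_, ?_⟩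
    · obtain ⟨a, h2, h3⟩ := (hv c hck).1
      exact ⟨a, O.sub_C h2, h3⟩
    · obtain ⟨a, h2, h3, h4⟩ := hcon c hck
      exact ⟨a, mem_range.2 h2, h3, h4⟩
  obtain ⟨c₁, hc₁, hc₁'⟩ := hin'
  obtain ⟨c₂, hc₂, hc₂'⟩ := hout'
  obtain ⟨s, hsS, hs⟩ := (hv c₁ hc₁).1
  obtain ⟨r, hrn, hrS, hr⟩ := (hv c₂ hc₂).2
  have hsB : s ∉ B := fun h => hc₁' s h hs
  have hrC : r ∈ C := by
    by_contra h; exact hc₂' r (mem_range.1 hrn) h hr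
  have hsT : s ∈ T := O.mem_T_of (O.sub_C hsS) hsB
  have hrT : r ∈ T := O.mem_T_of hrC fun h => hrS (O.B_sub h)
  have hsr : s ≠ r := fun h => hrS (h ▸ hsS)
  have hT2 : 2 ≤ #T := one_lt_card.2 ⟨s, hsT, r, hrT, hsr⟩
  have hSC1 : #S + 1 ≤ #C := by
    rw [← card_insert_of_notMem hrS]
    exact card_le_card (insert_subset hrC O.sub_C)
  have hT23 : #T = 2 ∨ #T = 3 := by omega
  rcases hT23 with hT2 | hT3
  · obtain ⟨S', i, j, hc, -, hN, -, h3⟩ := hcov' (#B + 1) (by omega) (by omega) True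
    exact h3 (O.shared_of_card_two hN hc (by omega))
  -- Gaps with two of the three circle points below, just before and just after `x`. The lowest
  -- circle point, `y` or `y'`, has a colour that is missing farther out, so it is not in `S`. They
  -- differ, since a line lowest among the three at both cuts would have to coincide with the other
  -- two.
  · obtain ⟨S₁, i₁, j₁, k1, k2, k3, -, k4⟩ := hcov' (#B + 2) (by omega) (by omega) False
    obtain ⟨S₂, i₂, j₂, l1, l2, l3, -, l4⟩ := hcov' (#B + 2) (by omega) (by omega) True
    obtain ⟨y, a1, a2, a3, a4, a5, a6, a7, a8, a9⟩ := O.high k2 k3 (by omega) (by omega) k4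
    obtain ⟨y', b1, b2, b3, b4, b5, b6, b7, b8, b9⟩ := O.high l2 l3 (by omega) (by omega) l4
    have hyy : y ≠ y' := by
      rintro rfl
      exact O.no_fixed hT3 hsqd hno3 a3 a1 a2 b1 b2 a4 b4 a5 a6 b5 b6
        (p := fun i => y < i) a8 a9 b8 b9
    have hSB : #S + 2 ≤ #C := by
      have h4 := card_le_card (insert_subset (O.T_sub a3) (insert_subset (O.T_sub b3) O.sub_C))
      rwa [card_insert_of_notMem (by simp [hyy, a7]), card_insert_of_notMem b7] at h4
    -- So `S` contains at most one circle point. With one circle point below the gap, the highest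
    -- one, `z` or `z'`, has a colour that is missing farther in and lies in `S`. Hence `z = z'`,
    -- and one line would be highest both before and after `x`.
    obtain ⟨S₁, i₁, j₁, k1, k2, k3, -, k4⟩ := hcov' (#B + 1) (by omega) (by omega) False
    obtain ⟨S₂, i₂, j₂, l1, l2, l3, -, l4⟩ := hcov' (#B + 1) (by omega) (by omega) True
    obtain ⟨z, c1, c2, c3, c4, c5, c6, c7, c8, c9⟩ := O.low k2 k3 k1 (by omega) k4
    obtain ⟨z', d1, d2, d3, d4, d5, d6, d7, d8, d9⟩ := O.low l2 l3 l1 (by omega) l4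
    have hzz : z = z' := by
      by_contra hzz
      have h4 := card_le_card (insert_subset c7 (insert_subset d7 O.B_sub))
      rw [card_insert_of_notMem (by simp [hzz, O.notMem_B c3]),
        card_insert_of_notMem (O.notMem_B d3)] at h4
      omega
    subst hzz
    exact O.no_fixed hT3 hsqd hno3 c3 c1 c2 d1 d2 c4 d4 c5 c6 d5 d6
      (p := fun i => ¬ z < i) c8 c9 d8 d9

end RealRAM.HL

/-! ## The whole program -/
namespace RealRAM.HL

open Arrangement Finset

/-- The search for at least three points. -/
def largeP : HP :=
  rotateP ;; sortP ;; buildP ;; .setS .has (.lit 0) ;; .setR .lim (.lit 0) ;; scanP ;;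
  -- A limit above `best` is a supremum that is not attained.
  .ite (.and (.weq (.s .has) (.lit 1)) (.not (.rlt (.r .best) (.r .lim))))
    (.setS .res (.lit 1)) (.setS .res (.lit 0)) ;;
  .setR .ox (.add (.inp (.lit 0)) (.mul (.r .bx) (.r .e0))) ;;
  .setR .oy (.add (.inp (.lit 1)) (.mul (.r .bx) (.r .e1)))

/-- The distance of a point to the given point of the line. -/
def radiusE (a b : ℕ) : RE :=
  .sqrt (.add (.mul (.sub (.inp (.lit a)) (.inp (.lit 0))) (.sub (.inp (.lit a)) (.inp (.lit 0))))
    (.mul (.sub (.inp (.lit b)) (.inp (.lit 1))) (.sub (.inp (.lit b)) (.inp (.lit 1)))))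

/-- Two points: a circle around both. -/
def smallP : HP :=
  .setR .ox (.inp (.lit 0)) ;; .setR .oy (.inp (.lit 1)) ;;
  .setR .bi (radiusE 4 5) ;; .setR .bo (radiusE 6 7) ;;
  .ite (.rlt (.r .bi) (.r .bo)) (.setR .bi (.r .bo)) (.setR .bo (.r .bi)) ;;
  .setS .res (.lit 1)

def mainP : HP := .ite (.wlt .n (.lit 3)) smallP largeP

section
variable {E : Env} {V : St} {k : ℕ}

/-- The outcome of the search, with the place `σ j` of the point `j` and the colours `col` in the
sorted order. -/
structure Outcome (E : Env) (k : ℕ) (V : St) (σ col : ℕ → ℕ) : Prop where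
  lt : ∀ j < E.n, σ j < E.n
  inj : ∀ i < E.n, ∀ j < E.n, σ i = σ j → i = j
  surj : ∀ a < E.n, ∃ j < E.n, σ j = a
  u : ∀ j < E.n, V.ra .u (σ j) = E.along j
  h : ∀ j < E.n, V.ra .h (σ j) = √(E.across j * E.across j)
  col_eq : ∀ j < E.n, col (σ j) = E.I.word (2 + j)
  sorted : Sorted (V.ra .u) (V.ra .h) E.n
  best : BestOK (Found (V.ra .u) (V.ra .h) E.n k col) V
  lim : LimOK (Found (V.ra .u) (V.ra .h) E.n k col) V
  covered : ∀ p, 2 ≤ p → p < E.n → ∀ b x, Covered E.n k col p V b x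

open Classical in
theorem go_large (hnr : E.nr ≠ 0) (hk : k ≤ E.n) (hk' : E.I.word 1 = k)
    (hcol : ∀ j < E.n, E.I.word (2 + j) < k)
    (hpos : ∀ c < k, ∃ j < E.n, E.I.word (2 + j) = c) (htot : ∀ c, V.a .tot c 0 = 0)
    {Q : St → Prop}
    (hQ : ∀ V₁ V' σ col, Outcome E k V₁ σ col →
      V'.s .res = (if V₁.s .has = 1 ∧ ¬ V₁.r .best < V₁.r .lim then 1 else 0) →
      V'.r .ox = E.I.real 0 + V₁.r .bx * (E.I.real 2 / E.nr) →
      V'.r .oy = E.I.real 1 + V₁.r .bx * (E.I.real 3 / E.nr) →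
      V'.r .bi = V₁.r .bi → V'.r .bo = V₁.r .bo → V'.t ≤ V.t + 3000 * E.n ^ 2 → Q V') :
    Go E largeP V Q := by
  have h2 := E.two_le
  rw [largeP, go_seq]
  refine go_rotate hnr fun V₁ a1 _ _ a4 a5 a6 a7 => ?_
  rw [go_seq]
  refine go_sort hk hcol (by rw [a1]; exact htot) fun V₂ _ b2 b3 b4 b5 => ?_
  rw [go_seq]
  set σ := place (V₁.ra .u0) (V₁.ra .h0) E.n with hσ
  have hsort : Sorted (V₂.ra .u) (V₂.ra .h) E.n := by
    refine sorted_of_place (fun j hj => (b3 j hj).1) (fun j hj => (b3 j hj).2.1) fun j hj => ?_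
    rw [(a6 j hj).2]; exact Real.sqrt_nonneg _
  refine go_build hsort fun V₃ c1 c2 c3 => ?_
  rw [go_seq, go_setS]
  refine ⟨by simp, ?_⟩
  rw [go_seq, go_setR]
  refine ⟨by simp, ?_⟩
  rw [go_seq]
  set col := fun a => V₂.a .col a 0 with hcoldef
  set V₄ := (V₃.setS .has (WE.eval E V₃ (.lit 0))) with hV₄
  set V₅ := V₄.setR .lim (RE.eval E V₄ (.lit 0)) with hV₅
  have ra5 : V₅.ra = V₂.ra := c1.ra
  have lt : ∀ j < E.n, σ j < E.n := fun j hj => place_lt hj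
  have inj : ∀ i < E.n, ∀ j < E.n, σ i = σ j → i = j := fun i hi j hj => place_inj hi hj
  have surj : ∀ a < E.n, ∃ j < E.n, σ j = a := fun a ha => place_surj ha
  have col_eq : ∀ j < E.n, col (σ j) = E.I.word (2 + j) := fun j hj => (b3 j hj).2.2
  have cnt : ∀ c, colorCount (fun j => E.I.word (2 + j)) (range E.n) c
      = colorCount col (range E.n) c := by
    intro c
    unfold colorCount
    refine card_bij (fun j _ => σ j) ?_ ?_ ?_
    · intro j hj
      simp only [mem_filter, mem_range] at hj ⊢
      exact ⟨lt j hj.1, (col_eq j hj.1).trans hj.2⟩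
    · intro i hi j hj h
      simp only [mem_filter, mem_range] at hi hj
      exact inj i hi.1 j hj.1 h
    · intro a ha
      simp only [mem_filter, mem_range] at ha
      obtain ⟨j, hj, rfl⟩ := surj a ha.1
      exact ⟨j, by simp only [mem_filter, mem_range]; exact ⟨hj, (col_eq j hj).symm.trans ha.2⟩, rfl⟩
  refine go_scan (V := V₅) (k := k) (col := col) (by rw [ra5]; exact hsort) c2 hk hk' ?_ ?_ ?_ ?_
    ?_ ?_ fun V₆ d1 d2 d3 d4 d5 d6 => ?_
  · intro a ha
    obtain ⟨j, hj, rfl⟩ := surj a ha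
    rw [col_eq j hj]; exact hcol j hj
  · intro a _
    change V₃.a .col a 0 = _
    rw [c1.a _ (by decide) (by decide)]
  · intro c hc
    change V₃.a .tot c 0 = _
    rw [c1.a _ (by decide) (by decide), b4 c hc, cnt]
  · intro c hc
    obtain ⟨j, hj, h⟩ := hpos c hc
    rw [← cnt, colorCount_pos]
    exact ⟨j, mem_range.2 hj, h⟩
  · simp [BestOK, hV₅, hV₄]
  · refine ⟨by simp [hV₅], fun w h1 h2 => ?_⟩
    simp [hV₅] at h2; linarith
  have ra6 : V₆.ra = V₂.ra := d4.trans ra5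
  have r6 : ∀ y, y ∉ eventR → y ≠ .lim → y ≠ .x1 → y ≠ .x2 → V₆.r y = V₁.r y := by
    intro y g1 g2 g3 g4
    rw [d1 y g1, hV₅, St.setR_r, if_neg g2, hV₄, St.setS_r, c1.r y g3 g4, b2]
  have e0 : V₆.r .e0 = E.I.real 2 / E.nr := by
    rw [r6 _ (by decide) (by decide) (by decide) (by decide), a4]
  have e1 : V₆.r .e1 = E.I.real 3 / E.nr := by
    rw [r6 _ (by decide) (by decide) (by decide) (by decide), a5]
  have t5 : V₅.t = V₃.t + 2 := by simp [hV₅, hV₄]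
  have ht : V₆.t + 5 ≤ V.t + 3000 * E.n ^ 2 := by nlinarith
  rw [ra5] at d2 d3
  rw [← ra6] at d2 d3
  have O : Outcome E k V₆ σ col :=
    ⟨lt, inj, surj, fun j hj => by rw [ra6, (b3 j hj).1, (a6 j hj).1],
      fun j hj => by rw [ra6, (b3 j hj).2.1, (a6 j hj).2], col_eq, by rw [ra6]; exact hsort,
      d2, d3, d5⟩
  rw [go_seq, go_ite]
  refine ⟨by simp, fun hb => ?_, fun hb => ?_⟩
  · simp only [TE.eval, WE.eval, RE.eval] at hb
    simp only [go_seq, go_setS, go_setR]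
    refine ⟨by simp, by simp, by simp, hQ V₆ _ σ col O ?_ ?_ ?_ ?_ ?_ ?_⟩
    · simp [hb.1, not_lt.1 hb.2]
    · simp [e0]
    · simp [e1]
    · simp
    · simp
    · simp; omega
  · simp only [TE.eval, WE.eval, RE.eval] at hb
    simp only [go_seq, go_setS, go_setR]
    refine ⟨by simp, by simp, by simp, hQ V₆ _ σ col O ?_ ?_ ?_ ?_ ?_ ?_⟩
    · rw [if_neg hb]; simp
    · simp [e0]
    · simp [e1]
    · simp
    · simp
    · simp; omega

/-- The distance of a point to the given point of the line. -/
noncomputable def Env.radius (E : Env) (a b : ℕ) : ℝ :=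
  √((E.I.real a - E.I.real 0) * (E.I.real a - E.I.real 0) +
    (E.I.real b - E.I.real 1) * (E.I.real b - E.I.real 1))

theorem go_small {Q : St → Prop}
    (hQ : ∀ V', V'.s .res = 1 → V'.r .ox = E.I.real 0 → V'.r .oy = E.I.real 1 →
      V'.r .bi = max (E.radius 4 5) (E.radius 6 7) →
      V'.r .bo = max (E.radius 4 5) (E.radius 6 7) → V'.t ≤ V.t + 3000 * E.n ^ 2 → Q V') :
    Go E smallP V Q := by
  have h2 := E.two_le
  have h4 : 8 ≤ 3000 * E.n ^ 2 := by nlinarith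
  have hok : ∀ a b : ℕ, a ≤ 7 → b ≤ 7 → ∀ V, (radiusE a b).ok E V ∧
      (radiusE a b).eval E V = E.radius a b := by
    intro a b ha hb V
    refine ⟨?_, by simp [radiusE, Env.radius]⟩
    simp [radiusE, ha, hb]
    refine ⟨⟨by omega, by omega⟩, add_nonneg (mul_self_nonneg _) (mul_self_nonneg _)⟩
  simp only [smallP, go_seq, go_setR, go_setS, go_ite]
  refine ⟨by simp, by simp, (hok 4 5 (by simp) (by simp) _).1,
    (hok 6 7 (by simp) (by simp) _).1, by simp, fun hb => ⟨by simp, by simp, ?_⟩,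
    fun hb => ⟨by simp, by simp, ?_⟩⟩
  · simp [hok] at hb
    refine hQ _ ?_ ?_ ?_ ?_ ?_ ?_ <;> simp [hok, max_eq_right hb.le]
    omega
  · simp [hok] at hb
    refine hQ _ ?_ ?_ ?_ ?_ ?_ ?_ <;> simp [hok, max_eq_left hb]
    omega

end

end RealRAM.HL

/-! ## Output -/
namespace RealRAM.HL

/-- Writes the result into the first memory cells. -/
def outputP : Prog :=
  .seq (.setReal (.const 0) (.cell (addrE (RV.blk .ox)))) <|
  .seq (.setReal (.const 1) (.cell (addrE (RV.blk .oy)))) <|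
  .seq (.setReal (.const 2) (.cell (addrE (RV.blk .bi)))) <|
  .seq (.setReal (.const 3) (.cell (addrE (RV.blk .bo)))) <|
  .setWord (.const 0) (.cell (addrE (SV.blk .res)))

section
variable {E : Env} {V : St} {s : Store} {M : ℕ}

/-- The environment after a real input cell was overwritten. -/
def Env.setReal (E : Env) (o : ℕ) (v : ℝ) : Env :=
  { E with I := { E.I with real := Function.update E.I.real o v } }

/-- The output overwrites input cells, so the environment changes with them; the variables are in
later blocks and survive. Word cell `0`, needed for addresses, is overwritten last. -/
theorem Rep.setOutput (hR : Rep E V s) {o : ℕ} (ho : o < 4) (v : ℝ) :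
    Rep (E.setReal o v) V { s with real := Function.update s.real o v } := by
  have hsq := E.sq_pos
  have h2 := E.two_le
  have key : ∀ b c, 0 < b → b * (2 * E.n ^ 2) + c ≠ o := by
    intro b c hb h
    have : 1 * (2 * E.n ^ 2) ≤ b * (2 * E.n ^ 2) := Nat.mul_le_mul_right _ hb
    omega
  refine ⟨hR.iw, fun c hc => ?_, hR.sv, hR.av, fun y => ?_, fun y i hi => ?_⟩
  · have := hR.ir c hc
    simp only [Env.setReal, Function.update_apply, this]
  · have := key y.blk 0 (by unfold RV.blk; omega)
    rw [add_zero] at this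
    simp only [Env.setReal, Function.update_apply, this, if_false, hR.rv]
  · have := key y.blk i (by unfold RAV.blk; omega)
    simp only [Env.setReal, Function.update_apply, this, if_false, hR.rav y i hi]

theorem Rep.exec_setReal (hR : Rep E V s) (hM : 400 * E.n ^ 2 ≤ M) {o : ℕ} (ho : o < 4) (x : RV) :
    Exec M (.setReal (.const o) (.cell (addrE x.blk))) s 13
      { s with real := Function.update s.real o (V.r x) } := by
  have hsq := E.sq_pos
  have h2 := E.two_le
  have hx := x.ctorIdx_lt
  have h5 : x.blk * (2 * E.n ^ 2) < M := by unfold RV.blk; nlinarith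
  refine Exec.setReal (addr := .const o) (val := .cell (addrE x.blk)) ?_ (by omega) ?_
  · simp only [WExp.eval, checkWord]; rw [if_pos (by omega)]
  · simp [RExp.eval, addrE_eval hM hR (show x.blk < 100 by unfold RV.blk; omega), h5, hR.rv]

theorem Rep.exec_setWord (hR : Rep E V s) (hM : 400 * E.n ^ 2 ≤ M) (x : SV) :
    Exec M (.setWord (.const 0) (.cell (addrE x.blk))) s 13
      { s with word := Function.update s.word 0 (V.s x) } := by
  have hsq := E.sq_pos
  have hx := x.ctorIdx_lt
  have h5 : x.blk * (2 * E.n ^ 2) < M := by unfold SV.blk; nlinarith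
  refine Exec.setWord (addr := .const 0) (val := .cell (addrE x.blk)) ?_ (by omega) ?_
  · simp only [WExp.eval, checkWord]; rw [if_pos (by omega)]
  · simp [WExp.eval, addrE_eval hM hR (show x.blk < 100 by unfold SV.blk; omega), h5, hR.sv]

theorem Rep.exec_output (hM : 400 * E.n ^ 2 ≤ M) (hR : Rep E V s) :
    ∃ s', Exec M outputP s 65 s' ∧ s'.word 0 = V.s .res ∧ s'.real 0 = V.r .ox ∧
      s'.real 1 = V.r .oy ∧ s'.real 2 = V.r .bi ∧ s'.real 3 = V.r .bo := by
  have R₁ := hR.setOutput (o := 0) (by simp) (V.r .ox)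
  have R₂ := R₁.setOutput (o := 1) (by simp) (V.r .oy)
  have R₃ := R₂.setOutput (o := 2) (by simp) (V.r .bi)
  have R₄ := R₃.setOutput (o := 3) (by simp) (V.r .bo)
  refine ⟨_, .seq (hR.exec_setReal hM (o := 0) (by simp) .ox) <|
    .seq (R₁.exec_setReal hM (o := 1) (by simp) .oy) <|
    .seq (R₂.exec_setReal hM (o := 2) (by simp) .bi) <|
    .seq (R₃.exec_setReal hM (o := 3) (by simp) .bo) (R₄.exec_setWord hM .res), ?_, ?_, ?_, ?_, ?_⟩ <;>
  simp [Function.update_apply]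

/-- If the program halts with the property `Q`, then it outputs values with this property. -/
theorem Go.exec {p : HP} {Q : St → Prop} (hM : 400 * E.n ^ 2 ≤ M) (hR : Rep E V s)
    (h : Go E p V Q) : ∃ k V' s', Exec M (.seq p.comp outputP) s k s' ∧ Q V' ∧
      k + p.unit * V.t ≤ p.unit * V'.t + 65 ∧ s'.word 0 = V'.s .res ∧ s'.real 0 = V'.r .ox ∧
      s'.real 1 = V'.r .oy ∧ s'.real 2 = V'.r .bi ∧ s'.real 3 = V'.r .bo := by
  obtain ⟨V', hrun, hQ⟩ := h
  obtain ⟨k, s₁, h1, h2, h3⟩ := hrun.sound hM s hR le_rfl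
  obtain ⟨s₂, h4, h5⟩ := h2.exec_output hM
  exact ⟨_, V', s₂, .seq h1 h4, hQ, by omega, h5⟩

end

end RealRAM.HL

namespace RainbowAnnulus

open RealRAM.HL

variable {n k : ℕ}

/-- The input as an environment. -/
noncomputable def Instance.env (P : Instance n k) (hn : 2 ≤ n) (q d : Plane) : Env where
  I := P.input q d
  n := n
  hn := by simp [Instance.input]
  two_le := hn

/-- Memory at the start. -/
def initial : St where
  s _ := 0
  a _ _ _ := 0
  r _ := 0
  ra _ _ := 0
  t := 0

theorem Instance.rep_initial (P : Instance n k) (hn : 2 ≤ n) (q d : Plane) :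
    Rep (P.env hn q d) initial (P.input q d) := by
  have hsq := (P.env hn q d).sq_pos
  have hsq : 2 * n + 3 < 2 * n ^ 2 := hsq
  have hw : ∀ b c, 0 < b → (P.input q d).word (b * (2 * n ^ 2) + c) = 0 := by
    intro b c hb
    have : 1 * (2 * n ^ 2) ≤ b * (2 * n ^ 2) := Nat.mul_le_mul_right _ hb
    simp only [Instance.input]
    rw [if_neg (by omega), if_neg (by omega), dif_neg (by omega)]
  have hr : ∀ b c, 0 < b → (P.input q d).real (b * (2 * n ^ 2) + c) = 0 := by
    intro b c hb
    have : 1 * (2 * n ^ 2) ≤ b * (2 * n ^ 2) := Nat.mul_le_mul_right _ hb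
    simp only [Instance.input]
    rw [if_neg (by omega), if_neg (by omega), if_neg (by omega), if_neg (by omega),
      dif_neg (by omega)]
  exact ⟨fun _ _ => rfl, fun _ _ => rfl, fun x => hw x.blk 0 (by unfold SV.blk; omega),
    fun x i j _ _ => hw x.blk _ (by unfold AV.blk; omega),
    fun x => hr x.blk 0 (by unfold RV.blk; omega),
    fun x i _ => hr x.blk i (by unfold RAV.blk; omega)⟩

end RainbowAnnulus

/-! ## From the annuli of the plane to the arrangement -/
namespace Arrangement

open Finset

variable {U H : ℕ → ℝ} {n k : ℕ} {col : ℕ → ℕ} {x ri ro : ℝ}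

/-- Two points on a circle of their own can be put on suitable sides of it. -/
theorem SharedRainbow.exists_bothRainbow {S : Finset ℕ} {i j : ℕ}
    (h : SharedRainbow n k col S i j) (hsub : ∀ a ∈ S, a < n) (hi : i ∈ S) (hj : j ∉ S)
    (hjn : j < n) (h2 : ∀ a < n, ∃ b < n, b ≠ a ∧ col b = col a) :
    ∃ S', S.erase i ⊆ S' ∧ S' ⊆ insert j S ∧ BothRainbow n k col S' := by
  classical
  have hij : i ≠ j := fun e => hj (e ▸ hi)
  by_cases hc : col i = col j
  · refine ⟨S, erase_subset _ _, subset_insert _ _, fun c hck => ⟨?_, ?_⟩⟩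
    · obtain ⟨a, ha, hac⟩ := (h c hck).1
      rcases mem_insert.1 ha with rfl | ha
      · exact ⟨i, hi, hc.trans hac⟩
      · exact ⟨a, ha, hac⟩
    · obtain ⟨a, ha, haS, hac⟩ := (h c hck).2
      by_cases hai : a = i
      · subst hai; exact ⟨j, mem_range.2 hjn, hj, hc.symm.trans hac⟩
      · exact ⟨a, ha, fun h1 => haS (mem_erase.2 ⟨hai, h1⟩), hac⟩
  set B := S.erase i with hB
  have hiB : i ∉ B := notMem_erase i S
  have hjB : j ∉ B := fun h1 => hj (mem_of_mem_erase h1)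
  -- Each of `i` and `j` goes inside exactly if its colour is missing in `B`. In that case a second
  -- point of the colour remains outside, as the colours of `i` and `j` differ.
  set S' := B ∪ ({i, j} : Finset ℕ).filter fun a => ∀ b ∈ B, col b ≠ col a with hS'
  have mem : ∀ a, a ∈ S' ↔ a ∈ B ∨ ((a = i ∨ a = j) ∧ ∀ b ∈ B, col b ≠ col a) := by
    intro a; simp [hS']
  have key : ∀ e e', e < n → (∀ a, (a = i ∨ a = j) ↔ (a = e ∨ a = e')) → e ∉ B →
      col e' ≠ col e →
      (∃ a ∈ S', col a = col e) ∧ ∃ a ∈ range n, a ∉ S' ∧ col a = col e := by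
    intro e e' hen hee heB hne
    by_cases h1 : ∃ b ∈ B, col b = col e
    · obtain ⟨b, hb, hbe⟩ := h1
      refine ⟨⟨b, (mem b).2 (Or.inl hb), hbe⟩, e, mem_range.2 hen, fun h3 => ?_, rfl⟩
      rcases (mem e).1 h3 with h4 | h4
      · exact heB h4
      · exact h4.2 b hb hbe
    · push Not at h1
      obtain ⟨b, hbn, hbe, hbc⟩ := h2 e hen
      refine ⟨⟨e, (mem e).2 (Or.inr ⟨(hee e).2 (Or.inl rfl), h1⟩), rfl⟩, b, mem_range.2 hbn,
        fun h3 => ?_, hbc⟩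
      rcases (mem b).1 h3 with h4 | h4
      · exact h1 b h4 hbc
      · rcases (hee b).1 h4.1 with h5 | h5
        · exact hbe h5
        · exact hne (h5 ▸ hbc)
  refine ⟨S', subset_union_left, fun a ha => ?_, fun c hck => ?_⟩
  · rw [mem_insert]
    rcases (mem a).1 ha with h1 | ⟨h1 | h1, -⟩
    · exact Or.inr (mem_of_mem_erase h1)
    · exact Or.inr (h1 ▸ hi)
    · exact Or.inl h1
  · by_cases h1 : c = col i
    · subst h1
      exact key i j (hsub i hi) (fun a => Iff.rfl) hiB (Ne.symm hc)
    by_cases h3 : c = col j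
    · subst h3
      exact key j i hjn (fun a => or_comm) hjB hc
    obtain ⟨⟨a, ha, hac⟩, b, hbn, hb, hbc⟩ := h c hck
    have ne : ∀ a, col a = c → a ≠ i ∧ a ≠ j :=
      fun a h4 => ⟨fun h5 => h1 (h5 ▸ h4.symm), fun h5 => h3 (h5 ▸ h4.symm)⟩
    refine ⟨⟨a, (mem a).2 (Or.inl (mem_erase.2 ⟨(ne a hac).1, ?_⟩)), hac⟩, b, hbn, fun h4 => ?_, hbc⟩
    · exact (mem_insert.1 ha).resolve_left (ne a hac).2
    · rcases (mem b).1 h4 with h5 | ⟨h5 | h5, -⟩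
      · exact hb h5
      · exact (ne b hbc).1 h5
      · exact (ne b hbc).2 h5

/-- The circles with radii `ri` and `ro` divide the points. -/
def Divides (D : ℕ → ℝ) (n k : ℕ) (col : ℕ → ℕ) (ri ro : ℝ) (S : Finset ℕ) : Prop :=
  (∀ a ∈ S, a < n) ∧ (∀ a ∈ S, D a ≤ ri) ∧ (∀ a < n, a ∉ S → ro ≤ D a) ∧ BothRainbow n k col S

theorem Found.divides (h : Found U H n k col x ri ro)
    (h2 : ∀ a < n, ∃ b < n, b ≠ a ∧ col b = col a) :
    0 ≤ ri ∧ ri ≤ ro ∧ (∃ S, Divides (fun a => dst (U a) (H a) x) n k col ri ro S) ∧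
      ∃ a b, a < n ∧ b < n ∧ a ≠ b ∧ dst (U a) (H a) x ≤ ri ∧ dst (U b) (H b) x ≤ ri := by
  obtain ⟨S, i, j, h1, h3, h4, h5, h6, h7, h8, h9, rfl, rfl, h10⟩ := h
  refine ⟨dst_nonneg _ _ _, dst_le_dst.2 h9, ?_, ?_⟩
  · rcases h10 with h10 | ⟨h10, h11⟩
    · exact ⟨S, h1, fun a ha => dst_le_dst.2 (h7 a ha), fun a ha haS => dst_le_dst.2 (h8 a ha haS),
        h10⟩
    · obtain ⟨S', e1, e2, e3⟩ := h10.exists_bothRainbow h1 h3 h4 h5 h2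
      refine ⟨S', fun a ha => ?_, fun a ha => ?_, fun a ha haS => ?_, e3⟩
      · rcases mem_insert.1 (e2 ha) with rfl | h
        · exact h5
        · exact h1 a h
      · refine dst_le_dst.2 ?_
        rcases mem_insert.1 (e2 ha) with rfl | h
        · exact h11.ge
        · exact h7 a h
      · refine dst_le_dst.2 ?_
        by_cases hai : a = i
        · subst hai; exact h11.ge
        · exact h8 a ha fun h => haS (e1 (mem_erase.2 ⟨hai, h⟩))
  · obtain ⟨a, ha, b, hb, hab⟩ := one_lt_card.1 (show 1 < #S by omega)
    exact ⟨a, b, h1 a ha, h1 b hb, hab, dst_le_dst.2 (h7 a ha), dst_le_dst.2 (h7 b hb)⟩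

end Arrangement

namespace RainbowAnnulus

open Arrangement Finset

variable {n k : ℕ} {P : Instance n k}

/-- The emptiness of the annulus and of neither part need no mention: each point is on one of the
two sides, and rainbow sets are nonempty since there is a colour. -/
theorem Instance.isRBCA_iff {A : CircAnnulus} {f : Fin n → ℕ} {D : ℕ → ℝ} {col : ℕ → ℕ}
    (hf : Function.Injective f) (hlt : ∀ j, f j < n) (hsurj : ∀ a < n, ∃ j, f j = a)
    (hcol : ∀ j, col (f j) = P.color j) (hD : ∀ j, D (f j) = dist (P.point j) A.center) :
    P.IsRBCA A ↔ (∃ S, Divides D n k col A.rIn A.rOut S) ∧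
      ∃ a b, a < n ∧ b < n ∧ a ≠ b ∧ D a ≤ A.rIn ∧ D b ≤ A.rIn := by
  classical
  constructor
  · rintro ⟨-, ⟨S, -, -, h1, h2, h3, h4⟩, i, j, hij, hi, hj⟩
    refine ⟨⟨S.image f, ?_, ?_, ?_, fun c hc => ⟨?_, ?_⟩⟩, f i, f j, hlt i, hlt j,
      fun h => hij (hf h), by rwa [hD], by rwa [hD]⟩
    · intro a ha
      obtain ⟨l, -, rfl⟩ := mem_image.1 ha
      exact hlt l
    · intro a ha
      obtain ⟨l, hl, rfl⟩ := mem_image.1 ha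
      rw [hD]; exact h1 l hl
    · intro a ha haS
      obtain ⟨l, rfl⟩ := hsurj a ha
      rw [hD]
      exact h2 l (mem_compl.2 fun h => haS (mem_image_of_mem f h))
    · obtain ⟨l, hl, hlc⟩ := h3 ⟨c, hc⟩
      exact ⟨f l, mem_image_of_mem f hl, by rw [hcol, hlc]⟩
    · obtain ⟨l, hl, hlc⟩ := h4 ⟨c, hc⟩
      refine ⟨f l, mem_range.2 (hlt l), fun h => mem_compl.1 hl ?_, by rw [hcol, hlc]⟩
      exact (hf.mem_finset_image).1 h
  · rintro ⟨⟨S, h0, h1, h2, h3⟩, a, b, ha, hb, hab, hDa, hDb⟩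
    obtain ⟨i, rfl⟩ := hsurj a ha
    obtain ⟨j, rfl⟩ := hsurj b hb
    rw [hD] at hDa hDb
    have r1 : P.Rainbow (univ.filter fun l => f l ∈ S) := by
      intro c
      obtain ⟨a, haS, hac⟩ := (h3 c c.2).1
      obtain ⟨l, rfl⟩ := hsurj a (h0 a haS)
      exact ⟨l, by simpa using haS, Fin.ext (by rw [← hcol, hac])⟩
    have r2 : P.Rainbow (univ.filter fun l => f l ∈ S)ᶜ := by
      intro c
      obtain ⟨a, han, haS, hac⟩ := (h3 c c.2).2
      obtain ⟨l, rfl⟩ := hsurj a (mem_range.1 han)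
      exact ⟨l, by simpa using haS, Fin.ext (by rw [← hcol, hac])⟩
    have i1 : ∀ l, f l ∈ S → dist (P.point l) A.center ≤ A.rIn := fun l hl => by
      rw [← hD]; exact h1 _ hl
    have i2 : ∀ l, f l ∉ S → A.rOut ≤ dist (P.point l) A.center := fun l hl => by
      rw [← hD]; exact h2 _ (hlt l) hl
    refine ⟨fun l hl => ?_, ⟨univ.filter fun l => f l ∈ S, ?_, ?_, ?_, ?_, r1, r2⟩,
      i, j, fun h => hab (h ▸ rfl), hDa, hDb⟩
    · by_cases hlS : f l ∈ S
      · exact absurd (i1 l hlS) (not_le.2 hl.1)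
      · exact absurd (i2 l hlS) (not_le.2 hl.2)
    · obtain ⟨l, hl, -⟩ := r1 ⟨0, P.k_pos⟩; exact ⟨l, hl⟩
    · obtain ⟨l, hl, -⟩ := r2 ⟨0, P.k_pos⟩; exact ⟨l, hl⟩
    · intro l hl; exact i1 l (by simpa using hl)
    · intro l hl; exact i2 l (by simpa using hl)

theorem Instance.exists_other (P : Instance n k) (i : Fin n) :
    ∃ j, j ≠ i ∧ P.color j = P.color i := by
  obtain ⟨a, ha, b, hb, hab⟩ := one_lt_card.1 (lt_of_lt_of_le one_lt_two
    (P.two_le_card_color (P.color i)))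
  simp only [mem_filter, mem_univ, true_and] at ha hb
  by_cases h : a = i
  · exact ⟨b, fun h' => hab (h.trans h'.symm), hb⟩
  · exact ⟨a, h, ha⟩

theorem Instance.color_surjective (P : Instance n k) : Function.Surjective P.color := by
  intro c
  obtain ⟨a, ha⟩ := card_pos.1 (lt_of_lt_of_le two_pos (P.two_le_card_color c))
  exact ⟨a, by simpa using ha⟩

theorem Instance.k_le (P : Instance n k) : k ≤ n := by
  simpa using Fintype.card_le_of_surjective _ P.color_surjective

theorem Instance.two_le (P : Instance n k) : 2 ≤ n :=
  (P.two_le_card_color ⟨0, P.k_pos⟩).trans (by simpa using card_le_univ (univ.filter fun i => P.color i = ⟨0, P.k_pos⟩))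

/-- At most three points are at the same distance from a point. -/
theorem Instance.card_le_three (P : Instance n k) (c : Plane) (R : ℝ) (s : Finset (Fin n))
    (h : ∀ j ∈ s, dist (P.point j) c = R) : #s ≤ 3 := by
  by_contra hs
  obtain ⟨t, hts, ht⟩ := exists_subset_card_eq (show 4 ≤ #s by omega)
  refine P.not_concyclic t ht ⟨⟨c, R, ?_⟩, ?_⟩
  · rintro _ ⟨j, hj, rfl⟩
    exact h j (hts hj)
  -- Concyclic points are also required to be coplanar, which is automatic in the plane.
  · exact coplanar_of_finrank_eq_two _ (by simp)

end RainbowAnnulus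

/-! ## Coordinates along the line -/
namespace RainbowAnnulus

open Arrangement Finset RealRAM.HL

variable {n k : ℕ} {P : Instance n k} {hn : 2 ≤ n} {q d : Plane} {x : ℝ}

theorem dist_eq (a b : Plane) :
    dist a b = √((a 0 - b 0) * (a 0 - b 0) + (a 1 - b 1) * (a 1 - b 1)) := by
  rw [EuclideanSpace.dist_eq, Fin.sum_univ_two, Real.dist_eq, Real.dist_eq, sq_abs, sq_abs, sq, sq]

theorem Instance.env_word (P : Instance n k) (hn : 2 ≤ n) (q d : Plane) (j : Fin n) :
    (P.env hn q d).I.word (2 + j) = P.color j := by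
  simp only [Instance.env, Instance.input]
  rw [if_neg (by omega), if_neg (by omega)]
  have : 2 + (j : ℕ) - 2 = j := by omega
  simp [this]

theorem Instance.env_real (P : Instance n k) (hn : 2 ≤ n) (q d : Plane) (j : Fin n) :
    (P.env hn q d).I.real (4 + (j + j)) = P.point j 0 ∧
      (P.env hn q d).I.real (5 + (j + j)) = P.point j 1 := by
  simp only [Instance.env, Instance.input]
  have h1 : ((j : ℕ) + j) / 2 = j := by omega
  have h2 : (5 + ((j : ℕ) + j) - 4) / 2 = j := by omega
  have h3 : ((j : ℕ) + j) % 2 = 0 := by omega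
  have h4 : (5 + ((j : ℕ) + j) - 4) % 2 = 1 := by omega
  rw [if_neg (by omega), if_neg (by omega), if_neg (by omega), if_neg (by omega),
    if_neg (by omega), if_neg (by omega), if_neg (by omega), if_neg (by omega)]
  simp [h1, h2, h3, h4]

/-- The point at position `x` on the line. -/
noncomputable def onLine (E : Env) (x : ℝ) : Plane :=
  !₂[E.I.real 0 + x * (E.I.real 2 / E.nr), E.I.real 1 + x * (E.I.real 3 / E.nr)]

theorem onLine_zero (E : Env) (x : ℝ) :
    onLine E x 0 = E.I.real 0 + x * (E.I.real 2 / E.nr) := rfl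

theorem onLine_one (E : Env) (x : ℝ) :
    onLine E x 1 = E.I.real 1 + x * (E.I.real 3 / E.nr) := rfl

theorem nr_pos (P : Instance n k) (hn : 2 ≤ n) (q : Plane) (hd : d ≠ 0) :
    0 < (P.env hn q d).nr := by
  refine Real.sqrt_pos.2 ?_
  change 0 < d 0 * d 0 + d 1 * d 1
  by_contra h
  refine hd (PiLp.ext fun i => ?_)
  have h0 := mul_self_nonneg (d 0)
  have h1 := mul_self_nonneg (d 1)
  have e0 : d 0 * d 0 = 0 := by linarith
  have e1 : d 1 * d 1 = 0 := by linarith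
  fin_cases i
  · exact mul_self_eq_zero.1 e0
  · exact mul_self_eq_zero.1 e1

theorem unit_sq (E : Env) (hE : 0 < E.nr) :
    E.I.real 2 / E.nr * (E.I.real 2 / E.nr) + E.I.real 3 / E.nr * (E.I.real 3 / E.nr) = 1 := by
  have h : E.nr * E.nr = E.I.real 2 * E.I.real 2 + E.I.real 3 * E.I.real 3 :=
    Real.mul_self_sqrt (add_nonneg (mul_self_nonneg _) (mul_self_nonneg _))
  field_simp
  nlinarith

theorem mem_lineThrough (hd : d ≠ 0) (y : Plane) :
    y ∈ lineThrough q d ↔ ∃ x, y = onLine (P.env hn q d) x := by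
  have hE := nr_pos P hn q hd
  rw [lineThrough, AffineSubspace.mem_mk', Submodule.mem_span_singleton, vsub_eq_sub]
  constructor
  · rintro ⟨a, ha⟩
    refine ⟨a * (P.env hn q d).nr, PiLp.ext fun i => ?_⟩
    have h0 : a * d i = y i - q i := by
      have := congrArg (fun z : Plane => z i) ha
      simpa using this
    fin_cases i
    · change y 0 = q 0 + _ * (d 0 / _)
      simp only [Fin.zero_eta] at h0
      field_simp; linarith
    · change y 1 = q 1 + _ * (d 1 / _)
      simp only [Fin.mk_one] at h0
      field_simp; linarith
  · rintro ⟨x, rfl⟩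
    refine ⟨x / (P.env hn q d).nr, PiLp.ext fun i => ?_⟩
    fin_cases i
    · change _ / _ * d 0 = q 0 + x * (d 0 / _) - q 0
      field_simp; ring
    · change _ / _ * d 1 = q 1 + x * (d 1 / _) - q 1
      field_simp; ring

/-- Invariance of the distance under the change to the orthonormal frame of the line. -/
theorem dist_onLine (hd : d ≠ 0) (j : Fin n) (x : ℝ) :
    dist (P.point j) (onLine (P.env hn q d) x) = dst ((P.env hn q d).along j)
      (√((P.env hn q d).across j * (P.env hn q d).across j)) x := by
  have h1 := unit_sq _ (nr_pos P hn q hd)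
  rw [dist_eq, dst, onLine_zero, onLine_one, Real.mul_self_sqrt (mul_self_nonneg _), Env.along,
    Env.across, (P.env_real hn q d j).1, (P.env_real hn q d j).2]
  congr 1
  generalize (P.env hn q d).I.real 2 / (P.env hn q d).nr = a at *
  generalize (P.env hn q d).I.real 3 / (P.env hn q d).nr = b at *
  linear_combination (-(P.point j 0 - (P.env hn q d).I.real 0) ^ 2 -
    (P.point j 1 - (P.env hn q d).I.real 1) ^ 2 + x ^ 2) * h1

theorem eq_of_along_across (hd : d ≠ 0) {i j : Fin n}
    (h1 : (P.env hn q d).along i = (P.env hn q d).along j)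
    (h2 : (P.env hn q d).across i = (P.env hn q d).across j) : i = j := by
  have h3 := unit_sq _ (nr_pos P hn q hd)
  simp only [Env.along, Env.across, (P.env_real hn q d _).1, (P.env_real hn q d _).2] at h1 h2
  generalize (P.env hn q d).I.real 2 / (P.env hn q d).nr = a at *
  generalize (P.env hn q d).I.real 3 / (P.env hn q d).nr = b at *
  refine P.point_injective (PiLp.ext fun l => ?_)
  fin_cases l
  · change P.point i 0 = P.point j 0
    linear_combination a * h1 + b * h2 - (P.point i 0 - P.point j 0) * h3
  · change P.point i 1 = P.point j 1
    linear_combination b * h1 - a * h2 - (P.point i 1 - P.point j 1) * h3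

/-- At most two points have the same position along the line and the same distance to it. -/
theorem not_three_along (hd : d ≠ 0) {i j l : Fin n} (hij : i ≠ j) (hil : i ≠ l) (hjl : j ≠ l)
    (h1 : (P.env hn q d).along i = (P.env hn q d).along j)
    (h2 : (P.env hn q d).along i = (P.env hn q d).along l)
    (h3 : (P.env hn q d).across i * (P.env hn q d).across i =
      (P.env hn q d).across j * (P.env hn q d).across j)
    (h4 : (P.env hn q d).across i * (P.env hn q d).across i =
      (P.env hn q d).across l * (P.env hn q d).across l) : False := by
  -- Only the mirror image in the line shares the foot and the distance, so of three such points two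
  -- would agree.
  rcases mul_self_eq_mul_self_iff.1 h3 with h5 | h5
  · exact hij (eq_of_along_across hd h1 h5)
  · rcases mul_self_eq_mul_self_iff.1 h4 with h6 | h6
    · exact hil (eq_of_along_across hd h2 h6)
    · exact hjl (eq_of_along_across hd (h1.symm.trans h2) (by linarith))

end RainbowAnnulus

/-! ## The algorithm -/
namespace RainbowAnnulus

open Arrangement Finset RealRAM RealRAM.HL

variable {n k : ℕ} {P : Instance n k} {hn : 2 ≤ n} {q d : Plane} {x : ℝ} {V : St} {σ col : ℕ → ℕ}

theorem dst_place (hd : d ≠ 0) (O : Outcome (P.env hn q d) k V σ col) (x : ℝ) (j : Fin n) :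
    dst (V.ra .u (σ j)) (V.ra .h (σ j)) x = dist (P.point j) (onLine (P.env hn q d) x) := by
  rw [dist_onLine hd, O.u j j.2, O.h j j.2]

theorem isRBCA_iff_of_outcome (hd : d ≠ 0) (O : Outcome (P.env hn q d) k V σ col)
    {A : CircAnnulus} (hA : A.center = onLine (P.env hn q d) x) :
    P.IsRBCA A ↔
      (∃ S, Divides (fun a => dst (V.ra .u a) (V.ra .h a) x) n k col A.rIn A.rOut S) ∧
      ∃ a b, a < n ∧ b < n ∧ a ≠ b ∧ dst (V.ra .u a) (V.ra .h a) x ≤ A.rIn ∧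
        dst (V.ra .u b) (V.ra .h b) x ≤ A.rIn :=
  Instance.isRBCA_iff (f := fun j => σ j) (D := fun a => dst (V.ra .u a) (V.ra .h a) x)
    (fun i j h => Fin.ext (O.inj i i.2 j j.2 h)) (fun j => O.lt j j.2)
    (fun a ha => let ⟨j, hj, h⟩ := O.surj a ha; ⟨⟨j, hj⟩, h⟩)
    (fun j => (O.col_eq j j.2).trans (P.env_word hn q d j))
    (fun j => by rw [hA]; exact dst_place hd O x j)

theorem exists_isRBCA_of_found (hd : d ≠ 0) (O : Outcome (P.env hn q d) k V σ col) {ri ro : ℝ}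
    (h : Found (V.ra .u) (V.ra .h) n k col x ri ro) :
    ∃ A : CircAnnulus, P.IsRBCA A ∧ A.center = onLine (P.env hn q d) x ∧ A.rIn = ri ∧
      A.rOut = ro := by
  obtain ⟨h1, h2, h3, h4⟩ := h.divides fun a ha => by
    obtain ⟨i, hi, rfl⟩ := O.surj a ha
    obtain ⟨j, hj, hc⟩ := P.exists_other ⟨i, hi⟩
    refine ⟨σ j, O.lt j j.2, fun h => hj (Fin.ext (O.inj j j.2 i hi h)), ?_⟩
    rw [O.col_eq j j.2, O.col_eq i hi]
    exact (P.env_word hn q d j).trans ((congrArg _ hc).trans (P.env_word hn q d ⟨i, hi⟩).symm)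
  exact ⟨⟨_, ri, ro, h1, h2⟩, (isRBCA_iff_of_outcome hd O rfl).2 ⟨h3, h4⟩, rfl, rfl, rfl⟩

/-- For positive width the points inside are forced and form a prefix, which was examined. For width
zero it is enough that something was found, since every width found is nonnegative. -/
theorem has_of_isRBCA (hd : d ≠ 0) (hn3 : 3 ≤ n) (O : Outcome (P.env hn q d) k V σ col)
    {A : CircAnnulus} (hA : P.IsRBCA A) (hL : A.center ∈ lineThrough q d) :
    V.s .has = 1 ∧ (A.width ≤ V.r .best ∨ A.width < V.r .lim) := by
  classical
  obtain ⟨x, hx⟩ := (mem_lineThrough (P := P) (hn := hn) hd _).1 hL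
  obtain ⟨⟨S, h1, h2, h3, h4⟩, a, b, ha, hb, hab, hDa, hDb⟩ :=
    (isRBCA_iff_of_outcome hd O hx).1 hA
  have hSn : #S < n := by
    obtain ⟨-, r, hr, hrS, -⟩ := h4 0 P.k_pos
    have : S ⊂ range n := ⟨fun a ha => mem_range.2 (h1 a ha), fun h => hrS (h hr)⟩
    simpa using card_lt_card this
  rcases A.rIn_le_rOut.lt_or_eq with hr | hr
  · have hin : ∀ c < n, dst (V.ra .u c) (V.ra .h c) x ≤ A.rIn → c ∈ S := by
      intro c hc h
      by_contra hcS
      linarith [h3 c hc hcS]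
    have hS2 : 2 ≤ #S := one_lt_card.2 ⟨a, hin a ha hDa, b, hin b hb hDb, hab⟩
    exact has_of_width O.sorted (fun p g1 g2 b => O.covered p g1 g2 b x) hr h1 hS2 hSn h2 h3 h4
  · have hhas : V.s .has = 1 := by
      refine has_of_circle (R := A.rIn) O.sorted hn3 (fun p g1 g2 b => O.covered p g1 g2 b x)
        ?_ ?_ ?_ h1 h2 (hr ▸ h3) h4
      · intro c hc
        obtain ⟨j, hj, rfl⟩ := O.surj c hc
        rw [O.col_eq j hj]
        exact (P.env_word hn q d ⟨j, hj⟩).trans_lt (P.color ⟨j, hj⟩).2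
      · rintro a c e ha hc he hac hae hce ⟨g1, g2, g3, g4⟩
        obtain ⟨i, hi, rfl⟩ := O.surj a ha
        obtain ⟨j, hj, rfl⟩ := O.surj c hc
        obtain ⟨l, hl, rfl⟩ := O.surj e he
        have sq : ∀ m, √((P.env hn q d).across m * (P.env hn q d).across m) *
            √((P.env hn q d).across m * (P.env hn q d).across m) =
            (P.env hn q d).across m * (P.env hn q d).across m :=
          fun m => Real.mul_self_sqrt (mul_self_nonneg _)
        simp only [sqd, O.u i hi, O.u j hj, O.u l hl, O.h i hi, O.h j hj, O.h l hl, sq] at g1 g2 g3 g4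
        rw [← g1] at g3
        rw [← g2] at g4
        refine not_three_along (P := P) (hn := hn) (q := q) (i := ⟨i, hi⟩) (j := ⟨j, hj⟩)
          (l := ⟨l, hl⟩) hd ?_ ?_ ?_ g1 g2 (by linarith) (by linarith)
        · exact fun h => hac (congrArg σ (Fin.mk.inj h))
        · exact fun h => hae (congrArg σ (Fin.mk.inj h))
        · exact fun h => hce (congrArg σ (Fin.mk.inj h))
      · intro Q hQ
        have hQ' : Q ⊆ (univ.filter fun j : Fin n => σ j ∈ Q).image fun j : Fin n => σ j := by
          intro a ha
          obtain ⟨j, hj, rfl⟩ := O.surj a (hQ a ha).1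
          exact mem_image.2 ⟨⟨j, hj⟩, by simpa using ha, rfl⟩
        refine (card_le_card hQ').trans (card_image_le.trans ?_)
        refine P.card_le_three (onLine (P.env hn q d) x) A.rIn _ fun j hj => ?_
        rw [← dst_place hd O]
        exact (hQ _ (by simpa using hj)).2
    refine ⟨hhas, Or.inl ?_⟩
    obtain ⟨g1, g2⟩ := O.best.2 hhas
    obtain ⟨B, -, -, g3, g4⟩ := exists_isRBCA_of_found hd O g1
    rw [g2, CircAnnulus.width, ← hr, sub_self, ← g3, ← g4]
    linarith [B.rIn_le_rOut]

-- If `best < lim`, an alleged maximum would have width below `lim`, and `LimOK` provides a wider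
-- annulus.
open Classical in
theorem isAnswer_of_outcome (hd : d ≠ 0) (hn3 : 3 ≤ n) (O : Outcome (P.env hn q d) k V σ col)
    {s : Store} (hw : s.word 0 = if V.s .has = 1 ∧ ¬ V.r .best < V.r .lim then 1 else 0)
    (h0 : s.real 0 = onLine (P.env hn q d) (V.r .bx) 0)
    (h1 : s.real 1 = onLine (P.env hn q d) (V.r .bx) 1) (h2 : s.real 2 = V.r .bi)
    (h3 : s.real 3 = V.r .bo) : P.IsAnswer (lineThrough q d) s := by
  by_cases h : V.s .has = 1 ∧ ¬ V.r .best < V.r .lim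
  · rw [if_pos h] at hw
    obtain ⟨g1, g2⟩ := O.best.2 h.1
    obtain ⟨A, hA, hc, hi, ho⟩ := exists_isRBCA_of_found hd O g1
    refine Or.inl ⟨A, ⟨hA, (mem_lineThrough hd _).2 ⟨_, hc⟩, fun B hB hBL => ?_⟩, hw, ?_, ?_, ?_, ?_⟩
    · have := (has_of_isRBCA hd hn3 O hB hBL).2
      have hAw : A.width = V.r .best := by rw [g2, CircAnnulus.width, hi, ho]
      rw [hAw]
      rcases this with h4 | h4
      · exact h4
      · exact h4.le.trans (not_lt.1 h.2)
    · rw [h0, hc]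
    · rw [h1, hc]
    · rw [h2, hi]
    · rw [h3, ho]
  · rw [if_neg h] at hw
    refine Or.inr ⟨hw, fun ⟨A, hA, hAL, hmax⟩ => ?_⟩
    obtain ⟨g1, g2⟩ := has_of_isRBCA hd hn3 O hA hAL
    have hlt : V.r .best < V.r .lim := by
      by_contra h4; exact h ⟨g1, h4⟩
    have hAw : A.width < V.r .lim := g2.elim (fun h4 => h4.trans_lt hlt) id
    obtain ⟨x, ri, ro, g3, g4⟩ := O.lim.2 _ (sub_nonneg.2 A.rIn_le_rOut) hAw
    obtain ⟨B, hB, hc, hi, ho⟩ := exists_isRBCA_of_found hd O g3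
    have := hmax B hB ((mem_lineThrough hd _).2 ⟨_, hc⟩)
    simp only [CircAnnulus.width, hi, ho] at this
    linarith

/-- Two points are always within or on the inner circle. -/
theorem isAnswer_of_two (P : Instance 2 k) {s : Store} (hw : s.word 0 = 1) (h0 : s.real 0 = q 0)
    (h1 : s.real 1 = q 1) (h2 : s.real 2 = max (dist (P.point 0) q) (dist (P.point 1) q))
    (h3 : s.real 3 = max (dist (P.point 0) q) (dist (P.point 1) q)) :
    P.IsAnswer (lineThrough q d) s := by
  classical
  have hk : ∀ c c' : Fin k, c = c' := by
    have h4 : Fintype.card (Fin k) ≤ 1 := by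
      rw [Fintype.card_fin]
      obtain ⟨j, hj, hc⟩ := P.exists_other 0
      have h5 := P.k_le
      by_contra h6
      have hinj : Function.Injective P.color :=
        ((Fintype.bijective_iff_surjective_and_card _).2
          ⟨P.color_surjective, by simp; omega⟩).1
      exact hj (hinj hc)
    exact fun c c' => Fintype.card_le_one_iff.1 h4 c c'
  have rb : ∀ S : Finset (Fin 2), S.Nonempty → P.Rainbow S :=
    fun S ⟨i, hi⟩ c => ⟨i, hi, hk _ _⟩
  set r := max (dist (P.point 0) q) (dist (P.point 1) q) with hr
  have hle : ∀ i, dist (P.point i) q ≤ r := by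
    intro i
    fin_cases i
    · exact le_max_left _ _
    · exact le_max_right _ _
  obtain ⟨m, hm⟩ : ∃ m, r = dist (P.point m) q := by
    rcases max_choice (dist (P.point 0) q) (dist (P.point 1) q) with h | h
    · exact ⟨0, h⟩
    · exact ⟨1, h⟩
  -- The farther point `m` lies on the circle and forms the outer part; the other point forms the
  -- inner part.
  refine Or.inl ⟨⟨q, r, r, (hle 0).trans' dist_nonneg, le_rfl⟩, ⟨⟨fun i h => ?_,
    ⟨{m}ᶜ, ?_, ?_, fun i _ => hle i, fun i hi => ?_, rb _ ?_, rb _ ?_⟩, 0, 1, by simp, hle 0, hle 1⟩,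
    ?_, fun B hB _ => ?_⟩, hw, h0, h1, h2, h3⟩
  · exact absurd (h.1.trans h.2) (lt_irrefl _)
  · exact ⟨m + 1, by fin_cases m <;> decide⟩
  · simp
  · simp only [compl_compl, mem_singleton] at hi
    subst hi; exact hm.le
  · exact ⟨m + 1, by fin_cases m <;> decide⟩
  · simp
  · exact AffineSubspace.self_mem_mk' _ _
  -- Both points are in the closed inner disk and one is outside or on the outer circle, so no width
  -- is positive.
  · obtain ⟨-, ⟨S, -, ⟨l, hl⟩, -, h5, -⟩, i, j, hij, hi, hj⟩ := hB
    have h6 := h5 l hl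
    have h7 : l = i ∨ l = j := by omega
    have h8 : dist (P.point l) B.center ≤ B.rIn := by
      rcases h7 with rfl | rfl <;> assumption
    simp only [CircAnnulus.width]
    linarith

theorem go_main (P : Instance n k) (hn : 2 ≤ n) (hd : d ≠ 0) :
    Go (P.env hn q d) mainP initial fun V' => V'.t ≤ 3001 * n ^ 2 ∧ ∀ s : Store,
      s.word 0 = V'.s .res → s.real 0 = V'.r .ox → s.real 1 = V'.r .oy → s.real 2 = V'.r .bi →
      s.real 3 = V'.r .bo → P.IsAnswer (lineThrough q d) s := by
  have hn2 : 1 ≤ n ^ 2 := Nat.one_le_pow _ _ (by omega)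
  rw [mainP, go_ite]
  refine ⟨by simp, fun hb => ?_, fun hb => ?_⟩
  · have hb : n < 3 := hb
    obtain rfl : n = 2 := by omega
    refine go_small fun V' e1 e2 e3 e4 e5 e6 => ⟨?_, fun s g1 g2 g3 g4 g5 => ?_⟩
    · have : (P.env hn q d).n = 2 := rfl
      rw [this] at e6
      simp [initial] at e6
      omega
    · have r0 : (P.env hn q d).radius 4 5 = dist (P.point 0) q := by
        rw [dist_eq, Env.radius]
        have := P.env_real hn q d 0
        exact congrArg₂ (fun a b => √((a - q 0) * (a - q 0) + (b - q 1) * (b - q 1))) this.1 this.2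
      have r1 : (P.env hn q d).radius 6 7 = dist (P.point 1) q := by
        rw [dist_eq, Env.radius]
        have := P.env_real hn q d 1
        exact congrArg₂ (fun a b => √((a - q 0) * (a - q 0) + (b - q 1) * (b - q 1))) this.1 this.2
      rw [r0, r1] at e4 e5
      exact isAnswer_of_two P (g1.trans e1) (g2.trans e2) (g3.trans e3) (g4.trans e4) (g5.trans e5)
  · have hb : 3 ≤ n := not_lt.1 hb
    refine go_large (k := k) (nr_pos P hn q hd).ne' P.k_le (by simp [Instance.env, Instance.input])
      (fun j hj => ?_) (fun c hc => ?_) (fun _ => rfl)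
      fun V₁ V' σ col O e1 e2 e3 e4 e5 e6 => ⟨?_, fun s g1 g2 g3 g4 g5 => ?_⟩
    · exact (P.env_word hn q d ⟨j, hj⟩).trans_lt (P.color ⟨j, hj⟩).2
    · obtain ⟨j, hj⟩ := P.color_surjective ⟨c, hc⟩
      exact ⟨j, j.2, (P.env_word hn q d j).trans (congrArg Fin.val hj)⟩
    · have : (P.env hn q d).n = n := rfl
      rw [this] at e6
      simp [initial] at e6
      omega
    · exact isAnswer_of_outcome hd hb O (g1.trans e1) (g2.trans e2) (g3.trans e3) (g4.trans e4)
        (g5.trans e5)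

end RainbowAnnulus

theorem mainTheorem6 :
    ∃ (prog : RealRAM.Prog) (C : ℕ),
      ∀ (n k : ℕ) (P : RainbowAnnulus.Instance n k) (q d : RainbowAnnulus.Plane), d ≠ 0 →
        ∃ (t : ℕ) (s : RealRAM.Store),
          RealRAM.Exec (C * n ^ 2) prog (P.input q d) t s ∧
          t ≤ C * n ^ 2 ∧
          P.IsAnswer (RainbowAnnulus.lineThrough q d) s := by
  refine ⟨.seq RealRAM.HL.mainP.comp RealRAM.HL.outputP,
    -- `400` accounts for the memory blocks, `65` for writing the output, and `3001` for the steps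
    -- of the program, each of cost at most `mainP.unit`.
    400 + 65 + 3001 * RealRAM.HL.mainP.unit, fun n k P q d hd => ?_⟩
  have hn := P.two_le
  have hn2 : 1 ≤ n ^ 2 := Nat.one_le_pow _ _ (by omega)
  generalize hU : RealRAM.HL.mainP.unit = U
  have hM : 400 * n ^ 2 ≤ (400 + 65 + 3001 * U) * n ^ 2 := Nat.mul_le_mul_right _ (by omega)
  obtain ⟨t, V', s, h1, ⟨h2, h3⟩, h4, h5, h6, h7, h8, h9⟩ :=
    (RainbowAnnulus.go_main (q := q) P hn hd).exec hM (P.rep_initial hn q d)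
  refine ⟨t, s, h1, ?_, h3 s h5 h6 h7 h8 h9⟩
  rw [hU] at h4
  have h10 : U * V'.t ≤ U * (3001 * n ^ 2) := Nat.mul_le_mul_left _ h2
  have h11 : (400 + 65 + 3001 * U) * n ^ 2 = 400 * n ^ 2 + 65 * n ^ 2 + U * (3001 * n ^ 2) := by ring
  omega
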